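/- **Setting.** Let $M$ be a smooth $(n+1)$-dimensional manifold with an oriented (pseudo-)Riemannian metric $g$ and volume form $\omega$, let $\mathcal V\to M$ be a smooth real vector bundle of finite rank, let $\Gamma$ be a smooth linear connection on $\mathcal V$ with connection mapping $K:T_v\mathcal V\to\mathcal V_x$ $(v\in\mathcal V_x)$, and let $\Lambda$ be a smooth linear connection on $TM$. Let $\mathcal P=(J^1\mathcal V)^*$ be the bundle of fibrewise affine maps from $J^1\mathcal V$ to $\Lambda^{n+1}T^*M$. By means of $\Gamma$ and $\omega$ it is identified with the vector bundle over $M$ with fibre $\mathcal P_x=\mathcal V_x\times \mathrm{Hom}(T_xM,\mathcal V_x)^*\times\mathbb R$; the point $(v,L,c)$ is the affine map $\gamma\mapsto (L(K\circ\gamma)+c)\,\omega$ on jets $\gamma$ at $v$. The connections $\Gamma,\Lambda$ (and the trivial connection on the factor $\mathbb R$) induce a linear connection on $\mathcal P\to M$, hence a splitting $T_z\mathcal P\cong T_xM\oplus\mathcal P_x$ into horizontal and vertical vectors. The vertical exterior derivative of a form $\alpha$ on $\mathcal P$ is $d^V\alpha=\sum_N \mathfrak e^{*N}\wedge D_{\mathfrak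 e_N}\alpha$, where $\mathfrak e_N$ runs through a basis of the directions $\mathcal V_x\times \mathrm{Hom}(T_xM,\mathcal V_x)^*\subset\mathcal P_x$, $\mathfrak e^{*N}$ are the dual covectors with respect to the splitting, and $D_{\mathfrak e_N}$ differentiates the components of $\alpha$ in the splitting along the fibres of $\mathcal P\to M$. Let $\Theta$ be the canonical $(n+1)$-form on $\mathcal P$, $\Theta^{(1,n)}=\Theta-\Theta^H$, where $\Theta^H$ is the horizontal form that agrees with $\Theta$ on horizontal lifts, and $\Omega^{(2,n)}=d^V\Theta^{(1,n)}$. Contraction with multivectors is normalised by $(u_1\wedge\dots\wedge u_k)\lrcorner\alpha=u_1\lrcorner(u_2\lrcorner\cdots(u_k\lrcorner\alpha))$. For $r\in\mathbb Z$, a smooth horizontal $r$-form $F$ on $\mathcal P$ is called *Hamiltonian* if there is a smooth $(n+1-r)$-vector field $X_F$ on $\mathcal P$ with $X_F\lrcorner\Omega^{(2,n)}=d^VF$ (forms and multivectors of negative degree are zero). For Hamiltonian forms $F,G$ of degrees $r,s$ put $$\{F,G\}=(-1)^{n+1-r}X_F\lrcorner X_G\lrcorner\Omega^{(2,n)},\qquad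 F\bullet G=*^{-1}(*F\wedge *G),$$ where $*$ is the operation on horizontal forms induced pointwise by the Hodge operator of $M$, with the sign convention $*(Y\lrcorner\omega)=Y^\flat$ for multivectors $Y$ on $M$, i.e. $*((e_{i_1}\wedge\dots\wedge e_{i_k})\lrcorner\omega)=e^{i_1}\wedge\dots\wedge e^{i_k}$ for oriented orthonormal frames of a Riemannian metric. **Proposition.** The bracket $\{F,G\}$ does not depend on the choice of $X_F$ and $X_G$. If $F,G,H$ are Hamiltonian forms of degrees $r,s,t$, then: 1. $\{F,G\}$ is a Hamiltonian form of degree $r+s-n$, and $\{F,G\}=-(-1)^{(n-r)(n-s)}\{G,F\}$. 2. $(-1)^{(n-r)(n-t)}\{F,\{G,H\}\}+(-1)^{(n-s)(n-r)}\{G,\{H,F\}\}+(-1)^{(n-t)(n-s)}\{H,\{F,G\}\}=0$. 3. $F\bullet G$ is a Hamiltonian form of degree $r+s-(n+1)$, $F\bullet G=(-1)^{(n+1-r)(n+1-s)}\,G\bullet F$, and $$\{F,G\bullet H\}=\{F,G\}\bullet H+(-1)^{(n-r)(n+1-s)}\,G\bullet\{F,H\}.$$ -/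

import Mathlib

open Bundle
open scoped Manifold ContDiff

noncomputable section

/-! ### Exterior algebra: multivectors, forms and contraction

For a real vector space `T`, multivectors are elements of `ExteriorAlgebra ℝ T`, exterior forms are
elements of `ExteriorAlgebra ℝ (Module.Dual ℝ T)`; the product in both algebras is the wedge
product. -/

section Algebra

variable {T : Type*} [AddCommGroup T] [Module ℝ T]

/-- Exterior forms on the vector space `T`. -/
abbrev ExtForm (T : Type*) [AddCommGroup T] [Module ℝ T] : Type _ :=
  ExteriorAlgebra ℝ (Module.Dual ℝ T)

/-- Contraction of forms with one vector `u`: the antiderivation with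
`u ⌟ (a ∧ β) = a(u) β - a ∧ (u ⌟ β)` for covectors `a`. -/
def vectorHook : T →ₗ[ℝ] Module.End ℝ (ExtForm T) :=
  (CliffordAlgebra.contractLeft (Q := (0 : QuadraticForm ℝ (Module.Dual ℝ T)))).comp
    (Module.Dual.eval ℝ T)

/-- Contraction `X ⌟ α` of a form with a multivector. It is an algebra morphism into the
endomorphisms, so that `(u₁ ∧ ⋯ ∧ u_r) ⌟ α = u₁ ⌟ (u₂ ⌟ ⋯ (u_r ⌟ α))`. -/
def hook : ExteriorAlgebra ℝ T →ₐ[ℝ] Module.End ℝ (ExtForm T) :=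
  ExteriorAlgebra.lift ℝ ⟨vectorHook, fun u => by
    refine LinearMap.ext fun α => ?_
    exact CliffordAlgebra.contractLeft_contractLeft
      (Q := (0 : QuadraticForm ℝ (Module.Dual ℝ T))) (Module.Dual.eval ℝ T u) α⟩

/-- Pull-back of forms along a linear map. -/
def formPullback {T' : Type*} [AddCommGroup T'] [Module ℝ T'] (f : T →ₗ[ℝ] T') :
    ExtForm T' →ₐ[ℝ] ExtForm T :=
  ExteriorAlgebra.map f.dualMap

/-- The part of degree `k ∈ ℤ` of the exterior algebra; it is zero for negative `k`. -/
def extDegree (W : Type*) [AddCommGroup W] [Module ℝ W] (k : ℤ) :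
    Submodule ℝ (ExteriorAlgebra ℝ W) :=
  if 0 ≤ k then ⋀[ℝ]^k.toNat W else ⊥

open Classical in
/-- The derivative at `0` of a curve in a real vector space, computed componentwise (that is, after
applying linear functionals). In a finite-dimensional space, the only case in which it is used, this
is the usual derivative. -/
def curveDeriv {W : Type*} [AddCommGroup W] [Module ℝ W] (c : ℝ → W) : W :=
  if h : ∃ D : W, ∀ f : Module.Dual ℝ W, HasDerivAt (fun t => f (c t)) (f D) 0 then h.choose else 0

end Algebra

/-! ### Smooth multivector fields and smooth forms on a manifold -/

section Smooth

variable {E : Type*} [NormedAddCommGroup E] [NormedSpace ℝ E]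
  {H : Type*} [TopologicalSpace H] (I : ModelWithCorners ℝ E H)
  {N : Type*} [TopologicalSpace N] [ChartedSpace H N]

/-- A form on the manifold `N` (of mixed degree, no smoothness required). -/
abbrev FormOn (N : Type*) [TopologicalSpace N] [ChartedSpace H N] : Type _ :=
  (x : N) → ExtForm (TangentSpace I x)

/-- A multivector field on the manifold `N` (of mixed degree, no smoothness required). -/
abbrev MultivectorOn (N : Type*) [TopologicalSpace N] [ChartedSpace H N] : Type _ :=
  (x : N) → ExteriorAlgebra ℝ (TangentSpace I x)

/-- A form is smooth if near every point `x₀` it is a polynomial, for the wedge product, in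
functions `f` and differentials `df` with `f` smooth at `x₀`. -/
def IsSmoothForm (α : FormOn I N) : Prop :=
  ∀ x₀ : N, ∃ β ∈ Algebra.adjoin ℝ
      ({τ : FormOn I N | ∃ f : N → ℝ, ContMDiffAt I 𝓘(ℝ, ℝ) ∞ f x₀ ∧
          τ = fun x => algebraMap ℝ _ (f x)} ∪
        {τ : FormOn I N | ∃ f : N → ℝ, ContMDiffAt I 𝓘(ℝ, ℝ) ∞ f x₀ ∧
          τ = fun x => ExteriorAlgebra.ι ℝ
            (mvfderiv I f x).toLinearMap}),
    ∀ᶠ x in nhds x₀, α x = β x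

variable [IsManifold I ∞ N] in
/-- A multivector field is smooth if near every point `x₀` it is a polynomial, for the wedge
product, in functions and vector fields that are smooth at `x₀`. -/
def IsSmoothMultivector (X : MultivectorOn I N) : Prop :=
  ∀ x₀ : N, ∃ Y ∈ Algebra.adjoin ℝ
      ({τ : MultivectorOn I N | ∃ f : N → ℝ, ContMDiffAt I 𝓘(ℝ, ℝ) ∞ f x₀ ∧
          τ = fun x => algebraMap ℝ _ (f x)} ∪
        {τ : MultivectorOn I N | ∃ Z : (x : N) → TangentSpace I x,
          ContMDiffAt I I.tangent ∞ (fun x => (⟨x, Z x⟩ : TangentBundle I N)) x₀ ∧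
          τ = fun x => ExteriorAlgebra.ι ℝ (Z x)}),
    ∀ᶠ x in nhds x₀, X x = Y x

end Smooth

/-! ### The base manifold: metric, volume form, Hodge operator -/

section Base

variable (n : ℕ) (M : Type*) [TopologicalSpace M] [ChartedSpace (EuclideanSpace ℝ (Fin (n + 1))) M]
  [IsManifold (𝓡 (n + 1)) ∞ M]

/-- A smooth pseudo-Riemannian metric on the `(n+1)`-dimensional manifold `M`, with an orientation,
given by its volume form: the smooth `(n+1)`-form `vol` with
`vol(b₀, …, b_n)² = |det g(b_i, b_j)|` for all bases `b` of the tangent spaces. -/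
structure OrientedMetric where
  /-- the metric -/
  g : (x : M) → TangentSpace (𝓡 (n + 1)) x →L[ℝ] TangentSpace (𝓡 (n + 1)) x →L[ℝ] ℝ
  g_symm : ∀ x u w, g x u w = g x w u
  g_nondegenerate : ∀ x u, (∀ w, g x u w = 0) → u = 0
  g_smooth : ContMDiff (𝓡 (n + 1))
    ((𝓡 (n + 1)).prod 𝓘(ℝ, EuclideanSpace ℝ (Fin (n + 1)) →L[ℝ]
      EuclideanSpace ℝ (Fin (n + 1)) →L[ℝ] ℝ)) ∞
    (fun x => TotalSpace.mk' (EuclideanSpace ℝ (Fin (n + 1)) →L[ℝ]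
      EuclideanSpace ℝ (Fin (n + 1)) →L[ℝ] ℝ)
      (E := fun x => TangentSpace (𝓡 (n + 1)) x →L[ℝ] TangentSpace (𝓡 (n + 1)) x →L[ℝ] ℝ) x (g x))
  /-- the volume form -/
  vol : FormOn (𝓡 (n + 1)) M
  vol_degree : ∀ x, vol x ∈ ⋀[ℝ]^(n + 1) (Module.Dual ℝ (TangentSpace (𝓡 (n + 1)) x))
  vol_smooth : IsSmoothForm (𝓡 (n + 1)) vol
  vol_sq : ∀ x (b : Module.Basis (Fin (n + 1)) ℝ (TangentSpace (𝓡 (n + 1)) x)),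
    ExteriorAlgebra.algebraMapInv (hook (ExteriorAlgebra.ιMulti ℝ (n + 1) b) (vol x)) ^ 2 =
      |(Matrix.of fun i j => g x (b i) (b j)).det|

variable {n M} (B : OrientedMetric n M)

/-- Lowering indices, `Λ T_xM → Λ T_x^*M`. -/
def OrientedMetric.flat (x : M) :
    ExteriorAlgebra ℝ (TangentSpace (𝓡 (n + 1)) x) →ₐ[ℝ] ExtForm (TangentSpace (𝓡 (n + 1)) x) :=
  ExteriorAlgebra.map
    { toFun := fun u => ((B.g x u : TangentSpace (𝓡 (n + 1)) x →L[ℝ] ℝ) :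
        TangentSpace (𝓡 (n + 1)) x →ₗ[ℝ] ℝ)
      map_add' := fun u w => by ext; simp
      map_smul' := fun c u => by ext; simp }

/-- The isomorphism `K ↦ K ⌟ vol` from multivectors to forms. -/
def OrientedMetric.hookVol (x : M) :
    ExteriorAlgebra ℝ (TangentSpace (𝓡 (n + 1)) x) →ₗ[ℝ] ExtForm (TangentSpace (𝓡 (n + 1)) x) :=
  (hook (T := TangentSpace (𝓡 (n + 1)) x)).toLinearMap.flip (B.vol x)

/-- The Hodge operator of `M`, with the sign convention `∗ (K ⌟ vol) = K^♭`, so that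
`∗ ((e_{i₁} ∧ ⋯ ∧ e_{i_r}) ⌟ vol) = e^{i₁} ∧ ⋯ ∧ e^{i_r}` for an oriented orthonormal basis of a
Riemannian metric. (`K ↦ K ⌟ vol` is bijective; `LinearMap.leftInverse` is its inverse.) -/
def OrientedMetric.hodge (x : M) :
    ExtForm (TangentSpace (𝓡 (n + 1)) x) →ₗ[ℝ] ExtForm (TangentSpace (𝓡 (n + 1)) x) :=
  (B.flat x).toLinearMap ∘ₗ (B.hookVol x).leftInverse

/-- The inverse of the Hodge operator. -/
def OrientedMetric.hodgeInv (x : M) :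
    ExtForm (TangentSpace (𝓡 (n + 1)) x) →ₗ[ℝ] ExtForm (TangentSpace (𝓡 (n + 1)) x) :=
  (B.hodge x).leftInverse

end Base

/-! ### Local frames and connections of vector bundles -/

section Bundles

variable {n : ℕ} {M : Type*} [TopologicalSpace M]
  [ChartedSpace (EuclideanSpace ℝ (Fin (n + 1))) M] [IsManifold (𝓡 (n + 1)) ∞ M]
  (F : Type*) [NormedAddCommGroup F] [NormedSpace ℝ F] [FiniteDimensional ℝ F]
  {V : M → Type*} [TopologicalSpace (TotalSpace F V)]
  [∀ x, AddCommGroup (V x)] [∀ x, Module ℝ (V x)] [∀ x, TopologicalSpace (V x)]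
  [FiberBundle F V] [VectorBundle ℝ F V]

/-- The local frame `e_A` of `V` given by the preferred trivialization around `x₀`. -/
def bundleFrame (x₀ : M) (A : Fin (Module.finrank ℝ F)) (y : M) : V y :=
  (trivializationAt F V x₀).symm y (Module.finBasis ℝ F A)

/-- The dual basis `e^A` at `x` of the frame given by the preferred trivialization around `x`. -/
def bundleCoframe (x : M) (A : Fin (Module.finrank ℝ F)) : V x →L[ℝ] ℝ :=
  (LinearMap.toContinuousLinearMap ((Module.finBasis ℝ F).coord A)).comp
    ((trivializationAt F V x).continuousLinearMapAt ℝ x)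

/-- The connection mapping `T_z V → V_{π(z)}` of a linear connection, given by its covariant
derivative `cov`: in a local trivialization it is `dz^A + Γ_{iB}^A z^B dx^i`. It maps vertical
vectors to themselves and the derivative `Tσ(ξ)` of a section to `∇_ξ σ`. -/
def connectionMap (cov : ((x : M) → V x) → (x : M) → TangentSpace (𝓡 (n + 1)) x →ₗ[ℝ] V x)
    (z : TotalSpace F V) :
    TangentSpace ((𝓡 (n + 1)).prod 𝓘(ℝ, F)) z →ₗ[ℝ] V z.proj :=
  ((trivializationAt F V z.proj).symmL ℝ z.proj).toLinearMap ∘ₗ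
      (mvfderiv ((𝓡 (n + 1)).prod 𝓘(ℝ, F))
        (fun w : TotalSpace F V => (trivializationAt F V z.proj w).2) z).toLinearMap +
    cov (FiberBundle.extend F z.2) z.proj ∘ₗ
      (mfderiv ((𝓡 (n + 1)).prod 𝓘(ℝ, F)) (𝓡 (n + 1))
        (TotalSpace.proj : TotalSpace F V → M) z).toLinearMap

end Bundles

/-! ### The multisymplectic phase space -/

section Phase

variable (n : ℕ) {M : Type*} [TopologicalSpace M]
  [ChartedSpace (EuclideanSpace ℝ (Fin (n + 1))) M]
  (F : Type*) [NormedAddCommGroup F] [NormedSpace ℝ F]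
  (V : M → Type*) [∀ x, AddCommGroup (V x)] [∀ x, Module ℝ (V x)] [∀ x, TopologicalSpace (V x)]
  [∀ x, IsTopologicalAddGroup (V x)] [∀ x, ContinuousSMul ℝ (V x)]

/-- The fibre `Hom(T_xM, V_x) = V_x ⊗ T_x^*M` of the linearised first jet bundle. -/
abbrev JetFiber (x : M) : Type _ := TangentSpace (𝓡 (n + 1)) x →L[ℝ] V x

/-- Model fibre of `JetFiber`. -/
abbrev JetModel : Type _ := EuclideanSpace ℝ (Fin (n + 1)) →L[ℝ] F

/-- The linear dual of `JetFiber`. -/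
abbrev DualJetFiber (x : M) : Type _ := JetFiber n V x →L[ℝ] Trivial M ℝ x

/-- Model fibre of `DualJetFiber`. -/
abbrev DualJetModel : Type _ := JetModel n F →L[ℝ] ℝ

/-- The fibre over `x ∈ M` of the phase space: triples `((v, L), c)` with `v ∈ V_x`, `L` a linear
form on `Hom(T_xM, V_x)` and `c ∈ ℝ`. With a linear connection of `V`, with connection mapping `K`,
and the volume form of `M` such a triple is the affine map
`γ ↦ (L (K ∘ γ) + c) • vol` from the jets `γ : T_xM → T_vV`, `Tπ ∘ γ = id`, of `V` at `v` to
`Λ^{n+1} T_x^*M`, and every affine map between these spaces is obtained once. -/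
abbrev PhaseFiber (x : M) : Type _ := (V x × DualJetFiber n V x) × Trivial M ℝ x

/-- Model fibre of `PhaseFiber`. -/
abbrev PhaseModel : Type _ := (F × DualJetModel n F) × ℝ

/-- The phase space `P`: the affine dual of the first jet bundle of `V`. -/
abbrev Phase : Type _ := TotalSpace (PhaseModel n F) (PhaseFiber n V)

/-- The model with corners of the phase space. -/
abbrev phaseCorners : ModelWithCorners ℝ (EuclideanSpace ℝ (Fin (n + 1)) × PhaseModel n F)
    (ModelProd (EuclideanSpace ℝ (Fin (n + 1))) (PhaseModel n F)) :=
  (𝓡 (n + 1)).prod 𝓘(ℝ, PhaseModel n F)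

end Phase

section Geometry

variable {n : ℕ} {M : Type*} [TopologicalSpace M]
  [ChartedSpace (EuclideanSpace ℝ (Fin (n + 1))) M] [IsManifold (𝓡 (n + 1)) ∞ M]
  {F : Type*} [NormedAddCommGroup F] [NormedSpace ℝ F] [FiniteDimensional ℝ F]
  {V : M → Type*} [TopologicalSpace (TotalSpace F V)]
  [∀ x, AddCommGroup (V x)] [∀ x, Module ℝ (V x)] [∀ x, TopologicalSpace (V x)]
  [∀ x, IsTopologicalAddGroup (V x)] [∀ x, ContinuousSMul ℝ (V x)]
  [FiberBundle F V] [VectorBundle ℝ F V]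
  (B : OrientedMetric n M)
  (Γ : CovariantDerivative (𝓡 (n + 1)) F V)
  (Λ : CovariantDerivative (𝓡 (n + 1)) (EuclideanSpace ℝ (Fin (n + 1)))
    (fun x : M => TangentSpace (𝓡 (n + 1)) x))

/-- The local frame `∂_j` of `TM`. -/
abbrev tangentFrame (x₀ : M) (j : Fin (Module.finrank ℝ (EuclideanSpace ℝ (Fin (n + 1))))) (y : M) :
    TangentSpace (𝓡 (n + 1)) y :=
  bundleFrame (V := fun x : M => TangentSpace (𝓡 (n + 1)) x) (EuclideanSpace ℝ (Fin (n + 1))) x₀ j y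

/-- The dual basis `dx^j` at `x`. -/
abbrev tangentCoframe (x : M) (j : Fin (Module.finrank ℝ (EuclideanSpace ℝ (Fin (n + 1))))) :
    TangentSpace (𝓡 (n + 1)) x →L[ℝ] ℝ :=
  bundleCoframe (V := fun x : M => TangentSpace (𝓡 (n + 1)) x) (EuclideanSpace ℝ (Fin (n + 1))) x j

/-- The covariant derivative on `Hom(TM, V)` induced by `Γ` and `Λ`:
`(∇_ξ φ)(Y) = Γ_ξ(φ(Y)) - φ(Λ_ξ Y)`. -/
def jetCov (φ : (x : M) → JetFiber n V x) (x : M) :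
    TangentSpace (𝓡 (n + 1)) x →ₗ[ℝ] JetFiber n V x where
  toFun ξ := ∑ j, (tangentCoframe x j).smulRight
    (Γ (fun y => φ y (tangentFrame x j y)) x ξ - φ x (Λ (tangentFrame x j) x ξ))
  map_add' ξ η := by
    rw [← Finset.sum_add_distrib]
    refine Finset.sum_congr rfl fun j _ => ?_
    ext u
    simp only [map_add, ContinuousLinearMap.smulRight_apply, add_apply]
    module
  map_smul' c ξ := by
    rw [Finset.smul_sum]
    refine Finset.sum_congr rfl fun j _ => ?_
    ext u
    simp only [map_smul, ContinuousLinearMap.smulRight_apply, smul_apply,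
      RingHom.id_apply]
    module

/-- The dual covariant derivative on the dual of `Hom(TM, V)`:
`(∇_ξ L)(φ) = ξ(L(φ)) - L(∇_ξ φ)`. -/
def dualJetCov (L : (x : M) → DualJetFiber n V x) (x : M) :
    TangentSpace (𝓡 (n + 1)) x →ₗ[ℝ] DualJetFiber n V x :=
  ∑ a, LinearMap.smulRight
    ((mvfderiv (𝓡 (n + 1))
        (fun y => (L y (bundleFrame (V := JetFiber n V) (JetModel n F) x a y) : ℝ)) x).toLinearMap -
      (L x : JetFiber n V x →ₗ[ℝ] ℝ) ∘ₗ
        jetCov Γ Λ (bundleFrame (V := JetFiber n V) (JetModel n F) x a) x)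
    (bundleCoframe (V := JetFiber n V) (JetModel n F) x a : DualJetFiber n V x)

/-! #### The splitting of the tangent spaces of the phase space -/

/-- The projection `P → V`. -/
def toField (z : Phase n F V) : TotalSpace F V := ⟨z.proj, z.2.1.1⟩

/-- The projection of `P` to the bundle of linear forms on `Hom(TM, V)`. -/
def toMomentum (z : Phase n F V) : TotalSpace (DualJetModel n F) (DualJetFiber n V) :=
  ⟨z.proj, z.2.1.2⟩

/-- The coordinate `p` on `P`: the constant part of the affine map. -/
def toScalar (z : Phase n F V) : ℝ := z.2.2

/-- The tangent map `T_zP → T_xM` of the projection `P → M`. -/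
def projTangent (z : Phase n F V) :
    TangentSpace (phaseCorners n F) z →ₗ[ℝ] TangentSpace (𝓡 (n + 1)) z.proj :=
  (mfderiv (phaseCorners n F) (𝓡 (n + 1)) (TotalSpace.proj : Phase n F V → M) z).toLinearMap

/-- The tangent map of the projection `P → V`. -/
def fieldTangent (z : Phase n F V) :
    TangentSpace (phaseCorners n F) z →ₗ[ℝ]
      TangentSpace ((𝓡 (n + 1)).prod 𝓘(ℝ, F)) (toField z) :=
  (mfderiv (phaseCorners n F) ((𝓡 (n + 1)).prod 𝓘(ℝ, F)) toField z).toLinearMap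

/-- The tangent map of the projection of `P` to the bundle of linear forms on `Hom(TM, V)`. -/
def momentumTangent (z : Phase n F V) :
    TangentSpace (phaseCorners n F) z →ₗ[ℝ]
      TangentSpace ((𝓡 (n + 1)).prod 𝓘(ℝ, DualJetModel n F)) (toMomentum z) :=
  (mfderiv (phaseCorners n F) ((𝓡 (n + 1)).prod 𝓘(ℝ, DualJetModel n F)) toMomentum z).toLinearMap

/-- The connection mapping `T_zP → P_x` of the connection on the vector bundle `P → M` induced by
`Γ` and `Λ`. -/
def phaseConnectionMap (z : Phase n F V) :
    TangentSpace (phaseCorners n F) z →ₗ[ℝ] PhaseFiber n V z.proj :=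
  ((connectionMap F (fun s x => (Γ s x).toLinearMap) (toField z) ∘ₗ fieldTangent z).prod
    (connectionMap (DualJetModel n F) (dualJetCov Γ Λ) (toMomentum z) ∘ₗ momentumTangent z)).prod
    (mvfderiv (phaseCorners n F) toScalar z).toLinearMap

/-- The splitting of a tangent space of `P` into horizontal and vertical part,
`T_zP ≅ T_xM × P_x`. -/
def splitting (z : Phase n F V) :
    TangentSpace (phaseCorners n F) z →ₗ[ℝ]
      TangentSpace (𝓡 (n + 1)) z.proj × PhaseFiber n V z.proj :=
  (projTangent z).prod (phaseConnectionMap Γ Λ z)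

/-- The inverse `T_xM × P_x → T_zP` of the splitting (which is bijective). -/
def unsplit (z : Phase n F V) :
    TangentSpace (𝓡 (n + 1)) z.proj × PhaseFiber n V z.proj →ₗ[ℝ]
      TangentSpace (phaseCorners n F) z :=
  (splitting Γ Λ z).leftInverse

/-- The horizontal lift `T_xM → T_zP`. -/
def horizontalLift (z : Phase n F V) :
    TangentSpace (𝓡 (n + 1)) z.proj →ₗ[ℝ] TangentSpace (phaseCorners n F) z :=
  unsplit Γ Λ z ∘ₗ LinearMap.inl ℝ _ _

/-- Forms on the phase space. -/
abbrev PhaseForm (n : ℕ) {M : Type*} [TopologicalSpace M]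
    [ChartedSpace (EuclideanSpace ℝ (Fin (n + 1))) M] [IsManifold (𝓡 (n + 1)) ∞ M]
    (F : Type*) [NormedAddCommGroup F] [NormedSpace ℝ F]
    (V : M → Type*) [TopologicalSpace (TotalSpace F V)]
    [∀ x, AddCommGroup (V x)] [∀ x, Module ℝ (V x)] [∀ x, TopologicalSpace (V x)]
    [∀ x, IsTopologicalAddGroup (V x)] [∀ x, ContinuousSMul ℝ (V x)]
    [FiberBundle F V] [VectorBundle ℝ F V] : Type _ :=
  FormOn (phaseCorners n F) (Phase n F V)

/-- Multivector fields on the phase space. -/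
abbrev PhaseMultivector (n : ℕ) {M : Type*} [TopologicalSpace M]
    [ChartedSpace (EuclideanSpace ℝ (Fin (n + 1))) M] [IsManifold (𝓡 (n + 1)) ∞ M]
    (F : Type*) [NormedAddCommGroup F] [NormedSpace ℝ F]
    (V : M → Type*) [TopologicalSpace (TotalSpace F V)]
    [∀ x, AddCommGroup (V x)] [∀ x, Module ℝ (V x)] [∀ x, TopologicalSpace (V x)]
    [∀ x, IsTopologicalAddGroup (V x)] [∀ x, ContinuousSMul ℝ (V x)]
    [FiberBundle F V] [VectorBundle ℝ F V] : Type _ :=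
  MultivectorOn (phaseCorners n F) (Phase n F V)

/-! #### The vertical exterior derivative -/

/-- The inclusion of the vertical directions `e_A` and `e_{(i,A)}`, in which the vertical
exterior derivative differentiates, into `P_x`. -/
def fieldDirection (x : M) (A : Fin (Module.finrank ℝ F)) : PhaseFiber n V x :=
  ((bundleFrame F x A x, 0), (0 : ℝ))

/-- See `fieldDirection`. -/
def momentumDirection (x : M) (a : Fin (Module.finrank ℝ (DualJetModel n F))) : PhaseFiber n V x :=
  ((0, bundleFrame (V := DualJetFiber n V) (DualJetModel n F) x a x), (0 : ℝ))

/-- The covector dual to `fieldDirection`. -/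
def fieldCovector (x : M) (A : Fin (Module.finrank ℝ F)) :
    Module.Dual ℝ (TangentSpace (𝓡 (n + 1)) x × PhaseFiber n V x) :=
  (bundleCoframe F x A).toLinearMap ∘ₗ LinearMap.fst ℝ (V x) (DualJetFiber n V x) ∘ₗ
    LinearMap.fst ℝ (V x × DualJetFiber n V x) (Trivial M ℝ x) ∘ₗ LinearMap.snd ℝ _ _

/-- The covector dual to `momentumDirection`. -/
def momentumCovector (x : M) (a : Fin (Module.finrank ℝ (DualJetModel n F))) :
    Module.Dual ℝ (TangentSpace (𝓡 (n + 1)) x × PhaseFiber n V x) :=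
  (bundleCoframe (V := DualJetFiber n V) (DualJetModel n F) x a).toLinearMap ∘ₗ
    LinearMap.snd ℝ (V x) (DualJetFiber n V x) ∘ₗ
    LinearMap.fst ℝ (V x × DualJetFiber n V x) (Trivial M ℝ x) ∘ₗ LinearMap.snd ℝ _ _

/-- A form on `P` at the point `q` of the fibre over `x`, expressed in the splitting
`T_qP ≅ T_xM × P_x`. -/
def splitForm (α : PhaseForm n F V) (x : M) (q : PhaseFiber n V x) :
    ExtForm (TangentSpace (𝓡 (n + 1)) x × PhaseFiber n V x) :=
  formPullback (unsplit Γ Λ (⟨x, q⟩ : Phase n F V)) (α ⟨x, q⟩)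

/-- The vertical derivative of a form along `w ∈ P_x`: its components in the splitting are
differentiated along the fibre of `P → M`. -/
def fibreDeriv (α : PhaseForm n F V) (x : M) (q w : PhaseFiber n V x) :
    ExtForm (TangentSpace (𝓡 (n + 1)) x × PhaseFiber n V x) :=
  curveDeriv fun t : ℝ => splitForm Γ Λ α x (q + t • w)

/-- The vertical exterior derivative `d^V α = ∑_M e^M ∧ D_{e_M} α`, the sum being over the
directions `M = A` and `M = (i,A)`. -/
def verticalD (α : PhaseForm n F V) :
    PhaseForm n F V := fun z =>
  formPullback (splitting Γ Λ z)
    (∑ A, ExteriorAlgebra.ι ℝ (fieldCovector (n := n) (F := F) (V := V) z.proj A) *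
        fibreDeriv Γ Λ α z.proj z.2 (fieldDirection (n := n) (F := F) (V := V) z.proj A) +
      ∑ a, ExteriorAlgebra.ι ℝ (momentumCovector (n := n) (F := F) (V := V) z.proj a) *
        fibreDeriv Γ Λ α z.proj z.2 (momentumDirection (n := n) (F := F) (V := V) z.proj a))

/-! #### The canonical forms -/

/-- The `(n+1)`-form on `T_vV` that corresponds to the point `z` of `P` over `v`: with
`e^A` the vertical covectors on `V`, `L` and `c` the linear and the constant part of `z`,
it is `∑ L(dx^j ⊗ e_A) e^A ∧ (∂_j ⌟ vol) + c vol`. Its pull-back along any jet `γ : T_xM → T_vV`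
is the value `(L (K ∘ γ) + c) vol` of the affine map `z` at `γ`. -/
def affineForm (z : Phase n F V) :
    ExtForm (TangentSpace ((𝓡 (n + 1)).prod 𝓘(ℝ, F)) (toField z)) :=
  let τ : TangentSpace ((𝓡 (n + 1)).prod 𝓘(ℝ, F)) (toField z) →ₗ[ℝ]
      TangentSpace (𝓡 (n + 1)) z.proj :=
    (mfderiv ((𝓡 (n + 1)).prod 𝓘(ℝ, F)) (𝓡 (n + 1))
      (TotalSpace.proj : TotalSpace F V → M) (toField z)).toLinearMap
  let K : TangentSpace ((𝓡 (n + 1)).prod 𝓘(ℝ, F)) (toField z) →ₗ[ℝ] V z.proj :=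
    connectionMap F (fun s x => (Γ s x).toLinearMap) (toField z)
  ∑ A, ∑ j,
      (z.2.1.2 ((tangentCoframe z.proj j).smulRight (bundleFrame F z.proj A z.proj)) : ℝ) •
        (ExteriorAlgebra.ι ℝ ((bundleCoframe F z.proj A).toLinearMap ∘ₗ K) *
          formPullback τ (vectorHook (tangentFrame z.proj j z.proj) (B.vol z.proj))) +
    (z.2.2 : ℝ) • formPullback τ (B.vol z.proj)

/-- The canonical `(n+1)`-form `Θ` on `P`. -/
def canonicalForm : PhaseForm n F V := fun z =>
  formPullback (fieldTangent z) (affineForm B Γ z)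

/-- The form on the base whose pull-back has the same values as `α` on horizontal lifts. -/
def baseForm (α : PhaseForm n F V) (z : Phase n F V) :
    ExtForm (TangentSpace (𝓡 (n + 1)) z.proj) :=
  formPullback (horizontalLift Γ Λ z) (α z)

/-- The part `Θ^{(1,n)} = Θ - Θ^H` of `Θ`, where `Θ^H` is the horizontal form that agrees with `Θ`
on horizontal lifts. -/
def canonicalFormVert : PhaseForm n F V := fun z =>
  canonicalForm B Γ z - formPullback (projTangent z) (baseForm Γ Λ (canonicalForm B Γ) z)

/-- The form `Ω^{(2,n)} = d^V Θ^{(1,n)}`. -/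
def multisymplecticForm : PhaseForm n F V :=
  verticalD Γ Λ (canonicalFormVert B Γ Λ)

/-! #### Hamiltonian forms, bracket and product -/

variable [ContMDiffVectorBundle ∞ F V (𝓡 (n + 1))]

/-- `α` is a smooth horizontal `k`-form on `P`. -/
structure IsHorizontalForm (k : ℤ) (α : PhaseForm n F V) : Prop where
  smooth : IsSmoothForm (phaseCorners n F) α
  degree : ∀ z, α z ∈ extDegree _ k
  horizontal : ∀ z (u : TangentSpace (phaseCorners n F) z), projTangent z u = 0 →
    vectorHook u (α z) = 0

/-- `X` is a Hamiltonian `(n+1-k)`-vector field for the horizontal `k`-form `α`: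
`X ⌟ Ω^{(2,n)} = d^V α`. -/
structure IsHamiltonianPair (k : ℤ) (X : PhaseMultivector n F V)
    (α : PhaseForm n F V) : Prop where
  horizontalForm : IsHorizontalForm k α
  smooth : IsSmoothMultivector (phaseCorners n F) X
  degree : ∀ z, X z ∈ extDegree _ (n + 1 - k)
  hook_eq : ∀ z, hook (X z) (multisymplecticForm B Γ Λ z) = verticalD Γ Λ α z

/-- `α` is a Hamiltonian form of degree `k`. -/
def IsHamiltonianForm (k : ℤ) (α : PhaseForm n F V) : Prop :=
  ∃ X, IsHamiltonianPair B Γ Λ k X α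

open Classical in
/-- A Hamiltonian `(n+1-k)`-vector field of the Hamiltonian `k`-form `α`. -/
def hamiltonianField (k : ℤ) (α : PhaseForm n F V) :
    PhaseMultivector n F V :=
  if h : IsHamiltonianForm B Γ Λ k α then h.choose else 0

/-- The bracket `{α, β} = (-1)^{n+1-k} X_α ⌟ X_β ⌟ Ω^{(2,n)}` of Hamiltonian forms `α` of degree `k`
and `β` of degree `l`. -/
def poissonBracket (k l : ℤ) (α β : PhaseForm n F V) :
    PhaseForm n F V := fun z =>
  ((n + 1 - k).negOnePow : ℤ) • hook (hamiltonianField B Γ Λ k α z)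
    (hook (hamiltonianField B Γ Λ l β z) (multisymplecticForm B Γ Λ z))

/-- The product `α • β = ∗⁻¹(∗α ∧ ∗β)` of horizontal forms. -/
def hodgeProduct (α β : PhaseForm n F V) :
    PhaseForm n F V := fun z =>
  formPullback (projTangent z)
    (B.hodgeInv z.proj (B.hodge z.proj (baseForm Γ Λ α z) * B.hodge z.proj (baseForm Γ Λ β z)))

end Geometry

end

open Bundle
open scoped Manifold ContDiff

noncomputable section

set_option linter.unusedSectionVars false

/-! The statement is local over `M` and algebraic along the fibres of the phase space `P`. Fix
trivializations around a point, let `E` and `G` be the model spaces of `TM` and of the fibres of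
`P`, and read every form in the splitting. Since the momentum enters `Θ^{(1,n)}` linearly,
`Ω^{(2,n)}` becomes `∑ ε_k ∧ e_k ∧ (b_k ⌟ μ)`, where `μ` is the volume form at the base point and
`ε_k`, `e_k`, `b_k` are the same at all points (`readForm_multisymplecticForm`). As `Y ↦ Y ⌟ μ` is
bijective, a horizontal `r`-form is, on one fibre, `φ ⌟ μ` for a smooth function `φ : G → Λ^{n+1-r}
E`, and its vertical derivative is `∑ ν_N ∧ (∂_N φ ⌟ μ)`.

Let `σ_{NK} ∈ E` be the values of the vector valued two-form `∑ b_k ⊗ (ε_k ∧ e_k)` on the basis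
directions. Sort the equation `X ⌟ Ω = d^V F` by the number of vertical covectors. The part with one
of them says `∂_K φ = ∑ X_N ∧ σ_{NK}`, where `X_N` are the vertical coefficients of `X`
(`vertForm_eq_of_hook_eq`); the part with two says that the horizontal part of `X` is annihilated by
all `σ_{NK}` (`map_fst_mul_eq_zero_of_hook_eq`). Because of the second relation the bracket is
horizontal, and it belongs to the function `-∑ X_N ∧ ∂_N γ`. The product `F • G` belongs to `φ ∧ γ`.
So the proposition becomes one about functions on a vector space with values in `Λ E`
(`ModelHamiltonian`).

There the bracket equals `∑ X_N ∧ Y_K ∧ σ_{NK}`, which is graded antisymmetric since multivectors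
commute up to sign. The operator `-∑ X_N ∧ ∂_N` is of first order, which gives the Leibniz rule.
Symmetry of second derivatives, for `φ` and for `γ`, and antisymmetry of `σ` show that the bracket
solves the Hamiltonian equation with the coefficients of the commutator of the two operators
(`ModelHamiltonian.bracket`). That these coefficients do act as the graded commutator
(`modelBracket_modelBracket`) is the Jacobi identity, up to antisymmetry.

A Hamiltonian form also needs a smooth global multivector field. From coefficients `Z_N` the
multivector `∑ w_N ∧ Z_N` solves the equation at a single point. In a trivialization the equation
has constant coefficients up to the density of the volume form, so one fixed generalized inverse
selects a smooth local solution; the solutions form an affine space, and a partition of unity on `M`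
glues them (`IsPolysymplectic.exists_isHamPair`). Independence of the choice of fields needs only
that contractions commute up to sign. The remaining work justifies the reduction: the connections
have smooth Christoffel symbols, hence the splitting is smooth, and smoothness of forms and
multivector fields can be tested in it. -/

namespace ExtFormInstances

variable {W : Type*} [AddCommGroup W] [Module ℝ W]

/-- Shortcuts for instance search. -/
scoped instance extSemiring : Semiring (ExteriorAlgebra ℝ W) := inferInstance
scoped instance extAddCommGroup : AddCommGroup (ExteriorAlgebra ℝ W) := inferInstance
scoped instance extAddCommMonoid : AddCommMonoid (ExteriorAlgebra ℝ W) := inferInstance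
scoped instance extAlgebra : Algebra ℝ (ExteriorAlgebra ℝ W) := inferInstance
scoped instance extModule : Module ℝ (ExteriorAlgebra ℝ W) := inferInstance
scoped instance extSMul : SMul ℝ (ExteriorAlgebra ℝ W) := inferInstance
scoped instance extMulAction : MulAction ℝ (ExteriorAlgebra ℝ W) := inferInstance
scoped instance extDistribSMul : DistribSMul ℝ (ExteriorAlgebra ℝ W) := inferInstance

end ExtFormInstances

open scoped ExtFormInstances

/-! ### Exterior algebra: grading, left and right contraction, bijectivity of contraction with a
volume form. -/

section ExteriorAlgebraLemmas

variable {W : Type*} [AddCommGroup W] [Module ℝ W] {W' : Type*} [AddCommGroup W'] [Module ℝ W']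

/-- The grading involution of the exterior algebra. -/
abbrev extInvolute : ExteriorAlgebra ℝ W →ₐ[ℝ] ExteriorAlgebra ℝ W :=
  CliffordAlgebra.involute (Q := (0 : QuadraticForm ℝ W))

/-- Right contraction of a multivector with a covector. -/
def coHook (d : Module.Dual ℝ W) : ExteriorAlgebra ℝ W →ₗ[ℝ] ExteriorAlgebra ℝ W :=
  (CliffordAlgebra.contractRight (Q := (0 : QuadraticForm ℝ W))).flip d

theorem extInvolute_ι (v : W) :
    extInvolute (ExteriorAlgebra.ι ℝ v) = -ExteriorAlgebra.ι ℝ v :=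
  CliffordAlgebra.involute_ι v

theorem extInvolute_involute (x : ExteriorAlgebra ℝ W) : extInvolute (extInvolute x) = x :=
  CliffordAlgebra.involute_involute x

theorem coHook_mul_ι (d : Module.Dual ℝ W) (b : ExteriorAlgebra ℝ W) (v : W) :
    coHook d (b * ExteriorAlgebra.ι ℝ v) = d v • b - coHook d b * ExteriorAlgebra.ι ℝ v :=
  CliffordAlgebra.contractRight_mul_ι (Q := (0 : QuadraticForm ℝ W)) (d := d) v b

theorem coHook_algebraMap (d : Module.Dual ℝ W) (r : ℝ) :
    coHook d (algebraMap ℝ (ExteriorAlgebra ℝ W) r) = 0 :=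
  CliffordAlgebra.contractRight_algebraMap (Q := (0 : QuadraticForm ℝ W)) (d := d) r

theorem coHook_add_left (d d' : Module.Dual ℝ W) (x : ExteriorAlgebra ℝ W) :
    coHook (d + d') x = coHook d x + coHook d' x := by simp [coHook]

theorem coHook_smul_left (c : ℝ) (d : Module.Dual ℝ W) (x : ExteriorAlgebra ℝ W) :
    coHook (c • d) x = c • coHook d x := by simp [coHook]

@[elab_as_elim]
theorem extInduction_left {P : ExteriorAlgebra ℝ W → Prop}
    (algebraMap : ∀ r, P (algebraMap ℝ _ r)) (add : ∀ x y, P x → P y → P (x + y))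
    (ι_mul : ∀ x v, P x → P (ExteriorAlgebra.ι ℝ v * x)) (x : ExteriorAlgebra ℝ W) : P x :=
  CliffordAlgebra.left_induction (Q := (0 : QuadraticForm ℝ W)) algebraMap add
    (fun x m hx => ι_mul x m hx) x

@[elab_as_elim]
theorem extInduction_right {P : ExteriorAlgebra ℝ W → Prop}
    (algebraMap : ∀ r, P (algebraMap ℝ _ r)) (add : ∀ x y, P x → P y → P (x + y))
    (mul_ι : ∀ x v, P x → P (x * ExteriorAlgebra.ι ℝ v)) (x : ExteriorAlgebra ℝ W) : P x :=
  CliffordAlgebra.right_induction (Q := (0 : QuadraticForm ℝ W)) algebraMap add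
    (fun m x hx => mul_ι x m hx) x

/-- Moving `v` past every factor of `y` changes the sign once per factor, and the grading involution
records the total. It turns a left factor into a right one, where the recursion for `coHook`
applies. -/
theorem ι_mul_eq_involute_mul (v : W) (y : ExteriorAlgebra ℝ W) :
    ExteriorAlgebra.ι ℝ v * y = extInvolute y * ExteriorAlgebra.ι ℝ v := by
  induction y using extInduction_left with
  | algebraMap r => rw [AlgHom.commutes]; exact (Algebra.commutes r _).symm
  | add x y hx hy => rw [mul_add, map_add, add_mul, hx, hy]
  | ι_mul x u hx =>
    have h := ExteriorAlgebra.ι_add_mul_swap (R := ℝ) v u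
    rw [map_mul, extInvolute_ι, mul_assoc, ← hx, ← mul_assoc, ← mul_assoc,
      eq_neg_of_add_eq_zero_left h, neg_mul, neg_mul, neg_mul]

/-! ### Degrees -/

theorem extDegree_natCast (k : ℕ) : extDegree W (k : ℤ) = ⋀[ℝ]^k W := by
  simp [extDegree]

theorem extDegree_of_neg {k : ℤ} (hk : k < 0) : extDegree W k = ⊥ := by
  simp [extDegree, not_le.2 hk]

theorem algebraMap_mem_extDegree (r : ℝ) :
    algebraMap ℝ (ExteriorAlgebra ℝ W) r ∈ extDegree W 0 := by
  have := extDegree_natCast (W := W) 0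
  rw [Nat.cast_zero] at this
  rw [this, ExteriorAlgebra.exteriorPower, pow_zero]
  exact Submodule.algebraMap_mem r

theorem ι_mem_extDegree (v : W) : ExteriorAlgebra.ι ℝ v ∈ extDegree W 1 := by
  have := extDegree_natCast (W := W) 1
  rw [Nat.cast_one] at this
  rw [this, ExteriorAlgebra.exteriorPower, pow_one]
  exact LinearMap.mem_range_self _ v

theorem mul_mem_extDegree {a b : ℤ} {x y : ExteriorAlgebra ℝ W} (hx : x ∈ extDegree W a)
    (hy : y ∈ extDegree W b) : x * y ∈ extDegree W (a + b) := by
  rcases lt_or_ge a 0 with ha | ha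
  · rw [extDegree_of_neg ha, Submodule.mem_bot] at hx
    simp [hx]
  rcases lt_or_ge b 0 with hb | hb
  · rw [extDegree_of_neg hb, Submodule.mem_bot] at hy
    simp [hy]
  lift a to ℕ using ha
  lift b to ℕ using hb
  rw [← Nat.cast_add, extDegree_natCast, ExteriorAlgebra.exteriorPower, pow_add]
  rw [extDegree_natCast] at hx hy
  exact Submodule.mul_mem_mul hx hy

@[elab_as_elim]
-- Induction over homogeneous elements that carries the integer degree along. Negative degrees
-- contain only zero, which is why the case `zero` is required for every degree.
theorem extDegree_induction {P : (k : ℤ) → (x : ExteriorAlgebra ℝ W) → x ∈ extDegree W k → Prop}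
    (zero : ∀ k, P k 0 (zero_mem _))
    (add : ∀ k x y hx hy, P k x hx → P k y hy → P k (x + y) (add_mem hx hy))
    (algebraMap : ∀ r, P 0 (algebraMap ℝ _ r) (algebraMap_mem_extDegree r))
    (ι_mul : ∀ k x v hx (h : ExteriorAlgebra.ι ℝ v * x ∈ extDegree W (k + 1)),
      P k x hx → P (k + 1) (ExteriorAlgebra.ι ℝ v * x) h)
    {k : ℤ} {x : ExteriorAlgebra ℝ W} (hx : x ∈ extDegree W k) : P k x hx := by
  suffices h : ∀ hx : x ∈ extDegree W k, P k x hx from h hx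
  rcases lt_or_ge k 0 with hk | hk
  · rw [extDegree_of_neg hk, Submodule.mem_bot] at hx
    subst hx
    exact fun _ => zero k
  lift k to ℕ using hk
  rw [extDegree_natCast] at hx
  induction hx using Submodule.pow_induction_on_left' with
  | algebraMap r => exact fun _ => algebraMap r
  | add x y i hx hy h1 h2 =>
    rw [← ExteriorAlgebra.exteriorPower, ← extDegree_natCast] at hx hy
    exact fun _ => add _ _ _ hx hy (h1 hx) (h2 hy)
  | mem_mul m hm i x hx ih =>
    obtain ⟨v, rfl⟩ := hm
    rw [← ExteriorAlgebra.exteriorPower, ← extDegree_natCast] at hx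
    rw [Nat.succ_eq_add_one, Nat.cast_add, Nat.cast_one]
    exact fun h => ι_mul i x v hx h (ih hx)

theorem map_mem_extDegree (f : W →ₗ[ℝ] W') {k : ℤ} {x : ExteriorAlgebra ℝ W}
    (hx : x ∈ extDegree W k) : ExteriorAlgebra.map f x ∈ extDegree W' k := by
  induction hx using extDegree_induction with
  | zero k => rw [map_zero]; exact zero_mem _
  | add k x y hx hy h1 h2 => rw [map_add]; exact add_mem h1 h2
  | algebraMap r => rw [AlgHom.commutes]; exact algebraMap_mem_extDegree r
  | ι_mul k x v hx h ih =>
    rw [map_mul, ExteriorAlgebra.map_apply_ι, add_comm]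
    exact mul_mem_extDegree (ι_mem_extDegree _) ih

theorem extInvolute_of_mem {k : ℤ} {x : ExteriorAlgebra ℝ W} (hx : x ∈ extDegree W k) :
    extInvolute x = (k.negOnePow : ℤ) • x := by
  induction hx using extDegree_induction with
  | zero k => simp
  | add k x y hx hy h1 h2 => rw [map_add, h1, h2, smul_add]
  | algebraMap r => rw [AlgHom.commutes]; simp
  | ι_mul k x v hx h ih =>
    rw [map_mul, ih, extInvolute_ι, Int.negOnePow_succ, neg_mul, mul_smul_comm]
    simp

theorem extInvolute_mem {k : ℤ} {x : ExteriorAlgebra ℝ W} (hx : x ∈ extDegree W k) :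
    extInvolute x ∈ extDegree W k := by
  rw [extInvolute_of_mem hx]
  exact zsmul_mem hx _

theorem negOnePow_mul_self (k : ℤ) : (k.negOnePow : ℤ) * (k.negOnePow : ℤ) = 1 := by
  rw [← Units.val_mul, ← Int.negOnePow_add, Int.negOnePow_even _ ⟨k, rfl⟩, Units.val_one]

/-- Each of the `a` vectors in `x` costs one involution of `y`, that is, a factor `(-1)^b`. -/
theorem ext_mul_comm {a b : ℤ} {x y : ExteriorAlgebra ℝ W} (hx : x ∈ extDegree W a)
    (hy : y ∈ extDegree W b) : x * y = ((a * b).negOnePow : ℤ) • (y * x) := by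
  induction hx using extDegree_induction with
  | zero k => simp
  | add k x y hx hy h1 h2 => rw [add_mul, mul_add, h1, h2, smul_add]
  | algebraMap r => rw [zero_mul]; simpa using Algebra.commutes r y
  | ι_mul k x v hx h ih =>
    rw [mul_assoc, ih, mul_smul_comm, ← mul_assoc, ι_mul_eq_involute_mul,
      extInvolute_of_mem hy, add_mul, one_mul, Int.negOnePow_add, smul_mul_assoc, smul_mul_assoc, smul_smul,
      Units.val_mul, mul_assoc]

theorem coHook_mem_extDegree (d : Module.Dual ℝ W) {k : ℤ} {x : ExteriorAlgebra ℝ W}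
    (hx : x ∈ extDegree W k) : coHook d x ∈ extDegree W (k - 1) := by
  induction hx using extDegree_induction with
  | zero k => rw [map_zero]; exact zero_mem _
  | add k x y hx hy h1 h2 => rw [map_add]; exact add_mem h1 h2
  | algebraMap r => rw [coHook_algebraMap]; exact zero_mem _
  | ι_mul k x v hx h ih =>
    rw [ι_mul_eq_involute_mul, coHook_mul_ι, extInvolute_of_mem hx, map_zsmul, add_sub_cancel_right]
    refine sub_mem (Submodule.smul_mem _ _ (zsmul_mem hx _)) ?_
    have := mul_mem_extDegree (zsmul_mem ih (k.negOnePow : ℤ)) (ι_mem_extDegree v)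
    rwa [sub_add_cancel] at this

theorem eq_zero_of_mem_extDegree_of_finrank_lt [FiniteDimensional ℝ W] {k : ℤ}
    (hk : (Module.finrank ℝ W : ℤ) < k) {x : ExteriorAlgebra ℝ W} (hx : x ∈ extDegree W k) :
    x = 0 := by
  lift k to ℕ using (by omega)
  rw [extDegree_natCast] at hx
  have h : Module.finrank ℝ (⋀[ℝ]^k W) = 0 := by
    rw [exteriorPower.finrank_eq]
    exact Nat.choose_eq_zero_of_lt (by exact_mod_cast hk)
  have := Module.finrank_zero_iff.1 h
  exact congrArg Subtype.val (Subsingleton.elim (⟨x, hx⟩ : ⋀[ℝ]^k W) 0)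

instance extFiniteDimensional [FiniteDimensional ℝ W] :
    FiniteDimensional ℝ (ExteriorAlgebra ℝ W) :=
  Module.Finite.of_basis (Module.finBasis ℝ W).ExteriorAlgebra

/-! ### Contraction -/

theorem vectorHook_ι_mul (u : W) (a : Module.Dual ℝ W) (β : ExtForm W) :
    vectorHook u (ExteriorAlgebra.ι ℝ a * β) = a u • β - ExteriorAlgebra.ι ℝ a * vectorHook u β :=
  CliffordAlgebra.contractLeft_ι_mul (Q := (0 : QuadraticForm ℝ (Module.Dual ℝ W)))
    (d := Module.Dual.eval ℝ W u) a β

theorem vectorHook_algebraMap (u : W) (r : ℝ) :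
    vectorHook u (algebraMap ℝ (ExtForm W) r) = 0 :=
  CliffordAlgebra.contractLeft_algebraMap (Q := (0 : QuadraticForm ℝ (Module.Dual ℝ W)))
    (d := Module.Dual.eval ℝ W u) r

theorem hook_ι (u : W) : hook (ExteriorAlgebra.ι ℝ u) = vectorHook u := by
  simp [hook]

theorem hook_ι_mul (u : W) (X : ExteriorAlgebra ℝ W) (α : ExtForm W) :
    hook (ExteriorAlgebra.ι ℝ u * X) α = vectorHook u (hook X α) := by
  rw [map_mul, hook_ι]; rfl

theorem hook_mul (X Y : ExteriorAlgebra ℝ W) (α : ExtForm W) :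
    hook (X * Y) α = hook X (hook Y α) := by
  rw [map_mul]; rfl

theorem formPullback_ι (f : W →ₗ[ℝ] W') (a : Module.Dual ℝ W') :
    formPullback f (ExteriorAlgebra.ι ℝ a) = ExteriorAlgebra.ι ℝ (a ∘ₗ f) := by
  simp only [formPullback, ExteriorAlgebra.map_apply_ι]
  rfl

theorem formPullback_comp {W'' : Type*} [AddCommGroup W''] [Module ℝ W''] (f : W →ₗ[ℝ] W')
    (g : W' →ₗ[ℝ] W'') (α : ExtForm W'') :
    formPullback (g ∘ₗ f) α = formPullback f (formPullback g α) := by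
  simp only [formPullback]
  rw [← AlgHom.comp_apply, ExteriorAlgebra.map_comp_map]
  rfl

theorem formPullback_id (α : ExtForm W) : formPullback LinearMap.id α = α := by
  simp only [formPullback, LinearMap.dualMap_id, ExteriorAlgebra.map_id]
  rfl

theorem map_map {W'' : Type*} [AddCommGroup W''] [Module ℝ W''] (f : W →ₗ[ℝ] W')
    (g : W' →ₗ[ℝ] W'') (x : ExteriorAlgebra ℝ W) :
    ExteriorAlgebra.map g (ExteriorAlgebra.map f x) = ExteriorAlgebra.map (g ∘ₗ f) x := by
  rw [← AlgHom.comp_apply, ExteriorAlgebra.map_comp_map]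

theorem map_id_apply (x : ExteriorAlgebra ℝ W) : ExteriorAlgebra.map LinearMap.id x = x := by
  rw [ExteriorAlgebra.map_id]; rfl

theorem formPullback_add (f : W →ₗ[ℝ] W') (α β : ExtForm W') :
    formPullback f (α + β) = formPullback f α + formPullback f β := map_add _ _ _

theorem formPullback_mul (f : W →ₗ[ℝ] W') (α β : ExtForm W') :
    formPullback f (α * β) = formPullback f α * formPullback f β := map_mul _ _ _

theorem formPullback_smul (f : W →ₗ[ℝ] W') (c : ℝ) (α : ExtForm W') :
    formPullback f (c • α) = c • formPullback f α := map_smul _ _ _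

theorem formPullback_zsmul (f : W →ₗ[ℝ] W') (c : ℤ) (α : ExtForm W') :
    formPullback f (c • α) = c • formPullback f α := map_zsmul _ _ _

theorem formPullback_zero (f : W →ₗ[ℝ] W') :
    formPullback f (0 : ExtForm W') = 0 := map_zero _

theorem formPullback_sum {κ : Type*} (f : W →ₗ[ℝ] W') (s : Finset κ) (α : κ → ExtForm W') :
    formPullback f (∑ i ∈ s, α i) = ∑ i ∈ s, formPullback f (α i) := map_sum _ _ _

theorem formPullback_mem_extDegree (f : W →ₗ[ℝ] W') {k : ℤ} {α : ExtForm W'}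
    (hα : α ∈ extDegree (Module.Dual ℝ W') k) :
    formPullback f α ∈ extDegree (Module.Dual ℝ W) k :=
  map_mem_extDegree _ hα

theorem vectorHook_formPullback (f : W →ₗ[ℝ] W') (u : W) (α : ExtForm W') :
    vectorHook u (formPullback f α) = formPullback f (vectorHook (f u) α) := by
  induction α using extInduction_left with
  | algebraMap r => simp only [AlgHom.commutes, vectorHook_algebraMap, map_zero]
  | add x y hx hy => simp only [map_add, hx, hy]
  | ι_mul x a hx =>
    simp only [map_mul, formPullback_ι, vectorHook_ι_mul, map_sub, map_smul, hx]
    rfl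

theorem hook_formPullback (f : W →ₗ[ℝ] W') (X : ExteriorAlgebra ℝ W) (α : ExtForm W') :
    hook X (formPullback f α) = formPullback f (hook (ExteriorAlgebra.map f X) α) := by
  induction X using extInduction_left with
  | algebraMap r => simp only [AlgHom.commutes, Module.algebraMap_end_apply, map_smul]
  | add x y hx hy => simp only [map_add, LinearMap.add_apply, hx, hy]
  | ι_mul x v hx =>
    rw [hook_ι_mul, hx, vectorHook_formPullback, map_mul, ExteriorAlgebra.map_apply_ι, hook_ι_mul]

/-- Either one vector of `X` consumes the covector `a`, which is the right contraction `coHook a X`,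
or all of them pass it, each with a sign. The induction is from the right because the rightmost
vector acts on the form first. -/
theorem hook_ι_form_mul (X : ExteriorAlgebra ℝ W) (a : Module.Dual ℝ W) (β : ExtForm W) :
    hook X (ExteriorAlgebra.ι ℝ a * β) =
      hook (coHook a X) β + ExteriorAlgebra.ι ℝ a * hook (extInvolute X) β := by
  induction X using extInduction_right generalizing β with
  | algebraMap r =>
    simp only [AlgHom.commutes, Module.algebraMap_end_apply, coHook_algebraMap, map_zero,
      LinearMap.zero_apply, zero_add, mul_smul_comm]
  | add x y hx hy =>
    simp only [map_add, LinearMap.add_apply, hx, hy, mul_add]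
    abel
  | mul_ι x v hx =>
    rw [hook_mul, hook_ι, vectorHook_ι_mul, map_sub, hx, coHook_mul_ι, map_mul, extInvolute_ι,
      map_smul, map_sub, map_smul, LinearMap.sub_apply, LinearMap.smul_apply, hook_mul, hook_ι,
      mul_neg, map_neg, LinearMap.neg_apply, hook_mul, hook_ι, mul_neg]
    abel

theorem vectorHook_mem_extDegree (u : W) {k : ℤ} {α : ExtForm W}
    (hα : α ∈ extDegree (Module.Dual ℝ W) k) :
    vectorHook u α ∈ extDegree (Module.Dual ℝ W) (k - 1) := by
  induction hα using extDegree_induction with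
  | zero k => rw [map_zero]; exact zero_mem _
  | add k x y hx hy h1 h2 => rw [map_add]; exact add_mem h1 h2
  | algebraMap r => rw [vectorHook_algebraMap]; exact zero_mem _
  | ι_mul k x v hx h ih =>
    rw [vectorHook_ι_mul, add_sub_cancel_right]
    refine sub_mem (Submodule.smul_mem _ _ hx) ?_
    have := mul_mem_extDegree (ι_mem_extDegree v) ih
    rwa [add_sub_cancel] at this

theorem hook_mem_extDegree {a b : ℤ} {X : ExteriorAlgebra ℝ W} (hX : X ∈ extDegree W a)
    {α : ExtForm W} (hα : α ∈ extDegree (Module.Dual ℝ W) b) :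
    hook X α ∈ extDegree (Module.Dual ℝ W) (b - a) := by
  induction hX using extDegree_induction with
  | zero k => rw [map_zero]; exact zero_mem _
  | add k x y hx hy h1 h2 => rw [map_add]; exact add_mem h1 h2
  | algebraMap r =>
    rw [AlgHom.commutes, sub_zero]; exact Submodule.smul_mem _ r hα
  | ι_mul k x v hx h ih =>
    rw [hook_ι_mul, ← sub_sub]
    exact vectorHook_mem_extDegree _ ih

theorem hook_hook_comm {a b : ℤ} {X Y : ExteriorAlgebra ℝ W} (hX : X ∈ extDegree W a)
    (hY : Y ∈ extDegree W b) (α : ExtForm W) :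
    hook X (hook Y α) = ((a * b).negOnePow : ℤ) • hook Y (hook X α) := by
  rw [← hook_mul, ext_mul_comm hX hY, map_zsmul, LinearMap.smul_apply, hook_mul]

/-! ### Contraction with a volume form -/

/-- A form of top degree. -/
theorem hook_top_exists [FiniteDimensional ℝ W] {μ : ExtForm W}
    (hμ : μ ∈ extDegree (Module.Dual ℝ W) (Module.finrank ℝ W))
    {K : ExteriorAlgebra ℝ W} (hK : K ∈ extDegree W (Module.finrank ℝ W)) (h1 : hook K μ = 1)
    {k : ℤ} {β : ExtForm W} (hβ : β ∈ extDegree (Module.Dual ℝ W) k) :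
    ∃ Y ∈ extDegree W (Module.finrank ℝ W - k), hook Y μ = β := by
  induction hβ using extDegree_induction with
  | zero k => exact ⟨0, zero_mem _, by simp⟩
  | add k x y hx hy h1 h2 =>
    obtain ⟨Y, hY, rfl⟩ := h1
    obtain ⟨Z, hZ, rfl⟩ := h2
    exact ⟨Y + Z, add_mem hY hZ, by simp⟩
  | algebraMap r =>
    refine ⟨r • K, Submodule.smul_mem _ _ (by simpa using hK), ?_⟩
    rw [map_smul, LinearMap.smul_apply, h1, Algebra.algebraMap_eq_smul_one]
  | ι_mul k x v hx _ ih =>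
    obtain ⟨Y, hY, rfl⟩ := ih
    -- The witness is read off from `hook_ι_form_mul` for `v ∧ μ`, which is zero because its degree
    -- exceeds the dimension; the involution on `Y` cancels the one in that formula.
    refine ⟨-coHook v (extInvolute Y), ?_, ?_⟩
    · rw [← sub_sub]
      exact neg_mem (coHook_mem_extDegree _ (extInvolute_mem hY))
    · have h0 : ExteriorAlgebra.ι ℝ v * μ = 0 := by
        refine eq_zero_of_mem_extDegree_of_finrank_lt (W := Module.Dual ℝ W) ?_
          (mul_mem_extDegree (ι_mem_extDegree v) hμ)
        rw [Subspace.dual_finrank_eq]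
        omega
      have := hook_ι_form_mul (extInvolute Y) v μ
      rw [h0, map_zero, extInvolute_involute] at this
      rw [map_neg, LinearMap.neg_apply]
      exact (eq_neg_of_add_eq_zero_right this.symm).symm

theorem ext_sum_decompose (x : ExteriorAlgebra ℝ W) :
    ∃ (s : Finset ℕ) (y : ℕ → ExteriorAlgebra ℝ W), (∀ k : ℕ, y k ∈ extDegree W k) ∧
      x = ∑ k ∈ s, y k := by
  classical
  refine ⟨_, fun k => DirectSum.decompose (fun i : ℕ => ⋀[ℝ]^i W) x k, fun k => ?_,
    (DirectSum.sum_support_decompose (fun i : ℕ => ⋀[ℝ]^i W) x).symm⟩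
  rw [extDegree_natCast]
  exact SetLike.coe_mem _

/-- Surjectivity holds degree by degree: from `K ⌟ μ = 1` all scalars are reached, and
`hook_top_exists` adds one covector at a time. Injectivity follows since the exterior algebras of a
space and of its dual have equal dimension. -/
theorem hook_top_bijective [FiniteDimensional ℝ W] {μ : ExtForm W}
    (hμ : μ ∈ extDegree (Module.Dual ℝ W) (Module.finrank ℝ W))
    {K : ExteriorAlgebra ℝ W} (hK : K ∈ extDegree W (Module.finrank ℝ W)) (h1 : hook K μ = 1) :
    Function.Bijective ((hook (T := W)).toLinearMap.flip μ) := by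
  have hs : Function.Surjective ((hook (T := W)).toLinearMap.flip μ) := by
    intro β
    obtain ⟨s, y, hy, rfl⟩ := ext_sum_decompose β
    choose Y _ hY using fun k => hook_top_exists hμ hK h1 (hy k)
    refine ⟨∑ k ∈ s, Y k, ?_⟩
    rw [map_sum]
    exact Finset.sum_congr rfl fun k _ => hY k
  refine ⟨?_, hs⟩
  refine (LinearMap.injective_iff_surjective_of_finrank_eq_finrank ?_).2 hs
  rw [Module.finrank_eq_card_basis (Module.finBasis ℝ W).ExteriorAlgebra,
    Module.finrank_eq_card_basis (Module.finBasis ℝ W).dualBasis.ExteriorAlgebra]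

end ExteriorAlgebraLemmas

set_option linter.unusedSimpArgs false

/-! ### Pointwise algebra of the Hamiltonian equation for a form `∑ ε_k ∧ e_k ∧ (b_k ⌟ μ)`. -/

section PolysymplecticAlgebra

variable {E : Type*} [AddCommGroup E] [Module ℝ E] {G : Type*} [AddCommGroup G] [Module ℝ G]

/-- A covector on the fibre, as a covector on the product that vanishes on the base. -/
abbrev vertCo (E : Type*) [AddCommGroup E] [Module ℝ E] (l : Module.Dual ℝ G) :
    Module.Dual ℝ (E × G) := l ∘ₗ LinearMap.snd ℝ E G

/-- A form on the base as a form on the product. -/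
abbrev horForm (G : Type*) [AddCommGroup G] [Module ℝ G] :
    ExtForm E →ₐ[ℝ] ExtForm (E × G) := formPullback (LinearMap.fst ℝ E G)

/-- The coefficient of a multivector along a vertical covector. -/
def vertComp (X : ExteriorAlgebra ℝ (E × G)) (l : Module.Dual ℝ G) : ExteriorAlgebra ℝ E :=
  ExteriorAlgebra.map (LinearMap.fst ℝ E G) (extInvolute (coHook (vertCo E l) X))

/-- The form `∑ ε_k ∧ e_k ∧ (b_k ⌟ μ)`. -/
def polyForm {κ : Type*} [Fintype κ] (ε e : κ → Module.Dual ℝ G) (b : κ → E) (μ : ExtForm E) :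
    ExtForm (E × G) :=
  ∑ k, ExteriorAlgebra.ι ℝ (vertCo E (ε k)) * (ExteriorAlgebra.ι ℝ (vertCo E (e k)) *
    horForm G (vectorHook (b k) μ))

/-- The vector valued two-form `∑ b_k ⊗ (ε_k ∧ e_k)`. -/
def polySymp {κ : Type*} [Fintype κ] (ε e : κ → Module.Dual ℝ G) (b : κ → E) (u u' : G) : E :=
  ∑ k, (ε k u * e k u' - e k u * ε k u') • b k

/-- The form `∑ ν_N ∧ (γ_N ⌟ μ)`. -/
def vertForm {J : Type*} [Fintype J] (ν : J → Module.Dual ℝ G) (μ : ExtForm E)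
    (γ : J → ExteriorAlgebra ℝ E) : ExtForm (E × G) :=
  ∑ N, ExteriorAlgebra.ι ℝ (vertCo E (ν N)) * horForm G (hook (γ N) μ)

theorem polySymp_swap {κ : Type*} [Fintype κ] (ε e : κ → Module.Dual ℝ G) (b : κ → E) (u u' : G) :
    polySymp ε e b u' u = -polySymp ε e b u u' := by
  simp only [polySymp, ← Finset.sum_neg_distrib, ← neg_smul]
  exact Finset.sum_congr rfl fun k _ => by congr 1; ring

theorem coHook_extInvolute {W : Type*} [AddCommGroup W] [Module ℝ W] (d : Module.Dual ℝ W)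
    (x : ExteriorAlgebra ℝ W) : coHook d (extInvolute x) = -extInvolute (coHook d x) := by
  induction x using extInduction_right with
  | algebraMap r => simp only [AlgHom.commutes, coHook_algebraMap, map_zero, neg_zero]
  | add x y hx hy => simp only [map_add, hx, hy, neg_add]
  | mul_ι x v hx =>
    simp only [map_mul, extInvolute_ι, mul_neg, map_neg, coHook_mul_ι, hx, map_sub, map_smul]
    simp only [neg_mul, sub_neg_eq_add, neg_add]

theorem coHook_map {W W' : Type*} [AddCommGroup W] [Module ℝ W] [AddCommGroup W'] [Module ℝ W']
    (f : W →ₗ[ℝ] W') (d : Module.Dual ℝ W') (x : ExteriorAlgebra ℝ W) :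
    coHook d (ExteriorAlgebra.map f x) = ExteriorAlgebra.map f (coHook (d ∘ₗ f) x) := by
  induction x using extInduction_right with
  | algebraMap r => simp only [AlgHom.commutes, coHook_algebraMap, map_zero]
  | add x y hx hy => simp only [map_add, hx, hy]
  | mul_ι x v hx =>
    simp only [map_mul, ExteriorAlgebra.map_apply_ι, coHook_mul_ι, hx, map_sub, map_smul,
      LinearMap.comp_apply]

theorem extInvolute_map {W W' : Type*} [AddCommGroup W] [Module ℝ W] [AddCommGroup W']
    [Module ℝ W'] (f : W →ₗ[ℝ] W') (x : ExteriorAlgebra ℝ W) :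
    extInvolute (ExteriorAlgebra.map f x) = ExteriorAlgebra.map f (extInvolute x) := by
  induction x using extInduction_right with
  | algebraMap r => simp only [AlgHom.commutes]
  | add x y hx hy => simp only [map_add, hx, hy]
  | mul_ι x v hx =>
    simp only [map_mul, ExteriorAlgebra.map_apply_ι, extInvolute_ι, hx, map_neg]

theorem coHook_zero_left {W : Type*} [AddCommGroup W] [Module ℝ W] (x : ExteriorAlgebra ℝ W) :
    coHook 0 x = 0 := by simp [coHook]

theorem vertCo_comp_inl (l : Module.Dual ℝ G) : vertCo E l ∘ₗ LinearMap.inl ℝ E G = 0 := by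
  ext; simp

theorem formPullback_inl_vertCo_mul (l : Module.Dual ℝ G) (β : ExtForm (E × G)) :
    formPullback (LinearMap.inl ℝ E G) (ExteriorAlgebra.ι ℝ (vertCo E l) * β) = 0 := by
  rw [map_mul, formPullback_ι, vertCo_comp_inl, map_zero, zero_mul]

theorem formPullback_inl_horForm (β : ExtForm E) :
    formPullback (LinearMap.inl ℝ E G) (horForm G β) = β := by
  rw [horForm, ← formPullback_comp, LinearMap.fst_comp_inl, formPullback_id]

theorem horForm_injective : Function.Injective (horForm G : ExtForm E → ExtForm (E × G)) :=
  Function.LeftInverse.injective formPullback_inl_horForm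

theorem vectorHook_vert_horForm (u : G) (β : ExtForm E) :
    vectorHook ((0, u) : E × G) (horForm G β) = 0 := by
  rw [horForm, vectorHook_formPullback]
  simp

theorem vectorHook_vert_vertCo_mul (u : G) (l : Module.Dual ℝ G) (β : ExtForm (E × G)) :
    vectorHook ((0, u) : E × G) (ExteriorAlgebra.ι ℝ (vertCo E l) * β) =
      l u • β - ExteriorAlgebra.ι ℝ (vertCo E l) * vectorHook ((0, u) : E × G) β := by
  rw [vectorHook_ι_mul]; rfl

theorem vertComp_add (X : ExteriorAlgebra ℝ (E × G)) (l l' : Module.Dual ℝ G) :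
    vertComp X (l + l') = vertComp X l + vertComp X l' := by
  simp only [vertComp, vertCo, LinearMap.add_comp, coHook_add_left, map_add]

theorem vertComp_smul (X : ExteriorAlgebra ℝ (E × G)) (c : ℝ) (l : Module.Dual ℝ G) :
    vertComp X (c • l) = c • vertComp X l := by
  simp only [vertComp, vertCo, LinearMap.smul_comp, coHook_smul_left, map_smul]

theorem vertComp_sum_smul {J : Type*} [Fintype J] (X : ExteriorAlgebra ℝ (E × G)) (c : J → ℝ)
    (l : J → Module.Dual ℝ G) :
    vertComp X (∑ N, c N • l N) = ∑ N, c N • vertComp X (l N) := by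
  have h : ∀ s : Finset J, vertComp X (∑ N ∈ s, c N • l N) = ∑ N ∈ s, c N • vertComp X (l N) := by
    intro s
    classical
    induction s using Finset.induction with
    | empty =>
      simp only [Finset.sum_empty, vertComp, vertCo, LinearMap.zero_comp, coHook_zero_left, map_zero]
    | insert i s hi ih => rw [Finset.sum_insert hi, Finset.sum_insert hi, vertComp_add, vertComp_smul, ih]
  exact h _

theorem vertComp_mem_extDegree {a : ℤ} {X : ExteriorAlgebra ℝ (E × G)}
    (hX : X ∈ extDegree (E × G) a) (l : Module.Dual ℝ G) : vertComp X l ∈ extDegree E (a - 1) :=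
  map_mem_extDegree _ (extInvolute_mem (coHook_mem_extDegree _ hX))

variable {κ : Type*} [Fintype κ] (ε e : κ → Module.Dual ℝ G) (b : κ → E) (μ : ExtForm E)
  {J : Type*} [Fintype J] (ν : J → Module.Dual ℝ G) (w : J → G)

/-- Each of the two vertical covectors `ε_k`, `e_k` is either absorbed by `X` or left standing
(`hook_ι_form_mul` twice). The four resulting terms carry 0, 1, 1 and 2 vertical covectors. -/
theorem hook_polyForm (X : ExteriorAlgebra ℝ (E × G)) :
    hook X (polyForm ε e b μ) =
      ∑ k, (horForm G (hook (ExteriorAlgebra.map (LinearMap.fst ℝ E G)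
          (coHook (vertCo E (e k)) (coHook (vertCo E (ε k)) X)) * ExteriorAlgebra.ι ℝ (b k)) μ) +
        ExteriorAlgebra.ι ℝ (vertCo E (e k)) *
          horForm G (hook (vertComp X (ε k) * ExteriorAlgebra.ι ℝ (b k)) μ) -
        ExteriorAlgebra.ι ℝ (vertCo E (ε k)) *
          horForm G (hook (vertComp X (e k) * ExteriorAlgebra.ι ℝ (b k)) μ) +
        ExteriorAlgebra.ι ℝ (vertCo E (ε k)) * (ExteriorAlgebra.ι ℝ (vertCo E (e k)) *
          horForm G (hook (ExteriorAlgebra.map (LinearMap.fst ℝ E G) X *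
            ExteriorAlgebra.ι ℝ (b k)) μ))) := by
  rw [polyForm, map_sum]
  refine Finset.sum_congr rfl fun k _ => ?_
  simp only [hook_ι_form_mul, coHook_extInvolute, extInvolute_involute, hook_formPullback,
    hook_mul, hook_ι, vertComp, map_neg, LinearMap.neg_apply, mul_add, mul_neg, horForm]
  abel

/-- Contracting with one vertical vector and restricting to horizontal vectors isolates the part
with exactly one vertical covector. -/
theorem pullback_vectorHook_hook_polyForm (X : ExteriorAlgebra ℝ (E × G)) (u : G) :
    formPullback (LinearMap.inl ℝ E G) (vectorHook ((0, u) : E × G) (hook X (polyForm ε e b μ))) =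
      hook (∑ k, (e k u • vertComp X (ε k) - ε k u • vertComp X (e k)) *
        ExteriorAlgebra.ι ℝ (b k)) μ := by
  rw [hook_polyForm, map_sum, map_sum, map_sum, LinearMap.sum_apply]
  refine Finset.sum_congr rfl fun k _ => ?_
  simp only [map_add, map_sub, vectorHook_vert_horForm, vectorHook_vert_vertCo_mul, mul_zero,
    sub_zero, zero_add, map_smul, formPullback_inl_horForm, formPullback_inl_vertCo_mul,
    smul_zero, add_zero, sub_mul, LinearMap.sub_apply, smul_mul_assoc, LinearMap.smul_apply,
    mul_sub, sub_self]

/-- Two vertical contractions isolate the part with two vertical covectors, to which only the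
horizontal part of `X` contributes. -/
theorem pullback_vectorHook_vectorHook_hook_polyForm (X : ExteriorAlgebra ℝ (E × G)) (u u' : G) :
    formPullback (LinearMap.inl ℝ E G) (vectorHook ((0, u') : E × G)
      (vectorHook ((0, u) : E × G) (hook X (polyForm ε e b μ)))) =
      hook (ExteriorAlgebra.map (LinearMap.fst ℝ E G) X *
        ExteriorAlgebra.ι ℝ (polySymp ε e b u u')) μ := by
  rw [hook_polyForm, map_sum, map_sum, map_sum, polySymp, map_sum, Finset.mul_sum, map_sum,
    LinearMap.sum_apply]
  refine Finset.sum_congr rfl fun k _ => ?_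
  simp only [map_add, map_sub, vectorHook_vert_horForm, vectorHook_vert_vertCo_mul, mul_zero,
    sub_zero, zero_add, map_smul, formPullback_inl_horForm, formPullback_inl_vertCo_mul,
    smul_zero, add_zero, sub_mul, LinearMap.sub_apply, smul_mul_assoc, LinearMap.smul_apply,
    mul_sub, sub_self, mul_smul_comm, smul_smul, sub_smul, zero_sub]

variable {ε e b μ ν w}

/-- Compare the parts with one vertical covector and cancel `μ`. Expanding `ε_k` and `e_k` in the
covectors `ν_N` collects the coefficients into the two-form `polySymp`. This is the Hamiltonian
equation in coordinates. -/
theorem vertForm_eq_of_hook_eq [DecidableEq J] (hε : ∀ k, ε k = ∑ N, ε k (w N) • ν N)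
    (he : ∀ k, e k = ∑ N, e k (w N) • ν N) (hνw : ∀ N K, ν N (w K) = if N = K then 1 else 0)
    (hμ : Function.Injective fun Y : ExteriorAlgebra ℝ E => hook Y μ)
    {X : ExteriorAlgebra ℝ (E × G)} {γ : J → ExteriorAlgebra ℝ E}
    (h : hook X (polyForm ε e b μ) = vertForm ν μ γ) (K : J) :
    γ K = ∑ N, vertComp X (ν N) * ExteriorAlgebra.ι ℝ (polySymp ε e b (w N) (w K)) := by
  apply hμ
  have h1 := pullback_vectorHook_hook_polyForm ε e b μ X (w K)
  rw [h, vertForm, map_sum, map_sum] at h1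
  simp only [vectorHook_vert_vertCo_mul, vectorHook_vert_horForm, mul_zero, sub_zero, map_smul,
    formPullback_inl_horForm, hνw] at h1
  simp only [ite_smul, one_smul, zero_smul, Finset.sum_ite_eq', Finset.mem_univ, if_true] at h1
  refine h1.trans (congrArg (fun Y => hook Y μ) ?_)
  have h2 : ∀ k, vertComp X (ε k) = ∑ N, ε k (w N) • vertComp X (ν N) := fun k => by
    conv_lhs => rw [hε k]
    exact vertComp_sum_smul X _ _
  have h3 : ∀ k, vertComp X (e k) = ∑ N, e k (w N) • vertComp X (ν N) := fun k => by
    conv_lhs => rw [he k]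
    exact vertComp_sum_smul X _ _
  simp only [polySymp, map_sum, Finset.mul_sum]
  rw [Finset.sum_comm]
  refine Finset.sum_congr rfl fun k _ => ?_
  rw [h2, h3, Finset.smul_sum, Finset.smul_sum, ← Finset.sum_sub_distrib, Finset.sum_mul]
  refine Finset.sum_congr rfl fun N _ => ?_
  rw [map_smul, mul_smul_comm, smul_smul, smul_smul, ← sub_smul, smul_mul_assoc]
  congr 1
  ring

/-- Every term of `vertForm` has a single vertical covector, so two vertical contractions kill the
right-hand side. This constraint on the horizontal part of `X` is what makes brackets horizontal. -/
theorem map_fst_mul_eq_zero_of_hook_eq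
    (hμ : Function.Injective fun Y : ExteriorAlgebra ℝ E => hook Y μ)
    {X : ExteriorAlgebra ℝ (E × G)} {γ : J → ExteriorAlgebra ℝ E}
    (h : hook X (polyForm ε e b μ) = vertForm ν μ γ) (u u' : G) :
    ExteriorAlgebra.map (LinearMap.fst ℝ E G) X *
      ExteriorAlgebra.ι ℝ (polySymp ε e b u u') = 0 := by
  apply hμ
  have h1 := pullback_vectorHook_vectorHook_hook_polyForm ε e b μ X u u'
  rw [h, vertForm, map_sum, map_sum, map_sum] at h1
  simp only [vectorHook_vert_vertCo_mul, vectorHook_vert_horForm, mul_zero, sub_zero, map_smul,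
    smul_zero, map_zero, Finset.sum_const_zero] at h1
  simp only [← h1, map_zero, LinearMap.zero_apply]

theorem hook_vertForm (X : ExteriorAlgebra ℝ (E × G)) (γ : J → ExteriorAlgebra ℝ E) :
    hook X (vertForm ν μ γ) =
      horForm G (hook (∑ N, ExteriorAlgebra.map (LinearMap.fst ℝ E G)
        (coHook (vertCo E (ν N)) X) * γ N) μ) +
      vertForm ν μ fun N =>
        ExteriorAlgebra.map (LinearMap.fst ℝ E G) (extInvolute X) * γ N := by
  simp only [vertForm, map_sum, LinearMap.sum_apply, ← Finset.sum_add_distrib, hook_ι_form_mul,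
    horForm, hook_formPullback, hook_mul]

/-- If no vector of `X` meets the covector `ν_N`, the horizontal part of `X` multiplies `γ'_N`,
hence some `σ_{KN}`, and vanishes. Only the terms in which `X` absorbs `ν_N` survive, and these are
horizontal. The sign `(-1)^a` is the one in the definition of the bracket. -/
theorem hook_vertForm_of_hamiltonian
    (hμ : Function.Injective fun Y : ExteriorAlgebra ℝ E => hook Y μ)
    {a c : ℤ} {X : ExteriorAlgebra ℝ (E × G)} (hX : X ∈ extDegree (E × G) a)
    {γ γ' : J → ExteriorAlgebra ℝ E} (h : hook X (polyForm ε e b μ) = vertForm ν μ γ)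
    {Y : J → ExteriorAlgebra ℝ E} (hY : ∀ N, Y N ∈ extDegree E c)
    (hγ' : ∀ K, γ' K = ∑ N, Y N * ExteriorAlgebra.ι ℝ (polySymp ε e b (w N) (w K))) :
    (a.negOnePow : ℤ) • hook X (vertForm ν μ γ') =
      horForm G (hook (-∑ N, vertComp X (ν N) * γ' N) μ) := by
  -- The horizontal part of `X` is moved past `Y N` to stand next to the value of `polySymp` that
  -- annihilates it.
  have h0 : ∀ N, ExteriorAlgebra.map (LinearMap.fst ℝ E G) (extInvolute X) * γ' N = 0 := by
    intro K
    rw [hγ', Finset.mul_sum]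
    refine Finset.sum_eq_zero fun N _ => ?_
    rw [extInvolute_of_mem hX, map_zsmul, smul_mul_assoc, ← mul_assoc,
      ext_mul_comm (map_mem_extDegree _ hX) (hY N), smul_mul_assoc, mul_assoc,
      map_fst_mul_eq_zero_of_hook_eq hμ h, mul_zero, smul_zero, smul_zero]
  rw [hook_vertForm]
  simp only [h0]
  -- `vertComp` contains an involution, applied here in degree `a - 1`; it contributes the sign
  -- `-(-1)^a`.
  have h1 : ∀ N, ExteriorAlgebra.map (LinearMap.fst ℝ E G) (coHook (vertCo E (ν N)) X) =
      -(a.negOnePow : ℤ) • vertComp X (ν N) := by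
    intro N
    have := extInvolute_of_mem (coHook_mem_extDegree (vertCo E (ν N)) hX)
    rw [vertComp, this, map_zsmul, smul_smul, Int.negOnePow_sub, Int.negOnePow_one, Units.val_mul,
      Units.val_neg, Units.val_one, mul_neg_one, neg_mul_neg, negOnePow_mul_self, one_smul]
  simp only [h1, smul_mul_assoc, ← Finset.smul_sum]
  rw [show (vertForm ν μ fun _ => 0) = 0 by simp [vertForm], add_zero, ← map_zsmul,
    ← LinearMap.smul_apply, ← map_zsmul, smul_smul, mul_neg, negOnePow_mul_self, neg_one_smul]

/-- The multivector `∑ w_N ∧ Z_N` has exactly one vertical factor in each term. It can absorb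
neither two vertical covectors nor none, so only the two middle terms of `hook_polyForm` remain.
This solves the Hamiltonian equation as soon as coefficients `Z_N` are known. -/
theorem hook_sum_vert_polyForm [DecidableEq J] (hε : ∀ k, ε k = ∑ N, ε k (w N) • ν N)
    (he : ∀ k, e k = ∑ N, e k (w N) • ν N) (Z : J → ExteriorAlgebra ℝ E) :
    hook (∑ N, ExteriorAlgebra.ι ℝ ((0, w N) : E × G) *
        ExteriorAlgebra.map (LinearMap.inl ℝ E G) (Z N)) (polyForm ε e b μ) =
      vertForm ν μ fun K =>
        ∑ N, Z N * ExteriorAlgebra.ι ℝ (polySymp ε e b (w N) (w K)) := by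
  have h1 : ∀ (l : Module.Dual ℝ G) (Y : ExteriorAlgebra ℝ E),
      coHook (vertCo E l) (ExteriorAlgebra.map (LinearMap.inl ℝ E G) Y) = 0 := by
    intro l Y
    rw [coHook_map, vertCo_comp_inl, coHook_zero_left, map_zero]
  have h2 : ∀ (l : Module.Dual ℝ G) (v : G) (Y : ExteriorAlgebra ℝ E),
      coHook (vertCo E l) (ExteriorAlgebra.ι ℝ ((0, v) : E × G) *
        ExteriorAlgebra.map (LinearMap.inl ℝ E G) Y) =
      l v • ExteriorAlgebra.map (LinearMap.inl ℝ E G) (extInvolute Y) := by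
    intro l v Y
    rw [ι_mul_eq_involute_mul, coHook_mul_ι, extInvolute_map, h1, zero_mul, sub_zero]
    rfl
  have h3 : ∀ Y : ExteriorAlgebra ℝ E, ExteriorAlgebra.map (LinearMap.fst ℝ E G)
      (ExteriorAlgebra.map (LinearMap.inl ℝ E G) Y) = Y := by
    intro Y
    rw [map_map, LinearMap.fst_comp_inl, map_id_apply]
  rw [hook_polyForm]
  simp only [vertComp, map_sum, h2, map_smul, h1, smul_zero, Finset.sum_const_zero, zero_mul,
    map_zero, LinearMap.zero_apply, extInvolute_map, h3, extInvolute_involute, map_mul,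
    ExteriorAlgebra.map_apply_ι, LinearMap.fst_apply, mul_zero, add_zero, zero_add, Finset.sum_mul,
    smul_mul_assoc, LinearMap.sum_apply, LinearMap.smul_apply]
  simp only [vertForm, polySymp, map_sum, Finset.mul_sum, LinearMap.sum_apply, map_smul,
    LinearMap.smul_apply, mul_smul_comm, map_mul]
  -- Expansion of an arbitrary vertical covector in the `ν_K`; applied below to both `ε_k` and
  -- `e_k`.
  have h4 : ∀ l : Module.Dual ℝ G, l = ∑ N, l (w N) • ν N → ∀ β : ExtForm (E × G),
      ExteriorAlgebra.ι ℝ (vertCo E l) * β =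
        ∑ K, l (w K) • (ExteriorAlgebra.ι ℝ (vertCo E (ν K)) * β) := by
    intro l hl β
    have : vertCo E l = ∑ N, l (w N) • vertCo E (ν N) := by
      conv_lhs => rw [hl]
      ext <;> simp
    rw [this, map_sum, Finset.sum_mul]
    simp only [map_smul, smul_mul_assoc]
  rw [Finset.sum_congr rfl fun K (_ : K ∈ Finset.univ) => Finset.sum_comm]
  rw [Finset.sum_comm (s := (Finset.univ : Finset J)) (t := (Finset.univ : Finset κ))]
  refine Finset.sum_congr rfl fun k _ => ?_
  rw [← Finset.sum_sub_distrib, Finset.sum_comm]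
  refine Finset.sum_congr rfl fun N _ => ?_
  rw [h4 _ (hε k), h4 _ (he k), Finset.smul_sum, Finset.smul_sum, ← Finset.sum_sub_distrib]
  refine Finset.sum_congr rfl fun K _ => ?_
  rw [smul_smul, smul_smul, ← sub_smul]

end PolysymplecticAlgebra

/-! ### Norms on exterior algebras; derivatives of linear and bilinear expressions. -/

section NormedExterior

/-- A norm on the exterior algebra. -/
@[reducible]
def extNormedAddCommGroup (W : Type*) [AddCommGroup W] [Module ℝ W] [FiniteDimensional ℝ W] :
    NormedAddCommGroup (ExteriorAlgebra ℝ W) :=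
  NormedAddCommGroup.induced _ _ (Module.finBasis ℝ (ExteriorAlgebra ℝ W)).equivFun
    (Module.finBasis ℝ (ExteriorAlgebra ℝ W)).equivFun.injective

attribute [local instance] extNormedAddCommGroup

/-- The exterior algebra as a normed space. -/
@[reducible]
def extNormedSpace (W : Type*) [AddCommGroup W] [Module ℝ W] [FiniteDimensional ℝ W] :
    NormedSpace ℝ (ExteriorAlgebra ℝ W) :=
  NormedSpace.induced ℝ _ _ (Module.finBasis ℝ (ExteriorAlgebra ℝ W)).equivFun.toLinearMap

attribute [local instance] extNormedSpace

variable {A B C : Type*} [NormedAddCommGroup A] [NormedSpace ℝ A] [FiniteDimensional ℝ A]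
  [NormedAddCommGroup B] [NormedSpace ℝ B] [FiniteDimensional ℝ B]
  [NormedAddCommGroup C] [NormedSpace ℝ C]

/-- A bilinear map between finite-dimensional spaces as a continuous bilinear map. -/
def bilinCLM (f : A →ₗ[ℝ] B →ₗ[ℝ] C) : A →L[ℝ] B →L[ℝ] C :=
  LinearMap.toContinuousLinearMap
    ((LinearMap.toContinuousLinearMap (𝕜 := ℝ) (E := B) (F' := C)).toLinearMap ∘ₗ f)

@[simp] theorem bilinCLM_apply (f : A →ₗ[ℝ] B →ₗ[ℝ] C) (x : A) (y : B) :
    bilinCLM f x y = f x y := rfl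

variable {G : Type*} [NormedAddCommGroup G] [NormedSpace ℝ G]

theorem fderiv_linear_comp (L : A →ₗ[ℝ] C) {φ : G → A} {g : G} (hφ : DifferentiableAt ℝ φ g)
    (u : G) : fderiv ℝ (fun g => L (φ g)) g u = L (fderiv ℝ φ g u) := by
  have h := (LinearMap.toContinuousLinearMap L).hasFDerivAt.comp g hφ.hasFDerivAt
  have h' : fderiv ℝ (fun g => L (φ g)) g = (LinearMap.toContinuousLinearMap L).comp (fderiv ℝ φ g) :=
    h.fderiv
  rw [h']; rfl

theorem fderiv_bilinear (f : A →ₗ[ℝ] B →ₗ[ℝ] C) {φ : G → A} {γ : G → B} {g : G}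
    (hφ : DifferentiableAt ℝ φ g) (hγ : DifferentiableAt ℝ γ g) (u : G) :
    fderiv ℝ (fun g => f (φ g) (γ g)) g u = f (fderiv ℝ φ g u) (γ g) + f (φ g) (fderiv ℝ γ g u) := by
  have h := (bilinCLM f).hasFDerivAt_of_bilinear hφ.hasFDerivAt hγ.hasFDerivAt
  have h' := h.fderiv
  simp only [bilinCLM_apply] at h'
  rw [h']
  simp [ContinuousLinearMap.precompR, ContinuousLinearMap.precompL, add_comm]

theorem fderiv_mem_of_forall_mem (S : Submodule ℝ A) {φ : G → A} {g : G} (h : ∀ g, φ g ∈ S)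
    (hφ : DifferentiableAt ℝ φ g) (u : G) : fderiv ℝ φ g u ∈ S := by
  obtain ⟨P, hP⟩ := S.exists_isCompl
  -- A function with values in `S` equals its own projection onto `S`, and the derivative commutes
  -- with that linear projection.
  have h1 : φ = fun g => (S.subtype ∘ₗ S.projectionOnto P hP) (φ g) := by
    funext g
    have := Submodule.projectionOnto_apply_left hP ⟨φ g, h g⟩
    simpa using (congrArg Subtype.val this).symm
  rw [h1, fderiv_linear_comp _ hφ]
  exact SetLike.coe_mem _

theorem fderiv_fderiv_comm {φ : G → A} (hφ : ContDiff ℝ ∞ φ) (g u v : G) :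
    fderiv ℝ (fun g => fderiv ℝ φ g u) g v = fderiv ℝ (fun g => fderiv ℝ φ g v) g u := by
  have h1 : DifferentiableAt ℝ (fderiv ℝ φ) g :=
    (hφ.fderiv_right (m := 1) (by norm_cast)).differentiable (by norm_num) g
  have h2 : ∀ u v : G, fderiv ℝ (fun g => fderiv ℝ φ g u) g v = fderiv ℝ (fderiv ℝ φ) g v u := by
    intro u v
    rw [fderiv_clm_apply h1 (differentiableAt_const u)]
    simp
  rw [h2, h2]
  have := (hφ.contDiffAt (x := g)).isSymmSndFDerivAt (n := ∞) (by
    rw [minSmoothness_of_isRCLikeNormedField]; exact WithTop.coe_le_coe.2 le_top)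
  exact this v u

theorem contDiff_fderiv_apply {φ : G → A} (hφ : ContDiff ℝ ∞ φ) (u : G) :
    ContDiff ℝ ∞ fun g => fderiv ℝ φ g u :=
  (hφ.fderiv_right (m := ∞) (by norm_cast)).clm_apply contDiff_const

theorem contDiff_bilinear (f : A →ₗ[ℝ] B →ₗ[ℝ] C) {φ : G → A} {γ : G → B}
    (hφ : ContDiff ℝ ∞ φ) (hγ : ContDiff ℝ ∞ γ) : ContDiff ℝ ∞ fun g => f (φ g) (γ g) :=
  ((bilinCLM f).contDiff.comp hφ).clm_apply hγ

theorem contDiff_linear (f : A →ₗ[ℝ] C) {φ : G → A} (hφ : ContDiff ℝ ∞ φ) :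
    ContDiff ℝ ∞ fun g => f (φ g) :=
  (LinearMap.toContinuousLinearMap f).contDiff.comp hφ

end NormedExterior

/-! ### Hamiltonian multivector valued functions on a vector space -/

section ModelCalculus

attribute [local instance] extNormedAddCommGroup extNormedSpace

variable {E : Type*} [AddCommGroup E] [Module ℝ E] [FiniteDimensional ℝ E]
  {G : Type*} [NormedAddCommGroup G] [NormedSpace ℝ G]
  {J : Type*} [Fintype J] (w : J → G) (σ : J → J → E)

theorem fderiv_ext_mul {φ γ : G → ExteriorAlgebra ℝ E} {g : G}
    (hφ : DifferentiableAt ℝ φ g) (hγ : DifferentiableAt ℝ γ g) (u : G) :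
    fderiv ℝ (fun g => φ g * γ g) g u = fderiv ℝ φ g u * γ g + φ g * fderiv ℝ γ g u :=
  fderiv_bilinear (LinearMap.mul ℝ (ExteriorAlgebra ℝ E)) hφ hγ u

theorem contDiff_ext_mul {φ γ : G → ExteriorAlgebra ℝ E}
    (hφ : ContDiff ℝ ∞ φ) (hγ : ContDiff ℝ ∞ γ) : ContDiff ℝ ∞ fun g => φ g * γ g :=
  contDiff_bilinear (LinearMap.mul ℝ (ExteriorAlgebra ℝ E)) hφ hγ

/-- The equation `∂_K φ = ∑ X_N ∧ σ_{NK}` for smooth functions, where `φ` has degree `a` and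
the `X_N` have degree `a - 1`. -/
structure ModelHamiltonian (a : ℤ) (X : J → G → ExteriorAlgebra ℝ E)
    (φ : G → ExteriorAlgebra ℝ E) : Prop where
  smooth : ContDiff ℝ ∞ φ
  smooth_field : ∀ N, ContDiff ℝ ∞ (X N)
  degree : ∀ g, φ g ∈ extDegree E a
  degree_field : ∀ N g, X N g ∈ extDegree E (a - 1)
  eq : ∀ K g, fderiv ℝ φ g (w K) = ∑ N, X N g * ExteriorAlgebra.ι ℝ (σ N K)

/-- The bracket on multivector valued functions. -/
def modelBracket (X : J → G → ExteriorAlgebra ℝ E) (γ : G → ExteriorAlgebra ℝ E) (g : G) :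
    ExteriorAlgebra ℝ E := -∑ N, X N g * fderiv ℝ γ g (w N)

/-- The Hamiltonian coefficients of the bracket. -/
def modelCommutator (X Y : J → G → ExteriorAlgebra ℝ E) (N : J) (g : G) : ExteriorAlgebra ℝ E :=
  ∑ K, (fderiv ℝ (X N) g (w K) * Y K g - X K g * fderiv ℝ (Y N) g (w K))

variable {w σ}

theorem contDiff_modelBracket {X : J → G → ExteriorAlgebra ℝ E} (hX : ∀ N, ContDiff ℝ ∞ (X N))
    {γ : G → ExteriorAlgebra ℝ E} (hγ : ContDiff ℝ ∞ γ) : ContDiff ℝ ∞ (modelBracket w X γ) :=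
  (ContDiff.sum fun N _ => contDiff_ext_mul (hX N) (contDiff_fderiv_apply hγ (w N))).neg

theorem fderiv_modelBracket {X : J → G → ExteriorAlgebra ℝ E} (hX : ∀ N, ContDiff ℝ ∞ (X N))
    {γ : G → ExteriorAlgebra ℝ E} (hγ : ContDiff ℝ ∞ γ) (g u : G) :
    fderiv ℝ (modelBracket w X γ) g u = -∑ N, (fderiv ℝ (X N) g u * fderiv ℝ γ g (w N) +
      X N g * fderiv ℝ (fun g => fderiv ℝ γ g u) g (w N)) := by
  have h1 : ∀ N, DifferentiableAt ℝ (X N) g := fun N => (hX N).differentiable (by norm_num) g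
  have h2 : ∀ v, DifferentiableAt ℝ (fun g => fderiv ℝ γ g v) g := fun v =>
    (contDiff_fderiv_apply hγ v).differentiable (by norm_num) g
  have h3 : modelBracket w X γ = fun g => -∑ N, X N g * fderiv ℝ γ g (w N) := rfl
  rw [h3, fderiv_fun_neg, fderiv_fun_sum fun N _ => ((contDiff_ext_mul (hX N)
    (contDiff_fderiv_apply hγ (w N))).differentiable (by norm_num) g)]
  rw [neg_apply, sum_apply]
  congr 1
  refine Finset.sum_congr rfl fun N _ => ?_
  rw [fderiv_ext_mul (h1 N) (h2 _), fderiv_fderiv_comm hγ]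

theorem contDiff_modelCommutator {X Y : J → G → ExteriorAlgebra ℝ E}
    (hX : ∀ N, ContDiff ℝ ∞ (X N)) (hY : ∀ N, ContDiff ℝ ∞ (Y N)) (N : J) :
    ContDiff ℝ ∞ (modelCommutator w X Y N) :=
  ContDiff.sum fun K _ => (contDiff_ext_mul (contDiff_fderiv_apply (hX N) _) (hY K)).sub
    (contDiff_ext_mul (hX K) (contDiff_fderiv_apply (hY N) _))

theorem modelBracket_mem_extDegree {X : J → G → ExteriorAlgebra ℝ E} {a b : ℤ}
    (hX : ∀ N g, X N g ∈ extDegree E (a - 1)) {γ : G → ExteriorAlgebra ℝ E}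
    (hγ : ContDiff ℝ ∞ γ) (hb : ∀ g, γ g ∈ extDegree E b) (g : G) :
    modelBracket w X γ g ∈ extDegree E (a + b - 1) := by
  refine neg_mem (sum_mem fun N _ => ?_)
  have := mul_mem_extDegree (hX N g)
    (fderiv_mem_of_forall_mem _ hb (hγ.differentiable (by norm_num) g) (w N))
  rwa [show a - 1 + b = a + b - 1 by ring] at this

/-- In `∂_K` of the bracket, the terms `X_N ∧ ∂_N ∂_K γ` already end in some `σ_{MK}`. The terms
`∂_K X_N ∧ ∂_N γ` end in the wrong factor `σ_{MN}`, and symmetry of the second derivatives of `φ`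
moves the index `K` to the right place. The result has the coefficients of the commutator of the two
first order operators. -/
theorem ModelHamiltonian.bracket (hσ : ∀ N K, σ N K = -σ K N) {a b : ℤ}
    {X Y : J → G → ExteriorAlgebra ℝ E} {φ γ : G → ExteriorAlgebra ℝ E}
    (h : ModelHamiltonian w σ a X φ) (h' : ModelHamiltonian w σ b Y γ) :
    ModelHamiltonian w σ (a + b - 1) (modelCommutator w X Y) (modelBracket w X γ) where
  smooth := contDiff_modelBracket h.smooth_field h'.smooth
  smooth_field := contDiff_modelCommutator h.smooth_field h'.smooth_field
  degree := modelBracket_mem_extDegree h.degree_field h'.smooth h'.degree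
  degree_field N g := by
    refine sum_mem fun K _ => sub_mem ?_ ?_
    · have := mul_mem_extDegree (fderiv_mem_of_forall_mem _ (h.degree_field N)
        ((h.smooth_field N).differentiable (by norm_num) g) (w K)) (h'.degree_field K g)
      rwa [show a - 1 + (b - 1) = a + b - 1 - 1 by ring] at this
    · have := mul_mem_extDegree (h.degree_field K g) (fderiv_mem_of_forall_mem _
        (h'.degree_field N) ((h'.smooth_field N).differentiable (by norm_num) g) (w K))
      rwa [show a - 1 + (b - 1) = a + b - 1 - 1 by ring] at this
  eq K g := by
    -- The Hamiltonian equation differentiated once more; `σ` is constant.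
    have hd : ∀ {Z : J → G → ExteriorAlgebra ℝ E} {ψ : G → ExteriorAlgebra ℝ E} {c : ℤ},
        ModelHamiltonian w σ c Z ψ → ∀ u K, fderiv ℝ (fun g => fderiv ℝ ψ g (w K)) g u =
          ∑ N, fderiv ℝ (Z N) g u * ExteriorAlgebra.ι ℝ (σ N K) := by
      intro Z ψ c hZ u K
      have h1 : (fun g => fderiv ℝ ψ g (w K)) =
          fun g => ∑ N, Z N g * ExteriorAlgebra.ι ℝ (σ N K) := by
        funext g; exact hZ.eq K g
      have h2 : ∀ N, DifferentiableAt ℝ (Z N) g := fun N =>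
        (hZ.smooth_field N).differentiable (by norm_num) g
      rw [h1, fderiv_fun_sum fun N _ => ((contDiff_ext_mul (hZ.smooth_field N)
        contDiff_const).differentiable (by norm_num) g), sum_apply]
      refine Finset.sum_congr rfl fun N _ => ?_
      rw [fderiv_ext_mul (h2 N) (differentiableAt_const _)]
      simp
    -- After commuting `Y_M` past `σ`, the inner sum `∑_N ∂_K X_N ∧ σ_{NM}` is `∂_K ∂_M φ`.
    -- Exchanging the derivatives turns it into `∑_N ∂_M X_N ∧ σ_{NK}`. The minus sign is the
    -- antisymmetry of `σ`.
    have h1 : ∑ N, fderiv ℝ (X N) g (w K) * fderiv ℝ γ g (w N) =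
        -∑ M, ∑ N, fderiv ℝ (X N) g (w M) * Y M g * ExteriorAlgebra.ι ℝ (σ N K) := by
      have hYι : ∀ M N, Y M g * ExteriorAlgebra.ι ℝ (σ M N) =
          -(((b - 1).negOnePow : ℤ) • (ExteriorAlgebra.ι ℝ (σ N M) * Y M g)) := by
        intro M N
        rw [ext_mul_comm (h'.degree_field M g) (ι_mem_extDegree _), mul_one, hσ M N, map_neg,
          neg_mul, smul_neg]
      have hYι' : ∀ M N, Y M g * ExteriorAlgebra.ι ℝ (σ N K) =
          (((b - 1).negOnePow : ℤ) • (ExteriorAlgebra.ι ℝ (σ N K) * Y M g)) := by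
        intro M N
        rw [ext_mul_comm (h'.degree_field M g) (ι_mem_extDegree _), mul_one]
      simp only [h'.eq, Finset.mul_sum]
      rw [Finset.sum_comm, ← Finset.sum_neg_distrib]
      refine Finset.sum_congr rfl fun M _ => ?_
      simp only [hYι, mul_assoc, hYι', mul_neg, mul_smul_comm, Finset.sum_neg_distrib,
        ← Finset.smul_sum]
      simp only [← mul_assoc, ← Finset.sum_mul]
      rw [← hd h, ← hd h, fderiv_fderiv_comm h.smooth]
    rw [fderiv_modelBracket h.smooth_field h'.smooth, Finset.sum_add_distrib, h1]
    simp only [hd h', modelCommutator, Finset.sum_mul, sub_mul, Finset.sum_sub_distrib,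
      Finset.mul_sum, ← mul_assoc]
    rw [neg_add, neg_neg, ← sub_eq_add_neg]
    congr 1
    · rw [Finset.sum_comm]
    · rw [Finset.sum_comm]

/-- By the Leibniz rule for the wedge product; the sign `(-1)^b` comes from moving `σ_{NK}` past
`γ`. -/
theorem ModelHamiltonian.mul {a b : ℤ}
    {X Y : J → G → ExteriorAlgebra ℝ E} {φ γ : G → ExteriorAlgebra ℝ E}
    (h : ModelHamiltonian w σ a X φ) (h' : ModelHamiltonian w σ b Y γ) :
    ModelHamiltonian w σ (a + b)
      (fun N g => (b.negOnePow : ℤ) • (X N g * γ g) + φ g * Y N g) (fun g => φ g * γ g) where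
  smooth := contDiff_ext_mul h.smooth h'.smooth
  smooth_field N := by
    have h1 : ContDiff ℝ ∞ fun g => (b.negOnePow : ℤ) • (X N g * γ g) := by
      have := contDiff_linear ((b.negOnePow : ℤ) • (LinearMap.id : ExteriorAlgebra ℝ E →ₗ[ℝ] _))
        (contDiff_ext_mul (h.smooth_field N) h'.smooth)
      exact this
    exact h1.add (contDiff_ext_mul h.smooth (h'.smooth_field N))
  degree g := mul_mem_extDegree (h.degree g) (h'.degree g)
  degree_field N g := by
    have h1 := mul_mem_extDegree (h.degree_field N g) (h'.degree g)
    have h2 := mul_mem_extDegree (h.degree g) (h'.degree_field N g)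
    rw [show a - 1 + b = a + b - 1 by ring] at h1
    rw [show a + (b - 1) = a + b - 1 by ring] at h2
    exact add_mem (zsmul_mem h1 _) h2
  eq K g := by
    have h1 := h.smooth.differentiable (by norm_num) g
    have h2 := h'.smooth.differentiable (by norm_num) g
    rw [fderiv_ext_mul h1 h2, h.eq, h'.eq, Finset.sum_mul, Finset.mul_sum,
      ← Finset.sum_add_distrib]
    refine Finset.sum_congr rfl fun N _ => ?_
    rw [add_mul, mul_assoc, mul_assoc, ext_mul_comm (ι_mem_extDegree _) (h'.degree g), one_mul,
      mul_smul_comm, smul_mul_assoc, mul_assoc]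

/-- The operator `-∑ X_N ∧ ∂_N` is a graded derivation of degree `a - 1`: in the second Leibniz term
`X_N` has to pass `γ`. -/
theorem modelBracket_mul {X : J → G → ExteriorAlgebra ℝ E} {a b : ℤ}
    (hX : ∀ N g, X N g ∈ extDegree E (a - 1)) {γ η : G → ExteriorAlgebra ℝ E}
    (hγ : ContDiff ℝ ∞ γ) (hη : ContDiff ℝ ∞ η) (hb : ∀ g, γ g ∈ extDegree E b) (g : G) :
    modelBracket w X (fun g => γ g * η g) g = modelBracket w X γ g * η g +
      (((a - 1) * b).negOnePow : ℤ) • (γ g * modelBracket w X η g) := by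
  have h1 := hγ.differentiable (by norm_num) g
  have h2 := hη.differentiable (by norm_num) g
  simp only [modelBracket, fderiv_ext_mul h1 h2, neg_mul, mul_neg, smul_neg, Finset.sum_mul,
    Finset.mul_sum, Finset.smul_sum, ← neg_add, ← Finset.sum_add_distrib, mul_add]
  congr 1
  refine Finset.sum_congr rfl fun N _ => ?_
  rw [← mul_assoc, ← mul_assoc, ext_mul_comm (hX N g) (hb g), smul_mul_assoc, mul_assoc (γ g)]

/-- In the graded commutator of two first order operators the second derivatives of `η` cancel, and
the terms that differentiate the coefficients form `modelCommutator`. No Hamiltonian equation is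
involved. -/
theorem modelBracket_modelBracket {X Y : J → G → ExteriorAlgebra ℝ E} {a b : ℤ}
    (hX : ∀ N, ContDiff ℝ ∞ (X N)) (hY : ∀ N, ContDiff ℝ ∞ (Y N))
    (ha : ∀ N g, X N g ∈ extDegree E (a - 1)) (hb : ∀ N g, Y N g ∈ extDegree E (b - 1))
    {η : G → ExteriorAlgebra ℝ E} (hη : ContDiff ℝ ∞ η) (g : G) :
    modelBracket w (modelCommutator w X Y) η g = modelBracket w X (modelBracket w Y η) g -
      (((a - 1) * (b - 1)).negOnePow : ℤ) • modelBracket w Y (modelBracket w X η) g := by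
  have h1 : ∀ N K, fderiv ℝ (X N) g (w K) ∈ extDegree E (a - 1) := fun N K =>
    fderiv_mem_of_forall_mem _ (ha N) ((hX N).differentiable (by norm_num) g) (w K)
  have key : ∀ {X Y : J → G → ExteriorAlgebra ℝ E}, (∀ N, ContDiff ℝ ∞ (X N)) →
      (∀ N, ContDiff ℝ ∞ (Y N)) → modelBracket w X (modelBracket w Y η) g =
      ∑ K, ∑ N, X K g * fderiv ℝ (Y N) g (w K) * fderiv ℝ η g (w N) +
      ∑ K, ∑ N, X K g * Y N g * fderiv ℝ (fun g => fderiv ℝ η g (w K)) g (w N) := by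
    intro X Y hX hY
    rw [modelBracket]
    simp only [fderiv_modelBracket hY hη, mul_neg, Finset.sum_neg_distrib, neg_neg,
      Finset.mul_sum, mul_add, Finset.sum_add_distrib, ← mul_assoc]
  -- Second order terms: exchanging `X_N` with `Y_K` gives the sign, and exchanging the two
  -- derivatives makes the sums equal.
  have h2 : (((a - 1) * (b - 1)).negOnePow : ℤ) •
      (∑ K, ∑ N, Y K g * X N g * fderiv ℝ (fun g => fderiv ℝ η g (w K)) g (w N)) =
      ∑ K, ∑ N, X K g * Y N g * fderiv ℝ (fun g => fderiv ℝ η g (w K)) g (w N) := by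
    rw [Finset.sum_comm, Finset.smul_sum]
    refine Finset.sum_congr rfl fun K _ => ?_
    rw [Finset.smul_sum]
    refine Finset.sum_congr rfl fun N _ => ?_
    rw [ext_mul_comm (ha K g) (hb N g), smul_mul_assoc, fderiv_fderiv_comm hη]
  -- First order terms: a derivative of `X_N` still has degree `a - 1`, so the same sign appears.
  have h3 : (((a - 1) * (b - 1)).negOnePow : ℤ) •
      (∑ K, ∑ N, Y K g * fderiv ℝ (X N) g (w K) * fderiv ℝ η g (w N)) =
      ∑ K, ∑ N, fderiv ℝ (X N) g (w K) * Y K g * fderiv ℝ η g (w N) := by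
    rw [Finset.smul_sum]
    refine Finset.sum_congr rfl fun K _ => ?_
    rw [Finset.smul_sum]
    refine Finset.sum_congr rfl fun N _ => ?_
    rw [ext_mul_comm (h1 N K) (hb K g), smul_mul_assoc]
  rw [key hX hY, key hY hX, smul_add, h2, h3, modelBracket]
  simp only [modelCommutator, Finset.sum_mul, sub_mul, Finset.sum_sub_distrib]
  rw [Finset.sum_comm, Finset.sum_comm (f := fun K N => X K g * fderiv ℝ (Y N) g (w K) * _)]
  abel

end ModelCalculus

/-! ### Tangent maps of charts and smoothness of vector fields and differentials in them. -/

section SmoothInCharts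

variable {E : Type*} [NormedAddCommGroup E] [NormedSpace ℝ E]
  {H : Type*} [TopologicalSpace H] (I : ModelWithCorners ℝ E H)
  {N : Type*} [TopologicalSpace N] [ChartedSpace H N] [IsManifold I ∞ N]

/-- The tangent map of the chart at `x₀`. -/
def tanMap (x₀ x : N) : TangentSpace I x →L[ℝ] E :=
  (trivializationAt E (TangentSpace I : N → Type _) x₀).continuousLinearMapAt ℝ x

/-- The inverse of the tangent map of the chart at `x₀`. -/
def tanInv (x₀ x : N) : E →L[ℝ] TangentSpace I x :=
  (trivializationAt E (TangentSpace I : N → Type _) x₀).symmL ℝ x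

variable {I}

theorem tanMap_tanInv {x₀ x : N} (hx : x ∈ (chartAt H x₀).source) (v : E) :
    tanMap I x₀ x (tanInv I x₀ x v) = v :=
  Bundle.Trivialization.continuousLinearMapAt_symmL _ (by simpa using hx) v

theorem tanInv_tanMap {x₀ x : N} (hx : x ∈ (chartAt H x₀).source) (v : TangentSpace I x) :
    tanInv I x₀ x (tanMap I x₀ x v) = v :=
  Bundle.Trivialization.symmL_continuousLinearMapAt _ (by simpa using hx) v

theorem tanMap_eq_mfderiv {x₀ x : N} (hx : x ∈ (chartAt H x₀).source) :
    tanMap I x₀ x = mfderiv I 𝓘(ℝ, E) (extChartAt I x₀) x :=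
  TangentBundle.continuousLinearMapAt_trivializationAt hx

theorem contMDiffAt_tangent_iff {Z : (x : N) → TangentSpace I x} {x₀ : N} :
    ContMDiffAt I I.tangent ∞ (fun x => (⟨x, Z x⟩ : TangentBundle I N)) x₀ ↔
      ContMDiffAt I 𝓘(ℝ, E) ∞ (fun x => tanMap I x₀ x (Z x)) x₀ := by
  refine (contMDiffAt_section (F := E) (E := (TangentSpace I : N → Type _)) x₀).trans ?_
  refine Filter.EventuallyEq.contMDiffAt_iff ?_
  filter_upwards [(chartAt H x₀).open_source.mem_nhds (mem_chart_source H x₀)] with x hx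
  rw [tanMap, Bundle.Trivialization.continuousLinearMapAt_apply,
    Bundle.Trivialization.coe_linearMapAt_of_mem _ (by simpa using hx)]

theorem contMDiffAt_mvfderiv_comp_tanInv {A : Type*} [NormedAddCommGroup A] [NormedSpace ℝ A]
    {f : N → A} {x₀ : N} (hf : ContMDiffAt I 𝓘(ℝ, A) ∞ f x₀) :
    ContMDiffAt I 𝓘(ℝ, E →L[ℝ] A) ∞ (fun x => (mvfderiv I f x).comp (tanInv I x₀ x)) x₀ := by
  have h := hf.mfderiv_const (m := ∞) (by norm_cast)
  refine h.congr_of_eventuallyEq ?_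
  filter_upwards [(chartAt H x₀).open_source.mem_nhds (mem_chart_source H x₀)] with x hx
  rw [inTangentCoordinates_eq_mfderiv_comp (f := id) (g := f) hx
    (by rw [chartAt_self_eq]; trivial), tanInv, TangentBundle.symmL_trivializationAt hx]
  have h3 : mfderiv 𝓘(ℝ, A) 𝓘(ℝ, A) (extChartAt 𝓘(ℝ, A) (f x₀)) (f x) =
      ContinuousLinearMap.id ℝ A := by
    rw [extChartAt_model_space_eq_id]
    exact mfderiv_id
  erw [h3]
  rfl

theorem mvfderiv_clm_extChartAt (l : E →L[ℝ] ℝ) {x₀ x : N} (hx : x ∈ (chartAt H x₀).source) :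
    mvfderiv I (fun x => l (extChartAt I x₀ x)) x = l.comp (tanMap I x₀ x) := by
  have h1 : MDifferentiableAt I 𝓘(ℝ, E) (extChartAt I x₀) x := mdifferentiableAt_extChartAt hx
  have h2 := l.hasMFDerivAt.comp x h1.hasMFDerivAt
  rw [tanMap_eq_mfderiv hx]
  exact h2.mfderiv

end SmoothInCharts

/-! ### Smooth forms and multivector fields are those with smooth components in charts. -/

section SmoothForms

attribute [local instance] extNormedAddCommGroup extNormedSpace

variable {E : Type*} [NormedAddCommGroup E] [NormedSpace ℝ E] [FiniteDimensional ℝ E]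
  {H : Type*} [TopologicalSpace H] {I : ModelWithCorners ℝ E H}
  {N : Type*} [TopologicalSpace N] [ChartedSpace H N]

/-- Functions on `N` with values in a family of algebras that agree near `x₀` with an element of
the subalgebra `S`. -/
def germSubalgebra {A : N → Type*} [∀ x, Ring (A x)] [∀ x, Algebra ℝ (A x)]
    (S : Subalgebra ℝ ((x : N) → A x)) (x₀ : N) : Subalgebra ℝ ((x : N) → A x) where
  carrier := {α | ∃ β ∈ S, ∀ᶠ x in nhds x₀, α x = β x}
  mul_mem' := by
    rintro α α' ⟨β, hβ, h⟩ ⟨β', hβ', h'⟩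
    exact ⟨β * β', mul_mem hβ hβ', by filter_upwards [h, h'] with x h h' using by simp [h, h']⟩
  add_mem' := by
    rintro α α' ⟨β, hβ, h⟩ ⟨β', hβ', h'⟩
    exact ⟨β + β', add_mem hβ hβ', by filter_upwards [h, h'] with x h h' using by simp [h, h']⟩
  algebraMap_mem' r := ⟨_, S.algebraMap_mem r, Filter.Eventually.of_forall fun _ => rfl⟩

/-- The subalgebra generated by the smooth functions and their differentials. -/
abbrev smoothFormAlg (I : ModelWithCorners ℝ E H) (x₀ : N) : Subalgebra ℝ (FormOn I N) :=
  Algebra.adjoin ℝ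
      ({τ : FormOn I N | ∃ f : N → ℝ, ContMDiffAt I 𝓘(ℝ, ℝ) ∞ f x₀ ∧
          τ = fun x => algebraMap ℝ _ (f x)} ∪
        {τ : FormOn I N | ∃ f : N → ℝ, ContMDiffAt I 𝓘(ℝ, ℝ) ∞ f x₀ ∧
          τ = fun x => ExteriorAlgebra.ι ℝ
            (mvfderiv I f x).toLinearMap})

/-- The subalgebra generated by the smooth functions and vector fields. -/
abbrev smoothMultivectorAlg (I : ModelWithCorners ℝ E H) [IsManifold I ∞ N] (x₀ : N) :
    Subalgebra ℝ (MultivectorOn I N) :=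
  Algebra.adjoin ℝ
      ({τ : MultivectorOn I N | ∃ f : N → ℝ, ContMDiffAt I 𝓘(ℝ, ℝ) ∞ f x₀ ∧
          τ = fun x => algebraMap ℝ _ (f x)} ∪
        {τ : MultivectorOn I N | ∃ Z : (x : N) → TangentSpace I x,
          ContMDiffAt I I.tangent ∞ (fun x => (⟨x, Z x⟩ : TangentBundle I N)) x₀ ∧
          τ = fun x => ExteriorAlgebra.ι ℝ (Z x)})

theorem contMDiffAt_linear {A C : Type*} [NormedAddCommGroup A] [NormedSpace ℝ A]
    [FiniteDimensional ℝ A] [NormedAddCommGroup C] [NormedSpace ℝ C] (L : A →ₗ[ℝ] C)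
    {φ : N → A} {x₀ : N} (hφ : ContMDiffAt I 𝓘(ℝ, A) ∞ φ x₀) :
    ContMDiffAt I 𝓘(ℝ, C) ∞ (fun x => L (φ x)) x₀ :=
  (LinearMap.toContinuousLinearMap L).contMDiff.contMDiffAt.comp x₀ hφ

theorem contMDiffAt_bilinear {A B C : Type*} [NormedAddCommGroup A] [NormedSpace ℝ A]
    [FiniteDimensional ℝ A] [NormedAddCommGroup B] [NormedSpace ℝ B] [FiniteDimensional ℝ B]
    [NormedAddCommGroup C] [NormedSpace ℝ C] (L : A →ₗ[ℝ] B →ₗ[ℝ] C)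
    {φ : N → A} {γ : N → B} {x₀ : N} (hφ : ContMDiffAt I 𝓘(ℝ, A) ∞ φ x₀)
    (hγ : ContMDiffAt I 𝓘(ℝ, B) ∞ γ x₀) :
    ContMDiffAt I 𝓘(ℝ, C) ∞ (fun x => L (φ x) (γ x)) x₀ :=
  ((bilinCLM L).contMDiff.contMDiffAt.comp x₀ hφ).clm_apply hγ

theorem contMDiffAt_ext_mul {W : Type*} [AddCommGroup W] [Module ℝ W] [FiniteDimensional ℝ W]
    {φ γ : N → ExteriorAlgebra ℝ W} {x₀ : N}
    (hφ : ContMDiffAt I 𝓘(ℝ, ExteriorAlgebra ℝ W) ∞ φ x₀)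
    (hγ : ContMDiffAt I 𝓘(ℝ, ExteriorAlgebra ℝ W) ∞ γ x₀) :
    ContMDiffAt I 𝓘(ℝ, ExteriorAlgebra ℝ W) ∞ (fun x => φ x * γ x) x₀ :=
  contMDiffAt_bilinear (LinearMap.mul ℝ (ExteriorAlgebra ℝ W)) hφ hγ

/-- After expanding `φ` in a basis, smoothness of the family `L` has to be known only on fixed
elements `y`. This permits induction over the exterior algebra without a topology on the space of
algebra morphisms. -/
theorem contMDiffAt_of_forall_apply {W : Type*} [AddCommGroup W] [Module ℝ W]
    {B : Type*} [NormedAddCommGroup B] [NormedSpace ℝ B]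
    [FiniteDimensional ℝ W] {L : N → ExteriorAlgebra ℝ W →ₗ[ℝ] B}
    {φ : N → ExteriorAlgebra ℝ W} {x₀ : N}
    (hL : ∀ y, ContMDiffAt I 𝓘(ℝ, B) ∞ (fun x => L x y) x₀)
    (hφ : ContMDiffAt I 𝓘(ℝ, ExteriorAlgebra ℝ W) ∞ φ x₀) :
    ContMDiffAt I 𝓘(ℝ, B) ∞ (fun x => L x (φ x)) x₀ := by
  let b := Module.finBasis ℝ (ExteriorAlgebra ℝ W)
  have h : (fun x => L x (φ x)) = fun x => ∑ i, b.coord i (φ x) • L x (b i) := by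
    funext x
    conv_lhs => rw [← b.sum_repr (φ x), map_sum]
    simp
  rw [h]
  refine contMDiffAt_finsetSum fun i _ => ?_
  exact (contMDiffAt_linear (b.coord i) hφ).smul (hL (b i))

/-- Applying a smooth family of linear maps to a smooth multivector. -/
theorem contMDiffAt_map {W W' : Type*} [NormedAddCommGroup W] [NormedSpace ℝ W]
    [FiniteDimensional ℝ W] [NormedAddCommGroup W'] [NormedSpace ℝ W'] [FiniteDimensional ℝ W']
    {a : N → W →L[ℝ] W'} {x₀ : N} (ha : ContMDiffAt I 𝓘(ℝ, W →L[ℝ] W') ∞ a x₀)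
    {φ : N → ExteriorAlgebra ℝ W} (hφ : ContMDiffAt I 𝓘(ℝ, ExteriorAlgebra ℝ W) ∞ φ x₀) :
    ContMDiffAt I 𝓘(ℝ, ExteriorAlgebra ℝ W') ∞
      (fun x => ExteriorAlgebra.map (a x : W →ₗ[ℝ] W') (φ x)) x₀ := by
  refine contMDiffAt_of_forall_apply
    (L := fun x => (ExteriorAlgebra.map (a x : W →ₗ[ℝ] W')).toLinearMap) (fun y => ?_) hφ
  simp only [AlgHom.toLinearMap_apply]
  induction y using extInduction_left with
  | algebraMap r => simp only [AlgHom.commutes]; exact contMDiffAt_const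
  | add x y hx hy => simp only [map_add]; exact hx.add hy
  | ι_mul x v hx =>
    simp only [map_mul, ExteriorAlgebra.map_apply_ι]
    exact contMDiffAt_ext_mul (contMDiffAt_linear (ExteriorAlgebra.ι ℝ)
      (ha.clm_apply contMDiffAt_const)) hx

/-- The covector of a continuous linear form, as an exterior form. -/
def clmToForm (W : Type*) [NormedAddCommGroup W] [NormedSpace ℝ W] :
    (W →L[ℝ] ℝ) →ₗ[ℝ] ExtForm W :=
  ExteriorAlgebra.ι ℝ ∘ₗ ContinuousLinearMap.coeLM ℝ

/-- Pulling back a smooth form along a smooth family of linear maps. -/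
theorem contMDiffAt_formPullback {W W' : Type*} [NormedAddCommGroup W] [NormedSpace ℝ W]
    [FiniteDimensional ℝ W] [NormedAddCommGroup W'] [NormedSpace ℝ W'] [FiniteDimensional ℝ W']
    {a : N → W →L[ℝ] W'} {x₀ : N} (ha : ContMDiffAt I 𝓘(ℝ, W →L[ℝ] W') ∞ a x₀)
    {φ : N → ExtForm W'} (hφ : ContMDiffAt I 𝓘(ℝ, ExtForm W') ∞ φ x₀) :
    ContMDiffAt I 𝓘(ℝ, ExtForm W) ∞
      (fun x => formPullback (a x : W →ₗ[ℝ] W') (φ x)) x₀ := by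
  refine contMDiffAt_of_forall_apply
    (L := fun x => (formPullback (a x : W →ₗ[ℝ] W')).toLinearMap) (fun y => ?_) hφ
  simp only [AlgHom.toLinearMap_apply]
  induction y using extInduction_left with
  | algebraMap r => simp only [AlgHom.commutes]; exact contMDiffAt_const
  | add x y hx hy => simp only [map_add]; exact hx.add hy
  | ι_mul x v hx =>
    simp only [map_mul, formPullback_ι]
    refine contMDiffAt_ext_mul ?_ hx
    exact contMDiffAt_linear (clmToForm W)
      (φ := fun x => (LinearMap.toContinuousLinearMap v).comp (a x))
      (contMDiffAt_const.clm_comp ha)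

variable [IsManifold I ∞ N]

theorem IsSmoothForm.contMDiffAt {α : FormOn I N} (hα : IsSmoothForm I α) (x₀ : N) :
    ContMDiffAt I 𝓘(ℝ, ExtForm E) ∞
      (fun x => formPullback (tanInv I x₀ x : E →ₗ[ℝ] TangentSpace I x) (α x)) x₀ := by
  obtain ⟨β, hβ, h⟩ := hα x₀
  have h1 : ContMDiffAt I 𝓘(ℝ, ExtForm E) ∞
      (fun x => formPullback (tanInv I x₀ x : E →ₗ[ℝ] TangentSpace I x) (β x)) x₀ := by
    clear h
    induction hβ using Algebra.adjoin_induction with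
    | mem τ hτ =>
      rcases hτ with ⟨f, hf, rfl⟩ | ⟨f, hf, rfl⟩
      · simp only [AlgHom.commutes]
        exact contMDiffAt_linear (Algebra.linearMap ℝ (ExtForm E)) hf
      · simp only [formPullback_ι]
        exact contMDiffAt_linear (clmToForm E) (contMDiffAt_mvfderiv_comp_tanInv hf)
    | algebraMap r =>
      simp only [Pi.algebraMap_apply, AlgHom.commutes]
      exact contMDiffAt_const
    | add x y _ _ hx hy => simp only [Pi.add_apply, formPullback_add]; exact hx.add hy
    | mul x y _ _ hx hy => simp only [Pi.mul_apply, formPullback_mul]; exact contMDiffAt_ext_mul hx hy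
  refine h1.congr_of_eventuallyEq ?_
  filter_upwards [h] with x hx
  rw [hx]

/-- Expand the form in a basis of the forms on the model space. The coefficients are smooth
functions, and the basis elements, pulled back by the chart, are polynomials in differentials of
linear functions of the coordinates. -/
theorem isSmoothForm_of_contMDiffAt {α : FormOn I N}
    (h : ∀ x₀ : N, ContMDiffAt I 𝓘(ℝ, ExtForm E) ∞
      (fun x => formPullback (tanInv I x₀ x : E →ₗ[ℝ] TangentSpace I x) (α x)) x₀) :
    IsSmoothForm I α := by
  intro x₀
  have hs := (chartAt H x₀).open_source.mem_nhds (mem_chart_source H x₀)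
  have hconst : ∀ B : ExtForm E,
      (fun x => formPullback (tanMap I x₀ x : TangentSpace I x →ₗ[ℝ] E) B) ∈
        germSubalgebra (smoothFormAlg I x₀) x₀ := by
    intro B
    induction B using extInduction_left with
    | algebraMap r => simp only [AlgHom.commutes]; exact Subalgebra.algebraMap_mem _ r
    | add x y hx hy => simp only [formPullback_add]; exact add_mem hx hy
    | ι_mul x v hx =>
      simp only [formPullback_mul]
      refine mul_mem ?_ hx
      let l : E →L[ℝ] ℝ := LinearMap.toContinuousLinearMap v
      refine ⟨_, Algebra.subset_adjoin (Or.inr ⟨fun x => l (extChartAt I x₀ x),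
        l.contMDiff.contMDiffAt.comp x₀ contMDiffAt_extChartAt, rfl⟩), ?_⟩
      filter_upwards [hs] with x hx
      rw [formPullback_ι, mvfderiv_clm_extChartAt l hx]
      rfl
  let b := Module.finBasis ℝ (ExtForm E)
  have h1 : (∑ i, (fun x => algebraMap ℝ (ExtForm (TangentSpace I x)) (b.coord i (formPullback
      (tanInv I x₀ x : E →ₗ[ℝ] TangentSpace I x) (α x)))) * (fun x =>
        formPullback (tanMap I x₀ x : TangentSpace I x →ₗ[ℝ] E) (b i)) : FormOn I N) ∈
      germSubalgebra (smoothFormAlg I x₀) x₀ := by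
    refine sum_mem fun i _ => mul_mem ?_ (hconst _)
    exact ⟨_, Algebra.subset_adjoin (Or.inl ⟨_, contMDiffAt_linear (b.coord i) (h x₀), rfl⟩),
      Filter.Eventually.of_forall fun _ => rfl⟩
  obtain ⟨β, hβ, h2⟩ := h1
  refine ⟨β, hβ, ?_⟩
  filter_upwards [h2, hs] with x hx hxs
  rw [← hx]
  simp only [Finset.sum_apply, Pi.mul_apply, ← Algebra.smul_def, ← map_smul, ← map_sum]
  rw [show ∑ i, b.coord i (formPullback (tanInv I x₀ x : E →ₗ[ℝ] TangentSpace I x) (α x)) • b i =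
    formPullback (tanInv I x₀ x : E →ₗ[ℝ] TangentSpace I x) (α x) from b.sum_repr _]
  rw [← formPullback_comp]
  conv_lhs => rw [← formPullback_id (α x)]
  congr 2
  ext v
  exact (tanInv_tanMap hxs v).symm

theorem IsSmoothMultivector.contMDiffAt {α : MultivectorOn I N} (hα : IsSmoothMultivector I α)
    (x₀ : N) : ContMDiffAt I 𝓘(ℝ, ExteriorAlgebra ℝ E) ∞
      (fun x => ExteriorAlgebra.map (tanMap I x₀ x : TangentSpace I x →ₗ[ℝ] E) (α x)) x₀ := by
  obtain ⟨β, hβ, h⟩ := hα x₀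
  have h1 : ContMDiffAt I 𝓘(ℝ, ExteriorAlgebra ℝ E) ∞
      (fun x => ExteriorAlgebra.map (tanMap I x₀ x : TangentSpace I x →ₗ[ℝ] E) (β x)) x₀ := by
    clear h
    induction hβ using Algebra.adjoin_induction with
    | mem τ hτ =>
      rcases hτ with ⟨f, hf, rfl⟩ | ⟨f, hf, rfl⟩
      · simp only [AlgHom.commutes]
        exact contMDiffAt_linear (Algebra.linearMap ℝ (ExteriorAlgebra ℝ E)) hf
      · simp only [ExteriorAlgebra.map_apply_ι]
        exact contMDiffAt_linear (ExteriorAlgebra.ι ℝ) (contMDiffAt_tangent_iff.1 hf)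
    | algebraMap r =>
      simp only [Pi.algebraMap_apply, AlgHom.commutes]
      exact contMDiffAt_const
    | add x y _ _ hx hy => simp only [Pi.add_apply, map_add]; exact hx.add hy
    | mul x y _ _ hx hy => simp only [Pi.mul_apply, map_mul]; exact contMDiffAt_ext_mul hx hy
  refine h1.congr_of_eventuallyEq ?_
  filter_upwards [h] with x hx
  rw [hx]

/-- As for forms, with the coordinate vector fields of the chart in place of the differentials. -/
theorem isSmoothMultivector_of_contMDiffAt {α : MultivectorOn I N}
    (h : ∀ x₀ : N, ContMDiffAt I 𝓘(ℝ, ExteriorAlgebra ℝ E) ∞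
      (fun x => ExteriorAlgebra.map (tanMap I x₀ x : TangentSpace I x →ₗ[ℝ] E) (α x)) x₀) :
    IsSmoothMultivector I α := by
  intro x₀
  have hs := (chartAt H x₀).open_source.mem_nhds (mem_chart_source H x₀)
  have hconst : ∀ B : ExteriorAlgebra ℝ E,
      (fun x => ExteriorAlgebra.map (tanInv I x₀ x : E →ₗ[ℝ] TangentSpace I x) B) ∈
        germSubalgebra (smoothMultivectorAlg I x₀) x₀ := by
    intro B
    induction B using extInduction_left with
    | algebraMap r => simp only [AlgHom.commutes]; exact Subalgebra.algebraMap_mem _ r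
    | add x y hx hy => simp only [map_add]; exact add_mem hx hy
    | ι_mul x v hx =>
      simp only [map_mul, ExteriorAlgebra.map_apply_ι]
      refine mul_mem ?_ hx
      refine ⟨_, Algebra.subset_adjoin (Or.inr ⟨fun x => tanInv I x₀ x v, ?_, rfl⟩),
        Filter.Eventually.of_forall fun _ => rfl⟩
      rw [contMDiffAt_tangent_iff]
      refine (contMDiffAt_const (c := v)).congr_of_eventuallyEq ?_
      filter_upwards [hs] with x hx
      exact tanMap_tanInv hx v
  let b := Module.finBasis ℝ (ExteriorAlgebra ℝ E)
  have h1 : (∑ i, (fun x => algebraMap ℝ (ExteriorAlgebra ℝ (TangentSpace I x)) (b.coord i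
      (ExteriorAlgebra.map (tanMap I x₀ x : TangentSpace I x →ₗ[ℝ] E) (α x)))) * (fun x =>
        ExteriorAlgebra.map (tanInv I x₀ x : E →ₗ[ℝ] TangentSpace I x) (b i)) :
          MultivectorOn I N) ∈ germSubalgebra (smoothMultivectorAlg I x₀) x₀ := by
    refine sum_mem fun i _ => mul_mem ?_ (hconst _)
    exact ⟨_, Algebra.subset_adjoin (Or.inl ⟨_, contMDiffAt_linear (b.coord i) (h x₀), rfl⟩),
      Filter.Eventually.of_forall fun _ => rfl⟩
  obtain ⟨β, hβ, h2⟩ := h1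
  refine ⟨β, hβ, ?_⟩
  filter_upwards [h2, hs] with x hx hxs
  rw [← hx]
  simp only [Finset.sum_apply, Pi.mul_apply, ← Algebra.smul_def, ← map_smul, ← map_sum]
  rw [show ∑ i, b.coord i (ExteriorAlgebra.map (tanMap I x₀ x : TangentSpace I x →ₗ[ℝ] E) (α x)) •
    b i = ExteriorAlgebra.map (tanMap I x₀ x : TangentSpace I x →ₗ[ℝ] E) (α x) from b.sum_repr _]
  rw [map_map]
  conv_lhs => rw [← map_id_apply (α x)]
  congr 2
  ext v
  exact (tanInv_tanMap hxs v).symm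

end SmoothForms

set_option maxSynthPendingDepth 3

/-! ### Chain and product rules for vector valued functions on manifolds. -/

section Derivatives

variable {E : Type*} [NormedAddCommGroup E] [NormedSpace ℝ E]
  {H : Type*} [TopologicalSpace H] {I : ModelWithCorners ℝ E H}
  {N : Type*} [TopologicalSpace N] [ChartedSpace H N]
  {E' : Type*} [NormedAddCommGroup E'] [NormedSpace ℝ E']
  {H' : Type*} [TopologicalSpace H'] {I' : ModelWithCorners ℝ E' H'}
  {N' : Type*} [TopologicalSpace N'] [ChartedSpace H' N']
  {A C : Type*} [NormedAddCommGroup A] [NormedSpace ℝ A] [NormedAddCommGroup C] [NormedSpace ℝ C]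

theorem mvfderiv_congr {f g : N → A} {x : N} (h : f =ᶠ[nhds x] g) :
    mvfderiv I f x = mvfderiv I g x := by
  have h1 : mfderiv I 𝓘(ℝ, A) f x = mfderiv I 𝓘(ℝ, A) g x := h.mfderiv_eq
  ext v
  exact congrArg (fun D : TangentSpace I x →L[ℝ] A => D v) h1

theorem mvfderiv_comp_map {f : N → N'} {g : N' → A} {x : N}
    (hg : MDifferentiableAt I' 𝓘(ℝ, A) g (f x)) (hf : MDifferentiableAt I I' f x) :
    mvfderiv I (fun y => g (f y)) x = (mvfderiv I' g (f x)).comp (mfderiv I I' f x) :=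
  mfderiv_comp x hg hf

theorem mvfderiv_clm_apply {L : N → A →L[ℝ] C} {f : N → A} {x : N}
    (hL : MDifferentiableAt I 𝓘(ℝ, A →L[ℝ] C) L x) (hf : MDifferentiableAt I 𝓘(ℝ, A) f x)
    (v : TangentSpace I x) :
    mvfderiv I (fun y => L y (f y)) x v =
      L x (mvfderiv I f x v) + mvfderiv I L x v (f x) := by
  have h1 := hL.hasMFDerivAt
  have h2 := hf.hasMFDerivAt
  have h3 : HasMFDerivAt I 𝓘(ℝ, C) (fun y => L y (f y)) x
      ((L x).comp (show E →L[ℝ] A from mvfderiv I f x) +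
        (show E →L[ℝ] A →L[ℝ] C from mvfderiv I L x).flip (f x)) := by
    refine ⟨(hL.clm_apply hf).continuousAt, ?_⟩
    have h4 := h1.2.clm_apply h2.2
    simp only [writtenInExtChartAt, extChartAt_model_space_eq_id, PartialEquiv.refl_coe,
      Function.comp_def, id_eq, (extChartAt I x).left_inv (mem_extChartAt_source x)] at h4 ⊢
    exact h4
  exact congrArg (fun D : TangentSpace I x →L[ℝ] C => D v) h3.mfderiv

theorem mvfderiv_clm_comp_left (L : A →L[ℝ] C) {f : N → A} {x : N}
    (hf : MDifferentiableAt I 𝓘(ℝ, A) f x) (v : TangentSpace I x) :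
    mvfderiv I (fun y => L (f y)) x v = L (mvfderiv I f x v) := by
  have h := mvfderiv_clm_apply (L := fun _ => L) (x := x) mdifferentiableAt_const hf v
  rw [h, mvfderiv_const]
  simp

theorem contMDiffAt_smulRight (l : A →L[ℝ] ℝ) {φ : N → C} {x₀ : N}
    (hφ : ContMDiffAt I 𝓘(ℝ, C) ∞ φ x₀) :
    ContMDiffAt I 𝓘(ℝ, A →L[ℝ] C) ∞ (fun x => l.smulRight (φ x)) x₀ :=
  (ContinuousLinearMap.smulRightL ℝ A C l).contMDiff.contMDiffAt.comp x₀ hφ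

end Derivatives

/-! ### Fibre coordinates of a vector bundle in a preferred trivialization. -/

section FibreMaps

variable {n : ℕ} {M : Type*} [TopologicalSpace M]
  [ChartedSpace (EuclideanSpace ℝ (Fin (n + 1))) M] [IsManifold (𝓡 (n + 1)) ∞ M]
  (F : Type*) [NormedAddCommGroup F] [NormedSpace ℝ F] [FiniteDimensional ℝ F]
  {V : M → Type*} [TopologicalSpace (TotalSpace F V)]
  [∀ x, AddCommGroup (V x)] [∀ x, Module ℝ (V x)] [∀ x, TopologicalSpace (V x)]
  [FiberBundle F V] [VectorBundle ℝ F V]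

/-- The fibre part of the preferred trivialization around `x₀`. -/
def fibMap (x₀ x : M) : V x →L[ℝ] F := (trivializationAt F V x₀).continuousLinearMapAt ℝ x

/-- The inverse of `fibMap`. -/
def fibInv (x₀ x : M) : F →L[ℝ] V x := (trivializationAt F V x₀).symmL ℝ x

variable {F}

theorem fibMap_fibInv {x₀ x : M} (hx : x ∈ (trivializationAt F V x₀).baseSet) (q : F) :
    fibMap F x₀ x (fibInv F x₀ x q : V x) = q :=
  Trivialization.continuousLinearMapAt_symmL _ hx q

theorem fibInv_fibMap {x₀ x : M} (hx : x ∈ (trivializationAt F V x₀).baseSet) (v : V x) :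
    fibInv F x₀ x (fibMap F x₀ x v) = v :=
  Trivialization.symmL_continuousLinearMapAt _ hx v

theorem fibMap_apply {x₀ x : M} (hx : x ∈ (trivializationAt F V x₀).baseSet) (v : V x) :
    fibMap F x₀ x v = (trivializationAt F V x₀ ⟨x, v⟩).2 := by
  rw [fibMap, Trivialization.continuousLinearMapAt_apply, Trivialization.coe_linearMapAt_of_mem _ hx]

theorem fibInv_eq_symm {x₀ x : M} (hx : x ∈ (trivializationAt F V x₀).baseSet) (q : F) :
    (fibInv F x₀ x q : V x) = (trivializationAt F V x₀).symm x q :=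
  Trivialization.symmL_apply _ hx q

theorem bundleFrame_eq_fibInv {x₀ x : M} (hx : x ∈ (trivializationAt F V x₀).baseSet)
    (A : Fin (Module.finrank ℝ F)) :
    (bundleFrame F x₀ A x : V x) = fibInv F x₀ x (Module.finBasis ℝ F A) :=
  (fibInv_eq_symm hx _).symm

theorem fibMap_comp_fibInv {x₀ x₁ x : M} (h₀ : x ∈ (trivializationAt F V x₀).baseSet)
    (h₁ : x ∈ (trivializationAt F V x₁).baseSet) (q : F) :
    fibMap F x₀ x (fibInv F x₁ x q : V x) =
      (trivializationAt F V x₁).coordChangeL ℝ (trivializationAt F V x₀) x q := by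
  rw [Trivialization.coordChangeL_apply _ _ ⟨h₁, h₀⟩, fibMap_apply h₀, fibInv_eq_symm h₁]

theorem baseSet_mem_nhds {x₀ x : M} (hx : x ∈ (trivializationAt F V x₀).baseSet) :
    (trivializationAt F V x₀).baseSet ∈ nhds x :=
  (trivializationAt F V x₀).open_baseSet.mem_nhds hx

variable [ContMDiffVectorBundle ∞ F V (𝓡 (n + 1))]

theorem mdifferentiableAt_fibMap_iff {s : (x : M) → V x} {x₀ x : M}
    (hx : x ∈ (trivializationAt F V x₀).baseSet) :
    MDifferentiableAt (𝓡 (n + 1)) ((𝓡 (n + 1)).prod 𝓘(ℝ, F))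
      (fun y => TotalSpace.mk' F y (s y)) x ↔
      MDifferentiableAt (𝓡 (n + 1)) 𝓘(ℝ, F) (fun y => fibMap F x₀ y (s y)) x := by
  rw [Trivialization.mdifferentiableAt_section_iff (e := trivializationAt F V x₀) _ s hx]
  refine Filter.EventuallyEq.mdifferentiableAt_iff ?_
  filter_upwards [baseSet_mem_nhds hx] with y hy
  rw [fibMap_apply hy]

theorem mdifferentiableAt_fibInv_const {x₀ x₁ x : M} (h₀ : x ∈ (trivializationAt F V x₀).baseSet)
    (h₁ : x ∈ (trivializationAt F V x₁).baseSet) (q : F) :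
    MDifferentiableAt (𝓡 (n + 1)) 𝓘(ℝ, F)
      (fun y => fibMap F x₀ y (fibInv F x₁ y q : V y)) x := by
  rw [← mdifferentiableAt_fibMap_iff h₀, mdifferentiableAt_fibMap_iff h₁]
  refine (mdifferentiableAt_const (c := q)).congr_of_eventuallyEq ?_
  filter_upwards [baseSet_mem_nhds h₁] with y hy
  exact fibMap_fibInv hy q

theorem mdifferentiableAt_bundleFrame {x₀ x₁ x : M} (h₀ : x ∈ (trivializationAt F V x₀).baseSet)
    (h₁ : x ∈ (trivializationAt F V x₁).baseSet) (A : Fin (Module.finrank ℝ F)) :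
    MDifferentiableAt (𝓡 (n + 1)) 𝓘(ℝ, F)
      (fun y => fibMap F x₀ y (bundleFrame F x₁ A y : V y)) x := by
  refine (mdifferentiableAt_fibInv_const h₀ h₁
    (Module.finBasis ℝ F A)).congr_of_eventuallyEq ?_
  filter_upwards [baseSet_mem_nhds h₁] with y hy
  rw [bundleFrame_eq_fibInv hy]

end FibreMaps

/-! ### Christoffel symbols of a covariant derivative: existence and smoothness. -/

section Christoffel

variable {n : ℕ} {M : Type*} [TopologicalSpace M]
  [ChartedSpace (EuclideanSpace ℝ (Fin (n + 1))) M] [IsManifold (𝓡 (n + 1)) ∞ M]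
  {F : Type*} [NormedAddCommGroup F] [NormedSpace ℝ F] [FiniteDimensional ℝ F]
  {V : M → Type*} [TopologicalSpace (TotalSpace F V)]
  [∀ x, AddCommGroup (V x)] [∀ x, Module ℝ (V x)] [∀ x, TopologicalSpace (V x)]
  [FiberBundle F V] [VectorBundle ℝ F V]

variable [∀ x, IsTopologicalAddGroup (V x)] [∀ x, ContinuousSMul ℝ (V x)]

variable (F) in
/-- `chr` gives the Christoffel symbols at `x` of `cov` in the preferred trivialization
around `x₀`. -/
def HasChristoffelAt (cov : ((x : M) → V x) → (x : M) → TangentSpace (𝓡 (n + 1)) x →ₗ[ℝ] V x)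
    (x₀ x : M) (chr : F →L[ℝ] EuclideanSpace ℝ (Fin (n + 1)) →L[ℝ] F) : Prop :=
  ∀ s : (x : M) → V x,
    MDifferentiableAt (𝓡 (n + 1)) 𝓘(ℝ, F) (fun y => fibMap F x₀ y (s y)) x →
    ∀ ξ : TangentSpace (𝓡 (n + 1)) x, fibMap F x₀ x (cov s x ξ) =
      mvfderiv (𝓡 (n + 1)) (fun y => fibMap F x₀ y (s y)) x ξ +
        chr (fibMap F x₀ x (s x)) (tanMap (𝓡 (n + 1)) x₀ x ξ)

/-- The Christoffel symbols of a covariant derivative. -/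
def christoffel (Γ : CovariantDerivative (𝓡 (n + 1)) F V) (x₀ x : M) :
    F →L[ℝ] EuclideanSpace ℝ (Fin (n + 1)) →L[ℝ] F :=
  ∑ A, (LinearMap.toContinuousLinearMap ((Module.finBasis ℝ F).coord A)).smulRight
    (((fibMap F x₀ x).comp (Γ (bundleFrame F x₀ A) x)).comp (tanInv (𝓡 (n + 1)) x₀ x))

variable [ContMDiffVectorBundle ∞ F V (𝓡 (n + 1))]

theorem CovariantDerivative.sum (Γ : CovariantDerivative (𝓡 (n + 1)) F V) {ι : Type*}
    (S : Finset ι) (s : ι → (x : M) → V x) {x : M}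
    (hs : ∀ i ∈ S, MDifferentiableAt (𝓡 (n + 1)) ((𝓡 (n + 1)).prod 𝓘(ℝ, F))
      (fun y => TotalSpace.mk' F y (s i y)) x) :
    Γ (∑ i ∈ S, s i) x = ∑ i ∈ S, Γ (s i) x := by
  classical
  induction S using Finset.induction_on with
  | empty => simp
  | insert i S hi ih =>
    rw [Finset.sum_insert hi, Finset.sum_insert hi, Γ.isCovariantDerivativeOnUniv.add, ih]
    · exact fun j hj => hs j (Finset.mem_insert_of_mem hj)
    · exact hs i (Finset.mem_insert_self _ _)
    · have := MDifferentiableAt.sum_section (I := 𝓡 (n + 1)) (F := F) (s := S) (t := s) (x₀ := x)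
        fun j hj => hs j (Finset.mem_insert_of_mem hj)
      simpa only [Finset.sum_apply] using this

/-- Near `x` a section is `∑ c^A e_A` in the local frame. Locality and the Leibniz rule split its
covariant derivative into the derivative of the `c^A` and a term linear in the value of the section.
-/
theorem hasChristoffelAt_christoffel (Γ : CovariantDerivative (𝓡 (n + 1)) F V) {x₀ x : M}
    (hx : x ∈ (trivializationAt F V x₀).baseSet)
    (hx' : x ∈ (chartAt (EuclideanSpace ℝ (Fin (n + 1))) x₀).source) :
    HasChristoffelAt F (fun s x => (Γ s x).toLinearMap) x₀ x (christoffel Γ x₀ x) := by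
  intro s hs ξ
  let b := Module.finBasis ℝ F
  let c : Fin (Module.finrank ℝ F) → M → ℝ := fun A y => b.coord A (fibMap F x₀ y (s y))
  have hc : ∀ A, MDifferentiableAt (𝓡 (n + 1)) 𝓘(ℝ, ℝ) (c A) x := fun A =>
    ((LinearMap.toContinuousLinearMap (b.coord A)).mdifferentiable _).comp x hs
  have hframe : ∀ A, MDifferentiableAt (𝓡 (n + 1)) ((𝓡 (n + 1)).prod 𝓘(ℝ, F))
      (fun y => TotalSpace.mk' F y (bundleFrame F x₀ A y : V y)) x := fun A =>
    (mdifferentiableAt_fibMap_iff hx).2 (mdifferentiableAt_bundleFrame hx hx A)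
  have hcf : ∀ A, MDifferentiableAt (𝓡 (n + 1)) ((𝓡 (n + 1)).prod 𝓘(ℝ, F))
      (fun y => TotalSpace.mk' F y ((c A • bundleFrame F x₀ A) y : V y)) x := fun A =>
    (hc A).smul_section (hframe A)
  have hexp : ∀ q : F, ∑ A, b.coord A q • b A = q := fun q => b.sum_repr q
  have heq : ∀ᶠ y in nhds x, s y = (∑ A, c A • bundleFrame F x₀ A : (x : M) → V x) y := by
    filter_upwards [baseSet_mem_nhds hx] with y hy
    rw [Finset.sum_apply]
    conv_lhs => rw [← fibInv_fibMap hy (s y), ← hexp (fibMap F x₀ y (s y)), map_sum]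
    refine Finset.sum_congr rfl fun A _ => ?_
    rw [map_smul, Pi.smul_apply', bundleFrame_eq_fibInv hy]
  have hsum : MDifferentiableAt (𝓡 (n + 1)) ((𝓡 (n + 1)).prod 𝓘(ℝ, F))
      (fun y => TotalSpace.mk' F y ((∑ A, c A • bundleFrame F x₀ A : (x : M) → V x) y)) x := by
    have := MDifferentiableAt.sum_section (I := 𝓡 (n + 1)) (F := F)
      (s := Finset.univ) (t := fun A => c A • bundleFrame (V := V) F x₀ A) (x₀ := x)
      fun A _ => hcf A
    simpa only [Finset.sum_apply] using this
  have h1 : Γ s x = ∑ A, Γ (c A • bundleFrame F x₀ A) x := by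
    rw [Γ.isCovariantDerivativeOnUniv.congr_of_eventuallyEq ((mdifferentiableAt_fibMap_iff hx).2 hs)
      hsum Filter.univ_mem heq]
    exact CovariantDerivative.sum Γ _ _ fun A _ => hcf A
  have h2 : ∀ A, Γ (c A • bundleFrame F x₀ A) x = _ := fun A =>
    Γ.isCovariantDerivativeOnUniv.leibniz (hframe A) (hc A)
  have h3 : ∀ A, mvfderiv (𝓡 (n + 1)) (c A) x ξ =
      b.coord A (mvfderiv (𝓡 (n + 1)) (fun y => fibMap F x₀ y (s y)) x ξ) := fun A =>
    mvfderiv_clm_comp_left (LinearMap.toContinuousLinearMap (b.coord A)) hs ξ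
  show fibMap F x₀ x (Γ s x ξ) = _
  rw [h1]
  simp only [h2, sum_apply, add_apply, smul_apply,
    ContinuousLinearMap.smulRight_apply, map_sum, map_add, map_smul, h3, Finset.sum_add_distrib]
  rw [add_comm]
  congr 1
  · conv_rhs => rw [← hexp (mvfderiv (𝓡 (n + 1)) (fun y => fibMap F x₀ y (s y)) x ξ)]
    refine Finset.sum_congr rfl fun A _ => ?_
    rw [bundleFrame_eq_fibInv hx, fibMap_fibInv hx]
  · simp only [christoffel, sum_apply, ContinuousLinearMap.smulRight_apply,
      smul_apply, ContinuousLinearMap.comp_apply, tanInv_tanMap hx']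
    rfl

/-- Smoothness of `Γ` is applied to a global smooth section, so the local frame is multiplied by a
bump function; by locality this changes nothing where the bump function is one. -/
theorem contMDiffAt_christoffel [T2Space M] (Γ : CovariantDerivative (𝓡 (n + 1)) F V)
    [Γ.ContMDiffCovariantDerivative ∞] (x₀ : M) :
    ContMDiffAt (𝓡 (n + 1)) 𝓘(ℝ, F →L[ℝ] EuclideanSpace ℝ (Fin (n + 1)) →L[ℝ] F) ∞
      (christoffel Γ x₀) x₀ := by
  have hx := mem_baseSet_trivializationAt F V x₀
  unfold christoffel
  refine contMDiffAt_finsetSum fun A _ => ?_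
  refine contMDiffAt_smulRight _ ?_
  obtain ⟨ψ, -, hψ⟩ := (SmoothBumpFunction.nhds_basis_tsupport (I := 𝓡 (n + 1)) x₀).mem_iff.1
    (baseSet_mem_nhds hx)
  have hframe : ContMDiffOn (𝓡 (n + 1)) ((𝓡 (n + 1)).prod 𝓘(ℝ, F)) ∞
      (fun y => TotalSpace.mk' F y (bundleFrame F x₀ A y : V y))
      (trivializationAt F V x₀).baseSet := by
    intro x hx
    refine ContMDiffAt.contMDiffWithinAt ?_
    rw [Trivialization.contMDiffAt_section_iff _ hx]
    refine (contMDiffAt_const (c := Module.finBasis ℝ F A)).congr_of_eventuallyEq ?_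
    filter_upwards [baseSet_mem_nhds hx] with y hy
    rw [← fibMap_apply hy]
    rw [bundleFrame_eq_fibInv hy, fibMap_fibInv hy]
  have hglob := ContMDiffOn.smul_section_of_tsupport (ψ.contMDiff.contMDiffOn)
    (trivializationAt F V x₀).open_baseSet hψ hframe
  have h1 := (CovariantDerivative.ContMDiffCovariantDerivative.contMDiff (cov := Γ) (k := ∞)).contMDiff
    (σ := (ψ : M → ℝ) • bundleFrame F x₀ A) (by
      simpa using hglob.contMDiffOn)
  have h2 := (contMDiffAt_hom_bundle _).1 (h1.contMDiffAt Filter.univ_mem (x := x₀))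
  refine h2.2.congr_of_eventuallyEq ?_
  -- The bump function must be one on a neighbourhood of each nearby point, not only at it, since a
  -- covariant derivative depends on the germ.
  filter_upwards [ψ.eventuallyEq_one.eventually_nhds, baseSet_mem_nhds hx] with x h h'
  have h3 : Γ ((ψ : M → ℝ) • bundleFrame F x₀ A) x = Γ (bundleFrame F x₀ A) x := by
    refine Γ.isCovariantDerivativeOnUniv.congr_of_eventuallyEq ?_ ?_ Filter.univ_mem ?_
    · exact (hglob.contMDiffAt).mdifferentiableAt (by simp)
    · exact (hframe.contMDiffAt (baseSet_mem_nhds h')).mdifferentiableAt (by simp)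
    · filter_upwards [h] with y hy
      simp [hy]
  rw [← h3]
  rfl

end Christoffel

/-! ### Christoffel symbols of the connections induced on `Hom(TM, V)` and on its dual. -/

section ModelChristoffel

variable {E W U : Type*} [NormedAddCommGroup E] [NormedSpace ℝ E]
  [NormedAddCommGroup W] [NormedSpace ℝ W] [NormedAddCommGroup U] [NormedSpace ℝ U]

/-- The map `φ ↦ (ξ ↦ φ ∘ k ξ)`. -/
def precompCLM (U : Type*) [NormedAddCommGroup U] [NormedSpace ℝ U] (k : E →L[ℝ] W →L[ℝ] W) :
    (W →L[ℝ] U) →L[ℝ] E →L[ℝ] (W →L[ℝ] U) :=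
  ((ContinuousLinearMap.compL ℝ E (W →L[ℝ] W) (W →L[ℝ] U)).flip k).comp
    (ContinuousLinearMap.compL ℝ W W U)

/-- The map `φ ↦ (ξ ↦ v ↦ a (φ v) ξ)`. -/
def postcompCLM (a : U →L[ℝ] E →L[ℝ] U) : (E →L[ℝ] U) →L[ℝ] E →L[ℝ] (E →L[ℝ] U) :=
  (ContinuousLinearMap.flipₗᵢ ℝ E E U).toContinuousLinearEquiv.toContinuousLinearMap.comp
    (ContinuousLinearMap.compL ℝ E U (E →L[ℝ] U) a)

/-- Christoffel symbols of the connection on linear maps. -/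
def jetChristoffel (a : U →L[ℝ] E →L[ℝ] U) (b : E →L[ℝ] E →L[ℝ] E) :
    (E →L[ℝ] U) →L[ℝ] E →L[ℝ] (E →L[ℝ] U) :=
  postcompCLM a - precompCLM U b.flip

theorem jetChristoffel_apply (a : U →L[ℝ] E →L[ℝ] U) (b : E →L[ℝ] E →L[ℝ] E) (φ : E →L[ℝ] U)
    (ξ v : E) : jetChristoffel a b φ ξ v = a (φ v) ξ - φ (b v ξ) := rfl

/-- Christoffel symbols of the dual connection. -/
def dualChristoffel (k : W →L[ℝ] E →L[ℝ] W) : (W →L[ℝ] ℝ) →L[ℝ] E →L[ℝ] (W →L[ℝ] ℝ) :=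
  -precompCLM ℝ k.flip

theorem dualChristoffel_apply (k : W →L[ℝ] E →L[ℝ] W) (c : W →L[ℝ] ℝ) (ξ : E) (φ : W) :
    dualChristoffel k c ξ φ = -c (k φ ξ) := rfl

variable {E₁ : Type*} [NormedAddCommGroup E₁] [NormedSpace ℝ E₁]
  {H : Type*} [TopologicalSpace H] {I : ModelWithCorners ℝ E₁ H}
  {N : Type*} [TopologicalSpace N] [ChartedSpace H N] {x₀ : N}

theorem contMDiffAt_clm {A C : Type*} [NormedAddCommGroup A] [NormedSpace ℝ A]
    [NormedAddCommGroup C] [NormedSpace ℝ C] (L : A →L[ℝ] C) {φ : N → A}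
    (hφ : ContMDiffAt I 𝓘(ℝ, A) ∞ φ x₀) : ContMDiffAt I 𝓘(ℝ, C) ∞ (fun x => L (φ x)) x₀ :=
  L.contMDiff.contMDiffAt.comp x₀ hφ

theorem contMDiffAt_clm_flip {k : N → W →L[ℝ] E →L[ℝ] U}
    (hk : ContMDiffAt I 𝓘(ℝ, W →L[ℝ] E →L[ℝ] U) ∞ k x₀) :
    ContMDiffAt I 𝓘(ℝ, E →L[ℝ] W →L[ℝ] U) ∞ (fun x => (k x).flip) x₀ :=
  contMDiffAt_clm (A := W →L[ℝ] E →L[ℝ] U) (C := E →L[ℝ] W →L[ℝ] U)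
    (ContinuousLinearMap.flipₗᵢ ℝ W E U).toContinuousLinearEquiv.toContinuousLinearMap hk

theorem contMDiffAt_clm_comp {A B C : Type*} [NormedAddCommGroup A] [NormedSpace ℝ A]
    [NormedAddCommGroup B] [NormedSpace ℝ B] [NormedAddCommGroup C] [NormedSpace ℝ C]
    {L : N → B →L[ℝ] C} {K : N → A →L[ℝ] B} (hL : ContMDiffAt I 𝓘(ℝ, B →L[ℝ] C) ∞ L x₀)
    (hK : ContMDiffAt I 𝓘(ℝ, A →L[ℝ] B) ∞ K x₀) :
    ContMDiffAt I 𝓘(ℝ, A →L[ℝ] C) ∞ (fun x => (L x).comp (K x)) x₀ := hL.clm_comp hK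

theorem contMDiffAt_precompCLM {k : N → E →L[ℝ] W →L[ℝ] W}
    (hk : ContMDiffAt I 𝓘(ℝ, E →L[ℝ] W →L[ℝ] W) ∞ k x₀) :
    ContMDiffAt I 𝓘(ℝ, (W →L[ℝ] U) →L[ℝ] E →L[ℝ] (W →L[ℝ] U)) ∞
      (fun x => precompCLM U (k x)) x₀ :=
  contMDiffAt_clm_comp (A := W →L[ℝ] U) (B := (W →L[ℝ] W) →L[ℝ] (W →L[ℝ] U))
    (C := E →L[ℝ] (W →L[ℝ] U))
    (contMDiffAt_clm (A := E →L[ℝ] W →L[ℝ] W)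
      (C := ((W →L[ℝ] W) →L[ℝ] (W →L[ℝ] U)) →L[ℝ] (E →L[ℝ] (W →L[ℝ] U)))
      (ContinuousLinearMap.compL ℝ E (W →L[ℝ] W) (W →L[ℝ] U)).flip hk) contMDiffAt_const

theorem contMDiffAt_postcompCLM {k : N → U →L[ℝ] E →L[ℝ] U}
    (hk : ContMDiffAt I 𝓘(ℝ, U →L[ℝ] E →L[ℝ] U) ∞ k x₀) :
    ContMDiffAt I 𝓘(ℝ, (E →L[ℝ] U) →L[ℝ] E →L[ℝ] (E →L[ℝ] U)) ∞
      (fun x => postcompCLM (k x)) x₀ :=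
  contMDiffAt_clm_comp (A := E →L[ℝ] U) (B := E →L[ℝ] E →L[ℝ] U) (C := E →L[ℝ] E →L[ℝ] U)
    contMDiffAt_const
    (contMDiffAt_clm (A := U →L[ℝ] E →L[ℝ] U)
      (C := (E →L[ℝ] U) →L[ℝ] (E →L[ℝ] E →L[ℝ] U))
      (ContinuousLinearMap.compL ℝ E U (E →L[ℝ] U)) hk)

theorem contMDiffAt_sub_of {C : Type*} [NormedAddCommGroup C] [NormedSpace ℝ C] {φ γ : N → C}
    (hφ : ContMDiffAt I 𝓘(ℝ, C) ∞ φ x₀) (hγ : ContMDiffAt I 𝓘(ℝ, C) ∞ γ x₀) :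
    ContMDiffAt I 𝓘(ℝ, C) ∞ (fun x => φ x - γ x) x₀ := hφ.sub hγ

theorem contMDiffAt_neg_of {C : Type*} [NormedAddCommGroup C] [NormedSpace ℝ C] {φ : N → C}
    (hφ : ContMDiffAt I 𝓘(ℝ, C) ∞ φ x₀) :
    ContMDiffAt I 𝓘(ℝ, C) ∞ (fun x => -φ x) x₀ := hφ.neg

theorem contMDiffAt_jetChristoffel {a : N → U →L[ℝ] E →L[ℝ] U} {b : N → E →L[ℝ] E →L[ℝ] E}
    (ha : ContMDiffAt I 𝓘(ℝ, U →L[ℝ] E →L[ℝ] U) ∞ a x₀)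
    (hb : ContMDiffAt I 𝓘(ℝ, E →L[ℝ] E →L[ℝ] E) ∞ b x₀) :
    ContMDiffAt I 𝓘(ℝ, (E →L[ℝ] U) →L[ℝ] E →L[ℝ] (E →L[ℝ] U)) ∞
      (fun x => jetChristoffel (a x) (b x)) x₀ :=
  contMDiffAt_sub_of (C := (E →L[ℝ] U) →L[ℝ] E →L[ℝ] (E →L[ℝ] U)) (contMDiffAt_postcompCLM ha)
    (contMDiffAt_precompCLM (contMDiffAt_clm_flip hb))

theorem contMDiffAt_dualChristoffel {k : N → W →L[ℝ] E →L[ℝ] W}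
    (hk : ContMDiffAt I 𝓘(ℝ, W →L[ℝ] E →L[ℝ] W) ∞ k x₀) :
    ContMDiffAt I 𝓘(ℝ, (W →L[ℝ] ℝ) →L[ℝ] E →L[ℝ] (W →L[ℝ] ℝ)) ∞
      (fun x => dualChristoffel (k x)) x₀ :=
  contMDiffAt_neg_of (C := (W →L[ℝ] ℝ) →L[ℝ] E →L[ℝ] (W →L[ℝ] ℝ))
    (contMDiffAt_precompCLM (contMDiffAt_clm_flip hk))

end ModelChristoffel

/-! ### Expansion of fibre vectors in the frame of the preferred trivialization. -/

section Frames

variable {n : ℕ} {M : Type*} [TopologicalSpace M]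
  [ChartedSpace (EuclideanSpace ℝ (Fin (n + 1))) M] [IsManifold (𝓡 (n + 1)) ∞ M]
  {F : Type*} [NormedAddCommGroup F] [NormedSpace ℝ F] [FiniteDimensional ℝ F]
  {V : M → Type*} [TopologicalSpace (TotalSpace F V)]
  [∀ x, AddCommGroup (V x)] [∀ x, Module ℝ (V x)] [∀ x, TopologicalSpace (V x)]
  [FiberBundle F V] [VectorBundle ℝ F V]

theorem bundleCoframe_apply (x : M) (A : Fin (Module.finrank ℝ F)) (v : V x) :
    bundleCoframe F x A v = (Module.finBasis ℝ F).coord A (fibMap F x x v) := rfl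

theorem bundleFrame_self (x : M) (A : Fin (Module.finrank ℝ F)) :
    (bundleFrame F x A x : V x) = fibInv F x x (Module.finBasis ℝ F A) :=
  bundleFrame_eq_fibInv (mem_baseSet_trivializationAt F V x) A

theorem sum_bundleCoframe_smul (x : M) (v : V x) :
    ∑ A, bundleCoframe F x A v • (bundleFrame F x A x : V x) = v := by
  simp only [bundleCoframe_apply, bundleFrame_self, ← map_smul, ← map_sum]
  rw [show ∑ A, (Module.finBasis ℝ F).coord A (fibMap F x x v) • Module.finBasis ℝ F A =
    fibMap F x x v from (Module.finBasis ℝ F).sum_repr _]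
  exact fibInv_fibMap (mem_baseSet_trivializationAt F V x) v

end Frames

namespace JetInstances

variable {n : ℕ} {M : Type*} [TopologicalSpace M]
  [ChartedSpace (EuclideanSpace ℝ (Fin (n + 1))) M]

/-- Shortcuts for instance search. -/
scoped instance isManifold_one [IsManifold (𝓡 (n + 1)) ∞ M] : IsManifold (𝓡 (n + 1)) 1 M :=
  inferInstance

scoped instance topologicalSpaceTangent [IsManifold (𝓡 (n + 1)) ∞ M] :
    TopologicalSpace (TotalSpace (EuclideanSpace ℝ (Fin (n + 1)))
      fun x : M => TangentSpace (𝓡 (n + 1)) x) := inferInstance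

variable {F : Type*} [NormedAddCommGroup F] [NormedSpace ℝ F]

scoped instance normedAddCommGroupJet : NormedAddCommGroup (JetModel n F) := inferInstance
scoped instance normedSpaceJet : NormedSpace ℝ (JetModel n F) := inferInstance
scoped instance normedAddCommGroupDualJet : NormedAddCommGroup (DualJetModel n F) := inferInstance
scoped instance normedSpaceDualJet : NormedSpace ℝ (DualJetModel n F) := inferInstance
scoped instance finiteDimensionalJet [FiniteDimensional ℝ F] :
    FiniteDimensional ℝ (JetModel n F) := inferInstance
scoped instance finiteDimensionalDualJet [FiniteDimensional ℝ F] :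
    FiniteDimensional ℝ (DualJetModel n F) := inferInstance

variable [IsManifold (𝓡 (n + 1)) ∞ M]
  {V : M → Type*} [∀ x, AddCommGroup (V x)] [∀ x, Module ℝ (V x)] [∀ x, TopologicalSpace (V x)]
  [∀ x, IsTopologicalAddGroup (V x)] [∀ x, ContinuousSMul ℝ (V x)]

scoped instance addCommGroupJet (x : M) : AddCommGroup (JetFiber n V x) := inferInstance
scoped instance moduleJet (x : M) : Module ℝ (JetFiber n V x) := inferInstance
scoped instance topologyJet (x : M) : TopologicalSpace (JetFiber n V x) := inferInstance
scoped instance addCommGroupDualJet (x : M) : AddCommGroup (DualJetFiber n V x) := inferInstance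
scoped instance moduleDualJet (x : M) : Module ℝ (DualJetFiber n V x) := inferInstance
scoped instance topologyDualJet (x : M) : TopologicalSpace (DualJetFiber n V x) := inferInstance

variable [TopologicalSpace (TotalSpace F V)] [FiberBundle F V] [VectorBundle ℝ F V]

scoped instance topologicalSpaceJet :
    TopologicalSpace (TotalSpace (JetModel n F) (JetFiber n V)) := inferInstance
scoped instance fiberBundleJet : FiberBundle (JetModel n F) (JetFiber n V) := inferInstance
scoped instance vectorBundleJet : VectorBundle ℝ (JetModel n F) (JetFiber n V) := inferInstance
scoped instance topologicalSpaceDualJet :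
    TopologicalSpace (TotalSpace (DualJetModel n F) (DualJetFiber n V)) := inferInstance
scoped instance fiberBundleDualJet : FiberBundle (DualJetModel n F) (DualJetFiber n V) :=
  inferInstance
scoped instance vectorBundleDualJet :
    VectorBundle ℝ (DualJetModel n F) (DualJetFiber n V) := inferInstance

end JetInstances

open scoped JetInstances

/-! ### The induced covariant derivatives have the expected Christoffel symbols. -/

section InducedConnections

variable {n : ℕ} {M : Type*} [TopologicalSpace M]
  [ChartedSpace (EuclideanSpace ℝ (Fin (n + 1))) M] [IsManifold (𝓡 (n + 1)) ∞ M]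
  {F : Type*} [NormedAddCommGroup F] [NormedSpace ℝ F] [FiniteDimensional ℝ F]
  {V : M → Type*} [TopologicalSpace (TotalSpace F V)]
  [∀ x, AddCommGroup (V x)] [∀ x, Module ℝ (V x)] [∀ x, TopologicalSpace (V x)]
  [∀ x, IsTopologicalAddGroup (V x)] [∀ x, ContinuousSMul ℝ (V x)]
  [FiberBundle F V] [VectorBundle ℝ F V]

theorem fibMap_tangent (x₀ x : M) :
    fibMap (V := fun x : M => TangentSpace (𝓡 (n + 1)) x) (EuclideanSpace ℝ (Fin (n + 1))) x₀ x =
      tanMap (𝓡 (n + 1)) x₀ x := rfl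

theorem mem_baseSet_jet {x₀ x : M} (hx : x ∈ (trivializationAt F V x₀).baseSet)
    (hx' : x ∈ (chartAt (EuclideanSpace ℝ (Fin (n + 1))) x₀).source) :
    x ∈ (trivializationAt (JetModel n F) (JetFiber n V) x₀).baseSet :=
  ⟨by simpa using hx', hx⟩

theorem mem_baseSet_dualJet {x₀ x : M} (hx : x ∈ (trivializationAt F V x₀).baseSet)
    (hx' : x ∈ (chartAt (EuclideanSpace ℝ (Fin (n + 1))) x₀).source) :
    x ∈ (trivializationAt (DualJetModel n F) (DualJetFiber n V) x₀).baseSet :=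
  ⟨⟨by simpa using hx', hx⟩, trivial⟩

theorem fibMap_jet {x₀ x : M} (hx : x ∈ (trivializationAt F V x₀).baseSet)
    (hx' : x ∈ (chartAt (EuclideanSpace ℝ (Fin (n + 1))) x₀).source) (φ : JetFiber n V x) :
    fibMap (JetModel n F) x₀ x φ =
      (fibMap F x₀ x).comp (φ.comp (tanInv (𝓡 (n + 1)) x₀ x)) := by
  exact fibMap_apply (F := JetModel n F) (V := JetFiber n V) (mem_baseSet_jet hx hx') φ

theorem fibMap_dualJet {x₀ x : M} (hx : x ∈ (trivializationAt F V x₀).baseSet)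
    (hx' : x ∈ (chartAt (EuclideanSpace ℝ (Fin (n + 1))) x₀).source) (L : DualJetFiber n V x) :
    fibMap (DualJetModel n F) x₀ x L =
      ContinuousLinearMap.comp (L : JetFiber n V x →L[ℝ] ℝ) (fibInv (JetModel n F) x₀ x) := by
  rw [fibMap_apply (F := DualJetModel n F) (V := DualJetFiber n V) (mem_baseSet_dualJet hx hx') L]
  ext φ
  exact congrArg (fun l : ℝ →L[ℝ] ℝ => l (L (fibInv (JetModel n F) x₀ x φ)))
    (Trivial.continuousLinearMapAt_trivialization ℝ M ℝ x)

variable [ContMDiffVectorBundle ∞ F V (𝓡 (n + 1))]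
  {Γ : CovariantDerivative (𝓡 (n + 1)) F V}
  {Λ : CovariantDerivative (𝓡 (n + 1)) (EuclideanSpace ℝ (Fin (n + 1)))
    (fun x : M => TangentSpace (𝓡 (n + 1)) x)}

-- `jetCov` uses the frame of the trivialization around `x`, whereas the coordinates belong to `x₀`.
-- The derivative of the frame occurs once through `φ(∂_j)` and once through `Λ ∂_j`, and cancels.
-- What remains is linear in the frame vector, so the frame can be replaced by any vector.
set_option maxHeartbeats 1000000 in
theorem hasChristoffelAt_jetCov {x₀ x : M} (hx : x ∈ (trivializationAt F V x₀).baseSet)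
    (hx' : x ∈ (chartAt (EuclideanSpace ℝ (Fin (n + 1))) x₀).source)
    {a : F →L[ℝ] EuclideanSpace ℝ (Fin (n + 1)) →L[ℝ] F}
    {b : EuclideanSpace ℝ (Fin (n + 1)) →L[ℝ] EuclideanSpace ℝ (Fin (n + 1)) →L[ℝ]
      EuclideanSpace ℝ (Fin (n + 1))}
    (ha : HasChristoffelAt F (fun s x => (Γ s x).toLinearMap) x₀ x a)
    (hb : HasChristoffelAt (V := fun x : M => TangentSpace (𝓡 (n + 1)) x)
      (EuclideanSpace ℝ (Fin (n + 1))) (fun s x => (Λ s x).toLinearMap) x₀ x b) :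
    HasChristoffelAt (V := JetFiber n V) (JetModel n F) (jetCov Γ Λ) x₀ x
      (jetChristoffel a b) := by
  intro φ hφ ξ
  have hxT : x ∈ (trivializationAt (EuclideanSpace ℝ (Fin (n + 1)))
    (fun x : M => TangentSpace (𝓡 (n + 1)) x) x₀).baseSet := by simpa using hx'
  have hfr : ∀ j, MDifferentiableAt (𝓡 (n + 1)) 𝓘(ℝ, EuclideanSpace ℝ (Fin (n + 1)))
      (fun y => tanMap (𝓡 (n + 1)) x₀ y (tangentFrame x j y)) x := fun j =>
    mdifferentiableAt_bundleFrame (V := fun x : M => TangentSpace (𝓡 (n + 1)) x) hxT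
      (mem_baseSet_trivializationAt _ _ x) j
  have hev : ∀ j, (fun y => fibMap F x₀ y (φ y (tangentFrame x j y))) =ᶠ[nhds x]
      fun y => fibMap (JetModel n F) x₀ y (φ y) (tanMap (𝓡 (n + 1)) x₀ y (tangentFrame x j y)) := by
    intro j
    filter_upwards [baseSet_mem_nhds hx, (chartAt _ x₀).open_source.mem_nhds hx'] with y hy hy'
    rw [fibMap_jet hy hy', ContinuousLinearMap.comp_apply, ContinuousLinearMap.comp_apply,
      tanInv_tanMap hy']
  have h1 : ∀ j, fibMap F x₀ x (Γ (fun y => φ y (tangentFrame x j y)) x ξ -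
      φ x (Λ (tangentFrame x j) x ξ)) =
      mvfderiv (𝓡 (n + 1)) (fun y => fibMap (JetModel n F) x₀ y (φ y)) x ξ
        (tanMap (𝓡 (n + 1)) x₀ x (tangentFrame x j x)) +
      jetChristoffel a b (fibMap (JetModel n F) x₀ x (φ x)) (tanMap (𝓡 (n + 1)) x₀ x ξ)
        (tanMap (𝓡 (n + 1)) x₀ x (tangentFrame x j x)) := by
    intro j
    have e1 := ha (fun y => φ y (tangentFrame x j y))
      ((hφ.clm_apply (hfr j)).congr_of_eventuallyEq (hev j)) ξ
    have e2 := hb (tangentFrame x j) (hfr j) ξ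
    rw [mvfderiv_congr (hev j), mvfderiv_clm_apply hφ (hfr j)] at e1
    have e3 : fibMap F x₀ x (φ x (Λ (tangentFrame x j) x ξ)) =
        fibMap (JetModel n F) x₀ x (φ x)
          (tanMap (𝓡 (n + 1)) x₀ x (Λ (tangentFrame x j) x ξ)) := by
      rw [fibMap_jet hx hx', ContinuousLinearMap.comp_apply, ContinuousLinearMap.comp_apply,
        tanInv_tanMap hx']
    have e4 := (hev j).self_of_nhds
    simp only [fibMap_tangent, ContinuousLinearMap.coe_coe] at e1 e2 e4
    rw [map_sub, e3, e1, e2, map_add, jetChristoffel_apply, e4]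
    abel
  -- Completeness of the frame at `x`, read in the chart around `x₀`; it removes the frame from the
  -- final formula.
  have h2 : ∀ v : EuclideanSpace ℝ (Fin (n + 1)),
      ∑ j, tangentCoframe x j (tanInv (𝓡 (n + 1)) x₀ x v) •
        tanMap (𝓡 (n + 1)) x₀ x (tangentFrame x j x) = v := by
    intro v
    simp only [← map_smul, ← map_sum]
    rw [sum_bundleCoframe_smul (V := fun x : M => TangentSpace (𝓡 (n + 1)) x), tanMap_tanInv hx']
  refine ContinuousLinearMap.ext fun v => ?_
  rw [fibMap_jet hx hx', ContinuousLinearMap.comp_apply, ContinuousLinearMap.comp_apply]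
  have h3 : jetCov Γ Λ φ x ξ (tanInv (𝓡 (n + 1)) x₀ x v) =
    ∑ j, tangentCoframe x j (tanInv (𝓡 (n + 1)) x₀ x v) •
      (Γ (fun y => φ y (tangentFrame x j y)) x ξ - φ x (Λ (tangentFrame x j) x ξ)) := by
    show (∑ j, (tangentCoframe x j).smulRight
      (Γ (fun y => φ y (tangentFrame x j y)) x ξ - φ x (Λ (tangentFrame x j) x ξ))) _ = _
    rw [sum_apply]
    rfl
  rw [h3, map_sum]
  simp only [map_smul, h1]
  conv_rhs => rw [← h2 v, map_sum]
  refine Finset.sum_congr rfl fun j _ => ?_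
  rw [map_smul]
  rfl

-- The same cancellation as for `jetCov`: the derivative of the frame in `ξ(L(φ))` is compensated by
-- the one in `L(∇_ξ φ)`.
set_option maxHeartbeats 1000000 in
theorem hasChristoffelAt_dualJetCov {x₀ x : M} (hx : x ∈ (trivializationAt F V x₀).baseSet)
    (hx' : x ∈ (chartAt (EuclideanSpace ℝ (Fin (n + 1))) x₀).source)
    {k : JetModel n F →L[ℝ] EuclideanSpace ℝ (Fin (n + 1)) →L[ℝ] JetModel n F}
    (hk : HasChristoffelAt (V := JetFiber n V) (JetModel n F) (jetCov Γ Λ) x₀ x k) :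
    HasChristoffelAt (V := DualJetFiber n V) (DualJetModel n F) (dualJetCov Γ Λ) x₀ x
      (dualChristoffel k) := by
  intro L hL ξ
  have hxJ := mem_baseSet_jet hx hx'
  have hfr : ∀ a, MDifferentiableAt (𝓡 (n + 1)) 𝓘(ℝ, JetModel n F)
      (fun y => fibMap (JetModel n F) x₀ y
        (bundleFrame (V := JetFiber n V) (JetModel n F) x a y)) x := fun a =>
    mdifferentiableAt_bundleFrame (V := JetFiber n V) hxJ (mem_baseSet_trivializationAt _ _ x) a
  have hL' : ∀ y, y ∈ (trivializationAt F V x₀).baseSet →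
      y ∈ (chartAt (EuclideanSpace ℝ (Fin (n + 1))) x₀).source → ∀ ψ : JetFiber n V y,
      (L y ψ : ℝ) = fibMap (DualJetModel n F) x₀ y (L y) (fibMap (JetModel n F) x₀ y ψ) := by
    intro y hy hy' ψ
    rw [fibMap_dualJet hy hy', ContinuousLinearMap.comp_apply, fibInv_fibMap (mem_baseSet_jet hy hy')]
  have hev : ∀ a, (fun y => (L y (bundleFrame (V := JetFiber n V) (JetModel n F) x a y) : ℝ))
      =ᶠ[nhds x] fun y => fibMap (DualJetModel n F) x₀ y (L y) (fibMap (JetModel n F) x₀ y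
        (bundleFrame (V := JetFiber n V) (JetModel n F) x a y)) := by
    intro a
    filter_upwards [baseSet_mem_nhds hx, (chartAt _ x₀).open_source.mem_nhds hx'] with y hy hy'
    exact hL' y hy hy' _
  have h1 : ∀ a, mvfderiv (𝓡 (n + 1))
        (fun y => (L y (bundleFrame (V := JetFiber n V) (JetModel n F) x a y) : ℝ)) x ξ -
      (L x (jetCov Γ Λ (bundleFrame (V := JetFiber n V) (JetModel n F) x a) x ξ) : ℝ) =
      mvfderiv (𝓡 (n + 1)) (fun y => fibMap (DualJetModel n F) x₀ y (L y)) x ξ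
        (fibMap (JetModel n F) x₀ x (bundleFrame (V := JetFiber n V) (JetModel n F) x a x)) +
      dualChristoffel k (fibMap (DualJetModel n F) x₀ x (L x)) (tanMap (𝓡 (n + 1)) x₀ x ξ)
        (fibMap (JetModel n F) x₀ x (bundleFrame (V := JetFiber n V) (JetModel n F) x a x)) := by
    intro a
    rw [mvfderiv_congr (hev a), mvfderiv_clm_apply hL (hfr a), hL' x hx hx', hk _ (hfr a) ξ,
      map_add, dualChristoffel_apply]
    abel
  refine ContinuousLinearMap.ext fun φ => ?_
  rw [fibMap_dualJet hx hx', ContinuousLinearMap.comp_apply]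
  have h3 : (dualJetCov Γ Λ L x ξ (fibInv (JetModel n F) x₀ x φ) : ℝ) =
      ∑ a, (mvfderiv (𝓡 (n + 1))
        (fun y => (L y (bundleFrame (V := JetFiber n V) (JetModel n F) x a y) : ℝ)) x ξ -
      (L x (jetCov Γ Λ (bundleFrame (V := JetFiber n V) (JetModel n F) x a) x ξ) : ℝ)) *
        bundleCoframe (V := JetFiber n V) (JetModel n F) x a (fibInv (JetModel n F) x₀ x φ) := by
    rw [dualJetCov, LinearMap.sum_apply]
    erw [sum_apply]
    rfl
  have h2 : ∑ a, bundleCoframe (V := JetFiber n V) (JetModel n F) x a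
      (fibInv (JetModel n F) x₀ x φ) • fibMap (JetModel n F) x₀ x
        (bundleFrame (V := JetFiber n V) (JetModel n F) x a x) = φ := by
    simp only [← map_smul, ← map_sum]
    rw [sum_bundleCoframe_smul (V := JetFiber n V), fibMap_fibInv hxJ]
  rw [h3]
  simp only [h1]
  conv_rhs => rw [← h2, map_sum]
  refine Finset.sum_congr rfl fun j _ => ?_
  rw [map_smul, mul_comm]
  rfl

end InducedConnections

/-! ### The connection mapping and the tangent map of a bundle chart in an arbitrary trivialization.
-/

section ConnectionMap

variable {n : ℕ} {M : Type*} [TopologicalSpace M]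
  [ChartedSpace (EuclideanSpace ℝ (Fin (n + 1))) M] [IsManifold (𝓡 (n + 1)) ∞ M]
  {F : Type*} [NormedAddCommGroup F] [NormedSpace ℝ F] [FiniteDimensional ℝ F]
  {V : M → Type*} [TopologicalSpace (TotalSpace F V)]
  [∀ x, AddCommGroup (V x)] [∀ x, Module ℝ (V x)] [∀ x, TopologicalSpace (V x)]
  [FiberBundle F V] [VectorBundle ℝ F V] [ContMDiffVectorBundle ∞ F V (𝓡 (n + 1))]

theorem mdifferentiableAt_snd_trivialization {x₀ : M} {z : TotalSpace F V}
    (hz : z.proj ∈ (trivializationAt F V x₀).baseSet) :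
    MDifferentiableAt ((𝓡 (n + 1)).prod 𝓘(ℝ, F)) 𝓘(ℝ, F)
      (fun w : TotalSpace F V => (trivializationAt F V x₀ w).2) z := by
  have h := ((trivializationAt F V x₀).contMDiffAt_iff (IB := 𝓡 (n + 1)) (n := ∞)
    (IM := (𝓡 (n + 1)).prod 𝓘(ℝ, F)) (f := fun w : TotalSpace F V => w) (x₀ := z)
    ((trivializationAt F V x₀).mem_source.2 hz)).1 contMDiffAt_id
  exact h.2.mdifferentiableAt (by simp)

/-- `connectionMap` is defined with the trivialization around the base point of `z` and the section
constant in it. Passing to `x₀`, the derivative of the transition function enters through the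
covariant derivative of that section, and it is the term needed to change `d` of the old fibre
coordinate into `d` of the new one. -/
theorem fibMap_connectionMap
    {cov : ((x : M) → V x) → (x : M) → TangentSpace (𝓡 (n + 1)) x →ₗ[ℝ] V x}
    {x₀ : M} {z : TotalSpace F V} (hz : z.proj ∈ (trivializationAt F V x₀).baseSet)
    {chr : F →L[ℝ] EuclideanSpace ℝ (Fin (n + 1)) →L[ℝ] F}
    (hchr : HasChristoffelAt F cov x₀ z.proj chr)
    (ξ : TangentSpace ((𝓡 (n + 1)).prod 𝓘(ℝ, F)) z) :
    fibMap F x₀ z.proj (connectionMap F cov z ξ) =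
      mvfderiv ((𝓡 (n + 1)).prod 𝓘(ℝ, F))
        (fun w : TotalSpace F V => (trivializationAt F V x₀ w).2) z ξ +
      chr (fibMap F x₀ z.proj z.2) (tanMap (𝓡 (n + 1)) x₀ z.proj
        (mfderiv ((𝓡 (n + 1)).prod 𝓘(ℝ, F)) (𝓡 (n + 1))
          (TotalSpace.proj : TotalSpace F V → M) z ξ)) := by
  have hx := mem_baseSet_trivializationAt F V z.proj
  set e := trivializationAt F V z.proj with he
  set e₀ := trivializationAt F V x₀ with he₀
  let q : F := (e z).2
  let c : M → F →L[ℝ] F := fun y => (e.coordChangeL ℝ e₀ y : F →L[ℝ] F)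
  have hc : MDifferentiableAt (𝓡 (n + 1)) 𝓘(ℝ, F →L[ℝ] F) c z.proj :=
    mdifferentiableAt_coordChangeL hx hz
  have hproj : MDifferentiableAt ((𝓡 (n + 1)).prod 𝓘(ℝ, F)) (𝓡 (n + 1))
      (TotalSpace.proj : TotalSpace F V → M) z := mdifferentiableAt_proj V
  have hcp : MDifferentiableAt ((𝓡 (n + 1)).prod 𝓘(ℝ, F)) 𝓘(ℝ, F →L[ℝ] F)
      (fun w : TotalSpace F V => c w.proj) z := hc.comp z hproj
  -- The constant section in one trivialization is `c y q` in the other, with `c` the transition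
  -- function.
  have hsec : (fun y => fibMap F x₀ y (FiberBundle.extend F z.2 y)) =ᶠ[nhds z.proj]
      fun y => c y q := by
    filter_upwards [baseSet_mem_nhds hx, baseSet_mem_nhds hz] with y hy hy₀
    have : (FiberBundle.extend F z.2 y : V y) = fibInv F z.proj y q := (fibInv_eq_symm hy q).symm
    rw [this, fibMap_comp_fibInv hy₀ hy]
    rfl
  have htot : (fun w : TotalSpace F V => (e₀ w).2) =ᶠ[nhds z]
      fun w => c w.proj (e w).2 := by
    have hcont : ContinuousAt (TotalSpace.proj : TotalSpace F V → M) z := hproj.continuousAt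
    filter_upwards [hcont.preimage_mem_nhds (baseSet_mem_nhds hx),
      hcont.preimage_mem_nhds (baseSet_mem_nhds hz)] with w hw hw₀
    have h1 := fibMap_comp_fibInv (F := F) (V := V) hw₀ hw (fibMap F z.proj w.proj w.2)
    rw [fibInv_fibMap hw, fibMap_apply hw₀, fibMap_apply hw] at h1
    exact h1
  have hq : MDifferentiableAt (𝓡 (n + 1)) 𝓘(ℝ, F) (fun _ : M => q) z.proj :=
    mdifferentiableAt_const
  have hs := hchr (FiberBundle.extend F z.2)
    ((hc.clm_apply hq).congr_of_eventuallyEq hsec)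
    (mfderiv ((𝓡 (n + 1)).prod 𝓘(ℝ, F)) (𝓡 (n + 1))
      (TotalSpace.proj : TotalSpace F V → M) z ξ)
  rw [mvfderiv_congr hsec, mvfderiv_clm_apply hc hq, mvfderiv_const] at hs
  have hext : (FiberBundle.extend F z.2 z.proj : V z.proj) = z.2 := by simp
  have hdc := congrArg (fun D => D ξ) (mvfderiv_comp_map hc hproj)
  rw [mvfderiv_congr htot, mvfderiv_clm_apply hcp (mdifferentiableAt_snd_trivialization hx)]
  have hK : connectionMap F cov z ξ = fibInv F z.proj z.proj
      (mvfderiv ((𝓡 (n + 1)).prod 𝓘(ℝ, F)) (fun w : TotalSpace F V => (e w).2) z ξ) +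
      cov (FiberBundle.extend F z.2) z.proj (mfderiv ((𝓡 (n + 1)).prod 𝓘(ℝ, F)) (𝓡 (n + 1))
      (TotalSpace.proj : TotalSpace F V → M) z ξ) := rfl
  rw [hK, map_add, hs, hext, fibMap_comp_fibInv hz hx]
  simp only [ContinuousLinearMap.comp_apply] at hdc
  rw [hdc]
  simp only [zero_apply, map_zero, zero_add]
  rw [← add_assoc]
  rfl

theorem mem_chartSource_total {z₀ z : TotalSpace F V}
    (hz : z.proj ∈ (trivializationAt F V z₀.proj).baseSet)
    (hz' : z.proj ∈ (chartAt (EuclideanSpace ℝ (Fin (n + 1))) z₀.proj).source) :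
    z ∈ (chartAt (ModelProd (EuclideanSpace ℝ (Fin (n + 1))) F) z₀).source := by
  rw [FiberBundle.chartedSpace_chartAt]
  simp only [mfld_simps]
  refine ⟨(Trivialization.mem_source _).2 hz, ?_⟩
  rwa [Trivialization.coe_fst' _ hz]

/-- The chart of the total space is the trivialization followed by the chart of the base, so its
tangent map splits into these two components. -/
theorem tanMap_total {z₀ z : TotalSpace F V}
    (hz : z.proj ∈ (trivializationAt F V z₀.proj).baseSet)
    (hz' : z.proj ∈ (chartAt (EuclideanSpace ℝ (Fin (n + 1))) z₀.proj).source)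
    (ξ : TangentSpace ((𝓡 (n + 1)).prod 𝓘(ℝ, F)) z) :
    tanMap ((𝓡 (n + 1)).prod 𝓘(ℝ, F)) z₀ z ξ =
      (tanMap (𝓡 (n + 1)) z₀.proj z.proj (mfderiv ((𝓡 (n + 1)).prod 𝓘(ℝ, F)) (𝓡 (n + 1))
        (TotalSpace.proj : TotalSpace F V → M) z ξ),
        mvfderiv ((𝓡 (n + 1)).prod 𝓘(ℝ, F)) (fun w : TotalSpace F V =>
          (trivializationAt F V z₀.proj w).2) z ξ) := by
  have hs := mem_chartSource_total hz hz'
  have hproj : MDifferentiableAt ((𝓡 (n + 1)).prod 𝓘(ℝ, F)) (𝓡 (n + 1))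
      (TotalSpace.proj : TotalSpace F V → M) z := mdifferentiableAt_proj V
  have hd : MDifferentiableAt ((𝓡 (n + 1)).prod 𝓘(ℝ, F))
      𝓘(ℝ, EuclideanSpace ℝ (Fin (n + 1)) × F)
      (extChartAt ((𝓡 (n + 1)).prod 𝓘(ℝ, F)) z₀) z := mdifferentiableAt_extChartAt hs
  have h0 : tanMap ((𝓡 (n + 1)).prod 𝓘(ℝ, F)) z₀ z ξ =
      mvfderiv ((𝓡 (n + 1)).prod 𝓘(ℝ, F)) (extChartAt ((𝓡 (n + 1)).prod 𝓘(ℝ, F)) z₀) z ξ := by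
    rw [tanMap_eq_mfderiv hs]
    rfl
  rw [h0]
  have h1 := mvfderiv_clm_comp_left (ContinuousLinearMap.fst ℝ (EuclideanSpace ℝ (Fin (n + 1)))
    F) hd ξ
  have h2 := mvfderiv_clm_comp_left (ContinuousLinearMap.snd ℝ (EuclideanSpace ℝ (Fin (n + 1)))
    F) hd ξ
  refine Prod.ext (h1.symm.trans ?_) (h2.symm.trans ?_)
  · have hM : MDifferentiableAt (𝓡 (n + 1)) 𝓘(ℝ, EuclideanSpace ℝ (Fin (n + 1)))
        (extChartAt (𝓡 (n + 1)) z₀.proj) z.proj := mdifferentiableAt_extChartAt hz'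
    have h3 := mvfderiv_comp_map hM hproj
    have h4 : (fun w : TotalSpace F V => ContinuousLinearMap.fst ℝ
        (EuclideanSpace ℝ (Fin (n + 1))) F (extChartAt ((𝓡 (n + 1)).prod 𝓘(ℝ, F)) z₀ w)) =ᶠ[nhds z]
        fun w => extChartAt (𝓡 (n + 1)) z₀.proj w.proj := by
      filter_upwards [hproj.continuousAt.preimage_mem_nhds (baseSet_mem_nhds hz)] with w hw
      rw [FiberBundle.extChartAt]
      exact congrArg (extChartAt (𝓡 (n + 1)) z₀.proj) (Trivialization.coe_fst' _ hw)
    rw [mvfderiv_congr h4, h3, tanMap_eq_mfderiv hz']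
    rfl
  · congr 1

end ConnectionMap

/-- The model space of the base manifold. -/
abbrev BaseModel (n : ℕ) : Type := EuclideanSpace ℝ (Fin (n + 1))

/-! ### Shears, which relate charts of a bundle to a splitting. -/

section Shear

variable {E G : Type*} [NormedAddCommGroup E] [NormedSpace ℝ E]
  [NormedAddCommGroup G] [NormedSpace ℝ G]

/-- The shear `(u, q) ↦ (u, q + C u)`. -/
def shear (C : E →L[ℝ] G) : E × G →L[ℝ] E × G :=
  ContinuousLinearMap.id ℝ (E × G) +
    (ContinuousLinearMap.inr ℝ E G).comp (C.comp (ContinuousLinearMap.fst ℝ E G))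

theorem shear_apply (C : E →L[ℝ] G) (v : E × G) : shear C v = (v.1, v.2 + C v.1) := by
  simp [shear, Prod.ext_iff]

theorem shear_shear_neg (C : E →L[ℝ] G) (v : E × G) : shear C (shear (-C) v) = v := by
  simp [shear_apply]

theorem shear_neg_shear (C : E →L[ℝ] G) (v : E × G) : shear (-C) (shear C v) = v := by
  simp [shear_apply]

theorem ContMDiffAt.shear {W : Type*} [NormedAddCommGroup W] [NormedSpace ℝ W]
    {H : Type*} [TopologicalSpace H] {I : ModelWithCorners ℝ W H}
    {N : Type*} [TopologicalSpace N] [ChartedSpace H N] {C : N → E →L[ℝ] G} {x₀ : N}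
    (hC : ContMDiffAt I 𝓘(ℝ, E →L[ℝ] G) ∞ C x₀) :
    ContMDiffAt I 𝓘(ℝ, E × G →L[ℝ] E × G) ∞ (fun x => shear (C x)) x₀ :=
  contMDiffAt_const.add (contMDiffAt_clm_comp contMDiffAt_const
    (contMDiffAt_clm_comp hC contMDiffAt_const))

end Shear

/-! ### Splittings of the tangent spaces of a vector bundle, and smoothness tested in a splitting.
-/

section Splitting

attribute [local instance] extNormedAddCommGroup extNormedSpace

variable {n : ℕ} {M : Type*} [TopologicalSpace M]
  [ChartedSpace (EuclideanSpace ℝ (Fin (n + 1))) M] [IsManifold (𝓡 (n + 1)) ∞ M]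
  {G : Type*} [NormedAddCommGroup G] [NormedSpace ℝ G] [FiniteDimensional ℝ G]
  {Q : M → Type*} [TopologicalSpace (TotalSpace G Q)]
  [∀ x, AddCommGroup (Q x)] [∀ x, Module ℝ (Q x)] [∀ x, TopologicalSpace (Q x)]
  [FiberBundle G Q] [VectorBundle ℝ G Q]

variable (n G Q) in
/-- The points over which the preferred trivializations of `TM` and of `Q` around `x₀` are
defined. -/
def trivDomain (x₀ : M) : Set M :=
  (trivializationAt G Q x₀).baseSet ∩ (chartAt (EuclideanSpace ℝ (Fin (n + 1))) x₀).source

theorem mem_trivDomain_self (x₀ : M) : x₀ ∈ trivDomain n G Q x₀ :=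
  ⟨mem_baseSet_trivializationAt G Q x₀, mem_chart_source _ x₀⟩

theorem isOpen_trivDomain (x₀ : M) : IsOpen (trivDomain n G Q x₀) :=
  (trivializationAt G Q x₀).open_baseSet.inter (chartAt _ x₀).open_source

theorem trivDomain_mem_nhds {x₀ x : M} (hx : x ∈ trivDomain n G Q x₀) :
    trivDomain n G Q x₀ ∈ nhds x := (isOpen_trivDomain x₀).mem_nhds hx

theorem eventually_mem_trivDomain {x₀ : M} {z : TotalSpace G Q}
    (hz : z.proj ∈ trivDomain n G Q x₀) : ∀ᶠ w in nhds z, w.proj ∈ trivDomain n G Q x₀ :=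
  (FiberBundle.continuous_proj G Q).continuousAt.preimage_mem_nhds (trivDomain_mem_nhds hz)

/-- A family of linear maps `T_zQ → T_xM × Q_x`, `x` the base point of `z`, whose first component
is the tangent map of the projection and whose second component is a smooth connection mapping. -/
structure IsSmoothSplitting (S : (z : TotalSpace G Q) →
    TangentSpace ((𝓡 (n + 1)).prod 𝓘(ℝ, G)) z →ₗ[ℝ]
      TangentSpace (𝓡 (n + 1)) z.proj × Q z.proj) : Prop where
  fst_eq : ∀ z ξ, (S z ξ).1 = mfderiv ((𝓡 (n + 1)).prod 𝓘(ℝ, G)) (𝓡 (n + 1))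
    (TotalSpace.proj : TotalSpace G Q → M) z ξ
  exists_christoffel : ∀ x₀ : M, ∃ C : TotalSpace G Q → BaseModel n →L[ℝ] G,
    (∀ z : TotalSpace G Q, z.proj = x₀ →
      ContMDiffAt ((𝓡 (n + 1)).prod 𝓘(ℝ, G)) 𝓘(ℝ, BaseModel n →L[ℝ] G) ∞ C z) ∧
    ∀ z : TotalSpace G Q, z.proj ∈ trivDomain n G Q x₀ → ∀ ξ,
      fibMap G x₀ z.proj (S z ξ).2 = mvfderiv ((𝓡 (n + 1)).prod 𝓘(ℝ, G))
        (fun w : TotalSpace G Q => (trivializationAt G Q x₀ w).2) z ξ +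
          C z (tanMap (𝓡 (n + 1)) x₀ z.proj (S z ξ).1)

variable (S : (z : TotalSpace G Q) → TangentSpace ((𝓡 (n + 1)).prod 𝓘(ℝ, G)) z →ₗ[ℝ]
    TangentSpace (𝓡 (n + 1)) z.proj × Q z.proj)

variable (n G Q) in
/-- The trivialization of `TM × Q` around `x₀`. -/
def pairMap (x₀ x : M) : TangentSpace (𝓡 (n + 1)) x × Q x →ₗ[ℝ] BaseModel n × G :=
  (tanMap (𝓡 (n + 1)) x₀ x).toLinearMap.prodMap (fibMap G x₀ x).toLinearMap

variable (n G Q) in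
/-- The inverse of `pairMap`. -/
def pairInv (x₀ x : M) : BaseModel n × G →ₗ[ℝ] TangentSpace (𝓡 (n + 1)) x × Q x :=
  (tanInv (𝓡 (n + 1)) x₀ x).toLinearMap.prodMap (fibInv G x₀ x : G →L[ℝ] Q x).toLinearMap

theorem pairMap_pairInv {x₀ x : M} (hx : x ∈ trivDomain n G Q x₀) (v : BaseModel n × G) :
    pairMap n G Q x₀ x (pairInv n G Q x₀ x v) = v :=
  Prod.ext (tanMap_tanInv hx.2 _) (fibMap_fibInv hx.1 _)

theorem pairInv_pairMap {x₀ x : M} (hx : x ∈ trivDomain n G Q x₀)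
    (v : TangentSpace (𝓡 (n + 1)) x × Q x) :
    pairInv n G Q x₀ x (pairMap n G Q x₀ x v) = v :=
  Prod.ext (tanInv_tanMap hx.2 _) (fibInv_fibMap hx.1 _)

/-- A splitting in the trivializations around `x₀`. -/
def splitChart (x₀ : M) (z : TotalSpace G Q) :
    TangentSpace ((𝓡 (n + 1)).prod 𝓘(ℝ, G)) z →ₗ[ℝ] BaseModel n × G :=
  pairMap n G Q x₀ z.proj ∘ₗ S z

/-- The inverse of `splitChart`. -/
def splitChartInv (x₀ : M) (z : TotalSpace G Q) :
    BaseModel n × G →ₗ[ℝ] TangentSpace ((𝓡 (n + 1)).prod 𝓘(ℝ, G)) z :=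
  (S z).leftInverse ∘ₗ pairInv n G Q x₀ z.proj

/-- A form in the splitting and the trivializations around `x₀`. -/
def readForm (x₀ : M) (α : FormOn ((𝓡 (n + 1)).prod 𝓘(ℝ, G)) (TotalSpace G Q))
    (z : TotalSpace G Q) : ExtForm (BaseModel n × G) :=
  formPullback (splitChartInv S x₀ z) (α z)

/-- A multivector field in the splitting and the trivializations around `x₀`. -/
def readField [ContMDiffVectorBundle ∞ G Q (𝓡 (n + 1))] (x₀ : M)
    (X : MultivectorOn ((𝓡 (n + 1)).prod 𝓘(ℝ, G)) (TotalSpace G Q))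
    (z : TotalSpace G Q) : ExteriorAlgebra ℝ (BaseModel n × G) :=
  ExteriorAlgebra.map (splitChart S x₀ z) (X z)

variable [ContMDiffVectorBundle ∞ G Q (𝓡 (n + 1))] {S}

namespace IsSmoothSplitting

variable (hS : IsSmoothSplitting S)
include hS

theorem splitChart_eq_shear (x₀ : M) : ∃ C : TotalSpace G Q → BaseModel n →L[ℝ] G,
    (∀ z : TotalSpace G Q, z.proj = x₀ →
      ContMDiffAt ((𝓡 (n + 1)).prod 𝓘(ℝ, G)) 𝓘(ℝ, BaseModel n →L[ℝ] G) ∞ C z) ∧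
    ∀ z z₀ : TotalSpace G Q, z₀.proj = x₀ → z.proj ∈ trivDomain n G Q x₀ → ∀ ξ,
      splitChart S x₀ z ξ = shear (C z) (tanMap ((𝓡 (n + 1)).prod 𝓘(ℝ, G)) z₀ z ξ) := by
  obtain ⟨C, hC, h⟩ := hS.exists_christoffel x₀
  refine ⟨C, hC, fun z z₀ h₀ hz ξ => ?_⟩
  subst h₀
  have h1 := h z hz ξ
  rw [tanMap_total hz.1 hz.2, shear_apply]
  rw [hS.fst_eq] at h1
  refine Prod.ext ?_ h1
  exact congrArg (tanMap (𝓡 (n + 1)) z₀.proj z.proj) (hS.fst_eq z ξ)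

/-- In trivializations `S z` is the tangent map of the chart followed by a shear, and both are
invertible. Consequently `LinearMap.leftInverse` is a two-sided inverse. -/
theorem bijective (z : TotalSpace G Q) : Function.Bijective (S z) := by
  obtain ⟨C, -, h⟩ := hS.splitChart_eq_shear z.proj
  have hz := mem_trivDomain_self (n := n) (G := G) (Q := Q) z.proj
  have hc := mem_chart_source (ModelProd (EuclideanSpace ℝ (Fin (n + 1))) G) z
  have h' := h z z rfl hz
  constructor
  · refine (injective_iff_map_eq_zero (S z)).2 fun ξ hξ => ?_
    have h1 : splitChart S z.proj z ξ = 0 := by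
      show pairMap n G Q z.proj z.proj (S z ξ) = 0
      rw [show S z ξ = 0 from hξ, map_zero]
    rw [h'] at h1
    have h2 := congrArg (shear (-C z)) h1
    rw [shear_neg_shear, map_zero] at h2
    rw [← tanInv_tanMap hc ξ, h2, map_zero]
  · intro v
    refine ⟨tanInv ((𝓡 (n + 1)).prod 𝓘(ℝ, G)) z z (shear (-C z) (pairMap n G Q z.proj z.proj v)),
      ?_⟩
    have h1 := h' (tanInv ((𝓡 (n + 1)).prod 𝓘(ℝ, G)) z z
      (shear (-C z) (pairMap n G Q z.proj z.proj v)))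
    rw [tanMap_tanInv hc, shear_shear_neg] at h1
    have h2 := congrArg (pairInv n G Q z.proj z.proj) h1
    rw [pairInv_pairMap hz] at h2
    exact (pairInv_pairMap hz _).symm.trans h2

theorem leftInverse_apply (z : TotalSpace G Q)
    (ξ : TangentSpace ((𝓡 (n + 1)).prod 𝓘(ℝ, G)) z) : (S z).leftInverse (S z ξ) = ξ :=
  LinearMap.leftInverse_apply_of_inj (LinearMap.ker_eq_bot.2 (hS.bijective z).1) ξ

theorem apply_leftInverse (z : TotalSpace G Q) (v : TangentSpace (𝓡 (n + 1)) z.proj × Q z.proj) :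
    S z ((S z).leftInverse v) = v := by
  obtain ⟨ξ, rfl⟩ := (hS.bijective z).2 v
  rw [hS.leftInverse_apply]

theorem splitChart_splitChartInv {x₀ : M} {z : TotalSpace G Q}
    (hz : z.proj ∈ trivDomain n G Q x₀) (v : BaseModel n × G) :
    splitChart S x₀ z (splitChartInv S x₀ z v) = v := by
  show pairMap n G Q x₀ z.proj (S z ((S z).leftInverse (pairInv n G Q x₀ z.proj v))) = v
  rw [hS.apply_leftInverse, pairMap_pairInv hz]

theorem splitChartInv_splitChart {x₀ : M} {z : TotalSpace G Q}
    (hz : z.proj ∈ trivDomain n G Q x₀) (ξ : TangentSpace ((𝓡 (n + 1)).prod 𝓘(ℝ, G)) z) :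
    splitChartInv S x₀ z (splitChart S x₀ z ξ) = ξ := by
  show (S z).leftInverse (pairInv n G Q x₀ z.proj (pairMap n G Q x₀ z.proj (S z ξ))) = ξ
  rw [pairInv_pairMap hz, hS.leftInverse_apply]

theorem formPullback_readForm {x₀ : M} {z : TotalSpace G Q}
    (hz : z.proj ∈ trivDomain n G Q x₀)
    (α : FormOn ((𝓡 (n + 1)).prod 𝓘(ℝ, G)) (TotalSpace G Q)) :
    formPullback (splitChart S x₀ z) (readForm S x₀ α z) = α z := by
  rw [readForm, ← formPullback_comp]
  conv_rhs => rw [← formPullback_id (α z)]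
  congr 2
  exact LinearMap.ext (hS.splitChartInv_splitChart hz)

theorem map_readField {x₀ : M} {z : TotalSpace G Q}
    (hz : z.proj ∈ trivDomain n G Q x₀)
    (X : MultivectorOn ((𝓡 (n + 1)).prod 𝓘(ℝ, G)) (TotalSpace G Q)) :
    ExteriorAlgebra.map (splitChartInv S x₀ z) (readField S x₀ X z) = X z := by
  rw [readField, map_map]
  conv_rhs => rw [← map_id_apply (X z)]
  congr 2
  exact LinearMap.ext (hS.splitChartInv_splitChart hz)

theorem readForm_injective {x₀ : M} {z : TotalSpace G Q} (hz : z.proj ∈ trivDomain n G Q x₀)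
    {α β : FormOn ((𝓡 (n + 1)).prod 𝓘(ℝ, G)) (TotalSpace G Q)}
    (h : readForm S x₀ α z = readForm S x₀ β z) : α z = β z := by
  rw [← hS.formPullback_readForm hz α, h, hS.formPullback_readForm hz]

theorem readField_map {x₀ : M} {z : TotalSpace G Q}
    (hz : z.proj ∈ trivDomain n G Q x₀) {X : ExteriorAlgebra ℝ (BaseModel n × G)} :
    ExteriorAlgebra.map (splitChart S x₀ z) (ExteriorAlgebra.map (splitChartInv S x₀ z) X) = X := by
  rw [map_map]
  conv_rhs => rw [← map_id_apply X]
  congr 2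
  exact LinearMap.ext (hS.splitChart_splitChartInv hz)

theorem hook_readForm {x₀ : M} {z : TotalSpace G Q} (hz : z.proj ∈ trivDomain n G Q x₀)
    (X : MultivectorOn ((𝓡 (n + 1)).prod 𝓘(ℝ, G)) (TotalSpace G Q))
    (α : FormOn ((𝓡 (n + 1)).prod 𝓘(ℝ, G)) (TotalSpace G Q)) :
    hook (readField S x₀ X z) (readForm S x₀ α z) =
      formPullback (splitChartInv S x₀ z) (hook (X z) (α z)) := by
  rw [readForm, hook_formPullback, hS.map_readField hz]

/-- Passing from the trivializations around `x₀` to those around `x₁`. -/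
theorem exists_transition {x₀ x₁ : M} {z : TotalSpace G Q}
    (hz₀ : z.proj ∈ trivDomain n G Q x₀) (hz₁ : z.proj ∈ trivDomain n G Q x₁) :
    ∃ A : TotalSpace G Q → (BaseModel n × G) →L[ℝ] (BaseModel n × G),
      ContMDiffAt ((𝓡 (n + 1)).prod 𝓘(ℝ, G)) 𝓘(ℝ, (BaseModel n × G) →L[ℝ] (BaseModel n × G)) ∞
        A z ∧
      ∀ᶠ w in nhds z, splitChartInv S x₀ w = splitChartInv S x₁ w ∘ₗ (A w).toLinearMap ∧
        splitChart S x₁ w = (A w).toLinearMap ∘ₗ splitChart S x₀ w := by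
  have hproj : ContMDiffAt ((𝓡 (n + 1)).prod 𝓘(ℝ, G)) (𝓡 (n + 1)) ∞
      (TotalSpace.proj : TotalSpace G Q → M) z := contMDiffAt_proj Q
  let a : M → BaseModel n →L[ℝ] BaseModel n := fun x =>
    (trivializationAt (BaseModel n) (TangentSpace (𝓡 (n + 1)) : M → Type _) x₀).coordChangeL ℝ
      (trivializationAt (BaseModel n) (TangentSpace (𝓡 (n + 1)) : M → Type _) x₁) x
  let b : M → G →L[ℝ] G := fun x =>
    (trivializationAt G Q x₀).coordChangeL ℝ (trivializationAt G Q x₁) x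
  have ha : ContMDiffAt ((𝓡 (n + 1)).prod 𝓘(ℝ, G)) 𝓘(ℝ, BaseModel n →L[ℝ] BaseModel n) ∞
      (fun w : TotalSpace G Q => a w.proj) z :=
    hproj.coordChangeL (by simpa using hz₀.2) (by simpa using hz₁.2)
  have hb : ContMDiffAt ((𝓡 (n + 1)).prod 𝓘(ℝ, G)) 𝓘(ℝ, G →L[ℝ] G) ∞
      (fun w : TotalSpace G Q => b w.proj) z := hproj.coordChangeL hz₀.1 hz₁.1
  refine ⟨fun w => (ContinuousLinearMap.inl ℝ (BaseModel n) G).comp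
      ((a w.proj).comp (ContinuousLinearMap.fst ℝ (BaseModel n) G)) +
      (ContinuousLinearMap.inr ℝ (BaseModel n) G).comp
      ((b w.proj).comp (ContinuousLinearMap.snd ℝ (BaseModel n) G)), ?_, ?_⟩
  · exact (contMDiffAt_clm_comp contMDiffAt_const
      (contMDiffAt_clm_comp ha contMDiffAt_const)).add
      (contMDiffAt_clm_comp contMDiffAt_const (contMDiffAt_clm_comp hb contMDiffAt_const))
  filter_upwards [eventually_mem_trivDomain hz₀, eventually_mem_trivDomain hz₁] with w hw₀ hw₁
  have h1 : ∀ v, pairMap n G Q x₁ w.proj (pairInv n G Q x₀ w.proj v) = (a w.proj v.1, b w.proj v.2) :=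
    fun v => Prod.ext (fibMap_comp_fibInv (F := BaseModel n)
      (V := fun x : M => TangentSpace (𝓡 (n + 1)) x)
      (by simpa using hw₁.2) (by simpa using hw₀.2) _) (fibMap_comp_fibInv hw₁.1 hw₀.1 _)
  have h3 : splitChart S x₁ w = ((ContinuousLinearMap.inl ℝ (BaseModel n) G).comp
      ((a w.proj).comp (ContinuousLinearMap.fst ℝ (BaseModel n) G)) +
      (ContinuousLinearMap.inr ℝ (BaseModel n) G).comp
      ((b w.proj).comp (ContinuousLinearMap.snd ℝ (BaseModel n) G))).toLinearMap ∘ₗ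
        splitChart S x₀ w := by
    refine LinearMap.ext fun ξ => ?_
    have h2 := h1 (pairMap n G Q x₀ w.proj (S w ξ))
    rw [pairInv_pairMap hw₀] at h2
    refine h2.trans ?_
    simp [splitChart]
  refine ⟨LinearMap.ext fun v => ?_, h3⟩
  rw [← hS.splitChartInv_splitChart hw₁ (splitChartInv S x₀ w v), h3]
  simp only [LinearMap.comp_apply, hS.splitChart_splitChartInv hw₀]

theorem contMDiffAt_readForm_congr {x₀ x₁ : M} {z : TotalSpace G Q}
    (hz₀ : z.proj ∈ trivDomain n G Q x₀) (hz₁ : z.proj ∈ trivDomain n G Q x₁)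
    {α : FormOn ((𝓡 (n + 1)).prod 𝓘(ℝ, G)) (TotalSpace G Q)}
    (h : ContMDiffAt ((𝓡 (n + 1)).prod 𝓘(ℝ, G)) 𝓘(ℝ, ExtForm (BaseModel n × G)) ∞
      (readForm S x₁ α) z) :
    ContMDiffAt ((𝓡 (n + 1)).prod 𝓘(ℝ, G)) 𝓘(ℝ, ExtForm (BaseModel n × G)) ∞
      (readForm S x₀ α) z := by
  obtain ⟨A, hA, h1⟩ := hS.exists_transition hz₀ hz₁
  refine (contMDiffAt_formPullback hA h).congr_of_eventuallyEq ?_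
  filter_upwards [h1] with w hw
  rw [readForm, hw.1, formPullback_comp]
  rfl

theorem contMDiffAt_readField_congr {x₀ x₁ : M} {z : TotalSpace G Q}
    (hz₀ : z.proj ∈ trivDomain n G Q x₀) (hz₁ : z.proj ∈ trivDomain n G Q x₁)
    {X : MultivectorOn ((𝓡 (n + 1)).prod 𝓘(ℝ, G)) (TotalSpace G Q)}
    (h : ContMDiffAt ((𝓡 (n + 1)).prod 𝓘(ℝ, G)) 𝓘(ℝ, ExteriorAlgebra ℝ (BaseModel n × G)) ∞
      (readField S x₀ X) z) :
    ContMDiffAt ((𝓡 (n + 1)).prod 𝓘(ℝ, G)) 𝓘(ℝ, ExteriorAlgebra ℝ (BaseModel n × G)) ∞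
      (readField S x₁ X) z := by
  obtain ⟨A, hA, h1⟩ := hS.exists_transition hz₀ hz₁
  refine (contMDiffAt_map hA h).congr_of_eventuallyEq ?_
  filter_upwards [h1] with w hw
  rw [readField, hw.2, ← map_map]
  rfl

/-- `splitChart` is the tangent map of the chart, up to a shear. -/
theorem exists_shear (z₀ : TotalSpace G Q) : ∃ C : TotalSpace G Q → BaseModel n →L[ℝ] G,
    ContMDiffAt ((𝓡 (n + 1)).prod 𝓘(ℝ, G)) 𝓘(ℝ, BaseModel n →L[ℝ] G) ∞ C z₀ ∧
    ∀ z : TotalSpace G Q, z.proj ∈ trivDomain n G Q z₀.proj →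
      splitChart S z₀.proj z = (shear (C z)).toLinearMap ∘ₗ
        (tanMap ((𝓡 (n + 1)).prod 𝓘(ℝ, G)) z₀ z).toLinearMap ∧
      splitChartInv S z₀.proj z = (tanInv ((𝓡 (n + 1)).prod 𝓘(ℝ, G)) z₀ z).toLinearMap ∘ₗ
        (shear (-C z)).toLinearMap := by
  obtain ⟨C, hC, h⟩ := hS.splitChart_eq_shear z₀.proj
  refine ⟨C, hC z₀ rfl, fun z hz => ?_⟩
  have h1 : splitChart S z₀.proj z = (shear (C z)).toLinearMap ∘ₗ
      (tanMap ((𝓡 (n + 1)).prod 𝓘(ℝ, G)) z₀ z).toLinearMap :=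
    LinearMap.ext fun ξ => h z z₀ rfl hz ξ
  refine ⟨h1, LinearMap.ext fun v => ?_⟩
  have hc := mem_chartSource_total hz.1 hz.2
  refine (hS.bijective z).1 ?_
  have h2 := h z z₀ rfl hz (tanInv ((𝓡 (n + 1)).prod 𝓘(ℝ, G)) z₀ z (shear (-C z) v))
  rw [tanMap_tanInv hc, shear_shear_neg] at h2
  have h3 := hS.splitChart_splitChartInv hz v
  have h4 : Function.Injective (pairMap n G Q z₀.proj z.proj) :=
    Function.LeftInverse.injective (pairInv_pairMap hz)
  exact h4 (h3.trans h2.symm)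

/-- At the centre of a trivialization, components in the splitting and in the chart differ by a
smooth shear. Points away from the centre are reached through smooth transition maps between
trivializations. -/
theorem isSmoothForm_iff {α : FormOn ((𝓡 (n + 1)).prod 𝓘(ℝ, G)) (TotalSpace G Q)} :
    IsSmoothForm ((𝓡 (n + 1)).prod 𝓘(ℝ, G)) α ↔ ∀ (x₀ : M) (z : TotalSpace G Q),
      z.proj ∈ trivDomain n G Q x₀ → ContMDiffAt ((𝓡 (n + 1)).prod 𝓘(ℝ, G))
        𝓘(ℝ, ExtForm (BaseModel n × G)) ∞ (readForm S x₀ α) z := by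
  constructor
  · intro h x₀ z hz
    refine hS.contMDiffAt_readForm_congr (x₁ := z.proj) hz (mem_trivDomain_self z.proj) ?_
    obtain ⟨C, hC, h1⟩ := hS.exists_shear z
    refine (contMDiffAt_formPullback (ContMDiffAt.shear (contMDiffAt_neg_of hC))
      (h.contMDiffAt z)).congr_of_eventuallyEq ?_
    filter_upwards [eventually_mem_trivDomain (mem_trivDomain_self (n := n) z.proj)] with w hw
    rw [readForm, (h1 w hw).2, formPullback_comp]
  · intro h
    refine isSmoothForm_of_contMDiffAt fun z => ?_
    obtain ⟨C, hC, h1⟩ := hS.exists_shear z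
    refine (contMDiffAt_formPullback (ContMDiffAt.shear hC)
      (h z.proj z (mem_trivDomain_self z.proj))).congr_of_eventuallyEq ?_
    filter_upwards [eventually_mem_trivDomain (mem_trivDomain_self (n := n) z.proj)] with w hw
    rw [readForm, (h1 w hw).2, ← formPullback_comp]
    congr 2
    refine LinearMap.ext fun v => ?_
    exact congrArg (tanInv ((𝓡 (n + 1)).prod 𝓘(ℝ, G)) z w) (shear_neg_shear _ _).symm

theorem isSmoothMultivector_iff
    {X : MultivectorOn ((𝓡 (n + 1)).prod 𝓘(ℝ, G)) (TotalSpace G Q)} :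
    IsSmoothMultivector ((𝓡 (n + 1)).prod 𝓘(ℝ, G)) X ↔ ∀ (x₀ : M) (z : TotalSpace G Q),
      z.proj ∈ trivDomain n G Q x₀ → ContMDiffAt ((𝓡 (n + 1)).prod 𝓘(ℝ, G))
        𝓘(ℝ, ExteriorAlgebra ℝ (BaseModel n × G)) ∞ (readField S x₀ X) z := by
  constructor
  · intro h x₀ z hz
    refine hS.contMDiffAt_readField_congr (x₀ := z.proj) (mem_trivDomain_self z.proj) hz ?_
    obtain ⟨C, hC, h1⟩ := hS.exists_shear z
    refine (contMDiffAt_map (ContMDiffAt.shear hC) (h.contMDiffAt z)).congr_of_eventuallyEq ?_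
    filter_upwards [eventually_mem_trivDomain (mem_trivDomain_self (n := n) z.proj)] with w hw
    rw [readField, (h1 w hw).1, map_map]
  · intro h
    refine isSmoothMultivector_of_contMDiffAt fun z => ?_
    obtain ⟨C, hC, h1⟩ := hS.exists_shear z
    refine (contMDiffAt_map (ContMDiffAt.shear (contMDiffAt_neg_of hC))
      (h z.proj z (mem_trivDomain_self z.proj))).congr_of_eventuallyEq ?_
    filter_upwards [eventually_mem_trivDomain (mem_trivDomain_self (n := n) z.proj)] with w hw
    rw [readField, (h1 w hw).1, map_map]
    congr 2
    refine LinearMap.ext fun v => ?_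
    exact (shear_neg_shear (C w) (tanMap ((𝓡 (n + 1)).prod 𝓘(ℝ, G)) z w v)).symm

end IsSmoothSplitting

end Splitting

/-! ### Vertical exterior derivative relative to a splitting. -/

section SplittingForms

variable {n : ℕ} {M : Type*} [TopologicalSpace M]
  [ChartedSpace (EuclideanSpace ℝ (Fin (n + 1))) M] [IsManifold (𝓡 (n + 1)) ∞ M]
  {G : Type*} [NormedAddCommGroup G] [NormedSpace ℝ G] [FiniteDimensional ℝ G]
  {Q : M → Type*} [TopologicalSpace (TotalSpace G Q)]
  [∀ x, AddCommGroup (Q x)] [∀ x, Module ℝ (Q x)] [∀ x, TopologicalSpace (Q x)]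
  [FiberBundle G Q] [VectorBundle ℝ G Q]

variable (S : (z : TotalSpace G Q) → TangentSpace ((𝓡 (n + 1)).prod 𝓘(ℝ, G)) z →ₗ[ℝ]
    TangentSpace (𝓡 (n + 1)) z.proj × Q z.proj)

/-- A form at the point `q` of the fibre over `x`, expressed in the splitting. -/
def splittingForm (α : FormOn ((𝓡 (n + 1)).prod 𝓘(ℝ, G)) (TotalSpace G Q)) (x : M) (q : Q x) :
    ExtForm (TangentSpace (𝓡 (n + 1)) x × Q x) :=
  formPullback (S ⟨x, q⟩).leftInverse (α ⟨x, q⟩)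

variable {J : Type*} [Fintype J]

/-- The derivative of a form, expressed in the splitting, along the vertical vector `w`. -/
def splittingFibreDeriv (α : FormOn ((𝓡 (n + 1)).prod 𝓘(ℝ, G)) (TotalSpace G Q)) (x : M)
    (q w : Q x) : ExtForm (TangentSpace (𝓡 (n + 1)) x × Q x) :=
  curveDeriv fun t : ℝ => splittingForm S α x (q + t • w)

/-- The vertical exterior derivative in the directions `w`, with dual covectors `ν`. -/
def splittingVertD (ν : (x : M) → J → Module.Dual ℝ (Q x)) (w : (x : M) → J → Q x)
    (α : FormOn ((𝓡 (n + 1)).prod 𝓘(ℝ, G)) (TotalSpace G Q)) :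
    FormOn ((𝓡 (n + 1)).prod 𝓘(ℝ, G)) (TotalSpace G Q) := fun z =>
  formPullback (S z) (∑ N, ExteriorAlgebra.ι ℝ (ν z.proj N ∘ₗ LinearMap.snd ℝ _ _) *
    splittingFibreDeriv S α z.proj z.2 (w z.proj N))

variable (n G Q) in
/-- The endomorphism `∑ ν_N ⊗ w_N` is constant in the preferred trivializations. -/
def IsVerticalFrame (ν : (x : M) → J → Module.Dual ℝ (Q x)) (w : (x : M) → J → Q x)
    (ν₀ : J → Module.Dual ℝ G) (w₀ : J → G) : Prop :=
  ∀ ⦃x₀ x : M⦄, x ∈ trivDomain n G Q x₀ → ∀ g : G,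
    ∑ N, ν x N (fibInv G x₀ x g) • fibMap G x₀ x (w x N) = ∑ N, ν₀ N g • w₀ N

variable {S}

theorem readForm_mk (x₀ : M) (α : FormOn ((𝓡 (n + 1)).prod 𝓘(ℝ, G)) (TotalSpace G Q))
    (x : M) (q : Q x) :
    readForm S x₀ α ⟨x, q⟩ = formPullback (pairInv n G Q x₀ x) (splittingForm S α x q) := by
  rw [splittingForm, ← formPullback_comp]
  rfl

theorem splittingForm_eq {x₀ x : M} (hx : x ∈ trivDomain n G Q x₀)
    (α : FormOn ((𝓡 (n + 1)).prod 𝓘(ℝ, G)) (TotalSpace G Q)) (q : Q x) :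
    splittingForm S α x q = formPullback (pairMap n G Q x₀ x) (readForm S x₀ α ⟨x, q⟩) := by
  rw [readForm_mk, ← formPullback_comp]
  conv_lhs => rw [← formPullback_id (splittingForm S α x q)]
  congr 2
  exact LinearMap.ext fun v => (pairInv_pairMap hx v).symm

end SplittingForms

/-! ### Uniqueness of `curveDeriv` and change of frames in contracted sums. -/

section Algebra

/-- Linear functionals separate the points of a real vector space, so the vector chosen in
`curveDeriv` can only be `D`. -/
theorem curveDeriv_eq {W : Type*} [AddCommGroup W] [Module ℝ W] {c : ℝ → W} {D : W}
    (h : ∀ f : Module.Dual ℝ W, HasDerivAt (fun t => f (c t)) (f D) 0) : curveDeriv c = D := by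
  have h0 : ∃ D : W, ∀ f : Module.Dual ℝ W, HasDerivAt (fun t => f (c t)) (f D) 0 := ⟨D, h⟩
  rw [curveDeriv, dif_pos h0]
  rw [← sub_eq_zero, ← Module.forall_dual_apply_eq_zero_iff ℝ]
  intro f
  rw [map_sub, sub_eq_zero]
  exact (h0.choose_spec f).unique (h f)

/-- The sum depends on the frame and coframe only through the tensor `∑ ν_N ⊗ w_N`, that is, through
the endomorphism it defines. -/
theorem sum_mul_eq_of_sum_smul_eq {J R W : Type*} [Fintype J] [Ring R] [Algebra ℝ R] [AddCommGroup W] [Module ℝ W]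
    [FiniteDimensional ℝ W] {J' : Type*} [Fintype J']
    (L : Module.Dual ℝ W →ₗ[ℝ] R) (D : W →ₗ[ℝ] R) {ν : J → Module.Dual ℝ W} {w : J → W}
    {ν' : J' → Module.Dual ℝ W} {w' : J' → W}
    (h : ∀ g, ∑ N, ν N g • w N = ∑ N, ν' N g • w' N) :
    ∑ N, L (ν N) * D (w N) = ∑ N, L (ν' N) * D (w' N) := by
  let b := Module.finBasis ℝ W
  have key : ∀ {J : Type _} [Fintype J] (ν : J → Module.Dual ℝ W) (w : J → W),
      ∑ N, L (ν N) * D (w N) = ∑ i, L (∑ N, b.coord i (w N) • ν N) * D (b i) := by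
    intro J _ ν w
    simp only [map_sum, map_smul, Finset.sum_mul]
    rw [Finset.sum_comm]
    refine Finset.sum_congr rfl fun N _ => ?_
    conv_lhs => rw [← b.sum_repr (w N), map_sum, Finset.mul_sum]
    refine Finset.sum_congr rfl fun i _ => ?_
    rw [map_smul, mul_smul_comm, smul_mul_assoc]
    rfl
  rw [key ν w]
  have key' : ∑ N, L (ν' N) * D (w' N) = ∑ i, L (∑ N, b.coord i (w' N) • ν' N) * D (b i) := by
    simp only [map_sum, map_smul, Finset.sum_mul]
    rw [Finset.sum_comm]
    refine Finset.sum_congr rfl fun N _ => ?_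
    conv_lhs => rw [← b.sum_repr (w' N), map_sum, Finset.mul_sum]
    refine Finset.sum_congr rfl fun i _ => ?_
    rw [map_smul, mul_smul_comm, smul_mul_assoc]
    rfl
  rw [key']
  refine Finset.sum_congr rfl fun i _ => ?_
  congr 2
  refine LinearMap.ext fun g => ?_
  have h1 := congrArg (b.coord i) (h g)
  simp only [map_sum, map_smul, smul_eq_mul] at h1
  simpa [LinearMap.sum_apply, mul_comm] using h1

end Algebra

/-! ### Derivatives along the fibres in a trivialization. -/

section VerticalDerivative

attribute [local instance] extNormedAddCommGroup extNormedSpace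

variable {n : ℕ} {M : Type*} [TopologicalSpace M]
  [ChartedSpace (EuclideanSpace ℝ (Fin (n + 1))) M] [IsManifold (𝓡 (n + 1)) ∞ M]
  {G : Type*} [NormedAddCommGroup G] [NormedSpace ℝ G] [FiniteDimensional ℝ G]
  {Q : M → Type*} [TopologicalSpace (TotalSpace G Q)]
  [∀ x, AddCommGroup (Q x)] [∀ x, Module ℝ (Q x)] [∀ x, TopologicalSpace (Q x)]
  [FiberBundle G Q] [VectorBundle ℝ G Q]
  {A : Type*} [NormedAddCommGroup A] [NormedSpace ℝ A]

variable (Q) in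
/-- The parametrization of the fibre over `x` by the trivialization around `x₀`. -/
def fibrePoint (x₀ x : M) (g : G) : TotalSpace G Q := ⟨x, fibInv G x₀ x g⟩

theorem fibrePoint_fibMap {x₀ : M} {z : TotalSpace G Q}
    (hz : z.proj ∈ (trivializationAt G Q x₀).baseSet) :
    fibrePoint Q x₀ z.proj (fibMap G x₀ z.proj z.2) = z := by
  rw [fibrePoint, fibInv_fibMap hz]

/-- The derivative of a function on `Q` along the fibres, in the trivialization around `x₀`. -/
def vertDeriv (x₀ : M) (φ : TotalSpace G Q → A) (w : G) (z : TotalSpace G Q) : A :=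
  fderiv ℝ (fun g => φ (fibrePoint Q x₀ z.proj g)) (fibMap G x₀ z.proj z.2) w

variable [ContMDiffVectorBundle ∞ G Q (𝓡 (n + 1))]

theorem contMDiff_fibrePoint {x₀ x : M} (hx : x ∈ (trivializationAt G Q x₀).baseSet) :
    ContMDiff 𝓘(ℝ, G) ((𝓡 (n + 1)).prod 𝓘(ℝ, G)) ∞
      (fibrePoint Q x₀ x : G → TotalSpace G Q) := by
  intro g
  rw [(trivializationAt G Q x₀).contMDiffAt_iff ((Trivialization.mem_source _).2 hx)]
  refine ⟨contMDiffAt_const, ?_⟩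
  have h : (fun g : G => (trivializationAt G Q x₀ (fibrePoint Q x₀ x g)).2) = fun g => g := by
    funext g
    exact (fibMap_apply hx _).symm.trans (fibMap_fibInv hx g)
  rw [h]
  exact contMDiffAt_id

theorem tanMap_mfderiv_fibrePoint {z₀ : TotalSpace G Q} {x : M}
    (hx : x ∈ trivDomain n G Q z₀.proj) (g w : G) :
    tanMap ((𝓡 (n + 1)).prod 𝓘(ℝ, G)) z₀ (fibrePoint Q z₀.proj x g)
      (mfderiv 𝓘(ℝ, G) ((𝓡 (n + 1)).prod 𝓘(ℝ, G)) (fibrePoint Q z₀.proj x) g w) =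
      ((0, w) : BaseModel n × G) := by
  have hp : MDifferentiableAt 𝓘(ℝ, G) ((𝓡 (n + 1)).prod 𝓘(ℝ, G)) (fibrePoint Q z₀.proj x) g :=
    (contMDiff_fibrePoint (n := n) hx.1).contMDiffAt.mdifferentiableAt (by simp)
  rw [tanMap_total (z := fibrePoint Q z₀.proj x g) hx.1 hx.2]
  refine Prod.ext ?_ ?_
  · have h1 : mfderiv ((𝓡 (n + 1)).prod 𝓘(ℝ, G)) (𝓡 (n + 1))
        (TotalSpace.proj : TotalSpace G Q → M) (fibrePoint Q z₀.proj x g)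
        (mfderiv 𝓘(ℝ, G) ((𝓡 (n + 1)).prod 𝓘(ℝ, G)) (fibrePoint Q z₀.proj x) g w) = 0 := by
      have h2 : mfderiv 𝓘(ℝ, G) (𝓡 (n + 1)) ((TotalSpace.proj : TotalSpace G Q → M) ∘
          fibrePoint Q z₀.proj x) g = 0 := mfderiv_const
      rw [mfderiv_comp g (mdifferentiableAt_proj Q) hp] at h2
      exact congrArg (fun D => D w) h2
    simp only [h1, map_zero]
  · have h1 := congrArg (fun D => D w) (mvfderiv_comp_map (mdifferentiableAt_snd_trivialization
      (x₀ := z₀.proj) (z := fibrePoint Q z₀.proj x g) hx.1) hp)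
    refine h1.symm.trans ?_
    have h : (fun g : G => (trivializationAt G Q z₀.proj (fibrePoint Q z₀.proj x g)).2) =
        fun g => g := by
      funext g
      exact (fibMap_apply hx.1 _).symm.trans (fibMap_fibInv hx.1 g)
    rw [h]
    exact congrArg (fun D : G →L[ℝ] G => D w) mfderiv_id

theorem fderiv_fibrePoint {z₀ : TotalSpace G Q} {x : M} (hx : x ∈ trivDomain n G Q z₀.proj)
    {φ : TotalSpace G Q → A} {g : G}
    (hφ : MDifferentiableAt ((𝓡 (n + 1)).prod 𝓘(ℝ, G)) 𝓘(ℝ, A) φ (fibrePoint Q z₀.proj x g))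
    (w : G) : fderiv ℝ (fun g => φ (fibrePoint Q z₀.proj x g)) g w =
      mvfderiv ((𝓡 (n + 1)).prod 𝓘(ℝ, G)) φ (fibrePoint Q z₀.proj x g)
        (tanInv ((𝓡 (n + 1)).prod 𝓘(ℝ, G)) z₀ (fibrePoint Q z₀.proj x g) (0, w)) := by
  have hp : MDifferentiableAt 𝓘(ℝ, G) ((𝓡 (n + 1)).prod 𝓘(ℝ, G)) (fibrePoint Q z₀.proj x) g :=
    (contMDiff_fibrePoint (n := n) hx.1).contMDiffAt.mdifferentiableAt (by simp)
  have h1 := congrArg (fun D => D w) (mvfderiv_comp_map hφ hp)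
  have h2 : mvfderiv 𝓘(ℝ, G) (fun g => φ (fibrePoint Q z₀.proj x g)) g =
    fderiv ℝ (fun g => φ (fibrePoint Q z₀.proj x g)) g := mfderiv_eq_fderiv
  rw [h2] at h1
  refine h1.trans ?_
  rw [← tanMap_mfderiv_fibrePoint hx g w, tanInv_tanMap (mem_chartSource_total hx.1 hx.2)]
  rfl

/-- The derivative along the fibre is the full differential applied to a coordinate vector field of
the chart, hence smooth in base and fibre variables jointly. -/
theorem contMDiffAt_vertDeriv {z₀ : TotalSpace G Q} {φ : TotalSpace G Q → A}
    (hφ : ContMDiffAt ((𝓡 (n + 1)).prod 𝓘(ℝ, G)) 𝓘(ℝ, A) ∞ φ z₀) (w : G) :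
    ContMDiffAt ((𝓡 (n + 1)).prod 𝓘(ℝ, G)) 𝓘(ℝ, A) ∞ (vertDeriv z₀.proj φ w) z₀ := by
  have h1 : ContMDiffAt ((𝓡 (n + 1)).prod 𝓘(ℝ, G)) 𝓘(ℝ, A) ∞
      (fun z => (mvfderiv ((𝓡 (n + 1)).prod 𝓘(ℝ, G)) φ z).comp
        (tanInv ((𝓡 (n + 1)).prod 𝓘(ℝ, G)) z₀ z) ((0, w) : BaseModel n × G)) z₀ :=
    (contMDiffAt_mvfderiv_comp_tanInv hφ).clm_apply contMDiffAt_const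
  refine h1.congr_of_eventuallyEq ?_
  have h2 : ∀ᶠ z in nhds z₀, ContMDiffAt ((𝓡 (n + 1)).prod 𝓘(ℝ, G)) 𝓘(ℝ, A) 1 φ z :=
    by
    have h3 : ContMDiffAt ((𝓡 (n + 1)).prod 𝓘(ℝ, G)) 𝓘(ℝ, A) 1 φ z₀ :=
      hφ.of_le (by norm_cast)
    exact (contMDiffAt_iff_contMDiffAt_nhds (by simp)).1 h3
  filter_upwards [h2, eventually_mem_trivDomain (mem_trivDomain_self (n := n) z₀.proj)] with z hz hz'
  have h3 := fibrePoint_fibMap (Q := Q) (z := z) hz'.1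
  have h4 := fderiv_fibrePoint (z₀ := z₀) hz' (φ := φ) (g := fibMap G z₀.proj z.proj z.2)
    (by rw [h3]; exact hz.mdifferentiableAt (by simp)) w
  rw [vertDeriv, h4]
  exact congrArg (fun z' => mvfderiv ((𝓡 (n + 1)).prod 𝓘(ℝ, G)) φ z'
    (tanInv ((𝓡 (n + 1)).prod 𝓘(ℝ, G)) z₀ z' (0, w))) h3

theorem contDiff_comp_fibrePoint {x₀ x : M} (hx : x ∈ (trivializationAt G Q x₀).baseSet)
    {φ : TotalSpace G Q → A}
    (hφ : ∀ q, ContMDiffAt ((𝓡 (n + 1)).prod 𝓘(ℝ, G)) 𝓘(ℝ, A) ∞ φ ⟨x, q⟩) :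
    ContDiff ℝ ∞ fun g => φ (fibrePoint Q x₀ x g) := by
  rw [← contMDiff_iff_contDiff]
  exact fun g => (hφ _).comp g (contMDiff_fibrePoint (n := n) hx).contMDiffAt

variable {S : (z : TotalSpace G Q) → TangentSpace ((𝓡 (n + 1)).prod 𝓘(ℝ, G)) z →ₗ[ℝ]
    TangentSpace (𝓡 (n + 1)) z.proj × Q z.proj} {J : Type*} [Fintype J]

/-- Along one fibre the components lie in a fixed vector space and the trivialization is linear. The
straight line `q + t w` therefore becomes a straight line in `G`, and its componentwise derivative
is an ordinary directional derivative. -/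
theorem formPullback_splittingFibreDeriv {x₀ x : M} (hx : x ∈ trivDomain n G Q x₀)
    {α : FormOn ((𝓡 (n + 1)).prod 𝓘(ℝ, G)) (TotalSpace G Q)} {q : Q x}
    (hα : MDifferentiableAt ((𝓡 (n + 1)).prod 𝓘(ℝ, G)) 𝓘(ℝ, ExtForm (BaseModel n × G))
      (readForm S x₀ α) ⟨x, q⟩) (w : Q x) :
    formPullback (pairInv n G Q x₀ x) (splittingFibreDeriv S α x q w) =
      vertDeriv x₀ (readForm S x₀ α) (fibMap G x₀ x w) ⟨x, q⟩ := by
  have h0 : fibrePoint Q x₀ x (fibMap G x₀ x q) = ⟨x, q⟩ :=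
    fibrePoint_fibMap (z := (⟨x, q⟩ : TotalSpace G Q)) hx.1
  have hd : DifferentiableAt ℝ (fun g => readForm S x₀ α (fibrePoint Q x₀ x g))
      (fibMap G x₀ x q) := by
    rw [← mdifferentiableAt_iff_differentiableAt]
    refine MDifferentiableAt.comp (fibMap G x₀ x q) (I' := (𝓡 (n + 1)).prod 𝓘(ℝ, G))
      (by rw [h0]; exact hα)
      ((contMDiff_fibrePoint (n := n) hx.1).contMDiffAt.mdifferentiableAt (by simp))
  have hline : HasDerivAt (fun t : ℝ => fibMap G x₀ x q + t • fibMap G x₀ x w)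
      (fibMap G x₀ x w) 0 := by
    simpa using ((hasDerivAt_id (0 : ℝ)).smul_const (fibMap G x₀ x w)).const_add (fibMap G x₀ x q)
  have hc : HasDerivAt (fun t : ℝ => readForm S x₀ α
      (fibrePoint Q x₀ x (fibMap G x₀ x q + t • fibMap G x₀ x w)))
      (vertDeriv x₀ (readForm S x₀ α) (fibMap G x₀ x w) ⟨x, q⟩) 0 := by
    refine HasFDerivAt.comp_hasDerivAt (f := fun t : ℝ => fibMap G x₀ x q + t • fibMap G x₀ x w)
      (0 : ℝ) (l := fun g => readForm S x₀ α (fibrePoint Q x₀ x g)) ?_ hline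
    simpa using hd.hasFDerivAt
  have h1 : splittingFibreDeriv S α x q w =
      formPullback (pairMap n G Q x₀ x)
        (vertDeriv x₀ (readForm S x₀ α) (fibMap G x₀ x w) ⟨x, q⟩) := by
    refine curveDeriv_eq fun f => ?_
    have h2 := (LinearMap.toContinuousLinearMap (f ∘ₗ
      (formPullback (pairMap n G Q x₀ x)).toLinearMap)).hasFDerivAt.comp_hasDerivAt (0 : ℝ) hc
    refine h2.congr_of_eventuallyEq (Filter.Eventually.of_forall fun t => ?_)
    show f _ = f _
    congr 1
    rw [splittingForm_eq hx]
    refine congrArg (formPullback (pairMap n G Q x₀ x)) (congrArg (readForm S x₀ α) ?_)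
    have h3 := fibrePoint_fibMap (z := (⟨x, q + t • w⟩ : TotalSpace G Q)) (x₀ := x₀) hx.1
    rw [← h3]
    simp only [map_add, map_smul]
  rw [h1, ← formPullback_comp]
  conv_rhs => rw [← formPullback_id (vertDeriv x₀ (readForm S x₀ α) (fibMap G x₀ x w) ⟨x, q⟩)]
  congr 2
  exact LinearMap.ext (pairMap_pairInv hx)

/-- The frame at the base point is replaced by the constant frame `ν₀`, `w₀`; only the endomorphism
they define matters, by `sum_mul_eq_of_sum_smul_eq`. -/
theorem IsSmoothSplitting.readForm_splittingVertD (hS : IsSmoothSplitting S)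
    {ν : (x : M) → J → Module.Dual ℝ (Q x)} {w : (x : M) → J → Q x}
    {ν₀ : J → Module.Dual ℝ G} {w₀ : J → G} (hν : IsVerticalFrame n G Q ν w ν₀ w₀)
    {x₀ : M} {z : TotalSpace G Q} (hz : z.proj ∈ trivDomain n G Q x₀)
    {α : FormOn ((𝓡 (n + 1)).prod 𝓘(ℝ, G)) (TotalSpace G Q)}
    (hα : MDifferentiableAt ((𝓡 (n + 1)).prod 𝓘(ℝ, G)) 𝓘(ℝ, ExtForm (BaseModel n × G))
      (readForm S x₀ α) z) :
    readForm S x₀ (splittingVertD S ν w α) z =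
      ∑ N, ExteriorAlgebra.ι ℝ (vertCo (BaseModel n) (ν₀ N)) *
        vertDeriv x₀ (readForm S x₀ α) (w₀ N) z := by
  have h1 : readForm S x₀ (splittingVertD S ν w α) z = formPullback (pairInv n G Q x₀ z.proj)
      (∑ N, ExteriorAlgebra.ι ℝ (ν z.proj N ∘ₗ LinearMap.snd ℝ _ _) *
        splittingFibreDeriv S α z.proj z.2 (w z.proj N)) := by
    rw [readForm, splittingVertD, ← formPullback_comp]
    congr 2
    exact LinearMap.ext fun v => hS.apply_leftInverse z (pairInv n G Q x₀ z.proj v)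
  rw [h1, formPullback_sum]
  simp only [formPullback_mul, formPullback_ι, formPullback_splittingFibreDeriv hz hα]
  have h2 := sum_mul_eq_of_sum_smul_eq
    (ExteriorAlgebra.ι ℝ ∘ₗ LinearMap.lcomp ℝ ℝ (LinearMap.snd ℝ (BaseModel n) G))
    (fderiv ℝ (fun g => readForm S x₀ α (fibrePoint Q x₀ z.proj g))
      (fibMap G x₀ z.proj z.2)).toLinearMap
    (ν := fun N => ν z.proj N ∘ₗ (fibInv G x₀ z.proj : G →L[ℝ] Q z.proj).toLinearMap)
    (w := fun N => fibMap G x₀ z.proj (w z.proj N)) (ν' := ν₀) (w' := w₀) (hν hz)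
  exact h2

end VerticalDerivative

/-! ### Horizontal forms come from the base; top degree forms; generalized inverses. -/

section HorizontalAlgebra

variable {W : Type*} [AddCommGroup W] [Module ℝ W]

/-- The map differs from the identity by rank one, and `ν ∧ ν = 0` leaves no terms beyond the first
order. -/
theorem formPullback_id_sub (ν : Module.Dual ℝ W) (u : W) (α : ExtForm W) :
    formPullback (LinearMap.id - ν.smulRight u) α =
      α - ExteriorAlgebra.ι ℝ ν * vectorHook u α := by
  induction α using extInduction_left with
  | algebraMap r => simp only [AlgHom.commutes, vectorHook_algebraMap, mul_zero, sub_zero]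
  | add x y hx hy => simp only [hx, hy, map_add, mul_add]; abel
  | ι_mul x a hx =>
    have h1 : a ∘ₗ (LinearMap.id - ν.smulRight u) = a - a u • ν := by
      ext v
      simp [mul_comm]
    have h2 : ExteriorAlgebra.ι ℝ ν * (ExteriorAlgebra.ι ℝ ν * vectorHook u x) = 0 := by
      rw [← mul_assoc, ExteriorAlgebra.ι_sq_zero, zero_mul]
    have h3 : ExteriorAlgebra.ι ℝ a * (ExteriorAlgebra.ι ℝ ν * vectorHook u x) =
        -(ExteriorAlgebra.ι ℝ ν * (ExteriorAlgebra.ι ℝ a * vectorHook u x)) := by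
      rw [← mul_assoc, ← mul_assoc, ← neg_mul]
      congr 1
      exact eq_neg_of_add_eq_zero_left (ExteriorAlgebra.ι_add_mul_swap a ν)
    rw [formPullback_mul, hx, formPullback_ι, h1, vectorHook_ι_mul, map_sub, map_smul]
    simp only [sub_mul, mul_sub, smul_mul_assoc, mul_smul_comm, h2, h3, smul_zero]
    abel

variable {E G : Type*} [AddCommGroup E] [Module ℝ E] [AddCommGroup G] [Module ℝ G]
  [FiniteDimensional ℝ G]

/-- The projection onto `E` is obtained from the identity by removing the basis directions of `G`
one at a time. Each removal leaves `α` unchanged by `formPullback_id_sub`, as `α` is killed by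
vertical vectors. -/
theorem horForm_of_vectorHook_eq_zero {α : ExtForm (E × G)}
    (h : ∀ u : G, vectorHook ((0, u) : E × G) α = 0) :
    horForm G (formPullback (LinearMap.inl ℝ E G) α) = α := by
  classical
  let b := Module.finBasis ℝ G
  let T : Finset (Fin (Module.finrank ℝ G)) → (E × G →ₗ[ℝ] E × G) := fun s =>
    LinearMap.id - ∑ i ∈ s, (vertCo E (b.coord i)).smulRight ((0, b i) : E × G)
  have key : ∀ s, formPullback (T s) α = α := by
    intro s
    induction s using Finset.induction_on with
    | empty => simp only [T, Finset.sum_empty, sub_zero, formPullback_id]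
    | insert i s hi ih =>
      have h1 : T (insert i s) = T s ∘ₗ
          (LinearMap.id - (vertCo E (b.coord i)).smulRight ((0, b i) : E × G)) := by
        refine LinearMap.ext fun v => ?_
        have h2 : T s ((0, b i) : E × G) = (0, b i) := by
          have h3 : ∀ j ∈ s, (vertCo E (b.coord j)).smulRight ((0, b j) : E × G) (0, b i) = 0 := by
            intro j hj
            have h4 : i ≠ j := fun h => hi (by rwa [h])
            simp [h4]
          rw [LinearMap.sub_apply, LinearMap.sum_apply, Finset.sum_eq_zero h3]
          simp
        have h5 : (LinearMap.id - (vertCo E (b.coord i)).smulRight ((0, b i) : E × G) :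
          E × G →ₗ[ℝ] E × G) v = v - b.coord i v.2 • ((0, b i) : E × G) := rfl
        rw [LinearMap.comp_apply, h5, map_sub, map_smul, h2]
        simp only [T, Finset.sum_insert hi, LinearMap.sub_apply, LinearMap.id_apply,
          LinearMap.add_apply, LinearMap.smulRight_apply, LinearMap.comp_apply, LinearMap.snd_apply]
        abel
      rw [h1, formPullback_comp, ih, formPullback_id_sub, h, mul_zero, sub_zero]
  have h1 : T Finset.univ = LinearMap.inl ℝ E G ∘ₗ LinearMap.fst ℝ E G := by
    refine LinearMap.ext fun v => ?_
    have h2 : ∑ i, b.coord i v.2 • ((0, b i) : E × G) = (0, v.2) := by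
      have h3 : ∀ i, b.coord i v.2 • ((0, b i) : E × G) =
          LinearMap.inr ℝ E G (b.coord i v.2 • b i) := fun i => by simp
      rw [Finset.sum_congr rfl fun i _ => h3 i, ← map_sum]
      exact congrArg (LinearMap.inr ℝ E G) (b.sum_repr v.2)
    simp only [T, LinearMap.sub_apply, LinearMap.id_apply, LinearMap.sum_apply,
      LinearMap.smulRight_apply, LinearMap.comp_apply, LinearMap.snd_apply, h2]
    simp [Prod.ext_iff]
  rw [horForm, ← formPullback_comp, ← h1, key]

theorem exists_algebraMap_of_mem_extDegree_zero {x : ExteriorAlgebra ℝ W}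
    (hx : x ∈ extDegree W 0) : ∃ c : ℝ, x = algebraMap ℝ _ c := by
  rw [← Nat.cast_zero, extDegree_natCast, ExteriorAlgebra.exteriorPower, pow_zero,
    Submodule.mem_one] at hx
  obtain ⟨c, hc⟩ := hx
  exact ⟨c, hc.symm⟩

theorem exists_eq_smul_of_top_degree [FiniteDimensional ℝ W] {μ β : ExtForm W}
    (hμ : μ ∈ extDegree (Module.Dual ℝ W) (Module.finrank ℝ W))
    {K : ExteriorAlgebra ℝ W} (hK : K ∈ extDegree W (Module.finrank ℝ W)) (h1 : hook K μ = 1)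
    (hβ : β ∈ extDegree (Module.Dual ℝ W) (Module.finrank ℝ W)) :
    β = ExteriorAlgebra.algebraMapInv (hook K β) • μ := by
  obtain ⟨Y, hY, rfl⟩ := hook_top_exists hμ hK h1 hβ
  rw [sub_self] at hY
  obtain ⟨c, rfl⟩ := exists_algebraMap_of_mem_extDegree_zero hY
  simp only [AlgHom.commutes, Module.algebraMap_end_apply, map_smul, h1, map_one, smul_eq_mul,
    mul_one]

/-- A right inverse on its range of a linear map restricted to a subspace. -/
theorem exists_generalized_inverse {A C : Type*} [AddCommGroup A] [Module ℝ A] [AddCommGroup C]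
    [Module ℝ C] (T : A →ₗ[ℝ] C) (U : Submodule ℝ A) :
    ∃ R : C →ₗ[ℝ] A, (∀ y, R y ∈ U) ∧ ∀ x ∈ U, T (R (T x)) = T x := by
  let T' := T ∘ₗ U.subtype
  obtain ⟨R', hR'⟩ := T'.rangeRestrict.exists_rightInverse_of_surjective
    (LinearMap.range_eq_top.2 T'.surjective_rangeRestrict)
  obtain ⟨R, hR⟩ := LinearMap.exists_extend R'
  refine ⟨U.subtype ∘ₗ R, fun y => (R y).2, fun x hx => ?_⟩
  have h1 : R (T' ⟨x, hx⟩) = R' (T'.rangeRestrict ⟨x, hx⟩) := by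
    rw [← hR]; rfl
  have h2 := congrArg (fun f => (f (T'.rangeRestrict ⟨x, hx⟩) : C)) hR'
  show T' (R (T' ⟨x, hx⟩)) = T' ⟨x, hx⟩
  rw [h1]
  exact h2

end HorizontalAlgebra

/-! ### The volume form and the Hodge operator of the base, pointwise and in charts. -/

section BaseVolume

variable {n : ℕ} {M : Type*} [TopologicalSpace M]
  [ChartedSpace (EuclideanSpace ℝ (Fin (n + 1))) M] [IsManifold (𝓡 (n + 1)) ∞ M]
  (B : OrientedMetric n M)

instance finiteDimensional_tangentSpace (x : M) :
    FiniteDimensional ℝ (TangentSpace (𝓡 (n + 1)) x) :=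
  inferInstanceAs (FiniteDimensional ℝ (EuclideanSpace ℝ (Fin (n + 1))))

theorem finrank_tangentSpace (x : M) : Module.finrank ℝ (TangentSpace (𝓡 (n + 1)) x) = n + 1 :=
  finrank_euclideanSpace_fin (𝕜 := ℝ) (n := n + 1)

namespace OrientedMetric

theorem flat_injective (x : M) : Function.Injective (B.flat x) := by
  refine ExteriorAlgebra.map_injective_field ?_
  rw [LinearMap.ker_eq_bot']
  intro u hu
  exact B.g_nondegenerate x u fun w => congrArg (fun f : Module.Dual ℝ (TangentSpace (𝓡 (n + 1)) x)
    => f w) hu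

/-- The volume form is nonzero on a basis because its square is the Gram determinant of a
nondegenerate metric, up to sign; rescale the multivector of the basis. -/
theorem exists_hook_vol_eq_one (x : M) : ∃ K ∈ extDegree (TangentSpace (𝓡 (n + 1)) x) (n + 1),
    hook K (B.vol x) = 1 := by
  let b : Module.Basis (Fin (n + 1)) ℝ (TangentSpace (𝓡 (n + 1)) x) :=
    Module.finBasisOfFinrankEq ℝ _ (finrank_tangentSpace x)
  have hb : ExteriorAlgebra.ιMulti ℝ (n + 1) b ∈ extDegree (TangentSpace (𝓡 (n + 1)) x) (n + 1) := by
    have h := extDegree_natCast (W := TangentSpace (𝓡 (n + 1)) x) (n + 1)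
    push_cast at h
    rw [h]
    exact ExteriorAlgebra.ιMulti_range ℝ (n + 1) ⟨_, rfl⟩
  have hv : B.vol x ∈ extDegree (Module.Dual ℝ (TangentSpace (𝓡 (n + 1)) x)) (n + 1) := by
    have h := extDegree_natCast (W := Module.Dual ℝ (TangentSpace (𝓡 (n + 1)) x)) (n + 1)
    push_cast at h
    rw [h]
    exact B.vol_degree x
  have h1 := hook_mem_extDegree hb hv
  rw [sub_self] at h1
  obtain ⟨c, hc⟩ := exists_algebraMap_of_mem_extDegree_zero h1
  have h2 := B.vol_sq x b
  have hc0 : c ≠ 0 := by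
    rintro rfl
    rw [hc, map_zero, map_zero, zero_pow two_ne_zero, eq_comm, abs_eq_zero] at h2
    -- A kernel vector of the Gram matrix gives a combination of the basis that is orthogonal to
    -- everything.
    obtain ⟨v, hv0, hv⟩ := Matrix.exists_mulVec_eq_zero_iff.2 h2
    refine hv0 ?_
    have h3 : ∑ j, v j • b j = 0 := by
      refine B.g_nondegenerate x _ fun w => ?_
      have h4 : (B.g x (∑ j, v j • b j)).toLinearMap = 0 := by
        refine b.ext fun i => ?_
        have h5 := congrFun hv i
        simp only [Matrix.mulVec, dotProduct, Matrix.of_apply, Pi.zero_apply] at h5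
        show B.g x (∑ j, v j • b j) (b i) = 0
        rw [B.g_symm, map_sum, ← h5]
        exact Finset.sum_congr rfl fun j _ => by rw [map_smul, smul_eq_mul, mul_comm]
      exact congrArg (fun f : Module.Dual ℝ (TangentSpace (𝓡 (n + 1)) x) => f w) h4
    funext j
    exact Fintype.linearIndependent_iff.1 b.linearIndependent v h3 j
  refine ⟨c⁻¹ • _, Submodule.smul_mem _ _ hb, ?_⟩
  rw [map_smul, LinearMap.smul_apply, hc, Algebra.algebraMap_eq_smul_one, smul_smul,
    inv_mul_cancel₀ hc0, one_smul]

theorem vol_mem_extDegree (x : M) :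
    B.vol x ∈ extDegree (Module.Dual ℝ (TangentSpace (𝓡 (n + 1)) x)) (n + 1) := by
  have h := extDegree_natCast (W := Module.Dual ℝ (TangentSpace (𝓡 (n + 1)) x)) (n + 1)
  push_cast at h
  rw [h]
  exact B.vol_degree x

theorem hookVol_bijective (x : M) : Function.Bijective (B.hookVol x) := by
  obtain ⟨K, hK, h1⟩ := B.exists_hook_vol_eq_one x
  have h : ((Module.finrank ℝ (TangentSpace (𝓡 (n + 1)) x) : ℕ) : ℤ) = n + 1 := by
    rw [finrank_tangentSpace]; push_cast; rfl
  exact hook_top_bijective (by rw [h]; exact B.vol_mem_extDegree x) (by rw [h]; exact hK) h1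

theorem hodge_hook (x : M) (Y : ExteriorAlgebra ℝ (TangentSpace (𝓡 (n + 1)) x)) :
    B.hodge x (hook Y (B.vol x)) = B.flat x Y :=
  congrArg (B.flat x) (LinearMap.leftInverse_apply_of_inj
    (LinearMap.ker_eq_bot.2 (B.hookVol_bijective x).1) Y)

theorem hodge_injective (x : M) : Function.Injective (B.hodge x) := by
  intro α β h
  obtain ⟨Y, rfl⟩ := (B.hookVol_bijective x).2 α
  obtain ⟨Z, rfl⟩ := (B.hookVol_bijective x).2 β
  have h1 := (B.hodge_hook x Y).symm.trans (h.trans (B.hodge_hook x Z))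
  rw [B.flat_injective x h1]

/-- Lowering indices is an algebra morphism, so the metric drops out: through `Y ↦ Y ⌟ vol` the
product of forms is the wedge product of multivectors. -/
theorem hodgeInv_hodge_mul (x : M) (Y Z : ExteriorAlgebra ℝ (TangentSpace (𝓡 (n + 1)) x)) :
    B.hodgeInv x (B.hodge x (hook Y (B.vol x)) * B.hodge x (hook Z (B.vol x))) =
      hook (Y * Z) (B.vol x) := by
  rw [hodge_hook, hodge_hook, ← map_mul, ← hodge_hook]
  exact LinearMap.leftInverse_apply_of_inj (LinearMap.ker_eq_bot.2 (B.hodge_injective x)) _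

/-- The volume form at `x` in the chart around `x₀`. -/
def volAt (x₀ x : M) : ExtForm (BaseModel n) :=
  formPullback (tanInv (𝓡 (n + 1)) x₀ x).toLinearMap (B.vol x)

theorem volAt_mem_extDegree (x₀ x : M) :
    B.volAt x₀ x ∈ extDegree (Module.Dual ℝ (BaseModel n)) (Module.finrank ℝ (BaseModel n)) := by
  rw [finrank_euclideanSpace_fin]
  push_cast
  exact formPullback_mem_extDegree _ (B.vol_mem_extDegree x)

theorem exists_hook_volAt_eq_one {x₀ x : M}
    (hx : x ∈ (chartAt (EuclideanSpace ℝ (Fin (n + 1))) x₀).source) :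
    ∃ K ∈ extDegree (BaseModel n) (Module.finrank ℝ (BaseModel n)),
      hook K (B.volAt x₀ x) = 1 := by
  obtain ⟨K, hK, h1⟩ := B.exists_hook_vol_eq_one x
  refine ⟨ExteriorAlgebra.map (tanMap (𝓡 (n + 1)) x₀ x).toLinearMap K, ?_, ?_⟩
  · rw [finrank_euclideanSpace_fin]
    push_cast
    exact map_mem_extDegree _ hK
  · have h2 : (tanInv (𝓡 (n + 1)) x₀ x).toLinearMap ∘ₗ
        (tanMap (𝓡 (n + 1)) x₀ x).toLinearMap = LinearMap.id :=
      LinearMap.ext fun v => tanInv_tanMap hx v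
    rw [volAt, hook_formPullback, map_map, h2, map_id_apply, h1, map_one]

theorem hook_volAt_injective {x₀ x : M}
    (hx : x ∈ (chartAt (EuclideanSpace ℝ (Fin (n + 1))) x₀).source) :
    Function.Injective fun Y : ExteriorAlgebra ℝ (BaseModel n) => hook Y (B.volAt x₀ x) := by
  obtain ⟨K, hK, h1⟩ := B.exists_hook_volAt_eq_one hx
  exact (hook_top_bijective (B.volAt_mem_extDegree x₀ x) hK h1).1

/-- The density of the volume form in the chart around `x₀`. -/
def volCoef (x₀ x : M) : ℝ := ExteriorAlgebra.algebraMapInv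
  (hook (B.exists_hook_volAt_eq_one (mem_chart_source _ x₀)).choose (B.volAt x₀ x))

theorem volAt_eq_smul (x₀ x : M) : B.volAt x₀ x = B.volCoef x₀ x • B.volAt x₀ x₀ :=
  have h := (B.exists_hook_volAt_eq_one (mem_chart_source _ x₀)).choose_spec
  exists_eq_smul_of_top_degree (B.volAt_mem_extDegree x₀ x₀) h.1 h.2 (B.volAt_mem_extDegree x₀ x)

theorem volCoef_ne_zero {x₀ x : M}
    (hx : x ∈ (chartAt (EuclideanSpace ℝ (Fin (n + 1))) x₀).source) : B.volCoef x₀ x ≠ 0 := by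
  intro h
  obtain ⟨K, hK, h1⟩ := B.exists_hook_volAt_eq_one hx
  rw [volAt_eq_smul, h, zero_smul, map_zero] at h1
  exact zero_ne_one h1

section Smoothness

attribute [local instance] extNormedAddCommGroup extNormedSpace

theorem contMDiffAt_volAt {x₀ x : M}
    (hx : x ∈ (chartAt (EuclideanSpace ℝ (Fin (n + 1))) x₀).source) :
    ContMDiffAt (𝓡 (n + 1)) 𝓘(ℝ, ExtForm (BaseModel n)) ∞ (B.volAt x₀) x := by
  let a : M → BaseModel n →L[ℝ] BaseModel n := fun y =>
    (trivializationAt (BaseModel n) (TangentSpace (𝓡 (n + 1)) : M → Type _) x₀).coordChangeL ℝ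
      (trivializationAt (BaseModel n) (TangentSpace (𝓡 (n + 1)) : M → Type _) x) y
  have hxx := mem_chart_source (EuclideanSpace ℝ (Fin (n + 1))) x
  have ha : ContMDiffAt (𝓡 (n + 1)) 𝓘(ℝ, BaseModel n →L[ℝ] BaseModel n) ∞ a x :=
    contMDiffAt_coordChangeL (by simpa using hx) (by simp)
  refine (contMDiffAt_formPullback ha (B.vol_smooth.contMDiffAt x)).congr_of_eventuallyEq ?_
  filter_upwards [(chartAt _ x₀).open_source.mem_nhds hx, (chartAt _ x).open_source.mem_nhds hxx]
    with y hy hy'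
  rw [volAt, ← formPullback_comp]
  congr 2
  refine LinearMap.ext fun v => ?_
  have h1 : tanMap (𝓡 (n + 1)) x y (tanInv (𝓡 (n + 1)) x₀ y v) = a y v :=
    fibMap_comp_fibInv (F := BaseModel n) (V := fun x : M => TangentSpace (𝓡 (n + 1)) x)
      (by simpa using hy') (by simpa using hy) v
  have h2 := congrArg (tanInv (𝓡 (n + 1)) x y) h1
  rw [tanInv_tanMap hy'] at h2
  exact h2

theorem contMDiffAt_volCoef {x₀ x : M}
    (hx : x ∈ (chartAt (EuclideanSpace ℝ (Fin (n + 1))) x₀).source) :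
    ContMDiffAt (𝓡 (n + 1)) 𝓘(ℝ, ℝ) ∞ (B.volCoef x₀) x :=
  contMDiffAt_linear (ExteriorAlgebra.algebraMapInv.toLinearMap ∘ₗ
    hook (B.exists_hook_volAt_eq_one (mem_chart_source _ x₀)).choose) (B.contMDiffAt_volAt hx)

end Smoothness

end OrientedMetric

end BaseVolume

/-! ### Hamiltonian pairs and contractions of the volume form on a bundle with a splitting. -/

section HamiltonianForms

variable {n : ℕ} {M : Type*} [TopologicalSpace M]
  [ChartedSpace (EuclideanSpace ℝ (Fin (n + 1))) M] [IsManifold (𝓡 (n + 1)) ∞ M]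
  {G : Type*} [NormedAddCommGroup G] [NormedSpace ℝ G] [FiniteDimensional ℝ G]
  {Q : M → Type*} [TopologicalSpace (TotalSpace G Q)]
  [∀ x, AddCommGroup (Q x)] [∀ x, Module ℝ (Q x)] [∀ x, TopologicalSpace (Q x)]
  [FiberBundle G Q] [VectorBundle ℝ G Q]
  (B : OrientedMetric n M)
  (S : (z : TotalSpace G Q) → TangentSpace ((𝓡 (n + 1)).prod 𝓘(ℝ, G)) z →ₗ[ℝ]
    TangentSpace (𝓡 (n + 1)) z.proj × Q z.proj)
  {J κ : Type*} [Fintype J] [DecidableEq J] [Fintype κ]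

variable (n G Q) in
/-- The tangent map of the projection. -/
def totalProjTangent (z : TotalSpace G Q) :
    TangentSpace ((𝓡 (n + 1)).prod 𝓘(ℝ, G)) z →ₗ[ℝ] TangentSpace (𝓡 (n + 1)) z.proj :=
  (mfderiv ((𝓡 (n + 1)).prod 𝓘(ℝ, G)) (𝓡 (n + 1))
    (TotalSpace.proj : TotalSpace G Q → M) z).toLinearMap

/-- `α` is a smooth horizontal `k`-form. -/
structure IsSmoothHorizontal (k : ℤ)
    (α : FormOn ((𝓡 (n + 1)).prod 𝓘(ℝ, G)) (TotalSpace G Q)) : Prop where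
  smooth : IsSmoothForm ((𝓡 (n + 1)).prod 𝓘(ℝ, G)) α
  degree : ∀ z, α z ∈ extDegree _ k
  horizontal : ∀ z (u : TangentSpace ((𝓡 (n + 1)).prod 𝓘(ℝ, G)) z),
    totalProjTangent n G Q z u = 0 → vectorHook u (α z) = 0

/-- The form on the base with the same values on horizontal lifts. -/
def splittingBaseForm (α : FormOn ((𝓡 (n + 1)).prod 𝓘(ℝ, G)) (TotalSpace G Q))
    (z : TotalSpace G Q) : ExtForm (TangentSpace (𝓡 (n + 1)) z.proj) :=
  formPullback ((S z).leftInverse ∘ₗ LinearMap.inl ℝ _ _) (α z)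

/-- The product `∗⁻¹(∗α ∧ ∗β)` of horizontal forms. -/
def splittingHodgeProduct (α β : FormOn ((𝓡 (n + 1)).prod 𝓘(ℝ, G)) (TotalSpace G Q)) :
    FormOn ((𝓡 (n + 1)).prod 𝓘(ℝ, G)) (TotalSpace G Q) := fun z =>
  formPullback (totalProjTangent n G Q z) (B.hodgeInv z.proj
    (B.hodge z.proj (splittingBaseForm S α z) * B.hodge z.proj (splittingBaseForm S β z)))

variable [ContMDiffVectorBundle ∞ G Q (𝓡 (n + 1))]

/-- The bracket computed with the Hamiltonian multivector fields `X` and `Y`, where `X` belongs to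
a form of degree `r`. -/
def fieldBracket (Om : FormOn ((𝓡 (n + 1)).prod 𝓘(ℝ, G)) (TotalSpace G Q)) (r : ℤ)
    (X Y : MultivectorOn ((𝓡 (n + 1)).prod 𝓘(ℝ, G)) (TotalSpace G Q)) :
    FormOn ((𝓡 (n + 1)).prod 𝓘(ℝ, G)) (TotalSpace G Q) := fun z =>
  ((n + 1 - r).negOnePow : ℤ) • hook (X z) (hook (Y z) (Om z))

variable (ν : (x : M) → J → Module.Dual ℝ (Q x)) (w : (x : M) → J → Q x)
  (Om : FormOn ((𝓡 (n + 1)).prod 𝓘(ℝ, G)) (TotalSpace G Q))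

/-- `X` is a Hamiltonian `(n+1-k)`-vector field for the horizontal `k`-form `α`. -/
structure IsHamPair (k : ℤ) (X : MultivectorOn ((𝓡 (n + 1)).prod 𝓘(ℝ, G)) (TotalSpace G Q))
    (α : FormOn ((𝓡 (n + 1)).prod 𝓘(ℝ, G)) (TotalSpace G Q)) : Prop where
  horizontalForm : IsSmoothHorizontal k α
  smooth : IsSmoothMultivector ((𝓡 (n + 1)).prod 𝓘(ℝ, G)) X
  degree : ∀ z, X z ∈ extDegree _ (n + 1 - k)
  hook_eq : ∀ z, hook (X z) (Om z) = splittingVertD S ν w α z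

/-- In the preferred trivializations `Om` is the form `∑ ε_k ∧ e_k ∧ (b_k ⌟ vol)`. -/
structure IsPolysymplectic (ν₀ : J → Module.Dual ℝ G) (w₀ : J → G)
    (ε e : κ → Module.Dual ℝ G) (b : κ → BaseModel n) : Prop where
  splitting : IsSmoothSplitting S
  frame : IsVerticalFrame n G Q ν w ν₀ w₀
  dual : ∀ N K, ν₀ N (w₀ K) = if N = K then 1 else 0
  expand_left : ∀ k, ε k = ∑ N, ε k (w₀ N) • ν₀ N
  expand_right : ∀ k, e k = ∑ N, e k (w₀ N) • ν₀ N
  readForm_eq : ∀ (x₀ : M) (z : TotalSpace G Q), z.proj ∈ trivDomain n G Q x₀ →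
    readForm S x₀ Om z = polyForm ε e b (B.volAt x₀ z.proj)

/-- The horizontal form `α` is at `z` the contraction of the volume form with `Y`, in the
trivializations around `x₀`. -/
def IsVolContraction (x₀ : M) (α : FormOn ((𝓡 (n + 1)).prod 𝓘(ℝ, G)) (TotalSpace G Q))
    (z : TotalSpace G Q) (Y : ExteriorAlgebra ℝ (BaseModel n)) : Prop :=
  readForm S x₀ α z = horForm G (hook Y (B.volAt x₀ z.proj))

variable {B S ν w Om}

theorem IsVolContraction.unique {x₀ : M} {z : TotalSpace G Q}
    (hz : z.proj ∈ trivDomain n G Q x₀)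
    {α : FormOn ((𝓡 (n + 1)).prod 𝓘(ℝ, G)) (TotalSpace G Q)} {Y Z : ExteriorAlgebra ℝ (BaseModel n)}
    (h : IsVolContraction B S x₀ α z Y) (h' : IsVolContraction B S x₀ α z Z) : Y = Z :=
  B.hook_volAt_injective hz.2 (horForm_injective (h.symm.trans h'))

namespace IsSmoothSplitting

variable (hS : IsSmoothSplitting S)
include hS

theorem totalProjTangent_splitChartInv {x₀ : M} {z : TotalSpace G Q} :
    totalProjTangent n G Q z ∘ₗ splitChartInv S x₀ z =
      (tanInv (𝓡 (n + 1)) x₀ z.proj).toLinearMap ∘ₗ LinearMap.fst ℝ (BaseModel n) G := by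
  refine LinearMap.ext fun v => ?_
  have h1 := hS.fst_eq z (splitChartInv S x₀ z v)
  have h2 : S z (splitChartInv S x₀ z v) = pairInv n G Q x₀ z.proj v :=
    hS.apply_leftInverse z (pairInv n G Q x₀ z.proj v)
  rw [h2] at h1
  exact h1.symm

theorem splitChart_fst {x₀ : M} {z : TotalSpace G Q} :
    LinearMap.fst ℝ (BaseModel n) G ∘ₗ splitChart S x₀ z =
      (tanMap (𝓡 (n + 1)) x₀ z.proj).toLinearMap ∘ₗ totalProjTangent n G Q z := by
  refine LinearMap.ext fun ξ => ?_
  exact congrArg (tanMap (𝓡 (n + 1)) x₀ z.proj) (hS.fst_eq z ξ)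

theorem readForm_pullback {x₀ : M} {z : TotalSpace G Q}
    {α : FormOn ((𝓡 (n + 1)).prod 𝓘(ℝ, G)) (TotalSpace G Q)}
    {θ : ExtForm (TangentSpace (𝓡 (n + 1)) z.proj)}
    (h : α z = formPullback (totalProjTangent n G Q z) θ) :
    readForm S x₀ α z =
      horForm G (formPullback (tanInv (𝓡 (n + 1)) x₀ z.proj).toLinearMap θ) := by
  rw [readForm, h, ← formPullback_comp, hS.totalProjTangent_splitChartInv, formPullback_comp]

theorem horizontal_iff {x₀ : M} {z : TotalSpace G Q} (hz : z.proj ∈ trivDomain n G Q x₀)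
    (α : FormOn ((𝓡 (n + 1)).prod 𝓘(ℝ, G)) (TotalSpace G Q)) :
    (∀ u : TangentSpace ((𝓡 (n + 1)).prod 𝓘(ℝ, G)) z,
      totalProjTangent n G Q z u = 0 → vectorHook u (α z) = 0) ↔
    ∃ β, readForm S x₀ α z = horForm G β := by
  constructor
  · intro h
    refine ⟨_, (horForm_of_vectorHook_eq_zero fun u => ?_).symm⟩
    rw [readForm, vectorHook_formPullback, h, map_zero]
    have h1 := LinearMap.congr_fun (hS.totalProjTangent_splitChartInv (x₀ := x₀) (z := z)) (0, u)
    refine h1.trans ?_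
    simp
  · rintro ⟨β, hβ⟩ u hu
    rw [← hS.formPullback_readForm hz α, hβ, vectorHook_formPullback, horForm,
      vectorHook_formPullback]
    have h1 := LinearMap.congr_fun (hS.splitChart_fst (x₀ := x₀) (z := z)) u
    simp only [LinearMap.comp_apply, hu, map_zero] at h1
    rw [h1]
    simp

theorem splittingBaseForm_eq {x₀ : M} {z : TotalSpace G Q} (hz : z.proj ∈ trivDomain n G Q x₀)
    {α : FormOn ((𝓡 (n + 1)).prod 𝓘(ℝ, G)) (TotalSpace G Q)} {Y : ExteriorAlgebra ℝ (BaseModel n)}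
    (h : IsVolContraction B S x₀ α z Y) : splittingBaseForm S α z =
      hook (ExteriorAlgebra.map (tanInv (𝓡 (n + 1)) x₀ z.proj).toLinearMap Y) (B.vol z.proj) := by
  have h1 : (S z).leftInverse ∘ₗ LinearMap.inl ℝ _ _ = splitChartInv S x₀ z ∘ₗ
      LinearMap.inl ℝ (BaseModel n) G ∘ₗ (tanMap (𝓡 (n + 1)) x₀ z.proj).toLinearMap := by
    refine LinearMap.ext fun v => congrArg (S z).leftInverse ?_
    refine Prod.ext (tanInv_tanMap hz.2 v).symm ?_
    simp [pairInv]
  have h2 : LinearMap.fst ℝ (BaseModel n) G ∘ₗ LinearMap.inl ℝ (BaseModel n) G ∘ₗ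
      (tanMap (𝓡 (n + 1)) x₀ z.proj).toLinearMap =
      (tanMap (𝓡 (n + 1)) x₀ z.proj).toLinearMap := rfl
  have h3 : (tanInv (𝓡 (n + 1)) x₀ z.proj).toLinearMap ∘ₗ
      (tanMap (𝓡 (n + 1)) x₀ z.proj).toLinearMap = LinearMap.id :=
    LinearMap.ext fun v => tanInv_tanMap hz.2 v
  rw [splittingBaseForm, h1, formPullback_comp]
  rw [IsVolContraction, readForm] at h
  rw [h, horForm, ← formPullback_comp, h2, OrientedMetric.volAt, hook_formPullback,
    ← formPullback_comp, h3, formPullback_id]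

theorem isVolContraction_splittingHodgeProduct {x₀ : M} {z : TotalSpace G Q}
    (hz : z.proj ∈ trivDomain n G Q x₀)
    {α β : FormOn ((𝓡 (n + 1)).prod 𝓘(ℝ, G)) (TotalSpace G Q)}
    {Y Z : ExteriorAlgebra ℝ (BaseModel n)} (h : IsVolContraction B S x₀ α z Y)
    (h' : IsVolContraction B S x₀ β z Z) :
    IsVolContraction B S x₀ (splittingHodgeProduct B S α β) z (Y * Z) := by
  rw [IsVolContraction, hS.readForm_pullback (x₀ := x₀) (α := splittingHodgeProduct B S α β) rfl,
    hS.splittingBaseForm_eq hz h, hS.splittingBaseForm_eq hz h', B.hodgeInv_hodge_mul, ← map_mul,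
    OrientedMetric.volAt, hook_formPullback]

end IsSmoothSplitting

end HamiltonianForms

/-! ### Dictionary between Hamiltonian forms and multivector valued functions on a fibre. -/

section HamiltonianCalculus

attribute [local instance] extNormedAddCommGroup extNormedSpace

variable {n : ℕ} {M : Type*} [TopologicalSpace M]
  [ChartedSpace (EuclideanSpace ℝ (Fin (n + 1))) M] [IsManifold (𝓡 (n + 1)) ∞ M]
  {G : Type*} [NormedAddCommGroup G] [NormedSpace ℝ G] [FiniteDimensional ℝ G]
  {Q : M → Type*} [TopologicalSpace (TotalSpace G Q)]
  [∀ x, AddCommGroup (Q x)] [∀ x, Module ℝ (Q x)] [∀ x, TopologicalSpace (Q x)]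
  [FiberBundle G Q] [VectorBundle ℝ G Q]
  {B : OrientedMetric n M}
  {S : (z : TotalSpace G Q) → TangentSpace ((𝓡 (n + 1)).prod 𝓘(ℝ, G)) z →ₗ[ℝ]
    TangentSpace (𝓡 (n + 1)) z.proj × Q z.proj}
  {J κ : Type*} [Fintype J] [DecidableEq J] [Fintype κ]
  [ContMDiffVectorBundle ∞ G Q (𝓡 (n + 1))]
  {ν : (x : M) → J → Module.Dual ℝ (Q x)} {w : (x : M) → J → Q x}
  {Om : FormOn ((𝓡 (n + 1)).prod 𝓘(ℝ, G)) (TotalSpace G Q)}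
  {ν₀ : J → Module.Dual ℝ G} {w₀ : J → G} {ε e : κ → Module.Dual ℝ G} {b : κ → BaseModel n}

variable (B S) in
/-- On the fibre over `x` the horizontal form `α` is the contraction of the volume form
with `φ`. -/
def IsVolFunction (x₀ x : M) (α : FormOn ((𝓡 (n + 1)).prod 𝓘(ℝ, G)) (TotalSpace G Q))
    (φ : G → ExteriorAlgebra ℝ (BaseModel n)) : Prop :=
  ∀ g, IsVolContraction B S x₀ α (fibrePoint Q x₀ x g) (φ g)

variable (S ν₀) in
/-- The vertical coefficients of a multivector field on the fibre over `x`. -/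
def fieldCoef (x₀ x : M) (X : MultivectorOn ((𝓡 (n + 1)).prod 𝓘(ℝ, G)) (TotalSpace G Q)) (N : J)
    (g : G) : ExteriorAlgebra ℝ (BaseModel n) :=
  vertComp (readField S x₀ X (fibrePoint Q x₀ x g)) (ν₀ N)

/-- `vertComp` as a linear map. -/
def vertCompLinear {E : Type*} [AddCommGroup E] [Module ℝ E] {G : Type*} [AddCommGroup G]
    [Module ℝ G] (l : Module.Dual ℝ G) : ExteriorAlgebra ℝ (E × G) →ₗ[ℝ] ExteriorAlgebra ℝ E where
  toFun X := vertComp X l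
  map_add' X Y := by simp only [vertComp, map_add]
  map_smul' c X := by simp only [vertComp, map_smul, RingHom.id_apply]

/-- The contraction of a fixed form as a linear map into horizontal forms. -/
def horHook {E : Type*} [AddCommGroup E] [Module ℝ E] (G : Type*) [AddCommGroup G]
    [Module ℝ G] (μ : ExtForm E) : ExteriorAlgebra ℝ E →ₗ[ℝ] ExtForm (E × G) :=
  (horForm G).toLinearMap ∘ₗ (hook (T := E)).toLinearMap.flip μ

theorem IsVolFunction.unique {x₀ x : M} (hx : x ∈ trivDomain n G Q x₀)
    {α : FormOn ((𝓡 (n + 1)).prod 𝓘(ℝ, G)) (TotalSpace G Q)}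
    {φ γ : G → ExteriorAlgebra ℝ (BaseModel n)} (h : IsVolFunction B S x₀ x α φ)
    (h' : IsVolFunction B S x₀ x α γ) : φ = γ :=
  funext fun g => (h g).unique (z := fibrePoint Q x₀ x g) hx (h' g)

namespace IsSmoothSplitting

variable (hS : IsSmoothSplitting S)
include hS

theorem readForm_fieldBracket (Om : FormOn ((𝓡 (n + 1)).prod 𝓘(ℝ, G)) (TotalSpace G Q)) (r : ℤ)
    (X Y : MultivectorOn ((𝓡 (n + 1)).prod 𝓘(ℝ, G)) (TotalSpace G Q)) {x₀ : M}
    {z : TotalSpace G Q} (hz : z.proj ∈ trivDomain n G Q x₀) :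
    readForm S x₀ (fieldBracket Om r X Y) z = ((n + 1 - r).negOnePow : ℤ) •
      hook (readField S x₀ X z) (hook (readField S x₀ Y z) (readForm S x₀ Om z)) := by
  rw [hS.hook_readForm hz Y Om]
  have h := hS.hook_readForm hz X (fun z => hook (Y z) (Om z))
  rw [show formPullback (splitChartInv S x₀ z) (hook (Y z) (Om z)) =
    readForm S x₀ (fun z => hook (Y z) (Om z)) z from rfl, h, ← formPullback_zsmul]
  rfl

theorem exists_isVolContraction {k : ℤ}
    {α : FormOn ((𝓡 (n + 1)).prod 𝓘(ℝ, G)) (TotalSpace G Q)} (hα : IsSmoothHorizontal k α)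
    {x₀ : M} {z : TotalSpace G Q} (hz : z.proj ∈ trivDomain n G Q x₀) :
    ∃ Y ∈ extDegree (BaseModel n) (n + 1 - k), IsVolContraction B S x₀ α z Y := by
  obtain ⟨β, hβ⟩ := (hS.horizontal_iff hz α).1 (hα.horizontal z)
  have h1 : β ∈ extDegree (Module.Dual ℝ (BaseModel n)) k := by
    rw [← formPullback_inl_horForm (G := G) β, ← hβ]
    exact formPullback_mem_extDegree _ (formPullback_mem_extDegree _ (hα.degree z))
  obtain ⟨K, hK, h2⟩ := B.exists_hook_volAt_eq_one hz.2
  obtain ⟨Y, hY, rfl⟩ := hook_top_exists (B.volAt_mem_extDegree x₀ z.proj) hK h2 h1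
  refine ⟨Y, ?_, hβ⟩
  have h3 : ((Module.finrank ℝ (BaseModel n) : ℕ) : ℤ) = n + 1 := by
    rw [finrank_euclideanSpace_fin]; push_cast; rfl
  rwa [h3] at hY

theorem exists_volContraction_function {k : ℤ}
    {α : FormOn ((𝓡 (n + 1)).prod 𝓘(ℝ, G)) (TotalSpace G Q)} (hα : IsSmoothHorizontal k α)
    (x₀ : M) : ∃ ψ : TotalSpace G Q → ExteriorAlgebra ℝ (BaseModel n), ∀ z : TotalSpace G Q,
      z.proj ∈ trivDomain n G Q x₀ →
      ContMDiffAt ((𝓡 (n + 1)).prod 𝓘(ℝ, G)) 𝓘(ℝ, ExteriorAlgebra ℝ (BaseModel n)) ∞ ψ z ∧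
      ψ z ∈ extDegree (BaseModel n) (n + 1 - k) ∧ IsVolContraction B S x₀ α z (ψ z) := by
  let T := (hook (T := BaseModel n)).toLinearMap.flip (B.volAt x₀ x₀)
  have hT : T.ker = ⊥ := LinearMap.ker_eq_bot.2 (B.hook_volAt_injective (mem_chart_source _ x₀))
  -- Only the contraction with the volume form at `x₀` is inverted, a fixed linear map; at other
  -- points the volume form differs by its density `volCoef`. This makes smoothness in `z` evident.
  let ψ : TotalSpace G Q → ExteriorAlgebra ℝ (BaseModel n) := fun z =>
    (B.volCoef x₀ z.proj)⁻¹ • T.leftInverse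
      (formPullback (LinearMap.inl ℝ (BaseModel n) G) (readForm S x₀ α z))
  refine ⟨ψ, fun z hz => ?_⟩
  have hψ : ContMDiffAt ((𝓡 (n + 1)).prod 𝓘(ℝ, G)) 𝓘(ℝ, ExteriorAlgebra ℝ (BaseModel n)) ∞ ψ z := by
    have hproj : ContMDiffAt ((𝓡 (n + 1)).prod 𝓘(ℝ, G)) (𝓡 (n + 1)) ∞
      (TotalSpace.proj : TotalSpace G Q → M) z := contMDiffAt_proj Q
    have h1 : ContMDiffAt ((𝓡 (n + 1)).prod 𝓘(ℝ, G)) 𝓘(ℝ, ℝ) ∞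
        (fun z : TotalSpace G Q => B.volCoef x₀ z.proj) z :=
      (B.contMDiffAt_volCoef hz.2).comp z hproj
    exact (h1.inv₀ (B.volCoef_ne_zero hz.2)).smul (contMDiffAt_linear (T.leftInverse ∘ₗ
      (formPullback (LinearMap.inl ℝ (BaseModel n) G)).toLinearMap)
      (hS.isSmoothForm_iff.1 hα.smooth x₀ z hz))
  obtain ⟨Y, hY, h⟩ := hS.exists_isVolContraction (B := B) hα hz
  have h1 : ψ z = Y := by
    rw [IsVolContraction] at h
    simp only [ψ]
    rw [h, formPullback_inl_horForm, B.volAt_eq_smul, map_smul]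
    have h2 : T.leftInverse (hook Y (B.volAt x₀ x₀)) = Y := LinearMap.leftInverse_apply_of_inj hT Y
    rw [map_smul, h2, inv_smul_smul₀ (B.volCoef_ne_zero hz.2)]
  exact ⟨hψ, by rwa [h1], by rwa [h1]⟩

theorem exists_isVolFunction {k : ℤ}
    {α : FormOn ((𝓡 (n + 1)).prod 𝓘(ℝ, G)) (TotalSpace G Q)} (hα : IsSmoothHorizontal k α)
    {x₀ x : M} (hx : x ∈ trivDomain n G Q x₀) :
    ∃ φ : G → ExteriorAlgebra ℝ (BaseModel n), ContDiff ℝ ∞ φ ∧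
      (∀ g, φ g ∈ extDegree (BaseModel n) (n + 1 - k)) ∧ IsVolFunction B S x₀ x α φ := by
  obtain ⟨ψ, hψ⟩ := hS.exists_volContraction_function (B := B) hα x₀
  exact ⟨fun g => ψ (fibrePoint Q x₀ x g),
    contDiff_comp_fibrePoint (n := n) hx.1 fun q => (hψ ⟨x, q⟩ hx).1,
    fun g => (hψ (fibrePoint Q x₀ x g) hx).2.1, fun g => (hψ (fibrePoint Q x₀ x g) hx).2.2⟩

theorem eq_of_isVolFunction {α β : FormOn ((𝓡 (n + 1)).prod 𝓘(ℝ, G)) (TotalSpace G Q)}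
    (h : ∀ x, ∃ φ, IsVolFunction B S x x α φ ∧ IsVolFunction B S x x β φ) : α = β := by
  funext z
  obtain ⟨φ, h1, h2⟩ := h z.proj
  have hz := mem_trivDomain_self (n := n) (G := G) (Q := Q) z.proj
  have h3 := (h1 (fibMap G z.proj z.proj z.2)).trans (h2 (fibMap G z.proj z.proj z.2)).symm
  rw [fibrePoint_fibMap hz.1] at h3
  exact hS.readForm_injective hz h3

theorem isSmoothHorizontal {k : ℤ} {α : FormOn ((𝓡 (n + 1)).prod 𝓘(ℝ, G)) (TotalSpace G Q)}
    (hα : IsSmoothForm ((𝓡 (n + 1)).prod 𝓘(ℝ, G)) α)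
    (h : ∀ x, ∃ φ : G → ExteriorAlgebra ℝ (BaseModel n),
      (∀ g, φ g ∈ extDegree (BaseModel n) (n + 1 - k)) ∧ IsVolFunction B S x x α φ) :
    IsSmoothHorizontal k α := by
  have h1 : ∀ z : TotalSpace G Q, ∃ Y ∈ extDegree (BaseModel n) (n + 1 - k),
      IsVolContraction B S z.proj α z Y := by
    intro z
    obtain ⟨φ, hφ, h2⟩ := h z.proj
    refine ⟨_, hφ (fibMap G z.proj z.proj z.2), ?_⟩
    have h3 := h2 (fibMap G z.proj z.proj z.2)
    rwa [fibrePoint_fibMap (mem_trivDomain_self (n := n) z.proj).1] at h3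
  refine ⟨hα, fun z => ?_, fun z => ?_⟩
  · obtain ⟨Y, hY, h2⟩ := h1 z
    rw [← hS.formPullback_readForm (mem_trivDomain_self z.proj) α, h2]
    refine formPullback_mem_extDegree _ (formPullback_mem_extDegree _ ?_)
    have h3 := hook_mem_extDegree hY (B.volAt_mem_extDegree z.proj z.proj)
    rw [finrank_euclideanSpace_fin] at h3
    push_cast at h3
    rwa [show (n : ℤ) + 1 - (n + 1 - k) = k by ring] at h3
  · obtain ⟨Y, hY, h2⟩ := h1 z
    exact (hS.horizontal_iff (mem_trivDomain_self z.proj) α).2 ⟨_, h2⟩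

/-- The volume form is constant along a fibre, so the vertical derivative falls on `φ` alone. -/
theorem readForm_splittingVertD_fibrePoint (hν : IsVerticalFrame n G Q ν w ν₀ w₀) {x₀ x : M}
    (hx : x ∈ trivDomain n G Q x₀) {α : FormOn ((𝓡 (n + 1)).prod 𝓘(ℝ, G)) (TotalSpace G Q)}
    (hα : IsSmoothForm ((𝓡 (n + 1)).prod 𝓘(ℝ, G)) α)
    {φ : G → ExteriorAlgebra ℝ (BaseModel n)} (hφ : ContDiff ℝ ∞ φ)
    (h : IsVolFunction B S x₀ x α φ) (g : G) :
    readForm S x₀ (splittingVertD S ν w α) (fibrePoint Q x₀ x g) =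
      vertForm ν₀ (B.volAt x₀ x) fun N => fderiv ℝ φ g (w₀ N) := by
  rw [hS.readForm_splittingVertD hν (z := fibrePoint Q x₀ x g) hx
    ((hS.isSmoothForm_iff.1 hα x₀ (fibrePoint Q x₀ x g) hx).mdifferentiableAt (by simp))]
  refine Finset.sum_congr rfl fun N _ => ?_
  congr 1
  have h1 : (fun g => readForm S x₀ α (fibrePoint Q x₀ x g)) =
      fun g => horHook G (B.volAt x₀ x) (φ g) := funext h
  show fderiv ℝ (fun g => readForm S x₀ α (fibrePoint Q x₀ x g))
    (fibMap G x₀ x (fibInv G x₀ x g : Q x)) (w₀ N) = _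
  rw [h1, fibMap_fibInv hx.1,
    fderiv_linear_comp _ ((hφ.differentiable (by simp)) g)]
  rfl

theorem isSmoothForm_splittingVertD (hν : IsVerticalFrame n G Q ν w ν₀ w₀)
    {α : FormOn ((𝓡 (n + 1)).prod 𝓘(ℝ, G)) (TotalSpace G Q)}
    (hα : IsSmoothForm ((𝓡 (n + 1)).prod 𝓘(ℝ, G)) α) :
    IsSmoothForm ((𝓡 (n + 1)).prod 𝓘(ℝ, G)) (splittingVertD S ν w α) := by
  refine hS.isSmoothForm_iff.2 fun x₀ z hz => ?_
  -- `contMDiffAt_vertDeriv` gives smoothness at the centre of a trivialization only, so the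
  -- trivialization around `z.proj` is used.
  refine hS.contMDiffAt_readForm_congr (x₁ := z.proj) hz (mem_trivDomain_self z.proj) ?_
  have h1 : ContMDiffAt ((𝓡 (n + 1)).prod 𝓘(ℝ, G)) 𝓘(ℝ, ExtForm (BaseModel n × G)) ∞
      (fun y => ∑ N, ExteriorAlgebra.ι ℝ (vertCo (BaseModel n) (ν₀ N)) *
        vertDeriv z.proj (readForm S z.proj α) (w₀ N) y) z := by
    refine contMDiffAt_finsetSum fun N _ => contMDiffAt_ext_mul contMDiffAt_const ?_
    exact contMDiffAt_vertDeriv (hS.isSmoothForm_iff.1 hα z.proj z (mem_trivDomain_self z.proj)) _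
  refine h1.congr_of_eventuallyEq ?_
  filter_upwards [eventually_mem_trivDomain (mem_trivDomain_self (n := n) z.proj)] with y hy
  exact hS.readForm_splittingVertD hν hy
    ((hS.isSmoothForm_iff.1 hα z.proj y hy).mdifferentiableAt (by simp))

end IsSmoothSplitting

namespace IsPolysymplectic

variable (hP : IsPolysymplectic B S ν w Om ν₀ w₀ ε e b)
include hP

theorem hook_readField {k : ℤ} {X : MultivectorOn ((𝓡 (n + 1)).prod 𝓘(ℝ, G)) (TotalSpace G Q)}
    {α : FormOn ((𝓡 (n + 1)).prod 𝓘(ℝ, G)) (TotalSpace G Q)} (h : IsHamPair S ν w Om k X α)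
    {x₀ x : M} (hx : x ∈ trivDomain n G Q x₀) {φ : G → ExteriorAlgebra ℝ (BaseModel n)}
    (hφ : ContDiff ℝ ∞ φ) (h' : IsVolFunction B S x₀ x α φ) (g : G) :
    hook (readField S x₀ X (fibrePoint Q x₀ x g)) (polyForm ε e b (B.volAt x₀ x)) =
      vertForm ν₀ (B.volAt x₀ x) fun N => fderiv ℝ φ g (w₀ N) := by
  have h1 := hP.splitting.hook_readForm (z := fibrePoint Q x₀ x g) hx X Om
  rw [hP.readForm_eq x₀ (fibrePoint Q x₀ x g) hx, h.hook_eq] at h1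
  exact h1.trans (hP.splitting.readForm_splittingVertD_fibrePoint hP.frame hx
    h.horizontalForm.smooth hφ h' g)

/-- Passage to the model: the vertical coefficients of the smooth field `X` are smooth on the fibre,
and the equation comes from the part with one vertical covector (`vertForm_eq_of_hook_eq`). The
function `φ` is smooth because it is unique. -/
theorem modelHamiltonian {k : ℤ}
    {X : MultivectorOn ((𝓡 (n + 1)).prod 𝓘(ℝ, G)) (TotalSpace G Q)}
    {α : FormOn ((𝓡 (n + 1)).prod 𝓘(ℝ, G)) (TotalSpace G Q)} (h : IsHamPair S ν w Om k X α)
    {x₀ x : M} (hx : x ∈ trivDomain n G Q x₀) {φ : G → ExteriorAlgebra ℝ (BaseModel n)}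
    (h' : IsVolFunction B S x₀ x α φ) :
    ModelHamiltonian w₀ (fun N K => polySymp ε e b (w₀ N) (w₀ K)) (n + 1 - k)
      (fieldCoef S ν₀ x₀ x X) φ := by
  obtain ⟨γ, hγ, hdeg, h2⟩ := hP.splitting.exists_isVolFunction (B := B) h.horizontalForm hx
  obtain rfl := h'.unique hx h2
  refine ⟨hγ, fun N => ?_, hdeg, fun N g => ?_, fun K g => ?_⟩
  · exact contDiff_linear (vertCompLinear (ν₀ N)) (contDiff_comp_fibrePoint (n := n) hx.1 fun q =>
      hP.splitting.isSmoothMultivector_iff.1 h.smooth x₀ ⟨x, q⟩ hx)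
  · exact vertComp_mem_extDegree (map_mem_extDegree _ (h.degree _)) _
  · exact vertForm_eq_of_hook_eq hP.expand_left hP.expand_right hP.dual
      (B.hook_volAt_injective hx.2) (hP.hook_readField h hx hγ h' g) K

/-- The inner contraction is `d^V β`, whose coefficients end in factors `σ_{NK}` because `β` is
Hamiltonian; the constraint on the horizontal part of `X` then applies
(`hook_vertForm_of_hamiltonian`). -/
theorem isVolFunction_fieldBracket {r s : ℤ}
    {X Y : MultivectorOn ((𝓡 (n + 1)).prod 𝓘(ℝ, G)) (TotalSpace G Q)}
    {α β : FormOn ((𝓡 (n + 1)).prod 𝓘(ℝ, G)) (TotalSpace G Q)}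
    (h : IsHamPair S ν w Om r X α) (h' : IsHamPair S ν w Om s Y β)
    {x₀ x : M} (hx : x ∈ trivDomain n G Q x₀) {γ : G → ExteriorAlgebra ℝ (BaseModel n)}
    (hγ : IsVolFunction B S x₀ x β γ) :
    IsVolFunction B S x₀ x (fieldBracket Om r X Y)
      (modelBracket w₀ (fieldCoef S ν₀ x₀ x X) γ) := by
  intro g
  obtain ⟨φ, hφ, -, h2⟩ := hP.splitting.exists_isVolFunction (B := B) h.horizontalForm hx
  have hm := hP.modelHamiltonian h' hx hγ
  have h3 : readForm S x₀ (fieldBracket Om r X Y) (fibrePoint Q x₀ x g) =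
      ((n + 1 - r).negOnePow : ℤ) • hook (readField S x₀ X (fibrePoint Q x₀ x g))
        (vertForm ν₀ (B.volAt x₀ x) fun N => fderiv ℝ γ g (w₀ N)) := by
    have h4 := hP.readForm_eq x₀ (fibrePoint Q x₀ x g) hx
    rw [hP.splitting.readForm_fieldBracket Om r X Y (z := fibrePoint Q x₀ x g) hx, h4,
      ← hP.hook_readField h' hx hm.smooth hγ g]
    rfl
  refine h3.trans ?_
  exact hook_vertForm_of_hamiltonian (B.hook_volAt_injective hx.2)
    (map_mem_extDegree _ (h.degree (fibrePoint Q x₀ x g))) (hP.hook_readField h hx hφ h2 g)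
    (fun N => hm.degree_field N g) (fun K => hm.eq K g)

end IsPolysymplectic

end HamiltonianCalculus

/-! ### Linear combinations of solutions of a contraction equation; rescaling the volume form. -/

section Patching

theorem polyForm_smul {E G : Type*} [AddCommGroup E] [Module ℝ E] [AddCommGroup G] [Module ℝ G]
    {κ : Type*} [Fintype κ] (ε e : κ → Module.Dual ℝ G) (b : κ → E) (c : ℝ) (μ : ExtForm E) :
    polyForm ε e b (c • μ) = c • polyForm ε e b μ := by
  simp only [polyForm, map_smul, mul_smul_comm, Finset.smul_sum]

variable {W : Type*} [AddCommGroup W] [Module ℝ W] {ι : Type*}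

theorem hook_sum_smul_eq {s : Finset ι} {c : ι → ℝ} {X : ι → ExteriorAlgebra ℝ W}
    {μ β : ExtForm W} (h : ∀ i ∈ s, hook (X i) μ = β) (hc : ∑ i ∈ s, c i = 1) :
    hook (∑ i ∈ s, c i • X i) μ = β := by
  rw [map_sum, LinearMap.sum_apply]
  have h1 : ∀ i ∈ s, hook (c i • X i) μ = c i • β := fun i hi => by
    rw [map_smul, LinearMap.smul_apply, h i hi]
  rw [Finset.sum_congr rfl h1, ← Finset.sum_smul, hc, one_smul]

theorem sum_smul_mem_extDegree {k : ℤ} {s : Finset ι} (c : ι → ℝ) {X : ι → ExteriorAlgebra ℝ W}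
    (h : ∀ i ∈ s, X i ∈ extDegree W k) : ∑ i ∈ s, c i • X i ∈ extDegree W k :=
  sum_mem fun i hi => Submodule.smul_mem _ _ (h i hi)

theorem extMap_sum_smul {W' : Type*} [AddCommGroup W'] [Module ℝ W'] (f : W →ₗ[ℝ] W')
    (s : Finset ι) (c : ι → ℝ) (X : ι → ExteriorAlgebra ℝ W) :
    ExteriorAlgebra.map f (∑ i ∈ s, c i • X i) = ∑ i ∈ s, c i • ExteriorAlgebra.map f (X i) := by
  rw [map_sum]
  exact Finset.sum_congr rfl fun i _ => map_smul _ _ _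

theorem hook_extMap_formPullback {W' : Type*} [AddCommGroup W'] [Module ℝ W'] {f : W →ₗ[ℝ] W'}
    {f' : W' →ₗ[ℝ] W} (h : f' ∘ₗ f = LinearMap.id) (X : ExteriorAlgebra ℝ W) (μ : ExtForm W) :
    hook (ExteriorAlgebra.map f X) (formPullback f' μ) = formPullback f' (hook X μ) := by
  rw [hook_formPullback, map_map, h, map_id_apply]

theorem hook_polyForm_generalized_inverse {E G : Type*} [AddCommGroup E] [Module ℝ E]
    [AddCommGroup G] [Module ℝ G] {κ : Type*} [Fintype κ] {ε e : κ → Module.Dual ℝ G} {b : κ → E}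
    {μ : ExtForm E} {U : Submodule ℝ (ExteriorAlgebra ℝ (E × G))}
    {R : ExtForm (E × G) →ₗ[ℝ] ExteriorAlgebra ℝ (E × G)}
    (hR : ∀ X ∈ U, hook (R (hook X (polyForm ε e b μ))) (polyForm ε e b μ) =
      hook X (polyForm ε e b μ)) {c : ℝ} (hc : c ≠ 0) {Y : ExteriorAlgebra ℝ (E × G)} (hY : Y ∈ U) :
    hook (c⁻¹ • R (hook Y (polyForm ε e b (c • μ)))) (polyForm ε e b (c • μ)) =
      hook Y (polyForm ε e b (c • μ)) := by
  rw [polyForm_smul, map_smul, map_smul, map_smul, map_smul, LinearMap.smul_apply, map_smul,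
    LinearMap.smul_apply, hR Y hY, smul_smul c⁻¹,
    inv_mul_cancel₀ hc, one_smul]

end Patching

/-! ### Existence of smooth global Hamiltonian multivector fields. -/

section HamiltonianExistence

attribute [local instance] extNormedAddCommGroup extNormedSpace

variable {n : ℕ} {M : Type*} [TopologicalSpace M]
  [ChartedSpace (EuclideanSpace ℝ (Fin (n + 1))) M] [IsManifold (𝓡 (n + 1)) ∞ M]
  {G : Type*} [NormedAddCommGroup G] [NormedSpace ℝ G] [FiniteDimensional ℝ G]
  {Q : M → Type*} [TopologicalSpace (TotalSpace G Q)]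
  [∀ x, AddCommGroup (Q x)] [∀ x, Module ℝ (Q x)] [∀ x, TopologicalSpace (Q x)]
  [FiberBundle G Q] [VectorBundle ℝ G Q]
  {B : OrientedMetric n M}
  {S : (z : TotalSpace G Q) → TangentSpace ((𝓡 (n + 1)).prod 𝓘(ℝ, G)) z →ₗ[ℝ]
    TangentSpace (𝓡 (n + 1)) z.proj × Q z.proj}
  {J κ : Type*} [Fintype J] [DecidableEq J] [Fintype κ]
  [ContMDiffVectorBundle ∞ G Q (𝓡 (n + 1))]
  {ν : (x : M) → J → Module.Dual ℝ (Q x)} {w : (x : M) → J → Q x}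
  {Om : FormOn ((𝓡 (n + 1)).prod 𝓘(ℝ, G)) (TotalSpace G Q)}
  {ν₀ : J → Module.Dual ℝ G} {w₀ : J → G} {ε e : κ → Module.Dual ℝ G} {b : κ → BaseModel n}

namespace IsPolysymplectic

variable (hP : IsPolysymplectic B S ν w Om ν₀ w₀ ε e b)
include hP

/-- A solution at one point: the multivector `∑ w_N ∧ Z_N` built from the model coefficients
(`hook_sum_vert_polyForm`). Since `φ` and `Z` may be chosen separately over each base point, no
smoothness across fibres is claimed. -/
theorem exists_hook_eq {k : ℤ} {α : FormOn ((𝓡 (n + 1)).prod 𝓘(ℝ, G)) (TotalSpace G Q)}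
    (hα : IsSmoothForm ((𝓡 (n + 1)).prod 𝓘(ℝ, G)) α) (z : TotalSpace G Q)
    {φ : G → ExteriorAlgebra ℝ (BaseModel n)} {Z : J → G → ExteriorAlgebra ℝ (BaseModel n)}
    (hφ : IsVolFunction B S z.proj z.proj α φ)
    (h : ModelHamiltonian w₀ (fun N K => polySymp ε e b (w₀ N) (w₀ K)) (n + 1 - k) Z φ) :
    ∃ X ∈ extDegree (TangentSpace ((𝓡 (n + 1)).prod 𝓘(ℝ, G)) z) (n + 1 - k),
      hook X (Om z) = splittingVertD S ν w α z := by
  have hz := mem_trivDomain_self (n := n) (G := G) (Q := Q) z.proj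
  let g := fibMap G z.proj z.proj z.2
  let X₀ : ExteriorAlgebra ℝ (BaseModel n × G) :=
    ∑ N, ExteriorAlgebra.ι ℝ ((0, w₀ N) : BaseModel n × G) *
      ExteriorAlgebra.map (LinearMap.inl ℝ (BaseModel n) G) (Z N g)
  have hX₀ : X₀ ∈ extDegree (BaseModel n × G) (n + 1 - k) := by
    refine sum_mem fun N _ => ?_
    have h1 := mul_mem_extDegree (ι_mem_extDegree ((0, w₀ N) : BaseModel n × G))
      (map_mem_extDegree (LinearMap.inl ℝ (BaseModel n) G) (h.degree_field N g))
    rwa [show (1 : ℤ) + (n + 1 - k - 1) = n + 1 - k by ring] at h1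
  refine ⟨ExteriorAlgebra.map (splitChartInv S z.proj z) X₀, map_mem_extDegree _ hX₀, ?_⟩
  have h1 : hook X₀ (polyForm ε e b (B.volAt z.proj z.proj)) =
      vertForm ν₀ (B.volAt z.proj z.proj) fun K => fderiv ℝ φ g (w₀ K) := by
    rw [hook_sum_vert_polyForm hP.expand_left hP.expand_right]
    congr 1
    funext K
    exact (h.eq K g).symm
  have h2 := hP.splitting.readForm_splittingVertD_fibrePoint hP.frame hz hα h.smooth hφ g
  rw [fibrePoint_fibMap hz.1] at h2
  rw [← hP.splitting.formPullback_readForm hz Om, hook_formPullback,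
    hP.splitting.readField_map hz, hP.readForm_eq z.proj z hz, h1, ← h2,
    hP.splitting.formPullback_readForm hz]

theorem hook_readForm_splitChart {x₀ : M} {z : TotalSpace G Q} (hz : z.proj ∈ trivDomain n G Q x₀)
    {Y : ExteriorAlgebra ℝ (TangentSpace ((𝓡 (n + 1)).prod 𝓘(ℝ, G)) z)}
    {β : FormOn ((𝓡 (n + 1)).prod 𝓘(ℝ, G)) (TotalSpace G Q)} (h : hook Y (Om z) = β z) :
    hook (ExteriorAlgebra.map (splitChart S x₀ z) Y) (polyForm ε e b (B.volAt x₀ z.proj)) =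
      readForm S x₀ β z := by
  rw [← hP.readForm_eq x₀ z hz]
  refine (hook_extMap_formPullback (LinearMap.ext
    (hP.splitting.splitChartInv_splitChart hz)) Y (Om z)).trans ?_
  rw [h]
  rfl

theorem hook_splitChartInv {x₀ : M} {z : TotalSpace G Q} (hz : z.proj ∈ trivDomain n G Q x₀)
    {X : ExteriorAlgebra ℝ (BaseModel n × G)}
    {β : FormOn ((𝓡 (n + 1)).prod 𝓘(ℝ, G)) (TotalSpace G Q)}
    (h : hook X (polyForm ε e b (B.volAt x₀ z.proj)) = readForm S x₀ β z) :
    hook (ExteriorAlgebra.map (splitChartInv S x₀ z) X) (Om z) = β z := by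
  rw [← hP.splitting.formPullback_readForm hz Om, hP.readForm_eq x₀ z hz,
    hook_extMap_formPullback (LinearMap.ext (hP.splitting.splitChart_splitChartInv hz)) X, h,
    hP.splitting.formPullback_readForm hz]

/-- In the trivialization the linear map `X ↦ X ⌟ Ω` is constant up to the density of the volume
form. One generalized inverse of it, with values in the right degree, selects a solution wherever
one exists, and depends smoothly on the smooth right-hand side. -/
theorem exists_local_field {k : ℤ} {α : FormOn ((𝓡 (n + 1)).prod 𝓘(ℝ, G)) (TotalSpace G Q)}
    (hα : IsSmoothForm ((𝓡 (n + 1)).prod 𝓘(ℝ, G)) α)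
    (h : ∀ z, ∃ X ∈ extDegree (TangentSpace ((𝓡 (n + 1)).prod 𝓘(ℝ, G)) z) (n + 1 - k),
      hook X (Om z) = splittingVertD S ν w α z) (x₀ : M) :
    ∃ X : MultivectorOn ((𝓡 (n + 1)).prod 𝓘(ℝ, G)) (TotalSpace G Q),
      ∀ z, z.proj ∈ trivDomain n G Q x₀ →
        ContMDiffAt ((𝓡 (n + 1)).prod 𝓘(ℝ, G)) 𝓘(ℝ, ExteriorAlgebra ℝ (BaseModel n × G)) ∞
          (readField S x₀ X) z ∧
        X z ∈ extDegree _ (n + 1 - k) ∧ hook (X z) (Om z) = splittingVertD S ν w α z := by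
  obtain ⟨R, hR, hR'⟩ := exists_generalized_inverse
    ((hook (T := BaseModel n × G)).toLinearMap.flip (polyForm ε e b (B.volAt x₀ x₀)))
    (extDegree (BaseModel n × G) (n + 1 - k))
  let X₀ : TotalSpace G Q → ExteriorAlgebra ℝ (BaseModel n × G) := fun z =>
    (B.volCoef x₀ z.proj)⁻¹ • R (readForm S x₀ (splittingVertD S ν w α) z)
  have hX₀ : ∀ z : TotalSpace G Q, z.proj ∈ trivDomain n G Q x₀ →
      ContMDiffAt ((𝓡 (n + 1)).prod 𝓘(ℝ, G)) 𝓘(ℝ, ExteriorAlgebra ℝ (BaseModel n × G)) ∞ X₀ z := by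
    intro z hz
    have h1 : ContMDiffAt ((𝓡 (n + 1)).prod 𝓘(ℝ, G)) 𝓘(ℝ, ℝ) ∞
        (fun z : TotalSpace G Q => B.volCoef x₀ z.proj) z :=
      (B.contMDiffAt_volCoef hz.2).comp z (contMDiffAt_proj Q)
    have h2 := contMDiffAt_linear R (hP.splitting.isSmoothForm_iff.1
        (hP.splitting.isSmoothForm_splittingVertD hP.frame hα) x₀ z hz)
    exact (h1.inv₀ (B.volCoef_ne_zero hz.2)).smul h2
  have hX₁ : ∀ z : TotalSpace G Q, z.proj ∈ trivDomain n G Q x₀ →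
      hook (X₀ z) (polyForm ε e b (B.volAt x₀ z.proj)) =
        readForm S x₀ (splittingVertD S ν w α) z := by
    intro z hz
    obtain ⟨Y, hY, h1⟩ := h z
    have h2 := hP.hook_readForm_splitChart hz h1
    have h3 := hook_polyForm_generalized_inverse (R := R) hR' (B.volCoef_ne_zero hz.2)
      (map_mem_extDegree (splitChart S x₀ z) hY)
    rw [← B.volAt_eq_smul, h2] at h3
    exact h3
  refine ⟨fun z => ExteriorAlgebra.map (splitChartInv S x₀ z) (X₀ z), fun z hz => ⟨?_, ?_, ?_⟩⟩
  · refine (hX₀ z hz).congr_of_eventuallyEq ?_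
    filter_upwards [eventually_mem_trivDomain hz] with y hy
    exact hP.splitting.readField_map hy
  · exact map_mem_extDegree _ (Submodule.smul_mem _ _ (hR _))
  · exact hP.hook_splitChartInv hz (hX₁ z hz)

/-- The equation `X ⌟ Ω = d^V α` is affine in `X`, so local solutions over open sets of `M` are
averaged with a partition of unity on `M`. -/
theorem exists_isHamPair [T2Space M] [SecondCountableTopology M] {k : ℤ}
    {α : FormOn ((𝓡 (n + 1)).prod 𝓘(ℝ, G)) (TotalSpace G Q)} (hα : IsSmoothHorizontal k α)
    (h : ∀ x, ∃ (φ : G → ExteriorAlgebra ℝ (BaseModel n))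
      (Z : J → G → ExteriorAlgebra ℝ (BaseModel n)), IsVolFunction B S x x α φ ∧
      ModelHamiltonian w₀ (fun N K => polySymp ε e b (w₀ N) (w₀ K)) (n + 1 - k) Z φ) :
    ∃ X, IsHamPair S ν w Om k X α := by
  have hpt : ∀ z, ∃ X ∈ extDegree (TangentSpace ((𝓡 (n + 1)).prod 𝓘(ℝ, G)) z) (n + 1 - k),
      hook X (Om z) = splittingVertD S ν w α z := fun z => by
    obtain ⟨φ, Z, hφ, hZ⟩ := h z.proj
    exact hP.exists_hook_eq hα.smooth z hφ hZ
  choose X hX using hP.exists_local_field hα.smooth hpt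
  have : LocallyCompactSpace M :=
    ChartedSpace.locallyCompactSpace (EuclideanSpace ℝ (Fin (n + 1))) M
  obtain ⟨f, hf⟩ := SmoothPartitionOfUnity.exists_isSubordinate (𝓡 (n + 1)) isClosed_univ
    (fun x₀ : M => trivDomain n G Q x₀) isOpen_trivDomain
    (fun x _ => Set.mem_iUnion_of_mem x (mem_trivDomain_self x))
  have hmem : ∀ {x₀ x : M}, x₀ ∈ f.fintsupport x → x ∈ trivDomain n G Q x₀ := fun h =>
    hf _ ((f.mem_fintsupport_iff _ _).1 h)
  let Y : MultivectorOn ((𝓡 (n + 1)).prod 𝓘(ℝ, G)) (TotalSpace G Q) := fun z =>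
    ∑ x₀ ∈ f.finsupport z.proj, f x₀ z.proj • X x₀ z
  refine ⟨Y, hα, hP.splitting.isSmoothMultivector_iff.2 fun x₁ z hz => ?_, fun z => ?_, fun z => ?_⟩
  · have hproj : ContMDiffAt ((𝓡 (n + 1)).prod 𝓘(ℝ, G)) (𝓡 (n + 1)) ∞
      (TotalSpace.proj : TotalSpace G Q → M) z := contMDiffAt_proj Q
    have h1 : ContMDiffAt ((𝓡 (n + 1)).prod 𝓘(ℝ, G)) 𝓘(ℝ, ExteriorAlgebra ℝ (BaseModel n × G)) ∞
        (fun y : TotalSpace G Q => ∑ x₀ ∈ f.fintsupport z.proj,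
          f x₀ y.proj • readField S x₁ (X x₀) y) z := by
      refine contMDiffAt_finsetSum fun x₀ hx₀ => ?_
      have h2 : ContMDiffAt ((𝓡 (n + 1)).prod 𝓘(ℝ, G)) 𝓘(ℝ, ℝ) ∞
          (fun y : TotalSpace G Q => f x₀ y.proj) z :=
        (f x₀).contMDiff.contMDiffAt.comp z hproj
      exact h2.smul (hP.splitting.contMDiffAt_readField_congr (hmem hx₀) hz (hX x₀ z (hmem hx₀)).1)
    refine h1.congr_of_eventuallyEq ?_
    -- The index set of the sum varies with the point; near `z` it stays inside one fixed finite
    -- set, and the additional terms vanish.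
    have h2 : ∀ᶠ y : TotalSpace G Q in nhds z, f.finsupport y.proj ⊆ f.fintsupport z.proj :=
      hproj.continuousAt.eventually (f.eventually_finsupport_subset z.proj)
    filter_upwards [h2] with y hy
    refine (extMap_sum_smul (splitChart S x₁ y) _ _ _).trans ?_
    refine Finset.sum_subset hy fun x₀ _ hx₀ => ?_
    rw [f.mem_finsupport, Function.notMem_support] at hx₀
    rw [hx₀, zero_smul]
  · exact sum_smul_mem_extDegree _ fun x₀ hx₀ =>
      (hX x₀ z (hmem (f.finsupport_subset_fintsupport _ hx₀))).2.1
  · exact hook_sum_smul_eq (fun x₀ hx₀ =>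
      (hX x₀ z (hmem (f.finsupport_subset_fintsupport _ hx₀))).2.2)
      (f.sum_finsupport _ (Set.mem_univ _))

end IsPolysymplectic

end HamiltonianExistence

/-! ### Antisymmetry and Jacobi identity on the model. -/

section ModelBracketSymmetry

attribute [local instance] extNormedAddCommGroup extNormedSpace

variable {E : Type*} [AddCommGroup E] [Module ℝ E] [FiniteDimensional ℝ E]
  {G : Type*} [NormedAddCommGroup G] [NormedSpace ℝ G] [FiniteDimensional ℝ G]
  {J : Type*} [Fintype J] {w : J → G} {σ : J → J → E}

/-- Inserting the Hamiltonian equation gives the double sum `∑ X_N ∧ Y_K ∧ σ_{NK}`; exchanging the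
roles commutes `X_N` with `Y_K` and changes the sign of `σ`. -/
theorem ModelHamiltonian.bracket_antisymm (hσ : ∀ N K, σ N K = -σ K N) {a b : ℤ}
    {X Y : J → G → ExteriorAlgebra ℝ E} {φ γ : G → ExteriorAlgebra ℝ E}
    (h : ModelHamiltonian w σ a X φ) (h' : ModelHamiltonian w σ b Y γ) (g : G) :
    modelBracket w X γ g = -(((a - 1) * (b - 1)).negOnePow : ℤ) • modelBracket w Y φ g := by
  have h1 : modelBracket w X γ g =
      ∑ N, ∑ K, X N g * Y K g * ExteriorAlgebra.ι ℝ (σ N K) := by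
    simp only [modelBracket, h'.eq, Finset.mul_sum, ← Finset.sum_neg_distrib, ← mul_neg]
    refine Finset.sum_congr rfl fun N _ => Finset.sum_congr rfl fun K _ => ?_
    rw [← map_neg, ← hσ, mul_assoc]
  have h2 : modelBracket w Y φ g =
      ∑ N, ∑ K, -(Y K g * X N g * ExteriorAlgebra.ι ℝ (σ N K)) := by
    simp only [modelBracket, h.eq, Finset.mul_sum, ← Finset.sum_neg_distrib, mul_assoc]
    exact Finset.sum_comm
  rw [h1, h2, Finset.smul_sum]
  refine Finset.sum_congr rfl fun N _ => ?_
  rw [Finset.smul_sum]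
  refine Finset.sum_congr rfl fun K _ => ?_
  rw [ext_mul_comm (h.degree_field N g) (h'.degree_field K g), smul_mul_assoc, neg_smul, smul_neg,
    neg_neg]

theorem modelBracket_zsmul (X : J → G → ExteriorAlgebra ℝ E) (k : ℤ)
    {γ : G → ExteriorAlgebra ℝ E} (hγ : ContDiff ℝ ∞ γ) (g : G) :
    modelBracket w X (fun g => k • γ g) g = k • modelBracket w X γ g := by
  have h1 : ∀ N, fderiv ℝ (fun g => k • γ g) g (w N) = k • fderiv ℝ γ g (w N) := fun N =>
    fderiv_linear_comp (k • (LinearMap.id : ExteriorAlgebra ℝ E →ₗ[ℝ] _))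
      (hγ.differentiable (by norm_num) g) (w N)
  simp only [modelBracket, h1, mul_smul_comm, smul_neg, Finset.smul_sum]

/-- By antisymmetry every term is written as an operator applied to `η`. The last one becomes the
bracket with the commutator coefficients, which `modelBracket_modelBracket` expands into the other
two. -/
theorem ModelHamiltonian.jacobi (hσ : ∀ N K, σ N K = -σ K N) {a b c : ℤ}
    {X Y Z : J → G → ExteriorAlgebra ℝ E} {φ γ η : G → ExteriorAlgebra ℝ E}
    (h : ModelHamiltonian w σ a X φ) (h' : ModelHamiltonian w σ b Y γ)
    (h'' : ModelHamiltonian w σ c Z η) (g : G) :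
    (((a - 1) * (c - 1)).negOnePow : ℤ) • modelBracket w X (modelBracket w Y η) g +
      (((b - 1) * (a - 1)).negOnePow : ℤ) • modelBracket w Y (modelBracket w Z φ) g +
      (((c - 1) * (b - 1)).negOnePow : ℤ) • modelBracket w Z (modelBracket w X γ) g = 0 := by
  have h1 : modelBracket w Z φ =
      fun g => (-(((c - 1) * (a - 1)).negOnePow : ℤ)) • modelBracket w X η g :=
    funext fun g => h''.bracket_antisymm hσ h g
  rw [h1, modelBracket_zsmul _ _ (contDiff_modelBracket h.smooth_field h''.smooth),
    h''.bracket_antisymm hσ (h.bracket hσ h'),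
    modelBracket_modelBracket h.smooth_field h'.smooth_field h.degree_field h'.degree_field
      h''.smooth, smul_smul, smul_smul, smul_sub, smul_smul]
  generalize modelBracket w X (modelBracket w Y η) g = x
  generalize modelBracket w Y (modelBracket w X η) g = y
  -- Only the signs remain: the bracket of `φ` and `γ` acts with degree `(a - 1) + (b - 1)`.
  have h2 : (((c - 1) * (a + b - 1 - 1)).negOnePow : ℤ) =
      ((c - 1) * (a - 1)).negOnePow * ((c - 1) * (b - 1)).negOnePow := by
    rw [← Units.val_mul, ← Int.negOnePow_add]
    congr 2
    ring
  have h3 : ∀ k : ℤ, (k.negOnePow : ℤ) * k.negOnePow = 1 := fun k => by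
    rw [← Units.val_mul, ← Int.negOnePow_add, Int.negOnePow_even _ ⟨k, rfl⟩, Units.val_one]
  rw [h2, mul_comm (a - 1) (c - 1), mul_comm (b - 1) (a - 1)]
  generalize hp : (((c - 1) * (a - 1)).negOnePow : ℤ) = p
  generalize hq : (((c - 1) * (b - 1)).negOnePow : ℤ) = q
  generalize (((a - 1) * (b - 1)).negOnePow : ℤ) = r
  have h4 : q * q = 1 := hq ▸ h3 _
  have h5 : q * -(p * q) = -p := by rw [mul_neg, mul_left_comm, h4, mul_one]
  have h6 : q * -(p * q) * r = -(r * p) := by rw [h5, neg_mul, mul_comm]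
  rw [h5, mul_neg, neg_smul, neg_smul, neg_mul, neg_smul, mul_comm p r]
  abel

end ModelBracketSymmetry

/-- `Y` acts directly on `μ` and can be replaced; commuting the two contractions puts `X` next to
`μ`, where it can be replaced as well. -/
theorem hook_hook_congr {W : Type*} [AddCommGroup W] [Module ℝ W] {a b : ℤ}
    {X X' Y Y' : ExteriorAlgebra ℝ W} {μ : ExtForm W} (hX : X ∈ extDegree W a)
    (hX' : X' ∈ extDegree W a) (hY' : Y' ∈ extDegree W b) (h : hook X μ = hook X' μ)
    (h' : hook Y μ = hook Y' μ) : hook X (hook Y μ) = hook X' (hook Y' μ) := by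
  rw [h', hook_hook_comm hX hY', h, ← hook_hook_comm hX' hY']

theorem negOnePow_smul_hook_hook {W : Type*} [AddCommGroup W] [Module ℝ W] {a b c d : ℤ}
    (hc : c = a + 1) (hd : d = b + 1) {X Y : ExteriorAlgebra ℝ W} {μ : ExtForm W}
    (hX : X ∈ extDegree W c) (hY : Y ∈ extDegree W d) :
    (c.negOnePow : ℤ) • hook X (hook Y μ) =
      -((a * b).negOnePow : ℤ) • ((d.negOnePow : ℤ) • hook Y (hook X μ)) := by
  subst hc hd
  rw [hook_hook_comm hX hY, smul_smul, smul_smul]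
  congr 1
  rw [neg_mul, ← Units.val_mul, ← Units.val_mul, ← Int.negOnePow_add, ← Int.negOnePow_add,
    ← Units.val_neg, ← Int.negOnePow_succ]
  -- The exponents on the two sides differ by `2a`.
  exact congrArg Units.val ((Int.negOnePow_eq_iff _ _).2 ⟨a, by ring⟩)

/-! ### Sums of volume contractions, antisymmetry of the bracket, commutativity of the product. -/

section HamiltonianAlgebra

variable {n : ℕ} {M : Type*} [TopologicalSpace M]
  [ChartedSpace (EuclideanSpace ℝ (Fin (n + 1))) M] [IsManifold (𝓡 (n + 1)) ∞ M]
  {G : Type*} [NormedAddCommGroup G] [NormedSpace ℝ G] [FiniteDimensional ℝ G]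
  {Q : M → Type*} [TopologicalSpace (TotalSpace G Q)]
  [∀ x, AddCommGroup (Q x)] [∀ x, Module ℝ (Q x)] [∀ x, TopologicalSpace (Q x)]
  [FiberBundle G Q] [VectorBundle ℝ G Q]
  {B : OrientedMetric n M}
  {S : (z : TotalSpace G Q) → TangentSpace ((𝓡 (n + 1)).prod 𝓘(ℝ, G)) z →ₗ[ℝ]
    TangentSpace (𝓡 (n + 1)) z.proj × Q z.proj}
  {J κ : Type*} [Fintype J] [DecidableEq J] [Fintype κ]
  [ContMDiffVectorBundle ∞ G Q (𝓡 (n + 1))]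
  {ν : (x : M) → J → Module.Dual ℝ (Q x)} {w : (x : M) → J → Q x}
  {Om : FormOn ((𝓡 (n + 1)).prod 𝓘(ℝ, G)) (TotalSpace G Q)}
  {ν₀ : J → Module.Dual ℝ G} {w₀ : J → G} {ε e : κ → Module.Dual ℝ G} {b : κ → BaseModel n}
  {α β : FormOn ((𝓡 (n + 1)).prod 𝓘(ℝ, G)) (TotalSpace G Q)}

theorem isVolContraction_zero (x₀ : M) (z : TotalSpace G Q) :
    IsVolContraction B S x₀ 0 z 0 := by
  exact (formPullback_zero _).trans (map_zero (horHook G (B.volAt x₀ z.proj))).symm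

theorem IsVolContraction.add {x₀ : M} {z : TotalSpace G Q} {Y Z : ExteriorAlgebra ℝ (BaseModel n)}
    (h : IsVolContraction B S x₀ α z Y) (h' : IsVolContraction B S x₀ β z Z) :
    IsVolContraction B S x₀ (α + β) z (Y + Z) := by
  refine Eq.trans ?_ (map_add (horHook G (B.volAt x₀ z.proj)) Y Z).symm
  exact (formPullback_add _ _ _).trans (congrArg₂ _ h h')

theorem IsVolContraction.zsmul {x₀ : M} {z : TotalSpace G Q} {Y : ExteriorAlgebra ℝ (BaseModel n)}
    (h : IsVolContraction B S x₀ α z Y) (k : ℤ) :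
    IsVolContraction B S x₀ (k • α) z (k • Y) := by
  refine Eq.trans ?_ (map_zsmul (horHook G (B.volAt x₀ z.proj)) k Y).symm
  exact (formPullback_zsmul _ _ _).trans (congrArg _ h)

theorem IsHamPair.fieldBracket_antisymm {r s : ℤ}
    {X Y : MultivectorOn ((𝓡 (n + 1)).prod 𝓘(ℝ, G)) (TotalSpace G Q)}
    (hX : IsHamPair S ν w Om r X α) (hY : IsHamPair S ν w Om s Y β) :
    fieldBracket Om r X Y = -(((n - r) * (n - s)).negOnePow : ℤ) • fieldBracket Om s Y X := by
  have h1 : (n : ℤ) + 1 - r = n - r + 1 := by ring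
  have h2 : (n : ℤ) + 1 - s = n - s + 1 := by ring
  refine funext fun z => ?_
  exact negOnePow_smul_hook_hook (a := n - r) (b := n - s) h1 h2 (hX.degree z) (hY.degree z)

theorem IsSmoothSplitting.splittingHodgeProduct_comm (hS : IsSmoothSplitting S) {r s : ℤ}
    (hα : IsSmoothHorizontal r α) (hβ : IsSmoothHorizontal s β) :
    splittingHodgeProduct B S α β =
      (((n + 1 - r) * (n + 1 - s)).negOnePow : ℤ) • splittingHodgeProduct B S β α := by
  funext z
  have hz := mem_trivDomain_self (n := n) (G := G) (Q := Q) z.proj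
  obtain ⟨Y, hY, h1⟩ := hS.exists_isVolContraction (B := B) hα hz
  obtain ⟨Z, hZ, h2⟩ := hS.exists_isVolContraction (B := B) hβ hz
  have h3 := hS.isVolContraction_splittingHodgeProduct hz h1 h2
  have h4 := (hS.isVolContraction_splittingHodgeProduct hz h2 h1).zsmul
    ((n + 1 - r) * (n + 1 - s)).negOnePow
  rw [← ext_mul_comm hY hZ] at h4
  exact hS.readForm_injective hz (h3.trans h4.symm)

end HamiltonianAlgebra

/-! ### Smoothness of brackets, products and the multisymplectic form. -/

section HamiltonianSmoothness

attribute [local instance] extNormedAddCommGroup extNormedSpace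

variable {n : ℕ} {M : Type*} [TopologicalSpace M]
  [ChartedSpace (EuclideanSpace ℝ (Fin (n + 1))) M] [IsManifold (𝓡 (n + 1)) ∞ M]
  {G : Type*} [NormedAddCommGroup G] [NormedSpace ℝ G] [FiniteDimensional ℝ G]
  {Q : M → Type*} [TopologicalSpace (TotalSpace G Q)]
  [∀ x, AddCommGroup (Q x)] [∀ x, Module ℝ (Q x)] [∀ x, TopologicalSpace (Q x)]
  [FiberBundle G Q] [VectorBundle ℝ G Q]
  {B : OrientedMetric n M}
  {S : (z : TotalSpace G Q) → TangentSpace ((𝓡 (n + 1)).prod 𝓘(ℝ, G)) z →ₗ[ℝ]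
    TangentSpace (𝓡 (n + 1)) z.proj × Q z.proj}
  [ContMDiffVectorBundle ∞ G Q (𝓡 (n + 1))]
  {Om α β : FormOn ((𝓡 (n + 1)).prod 𝓘(ℝ, G)) (TotalSpace G Q)}

namespace IsSmoothSplitting

variable (hS : IsSmoothSplitting S)
include hS

theorem isSmoothForm_fieldBracket
    (hOm : IsSmoothForm ((𝓡 (n + 1)).prod 𝓘(ℝ, G)) Om) (r : ℤ)
    {X Y : MultivectorOn ((𝓡 (n + 1)).prod 𝓘(ℝ, G)) (TotalSpace G Q)}
    (hX : IsSmoothMultivector ((𝓡 (n + 1)).prod 𝓘(ℝ, G)) X)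
    (hY : IsSmoothMultivector ((𝓡 (n + 1)).prod 𝓘(ℝ, G)) Y) :
    IsSmoothForm ((𝓡 (n + 1)).prod 𝓘(ℝ, G)) (fieldBracket Om r X Y) := by
  refine hS.isSmoothForm_iff.2 fun x₀ z hz => ?_
  have h1 := contMDiffAt_bilinear (hook (T := BaseModel n × G)).toLinearMap
    (hS.isSmoothMultivector_iff.1 hY x₀ z hz) (hS.isSmoothForm_iff.1 hOm x₀ z hz)
  have h2 := contMDiffAt_bilinear (hook (T := BaseModel n × G)).toLinearMap
    (hS.isSmoothMultivector_iff.1 hX x₀ z hz) h1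
  have h3 := contMDiffAt_linear
    (((n + 1 - r).negOnePow : ℤ) • (LinearMap.id : ExtForm (BaseModel n × G) →ₗ[ℝ] _)) h2
  refine h3.congr_of_eventuallyEq ?_
  filter_upwards [eventually_mem_trivDomain hz] with y hy
  exact hS.readForm_fieldBracket Om r X Y hy

/-- The product is read as the contraction of the volume form with the wedge of two smooth
functions, so the Hodge operators need not be examined. -/
theorem isSmoothForm_splittingHodgeProduct {r s : ℤ}
    (hα : IsSmoothHorizontal r α) (hβ : IsSmoothHorizontal s β) :
    IsSmoothForm ((𝓡 (n + 1)).prod 𝓘(ℝ, G)) (splittingHodgeProduct B S α β) := by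
  refine hS.isSmoothForm_iff.2 fun x₀ z hz => ?_
  obtain ⟨φ, hφ⟩ := hS.exists_volContraction_function (B := B) hα x₀
  obtain ⟨γ, hγ⟩ := hS.exists_volContraction_function (B := B) hβ x₀
  have hvol : ContMDiffAt ((𝓡 (n + 1)).prod 𝓘(ℝ, G)) 𝓘(ℝ, ExtForm (BaseModel n)) ∞
      (fun z : TotalSpace G Q => B.volAt x₀ z.proj) z :=
    (B.contMDiffAt_volAt hz.2).comp z (contMDiffAt_proj Q)
  have h1 := contMDiffAt_bilinear (hook (T := BaseModel n)).toLinearMap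
    (contMDiffAt_ext_mul (hφ z hz).1 (hγ z hz).1) hvol
  refine (contMDiffAt_linear (horForm G).toLinearMap h1).congr_of_eventuallyEq ?_
  filter_upwards [eventually_mem_trivDomain hz] with y hy
  exact hS.isVolContraction_splittingHodgeProduct hy (hφ y hy).2.2 (hγ y hy).2.2

theorem isVolFunction_splittingHodgeProduct {x₀ x : M} (hx : x ∈ trivDomain n G Q x₀)
    {φ γ : G → ExteriorAlgebra ℝ (BaseModel n)} (h : IsVolFunction B S x₀ x α φ)
    (h' : IsVolFunction B S x₀ x β γ) :
    IsVolFunction B S x₀ x (splittingHodgeProduct B S α β) fun g => φ g * γ g := fun g =>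
  hS.isVolContraction_splittingHodgeProduct (z := fibrePoint Q x₀ x g) hx (h g) (h' g)

theorem isSmoothForm_of_readForm_eq {κ : Type*} [Fintype κ] {ε e : κ → Module.Dual ℝ G}
    {b : κ → BaseModel n} (h : ∀ (x₀ : M) (z : TotalSpace G Q), z.proj ∈ trivDomain n G Q x₀ →
      readForm S x₀ Om z = polyForm ε e b (B.volAt x₀ z.proj)) :
    IsSmoothForm ((𝓡 (n + 1)).prod 𝓘(ℝ, G)) Om := by
  refine hS.isSmoothForm_iff.2 fun x₀ z hz => ?_
  have h1 : ContMDiffAt ((𝓡 (n + 1)).prod 𝓘(ℝ, G)) 𝓘(ℝ, ℝ) ∞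
      (fun z : TotalSpace G Q => B.volCoef x₀ z.proj) z :=
    (B.contMDiffAt_volCoef hz.2).comp z (contMDiffAt_proj Q)
  have h2 : ContMDiffAt ((𝓡 (n + 1)).prod 𝓘(ℝ, G)) 𝓘(ℝ, ExtForm (BaseModel n × G)) ∞
      (fun z : TotalSpace G Q => B.volCoef x₀ z.proj • polyForm ε e b (B.volAt x₀ x₀)) z :=
    h1.smul contMDiffAt_const
  refine h2.congr_of_eventuallyEq ?_
  filter_upwards [eventually_mem_trivDomain hz] with y hy
  rw [h x₀ y hy, B.volAt_eq_smul, polyForm_smul]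

end IsSmoothSplitting

end HamiltonianSmoothness

/-! ### The proposition for a bundle with a polysymplectic form of constant coefficients. -/

section HamiltonianBracket

variable {n : ℕ} {M : Type*} [TopologicalSpace M]
  [ChartedSpace (EuclideanSpace ℝ (Fin (n + 1))) M] [IsManifold (𝓡 (n + 1)) ∞ M]
  {G : Type*} [NormedAddCommGroup G] [NormedSpace ℝ G] [FiniteDimensional ℝ G]
  {Q : M → Type*} [TopologicalSpace (TotalSpace G Q)]
  [∀ x, AddCommGroup (Q x)] [∀ x, Module ℝ (Q x)] [∀ x, TopologicalSpace (Q x)]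
  [FiberBundle G Q] [VectorBundle ℝ G Q]
  {B : OrientedMetric n M}
  {S : (z : TotalSpace G Q) → TangentSpace ((𝓡 (n + 1)).prod 𝓘(ℝ, G)) z →ₗ[ℝ]
    TangentSpace (𝓡 (n + 1)) z.proj × Q z.proj}
  {J κ : Type*} [Fintype J] [DecidableEq J] [Fintype κ]
  [ContMDiffVectorBundle ∞ G Q (𝓡 (n + 1))]
  {ν : (x : M) → J → Module.Dual ℝ (Q x)} {w : (x : M) → J → Q x}
  {Om : FormOn ((𝓡 (n + 1)).prod 𝓘(ℝ, G)) (TotalSpace G Q)}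
  {ν₀ : J → Module.Dual ℝ G} {w₀ : J → G} {ε e : κ → Module.Dual ℝ G} {b : κ → BaseModel n}
  {α β γ : FormOn ((𝓡 (n + 1)).prod 𝓘(ℝ, G)) (TotalSpace G Q)} {r s t : ℤ}
  {X Y Z U U' U'' : MultivectorOn ((𝓡 (n + 1)).prod 𝓘(ℝ, G)) (TotalSpace G Q)}

namespace IsPolysymplectic

variable (hP : IsPolysymplectic B S ν w Om ν₀ w₀ ε e b)
include hP

/-- On each fibre `ModelHamiltonian.bracket` supplies the coefficients of the bracket;
`exists_isHamPair` turns them into a smooth field. -/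
theorem exists_isHamPair_fieldBracket [T2Space M] [SecondCountableTopology M]
    (hX : IsHamPair S ν w Om r X α) (hY : IsHamPair S ν w Om s Y β) :
    ∃ Z, IsHamPair S ν w Om (r + s - n) Z (fieldBracket Om r X Y) := by
  have hd : (n : ℤ) + 1 - r + (n + 1 - s) - 1 = n + 1 - (r + s - n) := by ring
  have key : ∀ x, ∃ (φ : G → ExteriorAlgebra ℝ (BaseModel n))
      (Z : J → G → ExteriorAlgebra ℝ (BaseModel n)),
      IsVolFunction B S x x (fieldBracket Om r X Y) φ ∧
      ModelHamiltonian w₀ (fun N K => polySymp ε e b (w₀ N) (w₀ K)) (n + 1 - (r + s - n)) Z φ := by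
    intro x
    have hx := mem_trivDomain_self (n := n) (G := G) (Q := Q) x
    obtain ⟨φ, -, -, hφ⟩ := hP.splitting.exists_isVolFunction (B := B) hX.horizontalForm hx
    obtain ⟨γ, -, -, hγ⟩ := hP.splitting.exists_isVolFunction (B := B) hY.horizontalForm hx
    have h1 := (hP.modelHamiltonian hX hx hφ).bracket (fun N K => polySymp_swap _ _ _ _ _)
      (hP.modelHamiltonian hY hx hγ)
    rw [hd] at h1
    exact ⟨_, _, hP.isVolFunction_fieldBracket hX hY hx hγ, h1⟩
  refine hP.exists_isHamPair (hP.splitting.isSmoothHorizontal (B := B)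
    (hP.splitting.isSmoothForm_fieldBracket
      (hP.splitting.isSmoothForm_of_readForm_eq hP.readForm_eq) r hX.smooth hY.smooth)
    fun x => ?_) key
  obtain ⟨φ, Z, h1, h2⟩ := key x
  exact ⟨φ, h2.degree, h1⟩

theorem exists_isHamPair_splittingHodgeProduct [T2Space M] [SecondCountableTopology M]
    (hX : IsHamPair S ν w Om r X α) (hY : IsHamPair S ν w Om s Y β) :
    ∃ Z, IsHamPair S ν w Om (r + s - (n + 1)) Z (splittingHodgeProduct B S α β) := by
  have hd : (n : ℤ) + 1 - r + (n + 1 - s) = n + 1 - (r + s - (n + 1)) := by ring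
  have key : ∀ x, ∃ (φ : G → ExteriorAlgebra ℝ (BaseModel n))
      (Z : J → G → ExteriorAlgebra ℝ (BaseModel n)),
      IsVolFunction B S x x (splittingHodgeProduct B S α β) φ ∧
      ModelHamiltonian w₀ (fun N K => polySymp ε e b (w₀ N) (w₀ K))
        (n + 1 - (r + s - (n + 1))) Z φ := by
    intro x
    have hx := mem_trivDomain_self (n := n) (G := G) (Q := Q) x
    obtain ⟨φ, -, -, hφ⟩ := hP.splitting.exists_isVolFunction (B := B) hX.horizontalForm hx
    obtain ⟨γ, -, -, hγ⟩ := hP.splitting.exists_isVolFunction (B := B) hY.horizontalForm hx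
    have h1 := (hP.modelHamiltonian hX hx hφ).mul (hP.modelHamiltonian hY hx hγ)
    rw [hd] at h1
    exact ⟨_, _, hP.splitting.isVolFunction_splittingHodgeProduct hx hφ hγ, h1⟩
  refine hP.exists_isHamPair (hP.splitting.isSmoothHorizontal (B := B)
    (hP.splitting.isSmoothForm_splittingHodgeProduct hX.horizontalForm hY.horizontalForm)
    fun x => ?_) key
  obtain ⟨φ, Z, h1, h2⟩ := key x
  exact ⟨φ, h2.degree, h1⟩

/-- On a fibre an outer bracket depends only on the outer field and on the function of the inner
bracket. Hence arbitrary Hamiltonian fields `U`, `U'`, `U''` of the inner brackets are allowed. -/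
theorem fieldBracket_jacobi (hX : IsHamPair S ν w Om r X α) (hY : IsHamPair S ν w Om s Y β)
    (hZ : IsHamPair S ν w Om t Z γ)
    (hU : IsHamPair S ν w Om (s + t - n) U (fieldBracket Om s Y Z))
    (hU' : IsHamPair S ν w Om (t + r - n) U' (fieldBracket Om t Z X))
    (hU'' : IsHamPair S ν w Om (r + s - n) U'' (fieldBracket Om r X Y)) :
    (((n - r) * (n - t)).negOnePow : ℤ) • fieldBracket Om r X U +
      (((n - s) * (n - r)).negOnePow : ℤ) • fieldBracket Om s Y U' +
      (((n - t) * (n - s)).negOnePow : ℤ) • fieldBracket Om t Z U'' = 0 := by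
  refine hP.splitting.eq_of_isVolFunction (B := B) fun x => ?_
  have hx := mem_trivDomain_self (n := n) (G := G) (Q := Q) x
  obtain ⟨φ, -, -, hφ⟩ := hP.splitting.exists_isVolFunction (B := B) hX.horizontalForm hx
  obtain ⟨ψ, -, -, hψ⟩ := hP.splitting.exists_isVolFunction (B := B) hY.horizontalForm hx
  obtain ⟨η, -, -, hη⟩ := hP.splitting.exists_isVolFunction (B := B) hZ.horizontalForm hx
  refine ⟨fun _ => 0, fun g => ?_, fun g => isVolContraction_zero _ _⟩
  have h1 := ((((hP.isVolFunction_fieldBracket hX hU hx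
      (hP.isVolFunction_fieldBracket hY hZ hx hη)) g).zsmul ((n - r) * (n - t)).negOnePow).add
    (((hP.isVolFunction_fieldBracket hY hU' hx
      (hP.isVolFunction_fieldBracket hZ hX hx hφ)) g).zsmul ((n - s) * (n - r)).negOnePow)).add
    (((hP.isVolFunction_fieldBracket hZ hU'' hx
      (hP.isVolFunction_fieldBracket hX hY hx hψ)) g).zsmul ((n - t) * (n - s)).negOnePow)
  have h2 := (hP.modelHamiltonian hX hx hφ).jacobi (fun N K => polySymp_swap _ _ _ _ _)
    (hP.modelHamiltonian hY hx hψ) (hP.modelHamiltonian hZ hx hη) g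
  have hd : ∀ k : ℤ, (n : ℤ) + 1 - k - 1 = n - k := fun k => by ring
  rw [hd, hd, hd] at h2
  rwa [h2] at h1

theorem fieldBracket_splittingHodgeProduct (hX : IsHamPair S ν w Om r X α)
    (hY : IsHamPair S ν w Om s Y β) (hZ : IsHamPair S ν w Om t Z γ)
    (hU : IsHamPair S ν w Om (s + t - (n + 1)) U (splittingHodgeProduct B S β γ)) :
    fieldBracket Om r X U = splittingHodgeProduct B S (fieldBracket Om r X Y) γ +
      (((n - r) * (n + 1 - s)).negOnePow : ℤ) •
        splittingHodgeProduct B S β (fieldBracket Om r X Z) := by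
  refine hP.splitting.eq_of_isVolFunction (B := B) fun x => ?_
  have hx := mem_trivDomain_self (n := n) (G := G) (Q := Q) x
  obtain ⟨φ, -, -, hφ⟩ := hP.splitting.exists_isVolFunction (B := B) hX.horizontalForm hx
  obtain ⟨ψ, -, -, hψ⟩ := hP.splitting.exists_isVolFunction (B := B) hY.horizontalForm hx
  obtain ⟨η, -, -, hη⟩ := hP.splitting.exists_isVolFunction (B := B) hZ.horizontalForm hx
  refine ⟨_, hP.isVolFunction_fieldBracket hX hU hx
    (hP.splitting.isVolFunction_splittingHodgeProduct hx hψ hη), fun g => ?_⟩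
  have h1 := ((hP.splitting.isVolFunction_splittingHodgeProduct hx
      (hP.isVolFunction_fieldBracket hX hY hx hψ) hη) g).add
    (((hP.splitting.isVolFunction_splittingHodgeProduct hx hψ
      (hP.isVolFunction_fieldBracket hX hZ hx hη)) g).zsmul ((n - r) * (n + 1 - s)).negOnePow)
  have hψ' := hP.modelHamiltonian hY hx hψ
  have h2 := modelBracket_mul (w := w₀) (hP.modelHamiltonian hX hx hφ).degree_field hψ'.smooth
    (hP.modelHamiltonian hZ hx hη).smooth hψ'.degree g
  rw [show (n : ℤ) + 1 - r - 1 = n - r by ring] at h2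
  rwa [← h2] at h1

end IsPolysymplectic

end HamiltonianBracket

/-! ### Sums of two bundles with connections and a trivial line bundle. -/

section ProductBundle

variable {n : ℕ} {M : Type*} [TopologicalSpace M]
  [ChartedSpace (EuclideanSpace ℝ (Fin (n + 1))) M] [IsManifold (𝓡 (n + 1)) ∞ M]
  {F : Type*} [NormedAddCommGroup F] [NormedSpace ℝ F] [FiniteDimensional ℝ F]
  {V : M → Type*} [TopologicalSpace (TotalSpace F V)]
  [∀ x, AddCommGroup (V x)] [∀ x, Module ℝ (V x)] [∀ x, TopologicalSpace (V x)]
  [FiberBundle F V] [VectorBundle ℝ F V]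
  {K : Type*} [NormedAddCommGroup K] [NormedSpace ℝ K] [FiniteDimensional ℝ K]
  {D : M → Type*} [TopologicalSpace (TotalSpace K D)]
  [∀ x, AddCommGroup (D x)] [∀ x, Module ℝ (D x)] [∀ x, TopologicalSpace (D x)]
  [FiberBundle K D] [VectorBundle ℝ K D]

variable (M) in
/-- The fibres of the sum of two bundles and a trivial line bundle. -/
abbrev SumFiber (V D : M → Type*) (x : M) : Type _ := (V x × D x) × Trivial M ℝ x

/-- The projection to the first summand. -/
def sumFst (z : TotalSpace ((F × K) × ℝ) (SumFiber M V D)) : TotalSpace F V := ⟨z.proj, z.2.1.1⟩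

/-- The projection to the second summand. -/
def sumSnd (z : TotalSpace ((F × K) × ℝ) (SumFiber M V D)) : TotalSpace K D := ⟨z.proj, z.2.1.2⟩

/-- The coordinate of the trivial summand. -/
def sumScalar (z : TotalSpace ((F × K) × ℝ) (SumFiber M V D)) : ℝ := z.2.2

theorem mem_baseSet_sum {x₀ x : M} :
    x ∈ (trivializationAt ((F × K) × ℝ) (SumFiber M V D) x₀).baseSet ↔
      x ∈ (trivializationAt F V x₀).baseSet ∧ x ∈ (trivializationAt K D x₀).baseSet :=
  and_iff_left trivial

theorem fibMap_sum {x₀ x : M}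
    (hx : x ∈ (trivializationAt ((F × K) × ℝ) (SumFiber M V D) x₀).baseSet) (q : SumFiber M V D x) :
    fibMap ((F × K) × ℝ) x₀ x q = ((fibMap F x₀ x q.1.1, fibMap K x₀ x q.1.2), q.2) := by
  rw [fibMap_apply hx, fibMap_apply (mem_baseSet_sum.1 hx).1, fibMap_apply (mem_baseSet_sum.1 hx).2]
  rfl

theorem fibInv_sum {x₀ x : M}
    (hx : x ∈ (trivializationAt ((F × K) × ℝ) (SumFiber M V D) x₀).baseSet) (q : (F × K) × ℝ) :
    (fibInv ((F × K) × ℝ) x₀ x q : SumFiber M V D x) =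
      ((fibInv F x₀ x q.1.1, fibInv K x₀ x q.1.2), q.2) := by
  have h1 := fibMap_sum hx (((fibInv F x₀ x q.1.1, fibInv K x₀ x q.1.2), q.2) : SumFiber M V D x)
  rw [fibMap_fibInv (mem_baseSet_sum.1 hx).1, fibMap_fibInv (mem_baseSet_sum.1 hx).2] at h1
  rw [← fibInv_fibMap hx (((fibInv F x₀ x q.1.1, fibInv K x₀ x q.1.2), q.2) : SumFiber M V D x), h1]

/-- The splitting of the tangent spaces of a sum of bundles with connections. -/
def sumSplitting (covV : ((x : M) → V x) → (x : M) → TangentSpace (𝓡 (n + 1)) x →ₗ[ℝ] V x)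
    (covD : ((x : M) → D x) → (x : M) → TangentSpace (𝓡 (n + 1)) x →ₗ[ℝ] D x)
    (z : TotalSpace ((F × K) × ℝ) (SumFiber M V D)) :
    TangentSpace ((𝓡 (n + 1)).prod 𝓘(ℝ, (F × K) × ℝ)) z →ₗ[ℝ]
      TangentSpace (𝓡 (n + 1)) z.proj × SumFiber M V D z.proj :=
  (totalProjTangent n ((F × K) × ℝ) (SumFiber M V D) z).prod
    (((connectionMap F covV (sumFst z) ∘ₗ (mfderiv ((𝓡 (n + 1)).prod 𝓘(ℝ, (F × K) × ℝ))
        ((𝓡 (n + 1)).prod 𝓘(ℝ, F)) sumFst z).toLinearMap).prod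
      (connectionMap K covD (sumSnd z) ∘ₗ (mfderiv ((𝓡 (n + 1)).prod 𝓘(ℝ, (F × K) × ℝ))
        ((𝓡 (n + 1)).prod 𝓘(ℝ, K)) sumSnd z).toLinearMap)).prod
      (mvfderiv ((𝓡 (n + 1)).prod 𝓘(ℝ, (F × K) × ℝ)) sumScalar z).toLinearMap)

variable [ContMDiffVectorBundle ∞ F V (𝓡 (n + 1))] [ContMDiffVectorBundle ∞ K D (𝓡 (n + 1))]

theorem contMDiffAt_snd_trivialization {x₀ : M} {z : TotalSpace F V}
    (hz : z.proj ∈ (trivializationAt F V x₀).baseSet) :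
    ContMDiffAt ((𝓡 (n + 1)).prod 𝓘(ℝ, F)) 𝓘(ℝ, F) ∞
      (fun w : TotalSpace F V => (trivializationAt F V x₀ w).2) z :=
  (((trivializationAt F V x₀).contMDiffAt_iff (IB := 𝓡 (n + 1)) (n := ∞)
    (IM := (𝓡 (n + 1)).prod 𝓘(ℝ, F)) (f := fun w : TotalSpace F V => w) (x₀ := z)
    ((trivializationAt F V x₀).mem_source.2 hz)).1 contMDiffAt_id).2

theorem contMDiffAt_sum_trivialization {x₀ : M} {z : TotalSpace ((F × K) × ℝ) (SumFiber M V D)}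
    (hz : z.proj ∈ (trivializationAt ((F × K) × ℝ) (SumFiber M V D) x₀).baseSet) :
    ContMDiffAt ((𝓡 (n + 1)).prod 𝓘(ℝ, (F × K) × ℝ)) 𝓘(ℝ, F) ∞
      (fun w => (trivializationAt F V x₀ (sumFst w)).2) z ∧
    ContMDiffAt ((𝓡 (n + 1)).prod 𝓘(ℝ, (F × K) × ℝ)) 𝓘(ℝ, K) ∞
      (fun w => (trivializationAt K D x₀ (sumSnd w)).2) z := by
  have h := contMDiffAt_snd_trivialization (n := n) hz
  exact ⟨contMDiffAt_clm (A := (F × K) × ℝ) (C := F)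
      ((ContinuousLinearMap.fst ℝ F K).comp (ContinuousLinearMap.fst ℝ (F × K) ℝ)) h,
    contMDiffAt_clm (A := (F × K) × ℝ) (C := K)
      ((ContinuousLinearMap.snd ℝ F K).comp (ContinuousLinearMap.fst ℝ (F × K) ℝ)) h⟩

theorem mdifferentiableAt_sumFst (z : TotalSpace ((F × K) × ℝ) (SumFiber M V D)) :
    MDifferentiableAt ((𝓡 (n + 1)).prod 𝓘(ℝ, (F × K) × ℝ)) ((𝓡 (n + 1)).prod 𝓘(ℝ, F))
      sumFst z := by
  have h : ContMDiffAt ((𝓡 (n + 1)).prod 𝓘(ℝ, (F × K) × ℝ)) ((𝓡 (n + 1)).prod 𝓘(ℝ, F)) ∞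
      (sumFst : TotalSpace ((F × K) × ℝ) (SumFiber M V D) → TotalSpace F V) z :=
    contMDiffAt_totalSpace.2 ⟨contMDiffAt_proj _,
      (contMDiffAt_sum_trivialization (V := V) (D := D) (mem_baseSet_trivializationAt _ _ z.proj)).1⟩
  exact h.mdifferentiableAt (by simp)

theorem mdifferentiableAt_sumSnd (z : TotalSpace ((F × K) × ℝ) (SumFiber M V D)) :
    MDifferentiableAt ((𝓡 (n + 1)).prod 𝓘(ℝ, (F × K) × ℝ)) ((𝓡 (n + 1)).prod 𝓘(ℝ, K))
      sumSnd z := by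
  have h : ContMDiffAt ((𝓡 (n + 1)).prod 𝓘(ℝ, (F × K) × ℝ)) ((𝓡 (n + 1)).prod 𝓘(ℝ, K)) ∞
      (sumSnd : TotalSpace ((F × K) × ℝ) (SumFiber M V D) → TotalSpace K D) z :=
    contMDiffAt_totalSpace.2 ⟨contMDiffAt_proj _,
      (contMDiffAt_sum_trivialization (V := V) (D := D) (mem_baseSet_trivializationAt _ _ z.proj)).2⟩
  exact h.mdifferentiableAt (by simp)

theorem mfderiv_proj_sumFst (z : TotalSpace ((F × K) × ℝ) (SumFiber M V D))
    (ξ : TangentSpace ((𝓡 (n + 1)).prod 𝓘(ℝ, (F × K) × ℝ)) z) :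
    mfderiv ((𝓡 (n + 1)).prod 𝓘(ℝ, F)) (𝓡 (n + 1)) (TotalSpace.proj : TotalSpace F V → M)
      (sumFst z) (mfderiv ((𝓡 (n + 1)).prod 𝓘(ℝ, (F × K) × ℝ)) ((𝓡 (n + 1)).prod 𝓘(ℝ, F))
        sumFst z ξ) = totalProjTangent n ((F × K) × ℝ) (SumFiber M V D) z ξ :=
  (mfderiv_comp_apply z (mdifferentiableAt_proj V) (mdifferentiableAt_sumFst z) ξ).symm

theorem mfderiv_proj_sumSnd (z : TotalSpace ((F × K) × ℝ) (SumFiber M V D))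
    (ξ : TangentSpace ((𝓡 (n + 1)).prod 𝓘(ℝ, (F × K) × ℝ)) z) :
    mfderiv ((𝓡 (n + 1)).prod 𝓘(ℝ, K)) (𝓡 (n + 1)) (TotalSpace.proj : TotalSpace K D → M)
      (sumSnd z) (mfderiv ((𝓡 (n + 1)).prod 𝓘(ℝ, (F × K) × ℝ)) ((𝓡 (n + 1)).prod 𝓘(ℝ, K))
        sumSnd z ξ) = totalProjTangent n ((F × K) × ℝ) (SumFiber M V D) z ξ :=
  (mfderiv_comp_apply z (mdifferentiableAt_proj D) (mdifferentiableAt_sumSnd z) ξ).symm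

theorem contMDiffAt_clm_prod {E₁ H N A C C' : Type*} [NormedAddCommGroup E₁] [NormedSpace ℝ E₁]
    [TopologicalSpace H] {I : ModelWithCorners ℝ E₁ H} [TopologicalSpace N] [ChartedSpace H N]
    [NormedAddCommGroup A] [NormedSpace ℝ A] [NormedAddCommGroup C] [NormedSpace ℝ C]
    [NormedAddCommGroup C'] [NormedSpace ℝ C'] {x₀ : N} {a : N → A →L[ℝ] C} {b : N → A →L[ℝ] C'}
    (ha : ContMDiffAt I 𝓘(ℝ, A →L[ℝ] C) ∞ a x₀) (hb : ContMDiffAt I 𝓘(ℝ, A →L[ℝ] C') ∞ b x₀) :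
    ContMDiffAt I 𝓘(ℝ, A →L[ℝ] C × C') ∞ (fun x => (a x).prod (b x)) x₀ :=
  contMDiffAt_clm (A := (A →L[ℝ] C) × (A →L[ℝ] C')) (C := A →L[ℝ] C × C')
    (ContinuousLinearMap.prodₗᵢ ℝ (𝕜 := ℝ)).toContinuousLinearEquiv.toContinuousLinearMap
    (ha.prodMk_space hb)

theorem isSmoothSplitting_sumSplitting
    {covV : ((x : M) → V x) → (x : M) → TangentSpace (𝓡 (n + 1)) x →ₗ[ℝ] V x}
    {covD : ((x : M) → D x) → (x : M) → TangentSpace (𝓡 (n + 1)) x →ₗ[ℝ] D x}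
    (hV : ∀ x₀, ∃ c : M → F →L[ℝ] BaseModel n →L[ℝ] F,
      ContMDiffAt (𝓡 (n + 1)) 𝓘(ℝ, F →L[ℝ] BaseModel n →L[ℝ] F) ∞ c x₀ ∧
      ∀ x ∈ trivDomain n F V x₀, HasChristoffelAt F covV x₀ x (c x))
    (hD : ∀ x₀, ∃ c : M → K →L[ℝ] BaseModel n →L[ℝ] K,
      ContMDiffAt (𝓡 (n + 1)) 𝓘(ℝ, K →L[ℝ] BaseModel n →L[ℝ] K) ∞ c x₀ ∧
      ∀ x ∈ trivDomain n F V x₀, HasChristoffelAt K covD x₀ x (c x)) :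
    IsSmoothSplitting (sumSplitting (F := F) (K := K) covV covD) where
  fst_eq z ξ := rfl
  exists_christoffel x₀ := by
    obtain ⟨c, hc, hc'⟩ := hV x₀
    obtain ⟨d, hd, hd'⟩ := hD x₀
    -- The trivializations are direct sums, so the Christoffel symbols are block diagonal; the final
    -- `0` is the trivial connection of the line bundle.
    refine ⟨fun z => ((c z.proj (trivializationAt F V x₀ (sumFst z)).2).prod
      (d z.proj (trivializationAt K D x₀ (sumSnd z)).2)).prod 0, ?_, ?_⟩
    · rintro z rfl
      have h1 := contMDiffAt_sum_trivialization (n := n) (F := F) (V := V) (K := K) (D := D)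
        (mem_baseSet_trivializationAt ((F × K) × ℝ) (SumFiber M V D) z.proj)
      have hproj : ContMDiffAt ((𝓡 (n + 1)).prod 𝓘(ℝ, (F × K) × ℝ)) (𝓡 (n + 1)) ∞
        (TotalSpace.proj : TotalSpace ((F × K) × ℝ) (SumFiber M V D) → M) z := contMDiffAt_proj _
      have h2 := (hc.comp z hproj).clm_apply h1.1
      have h3 := (hd.comp z hproj).clm_apply h1.2
      exact contMDiffAt_clm_prod (contMDiffAt_clm_prod h2 h3) contMDiffAt_const
    · intro z hz ξ
      have hz1 := mem_baseSet_sum.1 hz.1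
      rw [fibMap_sum hz.1]
      have e1 := fibMap_connectionMap (z := sumFst z) hz1.1 (hc' z.proj ⟨hz1.1, hz.2⟩)
        (mfderiv ((𝓡 (n + 1)).prod 𝓘(ℝ, (F × K) × ℝ)) ((𝓡 (n + 1)).prod 𝓘(ℝ, F)) sumFst z ξ)
      have e2 := fibMap_connectionMap (z := sumSnd z) hz1.2 (hd' z.proj ⟨hz1.1, hz.2⟩)
        (mfderiv ((𝓡 (n + 1)).prod 𝓘(ℝ, (F × K) × ℝ)) ((𝓡 (n + 1)).prod 𝓘(ℝ, K)) sumSnd z ξ)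
      have hd := (contMDiffAt_snd_trivialization (n := n) hz.1).mdifferentiableAt (by simp)
      have h1 := mvfderiv_comp_map (mdifferentiableAt_snd_trivialization (n := n)
        (z := sumFst z) hz1.1) (mdifferentiableAt_sumFst z)
      have h2 := mvfderiv_comp_map (mdifferentiableAt_snd_trivialization (n := n)
        (z := sumSnd z) hz1.2) (mdifferentiableAt_sumSnd z)
      have h3 := mvfderiv_clm_comp_left
        ((ContinuousLinearMap.fst ℝ F K).comp (ContinuousLinearMap.fst ℝ (F × K) ℝ)) hd ξ
      have h4 := mvfderiv_clm_comp_left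
        ((ContinuousLinearMap.snd ℝ F K).comp (ContinuousLinearMap.fst ℝ (F × K) ℝ)) hd ξ
      have h5 := mvfderiv_clm_comp_left (ContinuousLinearMap.snd ℝ (F × K) ℝ) hd ξ
      rw [mfderiv_proj_sumFst, fibMap_apply (x := (sumFst z).proj) hz1.1 (sumFst z).2] at e1
      rw [mfderiv_proj_sumSnd, fibMap_apply (x := (sumSnd z).proj) hz1.2 (sumSnd z).2] at e2
      refine Prod.ext (Prod.ext ?_ ?_) ?_
      · refine e1.trans (congrArg₂ _ ?_ rfl)
        exact (congrArg (fun L => L ξ) h1).symm.trans h3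
      · refine e2.trans (congrArg₂ _ ?_ rfl)
        exact (congrArg (fun L => L ξ) h2).symm.trans h4
      · exact h5.trans (add_zero _).symm

end ProductBundle

/-! ### Contractions with the identity do not depend on the frame. -/

section FrameChange

theorem curveDeriv_add_smul {W : Type*} [AddCommGroup W] [Module ℝ W] (a b : W) :
    curveDeriv (fun t : ℝ => a + t • b) = b := by
  refine curveDeriv_eq fun f => ?_
  simp only [map_add, map_smul, smul_eq_mul]
  simpa using ((hasDerivAt_id (0 : ℝ)).mul_const (f b)).const_add (f a)

/-- Both sums are the contraction of `Φ` with the identity tensor of `W`. -/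
theorem sum_eq_of_sum_smul_eq {ι W R : Type*} [Fintype ι] [AddCommGroup W] [Module ℝ W]
    [FiniteDimensional ℝ W] [AddCommGroup R] [Module ℝ R] (Φ : Module.Dual ℝ W →ₗ[ℝ] W →ₗ[ℝ] R)
    {l : ι → Module.Dual ℝ W} {u : ι → W} (h : ∀ v, ∑ i, l i v • u i = v) {ι' : Type*} [Fintype ι']
    {l' : ι' → Module.Dual ℝ W} {u' : ι' → W} (h' : ∀ v, ∑ i, l' i v • u' i = v) :
    ∑ i, Φ (l i) (u i) = ∑ i, Φ (l' i) (u' i) := by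
  have h1 : ∀ i, l i = ∑ j, l i (u' j) • l' j := fun i => LinearMap.ext fun v => by
    conv_lhs => rw [← h' v]
    simp [mul_comm]
  calc ∑ i, Φ (l i) (u i) = ∑ i, ∑ j, Φ (l' j) (l i (u' j) • u i) := by
        refine Finset.sum_congr rfl fun i _ => ?_
        conv_lhs => rw [h1 i]
        simp only [map_sum, LinearMap.sum_apply, map_smul, LinearMap.smul_apply]
    _ = _ := by
        rw [Finset.sum_comm]
        refine Finset.sum_congr rfl fun j _ => ?_
        rw [← map_sum, h]

end FrameChange

/-! ### Vertical derivatives of forms whose coefficients are linear along the fibres. -/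

section CoefficientForms

/-- The form `u ∧ η` on a product. -/
def splitTerm {E W : Type*} [AddCommGroup E] [Module ℝ E] [AddCommGroup W] [Module ℝ W]
    (u : Module.Dual ℝ W) (η : ExtForm E) : ExtForm (E × W) :=
  ExteriorAlgebra.ι ℝ (u ∘ₗ LinearMap.snd ℝ E W) * formPullback (LinearMap.fst ℝ E W) η

theorem formPullback_sum_splitTerm {E E' W W' κ : Type*} [AddCommGroup E] [Module ℝ E]
    [AddCommGroup W] [Module ℝ W] [AddCommGroup E'] [Module ℝ E'] [AddCommGroup W'] [Module ℝ W']
    [Fintype κ] (f : E' →ₗ[ℝ] E) (g : W' →ₗ[ℝ] W) (ε u : κ → Module.Dual ℝ W) (b : κ → E')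
    (μ : ExtForm E) :
    formPullback (f.prodMap g) (∑ k, ExteriorAlgebra.ι ℝ (ε k ∘ₗ LinearMap.snd ℝ E W) *
      splitTerm (u k) (vectorHook (f (b k)) μ)) =
    polyForm (fun k => ε k ∘ₗ g) (fun k => u k ∘ₗ g) b (formPullback f μ) := by
  rw [polyForm, formPullback_sum]
  refine Finset.sum_congr rfl fun k _ => ?_
  rw [splitTerm, formPullback_mul, formPullback_mul, formPullback_ι, formPullback_ι,
    ← formPullback_comp, horForm, vectorHook_formPullback f, ← formPullback_comp]
  rfl

variable {n : ℕ} {M : Type*} [TopologicalSpace M]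
  [ChartedSpace (EuclideanSpace ℝ (Fin (n + 1))) M] [IsManifold (𝓡 (n + 1)) ∞ M]
  {G : Type*} [NormedAddCommGroup G] [NormedSpace ℝ G] [FiniteDimensional ℝ G]
  {Q : M → Type*} [TopologicalSpace (TotalSpace G Q)]
  [∀ x, AddCommGroup (Q x)] [∀ x, Module ℝ (Q x)] [∀ x, TopologicalSpace (Q x)]
  [FiberBundle G Q] [VectorBundle ℝ G Q]
  (B : OrientedMetric n M)
  (S : (z : TotalSpace G Q) → TangentSpace ((𝓡 (n + 1)).prod 𝓘(ℝ, G)) z →ₗ[ℝ]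
    TangentSpace (𝓡 (n + 1)) z.proj × Q z.proj)
  {J κ : Type*} [Fintype J] [Fintype κ]
  [ContMDiffVectorBundle ∞ G Q (𝓡 (n + 1))]
  {ν : (x : M) → J → Module.Dual ℝ (Q x)} {w : (x : M) → J → Q x}

variable {S}

theorem IsSmoothSplitting.comp_leftInverse (hS : IsSmoothSplitting S) (z : TotalSpace G Q) :
    S z ∘ₗ (S z).leftInverse = LinearMap.id :=
  LinearMap.ext fun v => hS.apply_leftInverse z v

theorem splittingVertD_sum {J' : Type*} [Fintype J'] (ν : (x : M) → J ⊕ J' → Module.Dual ℝ (Q x))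
    (w : (x : M) → J ⊕ J' → Q x) (α : FormOn ((𝓡 (n + 1)).prod 𝓘(ℝ, G)) (TotalSpace G Q))
    (z : TotalSpace G Q) : splittingVertD S ν w α z = formPullback (S z)
      (∑ N, ExteriorAlgebra.ι ℝ (ν z.proj (.inl N) ∘ₗ LinearMap.snd ℝ _ _) *
          splittingFibreDeriv S α z.proj z.2 (w z.proj (.inl N)) +
        ∑ N, ExteriorAlgebra.ι ℝ (ν z.proj (.inr N) ∘ₗ LinearMap.snd ℝ _ _) *
          splittingFibreDeriv S α z.proj z.2 (w z.proj (.inr N))) := by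
  rw [splittingVertD, Fintype.sum_sum_type]

/-- A linear coefficient `ε_k` has constant derivative `ε_k(w_N)`, and summing against the coframe
reassembles the covector `ε_k`. -/
theorem IsSmoothSplitting.splittingVertD_of_linear (hS : IsSmoothSplitting S)
    {α : FormOn ((𝓡 (n + 1)).prod 𝓘(ℝ, G)) (TotalSpace G Q)}
    {ε : (x : M) → κ → Module.Dual ℝ (Q x)}
    {θ : (x : M) → κ → ExtForm (TangentSpace (𝓡 (n + 1)) x × Q x)}
    (h : ∀ z, α z = formPullback (S z) (∑ k, ε z.proj k z.2 • θ z.proj k))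
    (hε : ∀ x k, ε x k = ∑ N, ε x k (w x N) • ν x N) (z : TotalSpace G Q) :
    splittingVertD S ν w α z = formPullback (S z)
      (∑ k, ExteriorAlgebra.ι ℝ (ε z.proj k ∘ₗ LinearMap.snd ℝ _ _) * θ z.proj k) := by
  have h1 : ∀ (x : M) (q : Q x), splittingForm S α x q = ∑ k, ε x k q • θ x k := by
    intro x q
    rw [splittingForm, h, ← formPullback_comp]
    rw [hS.comp_leftInverse, formPullback_id]
  have h2 : ∀ (x : M) (q v : Q x), splittingFibreDeriv S α x q v = ∑ k, ε x k v • θ x k := by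
    intro x q v
    have h3 : (fun t : ℝ => splittingForm S α x (q + t • v)) =
        fun t : ℝ => (∑ k, ε x k q • θ x k) + t • ∑ k, ε x k v • θ x k := by
      funext t
      rw [h1, Finset.smul_sum, ← Finset.sum_add_distrib]
      refine Finset.sum_congr rfl fun k _ => ?_
      rw [map_add, map_smul, add_smul, smul_assoc]
    rw [splittingFibreDeriv, h3, curveDeriv_add_smul]
  rw [splittingVertD]
  congr 1
  simp only [h2, Finset.mul_sum]
  rw [Finset.sum_comm]
  refine Finset.sum_congr rfl fun k _ => ?_
  have h4 : ε z.proj k ∘ₗ LinearMap.snd ℝ (TangentSpace (𝓡 (n + 1)) z.proj) (Q z.proj) =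
      ∑ N, ε z.proj k (w z.proj N) • (ν z.proj N ∘ₗ LinearMap.snd ℝ _ _) := by
    refine LinearMap.ext fun v => ?_
    have h5 := LinearMap.congr_fun (hε z.proj k) v.2
    rw [LinearMap.sum_apply] at h5 ⊢
    exact h5
  rw [h4, map_sum, Finset.sum_mul]
  refine Finset.sum_congr rfl fun N _ => ?_
  rw [map_smul, smul_mul_assoc, mul_smul_comm]

theorem IsSmoothSplitting.readForm_eq_polyForm (hS : IsSmoothSplitting S)
    {Om : FormOn ((𝓡 (n + 1)).prod 𝓘(ℝ, G)) (TotalSpace G Q)} {z : TotalSpace G Q}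
    {ε u : κ → Module.Dual ℝ (Q z.proj)} {b : κ → TangentSpace (𝓡 (n + 1)) z.proj}
    (h : Om z = formPullback (S z) (∑ k, ExteriorAlgebra.ι ℝ (ε k ∘ₗ LinearMap.snd ℝ _ _) *
      splitTerm (u k) (vectorHook (b k) (B.vol z.proj)))) {x₀ : M}
    (hz : z.proj ∈ trivDomain n G Q x₀) :
    readForm S x₀ Om z = polyForm (fun k => ε k ∘ₗ (fibInv G x₀ z.proj).toLinearMap)
      (fun k => u k ∘ₗ (fibInv G x₀ z.proj).toLinearMap)
      (fun k => tanMap (𝓡 (n + 1)) x₀ z.proj (b k)) (B.volAt x₀ z.proj) := by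
  have h1 : S z ∘ₗ splitChartInv S x₀ z = pairInv n G Q x₀ z.proj :=
    LinearMap.ext fun v => hS.apply_leftInverse z (pairInv n G Q x₀ z.proj v)
  have h2 : b = fun k => (tanInv (𝓡 (n + 1)) x₀ z.proj).toLinearMap
      (tanMap (𝓡 (n + 1)) x₀ z.proj (b k)) := funext fun k => (tanInv_tanMap hz.2 (b k)).symm
  rw [h2] at h
  rw [readForm, h, ← formPullback_comp, h1]
  exact formPullback_sum_splitTerm (tanInv (𝓡 (n + 1)) x₀ z.proj).toLinearMap
    (fibInv G x₀ z.proj : G →L[ℝ] Q z.proj).toLinearMap ε u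
    (fun k => tanMap (𝓡 (n + 1)) x₀ z.proj (b k)) (B.vol z.proj)

end CoefficientForms

/-! ### Frames of the first two summands. -/

section SumFrames

variable {n : ℕ} {M : Type*} [TopologicalSpace M]
  [ChartedSpace (EuclideanSpace ℝ (Fin (n + 1))) M] [IsManifold (𝓡 (n + 1)) ∞ M]
  {F : Type*} [NormedAddCommGroup F] [NormedSpace ℝ F] [FiniteDimensional ℝ F]
  {V : M → Type*} [TopologicalSpace (TotalSpace F V)]
  [∀ x, AddCommGroup (V x)] [∀ x, Module ℝ (V x)] [∀ x, TopologicalSpace (V x)]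
  [FiberBundle F V] [VectorBundle ℝ F V]
  {K : Type*} [NormedAddCommGroup K] [NormedSpace ℝ K] [FiniteDimensional ℝ K]
  {D : M → Type*} [TopologicalSpace (TotalSpace K D)]
  [∀ x, AddCommGroup (D x)] [∀ x, Module ℝ (D x)] [∀ x, TopologicalSpace (D x)]
  [FiberBundle K D] [VectorBundle ℝ K D]

variable (F K) in
/-- The basis directions of the first two summands. -/
def sumDirection : Fin (Module.finrank ℝ F) ⊕ Fin (Module.finrank ℝ K) → (F × K) × ℝ
  | .inl A => ((Module.finBasis ℝ F A, 0), 0)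
  | .inr a => ((0, Module.finBasis ℝ K a), 0)

variable (F K) in
/-- The covectors dual to `sumDirection`. -/
def sumCovector : Fin (Module.finrank ℝ F) ⊕ Fin (Module.finrank ℝ K) →
    Module.Dual ℝ ((F × K) × ℝ)
  | .inl A => (Module.finBasis ℝ F).coord A ∘ₗ LinearMap.fst ℝ F K ∘ₗ LinearMap.fst ℝ (F × K) ℝ
  | .inr a => (Module.finBasis ℝ K).coord a ∘ₗ LinearMap.snd ℝ F K ∘ₗ LinearMap.fst ℝ (F × K) ℝ

variable (F V K D) in
/-- The frame directions of the first two summands. -/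
def sumFrame (x : M) : Fin (Module.finrank ℝ F) ⊕ Fin (Module.finrank ℝ K) → SumFiber M V D x
  | .inl A => ((bundleFrame F x A x, 0), (0 : ℝ))
  | .inr a => ((0, bundleFrame K x a x), (0 : ℝ))

variable (F V K D) in
/-- The covectors dual to `sumFrame`. -/
def sumCoframe (x : M) : Fin (Module.finrank ℝ F) ⊕ Fin (Module.finrank ℝ K) →
    Module.Dual ℝ (SumFiber M V D x)
  | .inl A => (bundleCoframe F x A).toLinearMap ∘ₗ LinearMap.fst ℝ (V x) (D x) ∘ₗ
      LinearMap.fst ℝ (V x × D x) (Trivial M ℝ x)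
  | .inr a => (bundleCoframe K x a).toLinearMap ∘ₗ LinearMap.snd ℝ (V x) (D x) ∘ₗ
      LinearMap.fst ℝ (V x × D x) (Trivial M ℝ x)

theorem sumCovector_sumDirection (N N' : Fin (Module.finrank ℝ F) ⊕ Fin (Module.finrank ℝ K)) :
    sumCovector F K N (sumDirection F K N') = if N = N' then 1 else 0 := by
  rcases N with A | A <;> rcases N' with A' | A' <;>
    simp [sumCovector, sumDirection, Finsupp.single_apply, eq_comm]

theorem sum_sumCovector_smul (q : (F × K) × ℝ) :
    ∑ N, sumCovector F K N q • sumDirection F K N = (q.1, 0) := by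
  rw [Fintype.sum_sum_type]
  have h1 : ∑ A, (Module.finBasis ℝ F).coord A q.1.1 • Module.finBasis ℝ F A = q.1.1 :=
    (Module.finBasis ℝ F).sum_repr _
  have h2 : ∑ A, (Module.finBasis ℝ K).coord A q.1.2 • Module.finBasis ℝ K A = q.1.2 :=
    (Module.finBasis ℝ K).sum_repr _
  refine Prod.ext (Prod.ext ?_ ?_) ?_ <;>
    simp [sumCovector, sumDirection, Prod.fst_sum, Prod.snd_sum]

theorem sum_sumCoframe_smul (x : M) (q : SumFiber M V D x) :
    ∑ N, sumCoframe F V K D x N q • sumFrame F V K D x N = ((q.1, (0 : ℝ)) : SumFiber M V D x) := by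
  rw [Fintype.sum_sum_type]
  have h1 := sum_bundleCoframe_smul (F := F) x q.1.1
  have h2 := sum_bundleCoframe_smul (F := K) x q.1.2
  refine Prod.ext (Prod.ext ?_ ?_) ?_
  · simpa [sumCoframe, sumFrame, Prod.fst_sum, Prod.snd_sum] using h1
  · simpa [sumCoframe, sumFrame, Prod.fst_sum, Prod.snd_sum] using h2
  · simp only [sumCoframe, sumFrame, Prod.snd_add, Prod.snd_sum, Prod.smul_snd]
    simp

/-- Frame and coframe define the projection that forgets the scalar summand, both in the fibre and
in the model, and the trivializations respect the sum. -/
theorem isVerticalFrame_sum : IsVerticalFrame n ((F × K) × ℝ) (SumFiber M V D)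
    (sumCoframe F V K D) (sumFrame F V K D) (sumCovector F K) (sumDirection F K) := by
  intro x₀ x hx g
  rw [sum_sumCovector_smul]
  simp only [← map_smul, ← map_sum]
  rw [sum_sumCoframe_smul, fibMap_sum hx.1, fibInv_sum hx.1]
  simp only []
  rw [fibMap_fibInv (mem_baseSet_sum.1 hx.1).1, fibMap_fibInv (mem_baseSet_sum.1 hx.1).2]

/-- The scalar direction is the only one missing from the frame, so exactly the forms vanishing on
it can be expanded. -/
theorem expand_sumCovector (l : Module.Dual ℝ ((F × K) × ℝ)) (h : ∀ c, l (0, c) = 0) :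
    l = ∑ N, l (sumDirection F K N) • sumCovector F K N := by
  refine LinearMap.ext fun q => ?_
  have h1 : q = (q.1, 0) + (0, q.2) := by simp
  conv_lhs => rw [h1, map_add, h, add_zero, ← sum_sumCovector_smul, map_sum]
  rw [LinearMap.sum_apply]
  exact Finset.sum_congr rfl fun N _ => by rw [map_smul, LinearMap.smul_apply, smul_eq_mul,
    smul_eq_mul, mul_comm]

theorem expand_sumCoframe {x : M} (l : Module.Dual ℝ (SumFiber M V D x))
    (h : ∀ c : ℝ, l (((0, c) : (V x × D x) × ℝ) : SumFiber M V D x) = 0) :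
    l = ∑ N, l (sumFrame F V K D x N) • sumCoframe F V K D x N := by
  refine LinearMap.ext fun q => ?_
  have h1 : q = ((q.1, (0 : ℝ)) : SumFiber M V D x) +
    (((0, (q.2 : ℝ)) : (V x × D x) × ℝ) : SumFiber M V D x) :=
    Prod.ext (add_zero _).symm (zero_add (q.2 : ℝ)).symm
  conv_lhs => rw [h1, map_add, h, add_zero, ← sum_sumCoframe_smul (F := F) (K := K), map_sum]
  rw [LinearMap.sum_apply]
  exact Finset.sum_congr rfl fun N _ => by rw [map_smul, LinearMap.smul_apply, smul_eq_mul,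
    smul_eq_mul, mul_comm]

end SumFrames

/-! ### Frame independence of the multisymplectic form on the model. -/

section PolyFormFrames

variable {E F : Type*} [NormedAddCommGroup E] [NormedSpace ℝ E] [FiniteDimensional ℝ E]
  [NormedAddCommGroup F] [NormedSpace ℝ F] [FiniteDimensional ℝ F]

/-- The linear form `((v, L), c) ↦ L (σ ⊗ u)`. -/
def momentForm : Module.Dual ℝ E →ₗ[ℝ] F →ₗ[ℝ] Module.Dual ℝ ((F × ((E →L[ℝ] F) →L[ℝ] ℝ)) × ℝ) :=
  LinearMap.mk₂ ℝ (fun σ u =>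
    { toFun := fun q => q.1.2 ((LinearMap.toContinuousLinearMap σ).smulRight u)
      map_add' := fun q q' => rfl
      map_smul' := fun c q => rfl })
    (fun σ σ' u => LinearMap.ext fun q => by
      show q.1.2 _ = q.1.2 _ + q.1.2 _
      rw [← map_add]
      congr 1
      ext v
      simp [add_smul])
    (fun c σ u => LinearMap.ext fun q => by
      show q.1.2 _ = c • q.1.2 _
      rw [← map_smul]
      congr 1
      ext v
      simp [mul_smul])
    (fun σ u u' => LinearMap.ext fun q => by
      show q.1.2 _ = q.1.2 _ + q.1.2 _
      rw [← map_add]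
      congr 1
      ext v
      simp)
    (fun c σ u => LinearMap.ext fun q => by
      show q.1.2 _ = c • q.1.2 _
      rw [← map_smul]
      congr 1
      ext v
      simp [smul_comm c])

/-- The linear form `((v, L), c) ↦ l v`. -/
def fieldForm : Module.Dual ℝ F →ₗ[ℝ] Module.Dual ℝ ((F × ((E →L[ℝ] F) →L[ℝ] ℝ)) × ℝ) :=
  (LinearMap.fst ℝ F ((E →L[ℝ] F) →L[ℝ] ℝ) ∘ₗ LinearMap.fst ℝ _ ℝ).dualMap

/-- The form is bilinear in the frame and coframe of `E`, and likewise in those of `F`; each pair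
enters as the identity tensor and is changed separately by `sum_eq_of_sum_smul_eq`. -/
theorem polyForm_congr_frame {ι ι' η η' : Type*} [Fintype ι] [Fintype ι'] [Fintype η] [Fintype η']
    {l : ι → Module.Dual ℝ F} {u : ι → F} (h : ∀ v, ∑ i, l i v • u i = v)
    {l' : ι' → Module.Dual ℝ F} {u' : ι' → F} (h' : ∀ v, ∑ i, l' i v • u' i = v)
    {σ : η → Module.Dual ℝ E} {t : η → E} (ht : ∀ v, ∑ i, σ i v • t i = v)
    {σ' : η' → Module.Dual ℝ E} {t' : η' → E} (ht' : ∀ v, ∑ i, σ' i v • t' i = v) (μ : ExtForm E) :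
    polyForm (fun k : ι × η => momentForm (σ k.2) (u k.1)) (fun k => fieldForm (l k.1))
      (fun k => t k.2) μ =
    polyForm (fun k : ι' × η' => momentForm (σ' k.2) (u' k.1)) (fun k => fieldForm (l' k.1))
      (fun k => t' k.2) μ := by
  let G := (F × ((E →L[ℝ] F) →L[ℝ] ℝ)) × ℝ
  let c : Module.Dual ℝ G →ₗ[ℝ] ExtForm (E × G) :=
    ExteriorAlgebra.ι ℝ ∘ₗ (LinearMap.snd ℝ E G).dualMap
  let p : E →ₗ[ℝ] ExtForm (E × G) := (horForm G).toLinearMap ∘ₗ vectorHook.flip μ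
  let Φ : Module.Dual ℝ F → F → Module.Dual ℝ E →ₗ[ℝ] E →ₗ[ℝ] ExtForm (E × G) := fun l u =>
    (LinearMap.mul ℝ (ExtForm (E × G))).compl₁₂ (c ∘ₗ momentForm.flip u)
      (LinearMap.mulLeft ℝ (c (fieldForm l)) ∘ₗ p)
  let Ψ : Module.Dual ℝ E → E → Module.Dual ℝ F →ₗ[ℝ] F →ₗ[ℝ] ExtForm (E × G) := fun σ t =>
    (LinearMap.mul ℝ (ExtForm (E × G))).flip.compl₁₂
      (LinearMap.mulRight ℝ (p t) ∘ₗ c ∘ₗ fieldForm) (c ∘ₗ momentForm σ)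
  simp only [polyForm, Fintype.sum_prod_type]
  have h1 : ∀ i, ∑ j, Φ (l i) (u i) (σ j) (t j) = ∑ j, Φ (l i) (u i) (σ' j) (t' j) := fun i =>
    sum_eq_of_sum_smul_eq (Φ (l i) (u i)) ht ht'
  have h2 : ∀ j, ∑ i, Ψ (σ' j) (t' j) (l i) (u i) = ∑ i, Ψ (σ' j) (t' j) (l' i) (u' i) := fun j =>
    sum_eq_of_sum_smul_eq (Ψ (σ' j) (t' j)) h h'
  refine (Finset.sum_congr rfl fun i _ => h1 i).trans ?_
  rw [Finset.sum_comm]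
  refine (Finset.sum_congr rfl fun j _ => h2 j).trans ?_
  rw [Finset.sum_comm]
  rfl

end PolyFormFrames

/-! ### The canonical form in the splitting, and removal of its horizontal part. -/

section CanonicalAlgebra

variable {X Y E U W : Type*} [AddCommGroup X] [Module ℝ X] [AddCommGroup Y] [Module ℝ Y]
  [AddCommGroup E] [Module ℝ E] [AddCommGroup U] [Module ℝ U] [AddCommGroup W] [Module ℝ W]

/-- The form `∑ c_k u_k ∧ η_k + r μ` read in a splitting. -/
theorem formPullback_affine {ι η : Type*} [Fintype ι] [Fintype η] {T : X →ₗ[ℝ] Y} {τ : Y →ₗ[ℝ] E}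
    {K : Y →ₗ[ℝ] U} {S : X →ₗ[ℝ] E × W} {p : W →ₗ[ℝ] U} (hτ : τ ∘ₗ T = LinearMap.fst ℝ E W ∘ₗ S)
    (hK : K ∘ₗ T = p ∘ₗ LinearMap.snd ℝ E W ∘ₗ S) (c : ι → η → ℝ) (l : ι → Module.Dual ℝ U)
    (θ : η → ExtForm E) (r : ℝ) (μ : ExtForm E) :
    formPullback T (∑ A, ∑ j, c A j • (ExteriorAlgebra.ι ℝ (l A ∘ₗ K) * formPullback τ (θ j)) +
      r • formPullback τ μ) =
    formPullback S (∑ k : ι × η, c k.1 k.2 • splitTerm (l k.1 ∘ₗ p) (θ k.2) +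
      r • formPullback (LinearMap.fst ℝ E W) μ) := by
  simp only [formPullback_add, formPullback_smul, formPullback_sum, Fintype.sum_prod_type,
    splitTerm, formPullback_mul, formPullback_ι, ← formPullback_comp, hτ]
  congr 1
  refine Finset.sum_congr rfl fun A _ => Finset.sum_congr rfl fun j _ => ?_
  rw [LinearMap.comp_assoc, hK]
  rfl

/-- The terms with a vertical covector vanish on horizontal lifts, so the horizontal part is exactly
the multiple of `μ`, and subtracting it leaves the rest. -/
theorem affine_sub_horizontal {κ : Type*} [Fintype κ] {S : X →ₗ[ℝ] E × W} {S' : E × W →ₗ[ℝ] X}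
    (h : S ∘ₗ S' = LinearMap.id) {τ : X →ₗ[ℝ] E} (hτ : τ = LinearMap.fst ℝ E W ∘ₗ S)
    {c : κ → ℝ} {u : κ → Module.Dual ℝ W} {θ : κ → ExtForm E} {r : ℝ} {μ : ExtForm E} {Θ : ExtForm X}
    (hΘ : Θ = formPullback S (∑ k, c k • splitTerm (u k) (θ k) +
        r • formPullback (LinearMap.fst ℝ E W) μ)) :
    Θ - formPullback τ (formPullback (S' ∘ₗ LinearMap.inl ℝ E W) Θ) =
      formPullback S (∑ k, c k • splitTerm (u k) (θ k)) := by
  have h1 : ∀ k, formPullback (LinearMap.inl ℝ E W) (splitTerm (u k) (θ k)) = 0 := fun k => by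
    rw [splitTerm, formPullback_mul, formPullback_ι, LinearMap.comp_assoc]
    simp
  rw [hΘ, ← formPullback_comp (S' ∘ₗ LinearMap.inl ℝ E W) S, ← LinearMap.comp_assoc, h,
    LinearMap.id_comp]
  simp only [formPullback_add, formPullback_smul, formPullback_sum, h1, smul_zero,
    Finset.sum_const_zero, zero_add, ← formPullback_comp, hτ]
  rw [← LinearMap.comp_assoc, LinearMap.fst_comp_inl, LinearMap.id_comp, add_sub_cancel_right]

end CanonicalAlgebra

namespace PhaseInstances

variable {n : ℕ} {M : Type*} [TopologicalSpace M]
  [ChartedSpace (EuclideanSpace ℝ (Fin (n + 1))) M] [IsManifold (𝓡 (n + 1)) ∞ M]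
  {F : Type*} [NormedAddCommGroup F] [NormedSpace ℝ F]

/-- Shortcuts for instance search. -/
scoped instance normedAddCommGroupPhase : NormedAddCommGroup (PhaseModel n F) := inferInstance
scoped instance normedSpacePhase : NormedSpace ℝ (PhaseModel n F) := inferInstance
scoped instance finiteDimensionalPhase [FiniteDimensional ℝ F] :
    FiniteDimensional ℝ (PhaseModel n F) := inferInstance

variable {V : M → Type*} [∀ x, AddCommGroup (V x)] [∀ x, Module ℝ (V x)]
  [∀ x, TopologicalSpace (V x)] [∀ x, IsTopologicalAddGroup (V x)] [∀ x, ContinuousSMul ℝ (V x)]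

scoped instance addCommGroupPhase (x : M) : AddCommGroup (PhaseFiber n V x) := inferInstance
scoped instance modulePhase (x : M) : Module ℝ (PhaseFiber n V x) := inferInstance
scoped instance topologyPhase (x : M) : TopologicalSpace (PhaseFiber n V x) := inferInstance

variable [TopologicalSpace (TotalSpace F V)] [FiberBundle F V] [VectorBundle ℝ F V]

scoped instance topologicalSpacePhase : TopologicalSpace (Phase n F V) := inferInstance
scoped instance fiberBundlePhase : FiberBundle (PhaseModel n F) (PhaseFiber n V) := inferInstance
scoped instance vectorBundlePhase : VectorBundle ℝ (PhaseModel n F) (PhaseFiber n V) :=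
  inferInstance

variable [ContMDiffVectorBundle ∞ F V (𝓡 (n + 1))]

scoped instance contMDiffVectorBundleDualJet :
    ContMDiffVectorBundle ∞ (DualJetModel n F) (DualJetFiber n V) (𝓡 (n + 1)) := inferInstance
scoped instance contMDiffVectorBundlePhase :
    ContMDiffVectorBundle ∞ (PhaseModel n F) (PhaseFiber n V) (𝓡 (n + 1)) := inferInstance

end PhaseInstances

open scoped PhaseInstances

/-! ### The phase space as a sum bundle; its splitting and canonical forms. -/

section PhaseSpace

variable {n : ℕ} {M : Type*} [TopologicalSpace M]
  [ChartedSpace (EuclideanSpace ℝ (Fin (n + 1))) M] [IsManifold (𝓡 (n + 1)) ∞ M]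
  {F : Type*} [NormedAddCommGroup F] [NormedSpace ℝ F] [FiniteDimensional ℝ F]
  {V : M → Type*} [TopologicalSpace (TotalSpace F V)]
  [∀ x, AddCommGroup (V x)] [∀ x, Module ℝ (V x)] [∀ x, TopologicalSpace (V x)]
  [∀ x, IsTopologicalAddGroup (V x)] [∀ x, ContinuousSMul ℝ (V x)]
  [FiberBundle F V] [VectorBundle ℝ F V] [ContMDiffVectorBundle ∞ F V (𝓡 (n + 1))]
  (B : OrientedMetric n M)
  (Γ : CovariantDerivative (𝓡 (n + 1)) F V)
  (Λ : CovariantDerivative (𝓡 (n + 1)) (EuclideanSpace ℝ (Fin (n + 1)))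
    (fun x : M => TangentSpace (𝓡 (n + 1)) x))

theorem fibreDeriv_eq (α : PhaseForm n F V) (x : M) (q w : PhaseFiber n V x) :
    fibreDeriv Γ Λ α x q w = splittingFibreDeriv (G := PhaseModel n F) (Q := PhaseFiber n V)
      (splitting Γ Λ) α x q w := by
  with_unfolding_all exact congrArg curveDeriv (funext fun t => congrArg (splitForm Γ Λ α x)
    (Prod.ext (Prod.ext rfl rfl) rfl))

set_option maxHeartbeats 600000 in
theorem verticalD_eq (α : PhaseForm n F V) (z : Phase n F V) : verticalD Γ Λ α z =
    splittingVertD (G := PhaseModel n F) (Q := PhaseFiber n V) (splitting Γ Λ)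
      (sumCoframe F V (DualJetModel n F) (DualJetFiber n V))
      (sumFrame F V (DualJetModel n F) (DualJetFiber n V)) α z := by
  rw [splittingVertD_sum]
  refine congrArg (formPullback (splitting Γ Λ z)) (congrArg₂ (· + ·)
    (Finset.sum_congr rfl fun A _ => ?_) (Finset.sum_congr rfl fun a _ => ?_))
  · rw [fibreDeriv_eq]
    with_unfolding_all rfl
  · rw [fibreDeriv_eq]
    with_unfolding_all rfl

/-- The phase space is the sum of `V`, the dual of `Hom(TM, V)` and a trivial line; the Christoffel
symbols of the second summand are algebraic expressions in those of `Γ` and `Λ`, hence smooth. -/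
theorem isSmoothSplitting_splitting [T2Space M] [Γ.ContMDiffCovariantDerivative ∞]
    [Λ.ContMDiffCovariantDerivative ∞] :
    IsSmoothSplitting (G := PhaseModel n F) (Q := PhaseFiber n V) (splitting Γ Λ) := by
  with_unfolding_all
    refine isSmoothSplitting_sumSplitting (F := F) (V := V) (K := DualJetModel n F)
      (D := DualJetFiber n V) (fun x₀ => ⟨_, contMDiffAt_christoffel Γ x₀,
        fun x hx => hasChristoffelAt_christoffel Γ hx.1 hx.2⟩) fun x₀ => ?_
  have h1 := contMDiffAt_dualChristoffel (contMDiffAt_jetChristoffel (contMDiffAt_christoffel Γ x₀)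
    (contMDiffAt_christoffel Λ x₀))
  refine ⟨_, h1, fun x hx => ?_⟩
  exact hasChristoffelAt_dualJetCov hx.1 hx.2 (hasChristoffelAt_jetCov hx.1 hx.2
    (hasChristoffelAt_christoffel Γ hx.1 hx.2) (hasChristoffelAt_christoffel
      (V := fun x : M => TangentSpace (𝓡 (n + 1)) x) Λ (by simpa using hx.2) hx.2))

/-- The linear form `((v, L), c) ↦ L (dx^j ⊗ e_A)`. -/
def phaseMomentForm (x : M) (k : Fin (Module.finrank ℝ F) ×
    Fin (Module.finrank ℝ (EuclideanSpace ℝ (Fin (n + 1))))) :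
    Module.Dual ℝ (PhaseFiber n V x) where
  toFun q := (q.1.2 ((tangentCoframe x k.2).smulRight (bundleFrame F x k.1 x)) : ℝ)
  map_add' _ _ := rfl
  map_smul' _ _ := rfl

/-- The linear form `((v, L), c) ↦ e^A(v)`. -/
def phaseFieldForm (x : M) (A : Fin (Module.finrank ℝ F)) : Module.Dual ℝ (PhaseFiber n V x) :=
  (bundleCoframe F x A).toLinearMap ∘ₗ LinearMap.fst ℝ (V x) (DualJetFiber n V x) ∘ₗ
    LinearMap.fst ℝ (V x × DualJetFiber n V x) (Trivial M ℝ x)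

theorem expand_phaseMomentForm (x : M) (k : Fin (Module.finrank ℝ F) ×
    Fin (Module.finrank ℝ (EuclideanSpace ℝ (Fin (n + 1))))) :
    phaseMomentForm (V := V) x k = ∑ N, phaseMomentForm (V := V) x k
      (sumFrame F V (DualJetModel n F) (DualJetFiber n V) x N) •
      sumCoframe F V (DualJetModel n F) (DualJetFiber n V) x N :=
  expand_sumCoframe (phaseMomentForm (V := V) x k) fun _ => rfl

theorem canonicalForm_eq (z : Phase n F V) : canonicalForm B Γ z =
    formPullback (splitting Γ Λ z) (∑ k, phaseMomentForm (n := n) (F := F) (V := V) z.proj k z.2 •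
      splitTerm (phaseFieldForm (n := n) (F := F) (V := V) z.proj k.1)
        (vectorHook (tangentFrame z.proj k.2 z.proj) (B.vol z.proj)) +
      (z.2.2 : ℝ) • formPullback (LinearMap.fst ℝ _ _) (B.vol z.proj)) := by
  refine formPullback_affine
    (p := LinearMap.fst ℝ (V z.proj) (DualJetFiber n V z.proj) ∘ₗ
      LinearMap.fst ℝ (V z.proj × DualJetFiber n V z.proj) (Trivial M ℝ z.proj)) ?_ ?_
    (fun A j => phaseMomentForm (n := n) (F := F) (V := V) z.proj (A, j) z.2)
    (fun A => (bundleCoframe F z.proj A).toLinearMap)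
    (fun j => vectorHook (tangentFrame z.proj j z.proj) (B.vol z.proj)) (z.2.2 : ℝ) (B.vol z.proj)
  · exact LinearMap.ext fun ξ => mfderiv_proj_sumFst (F := F) (V := V) (K := DualJetModel n F)
      (D := DualJetFiber n V) z ξ
  · rfl

theorem canonicalFormVert_eq (hS : IsSmoothSplitting (G := PhaseModel n F) (Q := PhaseFiber n V)
    (splitting Γ Λ)) (z : Phase n F V) : canonicalFormVert B Γ Λ z =
    formPullback (splitting Γ Λ z) (∑ k, phaseMomentForm (n := n) (F := F) (V := V) z.proj k z.2 •
      splitTerm (phaseFieldForm (n := n) (F := F) (V := V) z.proj k.1)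
        (vectorHook (tangentFrame z.proj k.2 z.proj) (B.vol z.proj))) := by
  with_unfolding_all exact affine_sub_horizontal (hS.comp_leftInverse z) rfl (canonicalForm_eq B Γ Λ z)

-- The coefficients of `Θ^{(1,n)}` are the linear forms `L(dx^j ⊗ e_A)` on the fibre, and the
-- vertical derivative puts these forms in front as covectors.
set_option maxHeartbeats 800000 in
theorem multisymplecticForm_eq (hS : IsSmoothSplitting (G := PhaseModel n F)
    (Q := PhaseFiber n V) (splitting Γ Λ)) (z : Phase n F V) : multisymplecticForm B Γ Λ z =
    formPullback (splitting Γ Λ z) (∑ k, ExteriorAlgebra.ι ℝ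
      (phaseMomentForm (n := n) (F := F) (V := V) z.proj k ∘ₗ LinearMap.snd ℝ _ _) *
      splitTerm (phaseFieldForm (n := n) (F := F) (V := V) z.proj k.1)
        (vectorHook (tangentFrame z.proj k.2 z.proj) (B.vol z.proj))) := by
  have h0 : multisymplecticForm B Γ Λ z = verticalD Γ Λ (canonicalFormVert B Γ Λ) z := rfl
  have h1 := hS.splittingVertD_of_linear (ε := fun x => phaseMomentForm (n := n) (F := F) (V := V) x)
    (θ := fun x k => splitTerm (phaseFieldForm (n := n) (F := F) (V := V) x k.1)
        (vectorHook (tangentFrame x k.2 x) (B.vol x)))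
    (canonicalFormVert_eq B Γ Λ hS) expand_phaseMomentForm z
  have h2 := verticalD_eq Γ Λ (canonicalFormVert B Γ Λ) z
  with_unfolding_all exact h0.trans (h2.trans h1)

end PhaseSpace

/-! ### Moving frames read in a fixed trivialization. -/

section LocalFrames

variable {n : ℕ} {M : Type*} [TopologicalSpace M]
  [ChartedSpace (EuclideanSpace ℝ (Fin (n + 1))) M] [IsManifold (𝓡 (n + 1)) ∞ M]
  {F : Type*} [NormedAddCommGroup F] [NormedSpace ℝ F] [FiniteDimensional ℝ F]
  {V : M → Type*} [TopologicalSpace (TotalSpace F V)]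
  [∀ x, AddCommGroup (V x)] [∀ x, Module ℝ (V x)] [∀ x, TopologicalSpace (V x)]
  [FiberBundle F V] [VectorBundle ℝ F V]

variable (F V) in
/-- The coframe `e^A` at `x` in the trivialization around `x₀`. -/
def localCoframe (x₀ x : M) (A : Fin (Module.finrank ℝ F)) : Module.Dual ℝ F :=
  (bundleCoframe (V := V) F x A).toLinearMap ∘ₗ (fibInv F x₀ x).toLinearMap

variable (F V) in
/-- The frame `e_A` at `x` in the trivialization around `x₀`. -/
def localFrame (x₀ x : M) (A : Fin (Module.finrank ℝ F)) : F :=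
  fibMap F x₀ x (bundleFrame (V := V) F x A x)

theorem sum_localCoframe_smul {x₀ x : M} (hx : x ∈ (trivializationAt F V x₀).baseSet) (v : F) :
    ∑ A, localCoframe F V x₀ x A v • localFrame F V x₀ x A = v := by
  have h := congrArg (fibMap F x₀ x) (sum_bundleCoframe_smul (F := F) x (fibInv F x₀ x v : V x))
  rw [fibMap_fibInv hx, map_sum] at h
  simp only [map_smul] at h
  exact h

variable [∀ x, IsTopologicalAddGroup (V x)] [∀ x, ContinuousSMul ℝ (V x)]

theorem fibInv_dualJet {x₀ x : M} (hx : x ∈ trivDomain n F V x₀) (ℓ : DualJetModel n F)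
    (φ : JetFiber n V x) :
    ((fibInv (DualJetModel n F) x₀ x ℓ : DualJetFiber n V x) φ : ℝ) =
      ℓ (fibMap (JetModel n F) x₀ x φ) := by
  have h1 := fibMap_fibInv (V := DualJetFiber n V) (mem_baseSet_dualJet hx.1 hx.2) ℓ
  rw [fibMap_dualJet hx.1 hx.2] at h1
  have h2 := congrArg (fun l : DualJetModel n F => l (fibMap (JetModel n F) x₀ x φ)) h1
  refine Eq.trans ?_ h2
  exact congrArg (fibInv (DualJetModel n F) x₀ x ℓ : DualJetFiber n V x)
    (fibInv_fibMap (V := JetFiber n V) (mem_baseSet_jet hx.1 hx.2) φ).symm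

theorem trivDomain_phase {x₀ x : M} (hx : x ∈ trivDomain n (PhaseModel n F) (PhaseFiber n V) x₀) :
    x ∈ trivDomain n F V x₀ :=
  ⟨(mem_baseSet_sum (F := F) (V := V) (K := DualJetModel n F) (D := DualJetFiber n V)).1 hx.1 |>.1,
    hx.2⟩

theorem phaseMomentForm_fibInv {x₀ x : M}
    (hx : x ∈ trivDomain n (PhaseModel n F) (PhaseFiber n V) x₀)
    (k : Fin (Module.finrank ℝ F) ×
      Fin (Module.finrank ℝ (EuclideanSpace ℝ (Fin (n + 1))))) :
    phaseMomentForm (V := V) x k ∘ₗ (fibInv (PhaseModel n F) x₀ x).toLinearMap =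
      momentForm (localCoframe (EuclideanSpace ℝ (Fin (n + 1)))
        (fun x : M => TangentSpace (𝓡 (n + 1)) x) x₀ x k.2) (localFrame F V x₀ x k.1) := by
  refine LinearMap.ext fun q => ?_
  have hx' := trivDomain_phase hx
  have h1 := fibInv_sum (F := F) (V := V) (K := DualJetModel n F) (D := DualJetFiber n V) hx.1 q
  refine (congrArg (phaseMomentForm (V := V) x k) h1).trans ?_
  refine (fibInv_dualJet hx' q.1.2 _).trans ?_
  rw [fibMap_jet hx'.1 hx'.2]
  refine congrArg q.1.2 (ContinuousLinearMap.ext fun v => ?_)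
  exact map_smul (fibMap F x₀ x) _ _

theorem phaseFieldForm_fibInv {x₀ x : M}
    (hx : x ∈ trivDomain n (PhaseModel n F) (PhaseFiber n V) x₀) (A : Fin (Module.finrank ℝ F)) :
    phaseFieldForm (n := n) (V := V) x A ∘ₗ (fibInv (PhaseModel n F) x₀ x).toLinearMap =
      fieldForm (localCoframe F V x₀ x A) := by
  refine LinearMap.ext fun q => ?_
  have h1 := fibInv_sum (F := F) (V := V) (K := DualJetModel n F) (D := DualJetFiber n V) hx.1 q
  exact congrArg (phaseFieldForm (n := n) (V := V) x A) h1

end LocalFrames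

/-! ### Horizontality as a condition relative to a single linear map. -/

section Horizontal

/-- The form `a` vanishes on the kernel of `p`. -/
def VanishesOnKer {T E : Type*} [AddCommGroup T] [Module ℝ T] [AddCommGroup E] [Module ℝ E]
    (p : T →ₗ[ℝ] E) (a : ExtForm T) : Prop := ∀ u, p u = 0 → vectorHook u a = 0

variable {n : ℕ} {M : Type*} [TopologicalSpace M]
  [ChartedSpace (EuclideanSpace ℝ (Fin (n + 1))) M] [IsManifold (𝓡 (n + 1)) ∞ M]
  {G : Type*} [NormedAddCommGroup G] [NormedSpace ℝ G] [FiniteDimensional ℝ G]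
  {Q : M → Type*} [TopologicalSpace (TotalSpace G Q)]
  [∀ x, AddCommGroup (Q x)] [∀ x, Module ℝ (Q x)] [∀ x, TopologicalSpace (Q x)]
  [FiberBundle G Q] [VectorBundle ℝ G Q]

theorem isSmoothHorizontal_iff_vanishesOnKer {k : ℤ}
    {α : FormOn ((𝓡 (n + 1)).prod 𝓘(ℝ, G)) (TotalSpace G Q)} : IsSmoothHorizontal k α ↔
    (IsSmoothForm ((𝓡 (n + 1)).prod 𝓘(ℝ, G)) α ∧ ∀ z, α z ∈ extDegree _ k) ∧
      ∀ z, VanishesOnKer (totalProjTangent n G Q z) (α z) :=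
  ⟨fun h => ⟨⟨h.1, h.2⟩, h.3⟩, fun h => ⟨h.1.1, h.1.2, h.2⟩⟩

end Horizontal

/-! ### The multisymplectic form is polysymplectic; transfer of the general results to the phase
space. -/

section PhaseStructure

variable {n : ℕ} {M : Type*} [TopologicalSpace M]
  [ChartedSpace (EuclideanSpace ℝ (Fin (n + 1))) M] [IsManifold (𝓡 (n + 1)) ∞ M]
  {F : Type*} [NormedAddCommGroup F] [NormedSpace ℝ F] [FiniteDimensional ℝ F]
  {V : M → Type*} [TopologicalSpace (TotalSpace F V)]
  [∀ x, AddCommGroup (V x)] [∀ x, Module ℝ (V x)] [∀ x, TopologicalSpace (V x)]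
  [∀ x, IsTopologicalAddGroup (V x)] [∀ x, ContinuousSMul ℝ (V x)]
  [FiberBundle F V] [VectorBundle ℝ F V] [ContMDiffVectorBundle ∞ F V (𝓡 (n + 1))]
  (B : OrientedMetric n M)
  (Γ : CovariantDerivative (𝓡 (n + 1)) F V)
  (Λ : CovariantDerivative (𝓡 (n + 1)) (EuclideanSpace ℝ (Fin (n + 1)))
    (fun x : M => TangentSpace (𝓡 (n + 1)) x))

/-- The frames that define the form at `x` appear in the trivialization around `x₀` as varying
bases. By `polyForm_congr_frame` they may be exchanged for the fixed standard bases, so the only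
dependence on the point is through the volume form. -/
theorem readForm_multisymplecticForm (hS : IsSmoothSplitting (G := PhaseModel n F)
    (Q := PhaseFiber n V) (splitting Γ Λ)) {x₀ : M} {z : Phase n F V}
    (hz : z.proj ∈ trivDomain n (PhaseModel n F) (PhaseFiber n V) x₀) :
    readForm (G := PhaseModel n F) (Q := PhaseFiber n V) (splitting Γ Λ) x₀
      (multisymplecticForm B Γ Λ) z =
    polyForm (fun k : Fin (Module.finrank ℝ F) × Fin (Module.finrank ℝ (BaseModel n)) =>
        momentForm ((Module.finBasis ℝ (BaseModel n)).coord k.2) (Module.finBasis ℝ F k.1))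
      (fun k => fieldForm ((Module.finBasis ℝ F).coord k.1))
      (fun k => Module.finBasis ℝ (BaseModel n) k.2) (B.volAt x₀ z.proj) := by
  have h1 := hS.readForm_eq_polyForm B (multisymplecticForm_eq B Γ Λ hS z) hz
  simp only [phaseMomentForm_fibInv hz, phaseFieldForm_fibInv hz] at h1
  refine h1.trans ?_
  exact polyForm_congr_frame (sum_localCoframe_smul (trivDomain_phase hz).1)
    (Module.finBasis ℝ F).sum_repr
    (sum_localCoframe_smul (V := fun x : M => TangentSpace (𝓡 (n + 1)) x) (by simpa using hz.2))
    (Module.finBasis ℝ (BaseModel n)).sum_repr _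

theorem isPolysymplectic_multisymplecticForm [T2Space M] [Γ.ContMDiffCovariantDerivative ∞]
    [Λ.ContMDiffCovariantDerivative ∞] :
    IsPolysymplectic (G := PhaseModel n F) (Q := PhaseFiber n V) B (splitting Γ Λ)
      (sumCoframe F V (DualJetModel n F) (DualJetFiber n V))
      (sumFrame F V (DualJetModel n F) (DualJetFiber n V)) (multisymplecticForm B Γ Λ)
      (sumCovector F (DualJetModel n F)) (sumDirection F (DualJetModel n F))
      (fun k : Fin (Module.finrank ℝ F) × Fin (Module.finrank ℝ (BaseModel n)) =>
        momentForm ((Module.finBasis ℝ (BaseModel n)).coord k.2) (Module.finBasis ℝ F k.1))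
      (fun k => fieldForm ((Module.finBasis ℝ F).coord k.1))
      (fun k => Module.finBasis ℝ (BaseModel n) k.2) where
  splitting := isSmoothSplitting_splitting Γ Λ
  frame := isVerticalFrame_sum
  dual := sumCovector_sumDirection
  expand_left _ := expand_sumCovector _ fun _ => rfl
  expand_right _ := expand_sumCovector _ fun _ =>
    map_zero ((Module.finBasis ℝ F).coord _)
  readForm_eq _ _ hz := readForm_multisymplecticForm B Γ Λ (isSmoothSplitting_splitting Γ Λ) hz

theorem isHorizontalForm_iff_vanishesOnKer {k : ℤ} {α : PhaseForm n F V} : IsHorizontalForm k α ↔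
    (IsSmoothForm (phaseCorners n F) α ∧ ∀ z, α z ∈ extDegree _ k) ∧
      ∀ z, @VanishesOnKer _ _ _ _ _ _ (projTangent z) (α z) := by
  unfold VanishesOnKer
  exact ⟨fun h => ⟨⟨h.1, h.2⟩, by with_reducible exact h.3⟩,
    fun h => ⟨h.1.1, h.1.2, by with_reducible exact h.2⟩⟩

theorem isHorizontalForm_iff {k : ℤ} {α : PhaseForm n F V} : IsHorizontalForm k α ↔
    IsSmoothHorizontal (n := n) (G := PhaseModel n F) (Q := PhaseFiber n V) k α := by
  with_unfolding_all
    exact isHorizontalForm_iff_vanishesOnKer.trans (isSmoothHorizontal_iff_vanishesOnKer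
      (G := PhaseModel n F) (Q := PhaseFiber n V)).symm

theorem isHamiltonianPair_iff {k : ℤ} {X : PhaseMultivector n F V} {α : PhaseForm n F V} :
    IsHamiltonianPair B Γ Λ k X α ↔
      IsHamPair (G := PhaseModel n F) (Q := PhaseFiber n V) (splitting Γ Λ)
        (sumCoframe F V (DualJetModel n F) (DualJetFiber n V))
        (sumFrame F V (DualJetModel n F) (DualJetFiber n V)) (multisymplecticForm B Γ Λ) k X α := by
  constructor
  · with_unfolding_all exact fun h => ⟨isHorizontalForm_iff.1 h.1, h.2, h.3,
      fun z => (h.4 z).trans (verticalD_eq Γ Λ α z)⟩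
  · with_unfolding_all exact fun h => ⟨isHorizontalForm_iff.2 h.1, h.2, h.3,
      fun z => (h.4 z).trans (verticalD_eq Γ Λ α z).symm⟩

variable {B Γ Λ} in
theorem IsHamiltonianForm.isHamiltonianPair {k : ℤ} {α : PhaseForm n F V}
    (h : IsHamiltonianForm B Γ Λ k α) :
    IsHamiltonianPair B Γ Λ k (hamiltonianField B Γ Λ k α) α := by
  rw [hamiltonianField, dif_pos h]
  exact h.choose_spec

variable {B Γ Λ} in
theorem IsHamiltonianForm.isHamPair {k : ℤ} {α : PhaseForm n F V}
    (h : IsHamiltonianForm B Γ Λ k α) :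
    IsHamPair (G := PhaseModel n F) (Q := PhaseFiber n V) (splitting Γ Λ)
        (sumCoframe F V (DualJetModel n F) (DualJetFiber n V))
        (sumFrame F V (DualJetModel n F) (DualJetFiber n V)) (multisymplecticForm B Γ Λ) k
        (hamiltonianField B Γ Λ k α) α := by
  exact (isHamiltonianPair_iff B Γ Λ).1 h.isHamiltonianPair

variable {B Γ Λ} [T2Space M] [SecondCountableTopology M] [Γ.ContMDiffCovariantDerivative ∞]
    [Λ.ContMDiffCovariantDerivative ∞]

theorem IsHamiltonianForm.poissonBracket {r s : ℤ} {f g : PhaseForm n F V}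
    (hf : IsHamiltonianForm B Γ Λ r f) (hg : IsHamiltonianForm B Γ Λ s g) :
    IsHamiltonianForm B Γ Λ (r + s - n) (poissonBracket B Γ Λ r s f g) := by
  obtain ⟨Z, hZ⟩ := (isPolysymplectic_multisymplecticForm B Γ Λ).exists_isHamPair_fieldBracket
    hf.isHamPair hg.isHamPair
  exact ⟨Z, (isHamiltonianPair_iff B Γ Λ).2 hZ⟩

theorem IsHamiltonianForm.hodgeProduct {r s : ℤ} {f g : PhaseForm n F V}
    (hf : IsHamiltonianForm B Γ Λ r f) (hg : IsHamiltonianForm B Γ Λ s g) :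
    IsHamiltonianForm B Γ Λ (r + s - (n + 1)) (hodgeProduct B Γ Λ f g) := by
  obtain ⟨Z, hZ⟩ :=
    (isPolysymplectic_multisymplecticForm B Γ Λ).exists_isHamPair_splittingHodgeProduct
      hf.isHamPair hg.isHamPair
  exact ⟨Z, (isHamiltonianPair_iff B Γ Λ).2 hZ⟩

/-- The chosen fields and the given ones have the same contractions with the multisymplectic form,
namely `d^V f` and `d^V g`; `hook_hook_congr` needs no more. -/
theorem poissonBracket_eq_of_pair {r s : ℤ} {f g : PhaseForm n F V} {X Y : PhaseMultivector n F V}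
    (hX : IsHamiltonianPair B Γ Λ r X f) (hY : IsHamiltonianPair B Γ Λ s Y g) (z : Phase n F V) :
    poissonBracket B Γ Λ r s f g z =
      ((n + 1 - r).negOnePow : ℤ) • hook (X z) (hook (Y z) (multisymplecticForm B Γ Λ z)) := by
  have hX' := IsHamiltonianForm.isHamiltonianPair ⟨X, hX⟩
  have hY' := IsHamiltonianForm.isHamiltonianPair ⟨Y, hY⟩
  have h1 := hook_hook_congr (hX'.degree z) (hX.degree z) (hY.degree z)
    ((hX'.hook_eq z).trans (hX.hook_eq z).symm) ((hY'.hook_eq z).trans (hY.hook_eq z).symm)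
  exact congrArg (fun a => ((n + 1 - r).negOnePow : ℤ) • a) h1

variable {r s t : ℤ} {f g h : PhaseForm n F V}

theorem poissonBracket_antisymm (hf : IsHamiltonianForm B Γ Λ r f)
    (hg : IsHamiltonianForm B Γ Λ s g) : poissonBracket B Γ Λ r s f g =
      -(((n - r) * (n - s)).negOnePow : ℤ) • poissonBracket B Γ Λ s r g f := by
  with_unfolding_all exact hf.isHamPair.fieldBracket_antisymm hg.isHamPair

theorem poissonBracket_jacobi (hf : IsHamiltonianForm B Γ Λ r f)
    (hg : IsHamiltonianForm B Γ Λ s g) (hh : IsHamiltonianForm B Γ Λ t h) :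
    (((n - r) * (n - t)).negOnePow : ℤ) •
        poissonBracket B Γ Λ r (s + t - n) f (poissonBracket B Γ Λ s t g h) +
      (((n - s) * (n - r)).negOnePow : ℤ) •
        poissonBracket B Γ Λ s (t + r - n) g (poissonBracket B Γ Λ t r h f) +
      (((n - t) * (n - s)).negOnePow : ℤ) •
        poissonBracket B Γ Λ t (r + s - n) h (poissonBracket B Γ Λ r s f g) = 0 := by
  with_unfolding_all
    exact (isPolysymplectic_multisymplecticForm B Γ Λ).fieldBracket_jacobi
      hf.isHamPair hg.isHamPair hh.isHamPair (hg.poissonBracket hh).isHamPair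
      (hh.poissonBracket hf).isHamPair (hf.poissonBracket hg).isHamPair

theorem hodgeProduct_comm (hf : IsHamiltonianForm B Γ Λ r f) (hg : IsHamiltonianForm B Γ Λ s g) :
    hodgeProduct B Γ Λ f g =
      (((n + 1 - r) * (n + 1 - s)).negOnePow : ℤ) • hodgeProduct B Γ Λ g f := by
  with_unfolding_all
    exact (isSmoothSplitting_splitting Γ Λ).splittingHodgeProduct_comm
      hf.isHamPair.horizontalForm hg.isHamPair.horizontalForm

theorem poissonBracket_hodgeProduct (hf : IsHamiltonianForm B Γ Λ r f)
    (hg : IsHamiltonianForm B Γ Λ s g) (hh : IsHamiltonianForm B Γ Λ t h) :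
    poissonBracket B Γ Λ r (s + t - (n + 1)) f (hodgeProduct B Γ Λ g h) =
      hodgeProduct B Γ Λ (poissonBracket B Γ Λ r s f g) h +
        (((n - r) * (n + 1 - s)).negOnePow : ℤ) •
          hodgeProduct B Γ Λ g (poissonBracket B Γ Λ r t f h) := by
  with_unfolding_all
    exact (isPolysymplectic_multisymplecticForm B Γ Λ).fieldBracket_splittingHodgeProduct
      hf.isHamPair hg.isHamPair hh.isHamPair (hg.hodgeProduct hh).isHamPair

end PhaseStructure

end

theorem mainTheorem1 (n : ℕ)
    {M : Type*} [TopologicalSpace M] [T2Space M] [SecondCountableTopology M]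
    [ChartedSpace (EuclideanSpace ℝ (Fin (n + 1))) M] [IsManifold (𝓡 (n + 1)) ∞ M]
    {F : Type*} [NormedAddCommGroup F] [NormedSpace ℝ F] [FiniteDimensional ℝ F]
    {V : M → Type*} [TopologicalSpace (TotalSpace F V)]
    [∀ x, AddCommGroup (V x)] [∀ x, Module ℝ (V x)] [∀ x, TopologicalSpace (V x)]
    [∀ x, IsTopologicalAddGroup (V x)] [∀ x, ContinuousSMul ℝ (V x)]
    [FiberBundle F V] [VectorBundle ℝ F V] [ContMDiffVectorBundle ∞ F V (𝓡 (n + 1))]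
    (B : OrientedMetric n M)
    (Γ : CovariantDerivative (𝓡 (n + 1)) F V) [Γ.ContMDiffCovariantDerivative ∞]
    (Λ : CovariantDerivative (𝓡 (n + 1)) (EuclideanSpace ℝ (Fin (n + 1)))
      (fun x : M => TangentSpace (𝓡 (n + 1)) x)) [Λ.ContMDiffCovariantDerivative ∞] :
    -- the bracket does not depend on the choice of the Hamiltonian multivector fields
    (∀ (r s : ℤ) (f g : PhaseForm n F V)
      (X Y : PhaseMultivector n F V),
      IsHamiltonianPair B Γ Λ r X f → IsHamiltonianPair B Γ Λ s Y g →
      ∀ z, poissonBracket B Γ Λ r s f g z =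
        ((n + 1 - r).negOnePow : ℤ) • hook (X z) (hook (Y z) (multisymplecticForm B Γ Λ z))) ∧
    -- the bracket of Hamiltonian forms is a Hamiltonian form
    (∀ (r s : ℤ) (f g : PhaseForm n F V),
      IsHamiltonianForm B Γ Λ r f → IsHamiltonianForm B Γ Λ s g →
      IsHamiltonianForm B Γ Λ (r + s - n) (poissonBracket B Γ Λ r s f g)) ∧
    -- graded antisymmetry
    (∀ (r s : ℤ) (f g : PhaseForm n F V),
      IsHamiltonianForm B Γ Λ r f → IsHamiltonianForm B Γ Λ s g →
      poissonBracket B Γ Λ r s f g =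
        -(((n - r) * (n - s)).negOnePow : ℤ) • poissonBracket B Γ Λ s r g f) ∧
    -- graded Jacobi identity
    (∀ (r s t : ℤ) (f g h : PhaseForm n F V),
      IsHamiltonianForm B Γ Λ r f → IsHamiltonianForm B Γ Λ s g → IsHamiltonianForm B Γ Λ t h →
      (((n - r) * (n - t)).negOnePow : ℤ) •
          poissonBracket B Γ Λ r (s + t - n) f (poissonBracket B Γ Λ s t g h) +
        (((n - s) * (n - r)).negOnePow : ℤ) •
          poissonBracket B Γ Λ s (t + r - n) g (poissonBracket B Γ Λ t r h f) +
        (((n - t) * (n - s)).negOnePow : ℤ) •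
          poissonBracket B Γ Λ t (r + s - n) h (poissonBracket B Γ Λ r s f g) = 0) ∧
    -- the product of Hamiltonian forms is a Hamiltonian form
    (∀ (r s : ℤ) (f g : PhaseForm n F V),
      IsHamiltonianForm B Γ Λ r f → IsHamiltonianForm B Γ Λ s g →
      IsHamiltonianForm B Γ Λ (r + s - (n + 1)) (hodgeProduct B Γ Λ f g)) ∧
    -- the product is graded commutative
    (∀ (r s : ℤ) (f g : PhaseForm n F V),
      IsHamiltonianForm B Γ Λ r f → IsHamiltonianForm B Γ Λ s g →
      hodgeProduct B Γ Λ f g =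
        (((n + 1 - r) * (n + 1 - s)).negOnePow : ℤ) • hodgeProduct B Γ Λ g f) ∧
    -- graded Leibniz rule
    (∀ (r s t : ℤ) (f g h : PhaseForm n F V),
      IsHamiltonianForm B Γ Λ r f → IsHamiltonianForm B Γ Λ s g → IsHamiltonianForm B Γ Λ t h →
      poissonBracket B Γ Λ r (s + t - (n + 1)) f (hodgeProduct B Γ Λ g h) =
        hodgeProduct B Γ Λ (poissonBracket B Γ Λ r s f g) h +
          (((n - r) * (n + 1 - s)).negOnePow : ℤ) •
            hodgeProduct B Γ Λ g (poissonBracket B Γ Λ r t f h)) := by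
  exact ⟨fun _ _ _ _ _ _ hX hY z => poissonBracket_eq_of_pair hX hY z,
    fun _ _ _ _ hf hg => hf.poissonBracket hg, fun _ _ _ _ hf hg => poissonBracket_antisymm hf hg,
    fun _ _ _ _ _ _ hf hg hh => poissonBracket_jacobi hf hg hh,
    fun _ _ _ _ hf hg => hf.hodgeProduct hg, fun _ _ _ _ hf hg => hodgeProduct_comm hf hg,
    fun _ _ _ _ _ _ hf hg hh => poissonBracket_hodgeProduct hf hg hh⟩
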